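/- Let $k$ be an algebraically closed field of characteristic $\ne 2$ and $G$ a finite group. A variety is a reduced separated scheme of finite type over $k$ (possibly reducible). "Normal crossing" means normal crossing in codimension one: at every point of codimension one the variety is either regular or a double normal crossing (a node, étale-locally $xy=0$). A $G$-cover $X\to Y$ is a finite morphism together with a faithful action of $G$ on $X$ such that $Y=X/G$. Let $Y$ be a variety that is $S_2$ and normal crossing, let $\nu:Y^\nu\to Y$ be its normalization, let $C\subset Y$ be the divisorial part of the singular locus of $Y$ (the closure of the set of non-regular points of codimension one), and let $C^\nu=\nu^{-1}(C)$, with its reduced structure. Let $\iota$ be the involution of $C^\nu$ exchanging the two branches of $Y$ along $C$: it is the involution over $C$ with $C^\nu/\iota=C$ over a dense open subset of $C$; it exists and is unique as an involution of the normalization $\widetilde C^\nu$ of $C^\nu$ (on $C^\nu$ it is in general only defined over a dense open subset), and it permutes the irreducible components of $C^\nu$. Let $\pi^\nu:X^\nu\to Y^\nu$ be a $G$-cover with $X^\nu$ normal, let $D_X^\nu=(\pi^\nu)^{-1}(C^\nu)$, with its reduced structure, and let $\widetilde D_X^\nu$ be the normalization of $D_X^\nu$, on which $G$ acts. Then the following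 are equivalent. (A) $X^\nu$ can be glued to an $S_2$ cover of $Y$: there is a $G$-cover $\pi:X\to Y$, where $X$ is reduced, $S_2$ and normal crossing, together with a $G$-equivariant morphism $n:X^\nu\to X$ that is the normalization of $X$ and satisfies $\pi\circ n=\nu\circ\pi^\nu$. (B) Both of the following hold: 1. for each irreducible component $C_i$ of $C^\nu$, the inertia subgroup of $C_i$ is the same as the inertia subgroup of $\iota(C_i)$ (the inertia subgroup of $C_i$ consists of the elements of $G$ acting trivially on a given component of $D_X^\nu$ lying over $C_i$; for non-abelian $G$ it is determined up to conjugacy, and the two conjugacy classes are required to coincide); 2. there exists an involution $j:\widetilde D_X^\nu\to\widetilde D_X^\nu$, commuting with the action of $G$, that covers $\iota$, i.e. is compatible with $\iota$ via the induced map $\widetilde D_X^\nu\to\widetilde C^\nu$. -/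

import Mathlib

open CategoryTheory AlgebraicGeometry TopologicalSpace

universe u v

namespace GCoverGluing

section LocalConditions

/-- A normal scheme: every local ring is an integrally closed domain. -/
def IsNormalScheme (X : Scheme.{u}) : Prop :=
  ∀ x : X, IsDomain (X.presheaf.stalk x) ∧ IsIntegrallyClosed (X.presheaf.stalk x)

/-- Serre's condition `S₂`: `depth 𝒪_{X,x} ≥ min (2, dim 𝒪_{X,x})` for all points `x`, where
`depth ≥ n` means that the maximal ideal contains a regular sequence of length `n`. -/
def SerreS2 (X : Scheme.{u}) : Prop :=
  ∀ (x : X) (n : ℕ), n ≤ 2 → (n : WithBot ℕ∞) ≤ ringKrullDim (X.presheaf.stalk x) →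
    ∃ rs : List (X.presheaf.stalk x), rs.length = n ∧
      (∀ r ∈ rs, r ∈ IsLocalRing.maximalIdeal (X.presheaf.stalk x)) ∧
      RingTheory.Sequence.IsRegular (X.presheaf.stalk x) rs

/-- A one-dimensional node (ordinary double point): a reduced one-dimensional local ring which is
not regular, whose maximal ideal is generated by two elements `u`, `v` subject to a relation
`a u² + b u v + c v² = 0` with invertible discriminant. Over an étale extension splitting the
quadratic form this is the equation `x y = 0` in generators `x`, `y` of the maximal ideal, that is,
a double normal crossing. -/
def IsNode (R : Type u) [CommRing R] [IsLocalRing R] : Prop :=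
  IsReduced R ∧ ringKrullDim R = 1 ∧ ¬ IsRegularLocalRing R ∧
    ∃ u v : R, IsLocalRing.maximalIdeal R = Ideal.span {u, v} ∧
      ∃ a b c : R, a * u ^ 2 + b * (u * v) + c * v ^ 2 = 0 ∧ IsUnit (b ^ 2 - 4 * a * c)

/-- Normal crossing in codimension one: at every point of codimension one, `X` is either regular
or a double normal crossing. -/
def IsNormalCrossing (X : Scheme.{u}) : Prop :=
  ∀ x : X, ringKrullDim (X.presheaf.stalk x) = 1 →
    IsRegularLocalRing (X.presheaf.stalk x) ∨ IsNode (X.presheaf.stalk x)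

end LocalConditions

section Normalization

/-- `n : X' ⟶ X` is the normalization of the (reduced) scheme `X`: the scheme `X'` is normal, and
`n` is integral and birational, i.e. an isomorphism over a dense open subset of `X` whose preimage
is dense in `X'`. -/
structure IsNormalization {X' X : Scheme.{u}} (n : X' ⟶ X) : Prop where
  normal : IsNormalScheme X'
  integral : IsIntegralHom n
  birational : ∃ U : X.Opens, Dense (U : Set X) ∧ Dense ((n ⁻¹ᵁ U : X'.Opens) : Set X') ∧
    IsIso (n ∣_ U)

end Normalization

section Quotients

/-- Over the open subset `W` of `Z`, the scheme `Z` is the quotient of `X` by the endomorphisms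
in `Φ`: they are all endomorphisms over `Z`, and over every open subset of `W` the functions on `Z`
are precisely the `Φ`-invariant functions on `X`. -/
def IsQuotientOver {X Z : Scheme.{u}} (Φ : Set (X ⟶ X)) (p : X ⟶ Z) (W : Z.Opens) : Prop :=
  (∀ φ ∈ Φ, φ ≫ p = p) ∧
    ∀ V : Z.Opens, V ≤ W → ∀ s : Γ(X, p ⁻¹ᵁ V),
      (∀ φ ∈ Φ, ∀ h : p ⁻¹ᵁ V ≤ φ ⁻¹ᵁ (p ⁻¹ᵁ V), φ.appLE (p ⁻¹ᵁ V) (p ⁻¹ᵁ V) h s = s) →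
      ∃! t : Γ(Z, V), p.app V t = s

/-- A `G`-cover: a finite morphism `p : X ⟶ Z` together with a faithful action of `G` on `X`
such that `Z = X / G`. -/
structure IsGCover {G : Type v} [Group G] {X Z : Scheme.{u}} (ρ : G →* Aut X) (p : X ⟶ Z) :
    Prop where
  finite : IsFinite p
  faithful : Function.Injective ρ
  quotient : IsQuotientOver (Set.range fun g => (ρ g).hom) p ⊤

/-- The inertia group of a point `x` (equivalently, of the integral closed subscheme with generic
point `x`): the elements of `G` that fix `x` and act trivially on its residue field. -/
def inertia {G : Type v} [Group G] {X : Scheme.{u}} (ρ : G →* Aut X) (x : X) : Set G :=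
  {g | X.fromSpecResidueField x ≫ (ρ g).hom = X.fromSpecResidueField x}

end Quotients

section DoubleLocus

/-- The divisorial part of the singular locus: the closure of the set of codimension one points
at which `Y` is not regular. -/
def doubleLocus (Y : Scheme.{u}) : Closeds Y :=
  ⟨closure {y : Y | ringKrullDim (Y.presheaf.stalk y) = 1 ∧
    ¬ IsRegularLocalRing (Y.presheaf.stalk y)}, isClosed_closure⟩

/-- A closed subset with its reduced scheme structure. -/
noncomputable def reducedSubscheme {X : Scheme.{u}} (Z : Closeds X) : Scheme.{u} :=
  (Scheme.IdealSheafData.vanishingIdeal Z).subscheme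

/-- The inclusion of a closed subset with its reduced scheme structure. -/
noncomputable def reducedSubschemeι {X : Scheme.{u}} (Z : Closeds X) : reducedSubscheme Z ⟶ X :=
  (Scheme.IdealSheafData.vanishingIdeal Z).subschemeι

/-- The preimage of the double locus of `Y` under a morphism `f : X ⟶ Y`. -/
def preimageDoubleLocus {X Y : Scheme.{u}} (f : X ⟶ Y) : Closeds X :=
  (doubleLocus Y).preimage f.continuous

/-- Let `ν : Y' ⟶ Y` be the normalization, `C` the double locus of `Y`, `C'` its preimage in `Y'`,
and `c` the normalization of `C'`. The involution `ι` exchanges the two branches of `Y` along `C`: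
it is an involution over `C`, and `C` is its quotient over a dense open subset of `C`. -/
def IsBranchInvolution {Y Y' Ct : Scheme.{u}} (ν : Y' ⟶ Y)
    (c : Ct ⟶ reducedSubscheme (preimageDoubleLocus ν)) (ι : Ct ⟶ Ct) : Prop :=
  ι ≫ ι = 𝟙 Ct ∧
    ∃ p : Ct ⟶ reducedSubscheme (doubleLocus Y),
      p ≫ reducedSubschemeι (doubleLocus Y) = c ≫ reducedSubschemeι (preimageDoubleLocus ν) ≫ ν ∧
      ∃ W : (reducedSubscheme (doubleLocus Y)).Opens,
        Dense (W : Set (reducedSubscheme (doubleLocus Y))) ∧ IsQuotientOver {ι} p W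

end DoubleLocus

section Gluing

variable {G : Type v} [Group G] {Y Y' X' : Scheme.{u}}

/-- The `G`-cover `p' : X' ⟶ Y'` of the normalization `ν : Y' ⟶ Y` can be glued to an `S₂` cover
of `Y`: there is a `G`-cover `p : X ⟶ Y` with `X` reduced, `S₂` and normal crossing in codimension
one, whose normalization is `X'`, compatibly with the projections and the actions of `G`. -/
def CanBeGlued (ν : Y' ⟶ Y) (ρ' : G →* Aut X') (p' : X' ⟶ Y') : Prop :=
  ∃ (X : Scheme.{u}) (ρ : G →* Aut X) (p : X ⟶ Y) (n : X' ⟶ X),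
    IsReduced X ∧ SerreS2 X ∧ IsNormalCrossing X ∧ IsGCover ρ p ∧ IsNormalization n ∧
      n ≫ p = p' ≫ ν ∧ ∀ g : G, (ρ' g).hom ≫ n = n ≫ (ρ g).hom

/-- For each component of the preimage `C'` of the double locus, the inertia group of the cover
`p' : X' ⟶ Y'` at this component is the same as at its image under `ι`. For a general group `G`
the inertia group depends on the choice of a point of `X'` above the generic point of the component
and is determined up to conjugacy; the condition compares the two conjugacy classes. -/
def SameInertia (ν : Y' ⟶ Y) (ρ' : G →* Aut X') (p' : X' ⟶ Y') {Ct : Scheme.{u}}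
    (c : Ct ⟶ reducedSubscheme (preimageDoubleLocus ν)) (ι : Ct ⟶ Ct) : Prop :=
  ∀ η ∈ genericPoints Ct,
    inertia ρ' '' {x : X' | p' x = (c ≫ reducedSubschemeι (preimageDoubleLocus ν)) η} =
      inertia ρ' '' {x : X' | p' x = (c ≫ reducedSubschemeι (preimageDoubleLocus ν)) (ι η)}

/-- Let `D'` be the preimage in `X'` of the double locus and `d : Dt ⟶ D'` its normalization.
There is an involution `j` of `Dt` which is compatible with the action of `G` (every element of `G`
has a unique lift `γ` to `Dt`, and `j` commutes with it) and which covers the involution `ι`, via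
the map `q : Dt ⟶ Ct` induced by `p'`. -/
def HasCoveringInvolution (ν : Y' ⟶ Y) (ρ' : G →* Aut X') (p' : X' ⟶ Y') {Ct Dt : Scheme.{u}}
    (c : Ct ⟶ reducedSubscheme (preimageDoubleLocus ν)) (ι : Ct ⟶ Ct)
    (d : Dt ⟶ reducedSubscheme (preimageDoubleLocus (p' ≫ ν))) : Prop :=
  ∃ j : Dt ⟶ Dt, j ≫ j = 𝟙 Dt ∧
    (∀ g : G, ∃ γ : Dt ⟶ Dt,
      γ ≫ d ≫ reducedSubschemeι (preimageDoubleLocus (p' ≫ ν)) =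
        d ≫ reducedSubschemeι (preimageDoubleLocus (p' ≫ ν)) ≫ (ρ' g).hom ∧
      γ ≫ j = j ≫ γ) ∧
    ∃ q : Dt ⟶ Ct,
      q ≫ c ≫ reducedSubschemeι (preimageDoubleLocus ν) =
        d ≫ reducedSubschemeι (preimageDoubleLocus (p' ≫ ν)) ≫ p' ∧
      j ≫ q = q ≫ ι

end Gluing

end GCoverGluing

/-! Near the generic point of a component of `C`, completing the square puts the node in the form
`u² = Δ v²` with `Δ` a unit; this uses that `2` is invertible. The quotient `e = u / v` lies in the
normalization `B` of the local ring `A` of `Y`. It satisfies `e² = Δ` and `B = A + A e`, and it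
multiplies the maximal ideal of `A` into itself (`exists_sqrt_of_isNode`). So near that point the
functions on `C^ν` are `K ⊕ K e`, with `K` the functions on `C`. An involution over `C` sends `e` to
`e` or to `-e`, and exchanging the branches means `e ↦ -e`. This treats uniformly the case of two
components of `C^ν` (`Δ` a square in `K`) and that of one component carrying an involution of its
own. Morphisms to an integral scheme extend over a normal scheme from a dense open subset
(`exists_extension`), so the local involutions extend to a unique global one
(`IsNodalAlong.exists_swap`, `IsNodalAlong.swap_unique`).

From a gluing `X` to the involution `j`. The points of `X` over the generic points of `C` have
codimension one. They are not regular: because `X / G = Y`, a function on `Y'` that is regular on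
`X` near a point is already regular on `Y` near its image (`IsGluing.exists_app_eq_mul`). Hence they
are nodes, and the construction above, applied to `X`, produces a swap `j`. Conjugating `j` by the
lift of an element of `G` gives another swap, so uniqueness makes `j` commute with `G`. On a node
chart of `X` the pullback of `e` has an even square, so it is even or odd under `j`. If it were
even, `e` would be a function on `X`; hence it is odd, and `j` covers `ι`
(`swap_comp_eq_comp_swap`).

From `j` to the inertia condition. An element of the inertia group at `δ t` has a lift fixing `Spec
κ(t)`. The lift commutes with `j`, so it also fixes the image under `j`
(`IsSetting.inertia_subset`). Thus the first condition of (B) follows from the second.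

From `j` to a gluing. Let `X` be the relative spectrum over `Y` of the sheaf of functions on `X'`
whose pullbacks along `δ` and `j ≫ δ` agree (`exists_coequalizer`). Nothing changes off `C`, so `X'`
is the normalization of `X`, and `G` acts by functoriality. An invariant function on `X` is a
function on `Y'` that is symmetric on the double locus. It is regular on `Y` at the nodes, hence
everywhere because `Y` is `S₂` (`IsSetting.exists_app_eq_of_pullbackOver_eq`); this gives `X / G =
Y`. If `t` does not divide `f` on `X`, the obstruction is visible in codimension one, either on the
normal scheme `X'` or at a generic point of its double locus, so `X` is `S₂`
(`IsPinching.exists_ringKrullDim_le_one_of_colon`). Finally the functions on `X'` over a chart have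
the form `A + A E` with `A` the functions on `X` and `E` the pullback of `e`. If `t` vanishes to
first order along the double locus, then `t` and `t E` generate the maximal ideal at the new point,
and `(t E)² = Δ t²`: a node (`exists_node_generators`). -/

open Limits

namespace GCoverGluing

/-! ### Finiteness of normalization over a perfect field. -/

section FiniteNormalization

/-- The iterated Frobenius of a polynomial ring over a perfect field is a finite ring
homomorphism. -/
theorem finite_iterateFrobenius_mvPolynomial (k : Type*) [Field k] (p : ℕ) [ExpChar k p]
    [PerfectRing k p] (s n : ℕ) :
    (iterateFrobenius (MvPolynomial (Fin s) k) p n).Finite := by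
  set φ := iterateFrobenius (MvPolynomial (Fin s) k) p n with hφ
  have hint : φ.IsIntegral := by
    intro x
    refine ⟨Polynomial.X ^ (p ^ n) - Polynomial.C x,
      Polynomial.monic_X_pow_sub_C x (pow_pos (expChar_pos k p) n).ne', ?_⟩
    simp [hφ, iterateFrobenius_def]
  refine hint.to_finite ?_
  let := φ.toAlgebra
  change Algebra.FiniteType (MvPolynomial (Fin s) k) (MvPolynomial (Fin s) k)
  classical
  refine ⟨⟨Finset.univ.image MvPolynomial.X, ?_⟩⟩
  rw [eq_top_iff]
  rintro f -
  induction f using MvPolynomial.induction_on with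
  | C a =>
    obtain ⟨b, hb⟩ := (bijective_iterateFrobenius (R := k) (p := p) n).2 a
    have : MvPolynomial.C a = algebraMap (MvPolynomial (Fin s) k) (MvPolynomial (Fin s) k)
        (MvPolynomial.C b) := by
      change _ = φ _
      rw [hφ, iterateFrobenius_def, ← map_pow, ← hb, iterateFrobenius_def]
    rw [this]
    exact Subalgebra.algebraMap_mem _ _
  | add f g hf hg => exact Subalgebra.add_mem _ hf hg
  | mul_X f i hf =>
    exact Subalgebra.mul_mem _ hf (Algebra.subset_adjoin (by simp))

/-- The integral closure of a polynomial ring over a perfect field in a finite extension of its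
fraction field is finite. -/
theorem finite_integralClosure_mvPolynomial (k : Type*) [Field k] [PerfectField k] (s : ℕ)
    (F K : Type*) [Field F] [Field K] [Algebra (MvPolynomial (Fin s) k) F]
    [IsFractionRing (MvPolynomial (Fin s) k) F] [Algebra F K]
    [Algebra (MvPolynomial (Fin s) k) K] [IsScalarTower (MvPolynomial (Fin s) k) F K]
    [FiniteDimensional F K] :
    Module.Finite (MvPolynomial (Fin s) k) (integralClosure (MvPolynomial (Fin s) k) K) := by
  set R := MvPolynomial (Fin s) k with hR
  obtain ⟨p, hp⟩ := ExpChar.exists k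
  have : PerfectRing k p := PerfectField.toPerfectRing p
  have : ExpChar R p := expChar_of_injective_algebraMap (MvPolynomial.C_injective (Fin s) k) p
  have : ExpChar F p := expChar_of_injective_algebraMap (IsFractionRing.injective R F) p
  -- Over the separable part `E` the trace form gives finiteness. The remaining extension is purely
  -- inseparable, so a power of Frobenius maps the integral closure in `K` injectively into the one
  -- in `E`, linearly over a finite Frobenius twist of `R`.
  let E := separableClosure F K
  have : ExpChar E p := expChar_of_injective_algebraMap (algebraMap F E).injective p
  have : IsPurelyInseparable E K := separableClosure.isPurelyInseparable F K
  have : FiniteDimensional E K := .right F E K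
  have : FiniteDimensional F E := .left F E K
  let n := IsPurelyInseparable.exponent E K
  let φ : K →+* E := IsPurelyInseparable.iterateFrobenius E K p (n := n) le_rfl
  have hφ : ∀ x : K, ((φ x : E) : K) = x ^ p ^ n := fun x =>
    IsPurelyInseparable.algebraMap_iterateFrobenius E p le_rfl x
  let B := integralClosure R K
  let Bs := integralClosure R E
  have : Module.Finite R Bs := IsIntegralClosure.finite R F E Bs
  have : IsScalarTower R E K := .of_algebraMap_eq fun x => by
    rw [IsScalarTower.algebraMap_apply R F K, IsScalarTower.algebraMap_apply R F E]
    rfl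
  have hE : ∀ x : E, IsIntegral R (x : K) → IsIntegral R x := fun x hx =>
    (isIntegral_algHom_iff (IsScalarTower.toAlgHom R E K) Subtype.val_injective).1 hx
  let ψ : B →+* Bs := (φ.comp B.val.toRingHom).codRestrict Bs.toSubring fun x => by
    refine hE _ ?_
    change IsIntegral R ((φ (x : K) : E) : K)
    rw [hφ]
    exact x.2.pow _
  have hψ : Function.Injective ψ := fun x y hxy => by
    have : φ (x : K) = φ (y : K) := congrArg (fun z : Bs => (z : E)) hxy
    exact Subtype.ext (φ.injective this)
  -- view `Bs` as an `R`-module through the iterated Frobenius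
  let fr := iterateFrobenius R p n
  let g : R →+* Bs := (algebraMap R Bs).comp fr
  have hg : g.Finite := RingHom.Finite.comp
    (RingHom.finite_algebraMap.2 inferInstance) (finite_iterateFrobenius_mvPolynomial k p s n)
  have hcomp : ψ.comp (algebraMap R B) = g := by
    refine RingHom.ext fun r => Subtype.ext (Subtype.val_injective ?_)
    change ((φ (algebraMap R K r) : E) : K) = algebraMap R K (fr r)
    rw [hφ, ← map_pow, iterateFrobenius_def]
  let : Algebra R Bs := g.toAlgebra
  let : Module R Bs := g.toAlgebra.toModule
  have : @Module.Finite R Bs _ _ g.toAlgebra.toModule := hg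
  let l : B →ₗ[R] Bs :=
    { toFun := ψ
      map_add' := map_add ψ
      map_smul' := fun r x => by
        have h1 : ψ (algebraMap R B r) = g r := congrArg (fun f => f r) hcomp
        rw [Algebra.smul_def, map_mul, h1]
        rfl }
  exact Module.Finite.of_injective l hψ

/-- The integral closure of a finitely generated domain over a perfect field in its fraction field
is finite. -/
theorem finite_integralClosure_of_finiteType (k : Type*) [Field k] [PerfectField k]
    (A : Type*) [CommRing A] [IsDomain A] [Algebra k A] [Algebra.FiniteType k A]
    (K : Type*) [Field K] [Algebra A K] [IsFractionRing A K] :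
    Module.Finite A (integralClosure A K) := by
  obtain ⟨s, g, hinj, hfin⟩ := exists_finite_inj_algHom_of_fg k A
  let R := MvPolynomial (Fin s) k
  let : Algebra R A := g.toRingHom.toAlgebra
  have : Module.Finite R A := hfin
  have : FaithfulSMul R A := (faithfulSMul_iff_algebraMap_injective R A).2 hinj
  let : Algebra R K := ((algebraMap A K).comp (algebraMap R A)).toAlgebra
  have : IsScalarTower R A K := .of_algebraMap_eq' rfl
  let F := FractionRing R
  have : FaithfulSMul R K := (faithfulSMul_iff_algebraMap_injective R K).2
    ((IsFractionRing.injective A K).comp hinj)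
  let : Algebra F K := FractionRing.liftAlgebra R K
  have : IsScalarTower R F K := FractionRing.isScalarTower_liftAlgebra R K
  have : FiniteDimensional F K := by
    have : IsLocalization (Algebra.algebraMapSubmonoid A (nonZeroDivisors R)) K := inferInstance
    exact Module.Finite.of_isLocalization R A (nonZeroDivisors R)
  have := finite_integralClosure_mvPolynomial k s F K
  let l : integralClosure A K →ₗ[R] integralClosure R K :=
    { toFun := fun x => ⟨x, isIntegral_trans (R := R) (A := A) _ x.2⟩
      map_add' := fun _ _ => rfl
      map_smul' := fun _ _ => rfl }
  have : IsNoetherianRing R := inferInstance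
  have : Module.Finite R (integralClosure A K) :=
    Module.Finite.of_injective l fun x y h =>
      Subtype.ext (congrArg (fun z : integralClosure R K => (z : K)) h)
  exact Module.Finite.of_restrictScalars_finite R A _

/-- A domain which is integral over a finitely generated domain over a perfect field and coincides
with it after inverting one element is finite. -/
theorem finite_of_isIntegral_of_isDomain (k : Type*) [Field k] [PerfectField k]
    (A D : Type*) [CommRing A] [IsDomain A] [CommRing D] [IsDomain D] [Algebra k A]
    [Algebra.FiniteType k A] [Algebra A D] [FaithfulSMul A D] [Algebra.IsIntegral A D]
    (a : A) (ha : a ≠ 0)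
    (h : ∀ d : D, ∃ (n : ℕ) (x : A), algebraMap A D (a ^ n) * d = algebraMap A D x) :
    Module.Finite A D := by
  let K := FractionRing D
  have hinj : Function.Injective (algebraMap A D) := FaithfulSMul.algebraMap_injective A D
  have : IsFractionRing A K := by
    refine IsFractionRing.of_field A K fun z => ?_
    obtain ⟨d₁, d₂, hd₂, rfl⟩ := IsFractionRing.div_surjective (A := D) z
    obtain ⟨n, x, hx⟩ := h d₁
    obtain ⟨m, y, hy⟩ := h d₂
    have h0 : ∀ n : ℕ, algebraMap A D (a ^ n) ≠ 0 := fun n =>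
      (map_ne_zero_iff _ hinj).2 (pow_ne_zero n ha)
    have hd : d₂ ≠ 0 := nonZeroDivisors.ne_zero hd₂
    have hy0 : algebraMap A D y ≠ 0 := hy ▸ mul_ne_zero (h0 m) hd
    refine ⟨x * a ^ m, y * a ^ n, ?_⟩
    rw [IsScalarTower.algebraMap_apply A D K, IsScalarTower.algebraMap_apply A D K, div_eq_div_iff
      ((map_ne_zero_iff _ (IsFractionRing.injective D K)).2 hd)
      ((map_ne_zero_iff _ (IsFractionRing.injective D K)).2 (by
        rw [map_mul]; exact mul_ne_zero hy0 (h0 n))), ← map_mul, ← map_mul]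
    congr 1
    rw [map_mul, map_mul, ← hx, ← hy]
    ring
  have := finite_integralClosure_of_finiteType k A K
  have : IsNoetherianRing A := Algebra.FiniteType.isNoetherianRing k A
  let l : D →ₗ[A] integralClosure A K :=
    { toFun := fun x => ⟨algebraMap D K x, (Algebra.IsIntegral.isIntegral x).map
        (IsScalarTower.toAlgHom A D K)⟩
      map_add' := fun _ _ => Subtype.ext (map_add _ _ _)
      map_smul' := fun r x => Subtype.ext (by
        change algebraMap D K (r • x) = r • algebraMap D K x
        rw [Algebra.smul_def, map_mul, ← IsScalarTower.algebraMap_apply, Algebra.smul_def]) }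
  exact Module.Finite.of_injective l fun x y h => IsFractionRing.injective D K
    (congrArg (fun z : integralClosure A K => (z : K)) h)

/-- A reduced ring which is integral over a finitely generated reduced algebra over a perfect field
and coincides with it after inverting one nonzerodivisor is finite. -/
theorem finite_of_isIntegral_of_away (k : Type*) [Field k] [PerfectField k]
    {A B : Type*} [CommRing A] [IsReduced A] [CommRing B] [Algebra k A]
    [Algebra.FiniteType k A] [Algebra A B] [FaithfulSMul A B] [Algebra.IsIntegral A B]
    (a : A) (ha : algebraMap A B a ∈ nonZeroDivisors B)
    (h : ∀ b : B, ∃ (n : ℕ) (x : A), algebraMap A B (a ^ n) * b = algebraMap A B x) :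
    Module.Finite A B := by
  have hinj : Function.Injective (algebraMap A B) := FaithfulSMul.algebraMap_injective A B
  have : IsNoetherianRing A := Algebra.FiniteType.isNoetherianRing k A
  have haA : a ∈ nonZeroDivisors A := by
    refine mem_nonZeroDivisors_iff_right.2 fun x hx => hinj ?_
    rw [map_zero]
    refine (mem_nonZeroDivisors_iff_right.1 ha) _ ?_
    rw [← map_mul, hx, map_zero]
  have hfin : (minimalPrimes A).Finite := minimalPrimes.finite_of_isNoetherianRing A
  have := hfin.to_subtype
  have hex : ∀ p : minimalPrimes A, ∃ Q : Ideal B, Q.IsPrime ∧ Q.comap (algebraMap A B) = p := by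
    intro p
    have := p.2.1.1
    obtain ⟨Q, -, hQ, hQ'⟩ := Ideal.exists_ideal_over_prime_of_isIntegral (p : Ideal A)
      (⊥ : Ideal B) (by
        change RingHom.ker (algebraMap A B) ≤ _
        rw [(RingHom.injective_iff_ker_eq_bot _).1 hinj]; exact bot_le)
    exact ⟨Q, hQ, hQ'⟩
  choose Q hQp hQ using hex
  have hfinQ : ∀ p : minimalPrimes A, Module.Finite A (B ⧸ Q p) := by
    intro p
    have := p.2.1.1
    have := hQp p
    have : (Q p).LiesOver (p : Ideal A) := ⟨(hQ p).symm⟩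
    have hap : (Ideal.Quotient.mk (p : Ideal A) a) ≠ 0 := by
      rw [Ne, Ideal.Quotient.eq_zero_iff_mem]
      intro hap
      exact (Set.disjoint_left.1 (Ideal.disjoint_nonZeroDivisors_of_mem_minimalPrimes p.2)) hap haA
    have : Module.Finite (A ⧸ (p : Ideal A)) (B ⧸ Q p) := by
      refine finite_of_isIntegral_of_isDomain k _ _ (Ideal.Quotient.mk (p : Ideal A) a) hap ?_
      intro d
      obtain ⟨b, rfl⟩ := Ideal.Quotient.mk_surjective d
      obtain ⟨n, x, hx⟩ := h b
      refine ⟨n, Ideal.Quotient.mk _ x, ?_⟩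
      rw [← map_pow, Ideal.Quotient.algebraMap_mk_of_liesOver,
        Ideal.Quotient.algebraMap_mk_of_liesOver, ← hx, map_mul]
    exact Module.Finite.trans (A ⧸ (p : Ideal A)) _
  -- The map to the product is injective: if `b` lies in every chosen `Q p`, then `a ^ n * b` comes
  -- from an element of all minimal primes of the reduced ring `A`, hence vanishes, and `a` is a
  -- nonzerodivisor on `B`.
  let l : B →ₗ[A] ∀ p : minimalPrimes A, B ⧸ Q p :=
    LinearMap.pi fun p => (Ideal.Quotient.mkₐ A (Q p)).toLinearMap
  refine Module.Finite.of_injective l ((injective_iff_map_eq_zero l).2 fun b hb => ?_)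
  obtain ⟨n, x, hx⟩ := h b
  have hbQ : ∀ p, b ∈ Q p := fun p => Ideal.Quotient.eq_zero_iff_mem.1 (congrFun hb p)
  have hx0 : x = 0 := by
    have : x ∈ nilradical A := by
      rw [nilradical, ← Ideal.sInf_minimalPrimes, Ideal.mem_sInf]
      intro p hp
      change x ∈ ((⟨p, hp⟩ : minimalPrimes A) : Ideal A)
      rw [← hQ ⟨p, hp⟩, Ideal.mem_comap, ← hx]
      exact (Q _).mul_mem_left _ (hbQ _)
    rwa [nilradical_eq_zero] at this
  rw [hx0, map_zero, map_pow, mul_comm] at hx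
  exact mem_nonZeroDivisors_iff_right.1 (pow_mem ha n) _ hx

end FiniteNormalization

/-! ### Normality, Serre's condition and denominators in birational extensions. -/

section CommutativeAlgebra

/-- A ring all of whose localizations at primes are integrally closed domains. -/
def StalkNormal (B : Type*) [CommRing B] : Prop :=
  ∀ (Q : Ideal B) [Q.IsPrime],
    IsDomain (Localization.AtPrime Q) ∧ IsIntegrallyClosed (Localization.AtPrime Q)

/-- A stalkwise normal ring is integrally closed in its localizations at nonzerodivisors. -/
theorem StalkNormal.exists_algebraMap_eq {B L : Type*} [CommRing B] [CommRing L] [Algebra B L]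
    (hB : StalkNormal B) (S : Submonoid B) [IsLocalization S L] (hS : S ≤ nonZeroDivisors B)
    (x : L) (hx : IsIntegral B x) : ∃ b, algebraMap B L b = x := by
  obtain ⟨⟨b, m⟩, hbm⟩ := IsLocalization.surj S x
  -- The denominators of `x`. If they lay in a maximal ideal `Q`, the image of `x` would be integral
  -- over the normal domain `B_Q`, hence in it, which produces a denominator outside `Q`.
  let I : Ideal B :=
    { carrier := {s | ∃ c, algebraMap B L s * x = algebraMap B L c}
      add_mem' := by
        rintro s t ⟨c, hc⟩ ⟨d, hd⟩
        exact ⟨c + d, by rw [map_add, map_add, add_mul, hc, hd]⟩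
      zero_mem' := ⟨0, by simp⟩
      smul_mem' := by
        rintro r s ⟨c, hc⟩
        exact ⟨r * c, by rw [smul_eq_mul, map_mul, map_mul, mul_assoc, hc]⟩ }
  by_cases hI : I = ⊤
  · obtain ⟨c, hc⟩ : (1 : B) ∈ I := hI ▸ Submodule.mem_top
    exact ⟨c, by rw [← hc, map_one, one_mul]⟩
  exfalso
  obtain ⟨Q, hQ, hIQ⟩ := Ideal.exists_le_maximal I hI
  let O := Localization.AtPrime Q
  obtain ⟨_, _⟩ := hB Q
  let F := FractionRing O
  let f : B →+* F := (algebraMap O F).comp (algebraMap B O)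
  have hO : ∀ y : B, algebraMap B O y = 0 → ∃ s ∉ Q, s * y = 0 := fun y hy => by
    obtain ⟨⟨s, hs⟩, h⟩ := (IsLocalization.map_eq_zero_iff Q.primeCompl O y).1 hy
    exact ⟨s, hs, h⟩
  have hf : ∀ y : B, f y = 0 → ∃ s ∉ Q, s * y = 0 := fun y hy =>
    hO y ((map_eq_zero_iff _ (IsFractionRing.injective O F)).1 hy)
  have hunit : ∀ y : S, IsUnit (f y) := by
    intro y
    rw [isUnit_iff_ne_zero]
    intro hy
    obtain ⟨s, hs, h⟩ := hf _ hy
    exact hs ((mem_nonZeroDivisors_iff_right.1 (hS y.2) s h) ▸ Q.zero_mem)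
  let g : L →+* F := IsLocalization.lift (M := S) hunit
  have hg : ∀ y, g (algebraMap B L y) = f y := fun y => IsLocalization.lift_eq hunit y
  have hint : IsIntegral O (g x) := by
    obtain ⟨p, hp, hpx⟩ := hx
    refine ⟨p.map (algebraMap B O), hp.map _, ?_⟩
    have h1 : g.comp (algebraMap B L) = (algebraMap O F).comp (algebraMap B O) := RingHom.ext hg
    rw [Polynomial.eval₂_map, ← h1, ← Polynomial.hom_eval₂, hpx, map_zero]
  obtain ⟨z, hz⟩ := IsIntegrallyClosed.isIntegral_iff.1 hint
  obtain ⟨⟨c, s⟩, hcs⟩ := IsLocalization.surj Q.primeCompl z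
  have h1 : f (s * b - c * m) = 0 := by
    have h2 := congrArg (algebraMap O F) hcs
    rw [map_mul, hz] at h2
    have h3 := congrArg g hbm
    rw [map_mul, hg, hg] at h3
    rw [map_sub, map_mul, map_mul, ← h3]
    change f s * (g x * f m) - algebraMap O F (algebraMap B O c) * f m = 0
    rw [← h2]
    change f s * (g x * f m) - g x * f s * f m = 0
    ring
  obtain ⟨s', hs', h2⟩ := hf _ h1
  have h3 : s' * s ∈ I := by
    refine ⟨s' * c, ?_⟩
    have hm : IsUnit (algebraMap B L m) := IsLocalization.map_units L m
    rw [← hm.mul_left_inj, mul_assoc, hbm, ← map_mul, ← map_mul]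
    congr 1
    linear_combination h2
  exact (hQ.isPrime.mul_notMem hs' s.2) (hIQ h3)

/-- Over a noetherian ring, below every prime containing `J` there is an associated prime of
`R ⧸ J`. -/
theorem exists_prime_mem_iff_mul_mem {R : Type*} [CommRing R] [IsNoetherianRing R] (J q : Ideal R)
    [q.IsPrime] (hJ : J ≤ q) :
    ∃ q₀ : Ideal R, q₀.IsPrime ∧ J ≤ q₀ ∧ q₀ ≤ q ∧ ∃ r, ∀ s, s ∈ q₀ ↔ s * r ∈ J := by
  obtain ⟨q₀, hq₀, hle⟩ := Ideal.exists_minimalPrimes_le hJ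
  have h1 : q₀ ∈ associatedPrimes R (R ⧸ J) := by
    apply Module.associatedPrimes.minimalPrimes_annihilator_subset_associatedPrimes
    rwa [Ideal.annihilator_quotient]
  obtain ⟨hp, x, hx⟩ := Submodule.isAssociatedPrime_iff.1 h1
  obtain ⟨r, rfl⟩ := Ideal.Quotient.mk_surjective x
  refine ⟨q₀, hp, hq₀.1.2, hle, r, fun s => ?_⟩
  rw [hx, Submodule.mem_colon_singleton, Submodule.mem_bot, ← Ideal.Quotient.mk_eq_mk,
    ← Submodule.Quotient.mk_smul, Ideal.Quotient.mk_eq_mk, Ideal.Quotient.eq_zero_iff_mem,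
    smul_eq_mul]

/-- A denominator for a finite module. -/
theorem exists_notMem_forall_smul_mem {A M : Type*} [CommRing A] [AddCommGroup M] [Module A M]
    [Module.Finite A M] (N : Submodule A M) (q : Ideal A) [q.IsPrime]
    (h : ∀ m : M, ∃ s ∉ q, s • m ∈ N) : ∃ s ∉ q, ∀ m : M, s • m ∈ N := by
  classical
  obtain ⟨T, hT⟩ := Module.Finite.fg_top (R := A) (M := M)
  choose s hs hs' using h
  refine ⟨∏ t ∈ T, s t, fun h => ?_, fun m => ?_⟩
  · obtain ⟨t, -, ht⟩ := (Ideal.IsPrime.prod_mem_iff).1 h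
    exact hs t ht
  · have hm : m ∈ Submodule.span A (T : Set M) := hT ▸ Submodule.mem_top
    induction hm using Submodule.span_induction with
    | mem x hx =>
      rw [← Finset.prod_erase_mul _ _ hx, mul_smul]
      exact N.smul_mem _ (hs' x)
    | zero => simp
    | add x y _ _ hx hy => rw [smul_add]; exact N.add_mem hx hy
    | smul a x _ hx => rw [smul_comm]; exact N.smul_mem _ hx

/-- A prime whose local ring has depth at least two, without localization. -/
def DepthTwo {A : Type*} [CommRing A] (q : Ideal A) : Prop :=
  ∃ t₁ ∈ q, ∃ t₂ ∈ q, (∀ x, t₁ * x = 0 → ∃ s ∉ q, s * x = 0) ∧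
    ∀ x z, t₂ * x = t₁ * z → ∃ s ∉ q, ∃ y, s * x = t₁ * y

section Birational

/-- The ideal of denominators of `b`. -/
def denomIdeal (A : Type*) {B : Type*} [CommRing A] [CommRing B] [Algebra A B] (b : B) : Ideal A :=
  (LinearMap.range (Algebra.linearMap A B)).comap (LinearMap.toSpanSingleton A B b)

theorem mem_denomIdeal {A B : Type*} [CommRing A] [CommRing B] [Algebra A B] {b : B} {s : A} :
    s ∈ denomIdeal A b ↔ ∃ c, algebraMap A B c = algebraMap A B s * b := by
  simp [denomIdeal, Algebra.smul_def]

variable {A B : Type*} [CommRing A] [CommRing B] [Algebra A B] [FaithfulSMul A B]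

/-- With `t₁, t₂ ∈ q` regular at `q`, the elements `x = t₁ b` and `y = t₂ b` of `A` satisfy `t₂ x =
t₁ y`, so `s x = t₁ z` with `s ∉ q`, and `s b - z` is killed by `t₁`. A power of `a` brings this
difference into `A`, where `t₁` can be cancelled near `q`. -/
theorem exists_notMem_mem_denomIdeal_of_depthTwo {a : A}
    (ha : algebraMap A B a ∈ nonZeroDivisors B)
    (h : ∀ b : B, ∃ n : ℕ, a ^ n ∈ denomIdeal A b) (q : Ideal A) [q.IsPrime]
    (hq : DepthTwo q) (b : B) (hb : q ≤ denomIdeal A b) : ∃ s ∉ q, s ∈ denomIdeal A b := by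
  have hinj : Function.Injective (algebraMap A B) := FaithfulSMul.algebraMap_injective A B
  obtain ⟨t₁, ht₁, t₂, ht₂, h1, h2⟩ := hq
  obtain ⟨x, hx⟩ := mem_denomIdeal.1 (hb ht₁)
  obtain ⟨y, hy⟩ := mem_denomIdeal.1 (hb ht₂)
  obtain ⟨s, hs, z, hz⟩ := h2 x y (hinj (by rw [map_mul, map_mul, hx, hy]; ring))
  let w := algebraMap A B s * b - algebraMap A B z
  obtain ⟨n, hn⟩ := h w
  obtain ⟨w', hw'⟩ := mem_denomIdeal.1 hn
  have hz' := congrArg (algebraMap A B) hz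
  rw [map_mul, map_mul, hx] at hz'
  obtain ⟨s', hs', h3⟩ := h1 w' (hinj (by
    rw [map_mul, hw', map_zero]
    simp only [w]
    linear_combination (algebraMap A B (a ^ n)) * hz'))
  have h4 : algebraMap A B s' * w = 0 := by
    have h5 := congrArg (algebraMap A B) h3
    rw [map_mul, hw', map_zero, map_pow] at h5
    refine mem_nonZeroDivisors_iff_right.1 (pow_mem ha n) _ ?_
    linear_combination h5
  refine ⟨s' * s, Ideal.IsPrime.mul_notMem ‹_› hs' hs, mem_denomIdeal.2 ⟨s' * z, ?_⟩⟩
  rw [map_mul, map_mul]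
  simp only [w] at h4
  linear_combination -h4

variable [IsNoetherianRing A]

/-- Under Serre's condition `S₂`, below every prime at which `b` is not defined, there is one of
height at most one at which `b` is not defined. -/
theorem exists_height_le_one_denomIdeal_le {a : A}
    (ha : algebraMap A B a ∈ nonZeroDivisors B)
    (h : ∀ b : B, ∃ n : ℕ, a ^ n ∈ denomIdeal A b)
    (hS2 : ∀ (q : Ideal A) [q.IsPrime], 1 < q.height → DepthTwo q) (b : B) (q : Ideal A)
    [q.IsPrime] (hq : denomIdeal A b ≤ q) :
    ∃ q₀ : Ideal A, q₀.IsPrime ∧ q₀ ≤ q ∧ q₀.height ≤ 1 ∧ denomIdeal A b ≤ q₀ := by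
  obtain ⟨q₀, hp, hJ, hle, r, hr⟩ := exists_prime_mem_iff_mul_mem (denomIdeal A b) q hq
  refine ⟨q₀, hp, hle, ?_, hJ⟩
  by_contra! hht
  -- The denominators of `r b` form exactly the associated prime `q₀`; depth two at `q₀` would give
  -- one outside it.
  have hmem : ∀ s, s ∈ denomIdeal A (algebraMap A B r * b) ↔ s * r ∈ denomIdeal A b := fun s => by
    rw [mem_denomIdeal, mem_denomIdeal, map_mul, mul_assoc]
  obtain ⟨s, hs, hs'⟩ := exists_notMem_mem_denomIdeal_of_depthTwo ha h q₀ (hS2 q₀ hht)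
    (algebraMap A B r * b) (fun s hs => (hmem s).2 ((hr s).1 hs))
  exact hs ((hr s).2 ((hmem s).1 hs'))

/-- Hartogs' principle for `S₂` rings: a proper ideal of denominators is contained in a prime of
height at most one. -/
theorem exists_algebraMap_eq_of_height_le_one {a : A}
    (ha : algebraMap A B a ∈ nonZeroDivisors B)
    (h : ∀ b : B, ∃ n : ℕ, a ^ n ∈ denomIdeal A b)
    (hS2 : ∀ (q : Ideal A) [q.IsPrime], 1 < q.height → DepthTwo q) (b : B)
    (hb : ∀ (q : Ideal A) [q.IsPrime], q.height ≤ 1 → ∃ s ∉ q, s ∈ denomIdeal A b) :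
    ∃ c, algebraMap A B c = b := by
  have htop : denomIdeal A b = ⊤ := by
    by_contra hne
    obtain ⟨q, hq, hle⟩ := Ideal.exists_le_maximal _ hne
    obtain ⟨q₀, hp, -, hht, hle'⟩ := exists_height_le_one_denomIdeal_le ha h hS2 b q hle
    obtain ⟨s, hs, hs'⟩ := hb q₀ hht
    exact hs (hle' hs')
  obtain ⟨c, hc⟩ := mem_denomIdeal.1 (htop ▸ Submodule.mem_top : (1 : A) ∈ denomIdeal A b)
  exact ⟨c, by rw [hc, map_one, one_mul]⟩

/-- A prime of `B` which is minimal among those over which `A` and `B` differ lies over a prime of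
height at most one. -/
theorem height_under_le_one_of_minimal [Module.Finite A B] {a : A}
    (ha : algebraMap A B a ∈ nonZeroDivisors B)
    (h : ∀ b : B, ∃ n : ℕ, a ^ n ∈ denomIdeal A b)
    (hS2 : ∀ (q : Ideal A) [q.IsPrime], 1 < q.height → DepthTwo q) (Q : Ideal B) [Q.IsPrime]
    (hQ : ∃ b : B, denomIdeal A b ≤ Q.comap (algebraMap A B))
    (hmin : ∀ (Q' : Ideal B) [Q'.IsPrime], Q' ≤ Q →
      (∃ b : B, denomIdeal A b ≤ Q'.comap (algebraMap A B)) → Q' = Q) :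
    (Q.comap (algebraMap A B)).height ≤ 1 := by
  have : IsNoetherianRing B := isNoetherian_of_isNoetherianRing_of_finite A B |> fun _ =>
    IsNoetherianRing.of_finite A B
  -- The conductor, as an ideal of `B`. Since `B` is finite over `A`, the primes containing it are
  -- exactly those over which the two rings differ.
  let I : Ideal B :=
    { carrier := {c | ∀ b, ∃ x, algebraMap A B x = c * b}
      add_mem' := by
        intro c d hc hd b
        obtain ⟨x, hx⟩ := hc b
        obtain ⟨y, hy⟩ := hd b
        exact ⟨x + y, by rw [map_add, hx, hy, add_mul]⟩
      zero_mem' := fun b => ⟨0, by simp⟩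
      smul_mem' := fun r c hc b => by
        obtain ⟨x, hx⟩ := hc (r * b)
        exact ⟨x, by rw [hx, smul_eq_mul]; ring⟩ }
  have key : ∀ (Q' : Ideal B) [Q'.IsPrime], I ≤ Q' →
      ∃ b : B, denomIdeal A b ≤ Q'.comap (algebraMap A B) := by
    intro Q' hQ' hI
    by_contra! hcon
    obtain ⟨s, hs, hs'⟩ := exists_notMem_forall_smul_mem (LinearMap.range (Algebra.linearMap A B))
      (Q'.comap (algebraMap A B)) (fun b => by
        obtain ⟨s, hs, hs'⟩ := SetLike.not_le_iff_exists.1 (hcon b)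
        exact ⟨s, hs', hs⟩)
    refine hs (hI fun b => ?_)
    obtain ⟨x, hx⟩ := hs' b
    exact ⟨x, by rw [← Algebra.smul_def]; exact hx⟩
  have hIQ : I ≤ Q := by
    intro c hc
    obtain ⟨b, hb⟩ := hQ
    obtain ⟨x, hx⟩ := hc 1
    rw [mul_one] at hx
    rw [← hx]
    refine hb (mem_denomIdeal.2 ?_)
    obtain ⟨y, hy⟩ := hc b
    exact ⟨y, by rw [hy, hx]⟩
  -- By minimality `Q` is itself of the form `(I : r)`. At depth two, `q r B ⊆ A` would yield `s ∉
  -- q` with `s r B ⊆ A`, that is `s ∈ (I : r) = Q`.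
  obtain ⟨Q', hQ', hIQ', hle, r, hr⟩ := exists_prime_mem_iff_mul_mem I Q hIQ
  obtain rfl := hmin Q' hle (key Q' hIQ')
  by_contra! hht
  set q := Q'.comap (algebraMap A B) with hq
  have h1 : ∀ b : B, ∃ s ∉ q, s ∈ denomIdeal A (r * b) := fun b =>
    exists_notMem_mem_denomIdeal_of_depthTwo ha h q (hS2 q hht) (r * b) fun s hs => by
      obtain ⟨x, hx⟩ := (hr _).1 hs b
      exact mem_denomIdeal.2 ⟨x, by rw [hx, mul_assoc]⟩
  obtain ⟨s, hs, hs'⟩ := exists_notMem_forall_smul_mem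
    ((LinearMap.range (Algebra.linearMap A B)).comap (LinearMap.mulLeft A r)) q (fun b => by
      obtain ⟨s, hs, hs'⟩ := h1 b
      obtain ⟨x, hx⟩ := mem_denomIdeal.1 hs'
      exact ⟨s, hs, x, by simp [hx, Algebra.smul_def]; ring⟩)
  refine hs ((hr _).2 fun b => ?_)
  obtain ⟨x, hx⟩ := hs' b
  refine ⟨x, ?_⟩
  simp only [Algebra.linearMap_apply, LinearMap.mulLeft_apply, Algebra.smul_def] at hx
  rw [hx]; ring

omit [IsNoetherianRing A] in
/-- If `A` and `B` agree at `q`, then primes of `B` over `q` have the same height. -/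
theorem height_eq_of_denomIdeal_not_le (Q : Ideal B) [Q.IsPrime]
    (hQ : ∀ b : B, ∃ s ∉ Q.comap (algebraMap A B), s ∈ denomIdeal A b) :
    (Q.comap (algebraMap A B)).height = Q.height := by
  have hqp : (Q.comap (algebraMap A B)).IsPrime := inferInstance
  set q := Q.comap (algebraMap A B) with hq
  let L := Localization.AtPrime Q
  have : IsLocalization.AtPrime L q := by
    refine ⟨⟨?_, ?_, ?_⟩⟩
    · rintro ⟨y, hy⟩
      rw [IsScalarTower.algebraMap_apply A B L]
      exact IsLocalization.map_units L (⟨algebraMap A B y, hy⟩ : Q.primeCompl)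
    · intro z
      obtain ⟨⟨b, t⟩, hbt⟩ := IsLocalization.surj Q.primeCompl z
      obtain ⟨s, hs, hs'⟩ := hQ b
      obtain ⟨s', hs1, hs1'⟩ := hQ t
      obtain ⟨c, hc⟩ := mem_denomIdeal.1 hs'
      obtain ⟨d, hd⟩ := mem_denomIdeal.1 hs1'
      have hdq : d ∉ q := fun hdq => by
        have h3 : algebraMap A B d ∈ Q := hdq
        rw [hd] at h3
        exact (Ideal.IsPrime.mul_notMem ‹Q.IsPrime› hs1 t.2) h3
      refine ⟨⟨c * s', ⟨d * s, Ideal.IsPrime.mul_notMem inferInstance hdq hs⟩⟩, ?_⟩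
      simp only [IsScalarTower.algebraMap_apply A B L, map_mul, hc, hd] at hbt ⊢
      linear_combination (algebraMap B L (algebraMap A B s')) *
        (algebraMap B L (algebraMap A B s)) * hbt
    · intro x y hxy
      rw [IsScalarTower.algebraMap_apply A B L, IsScalarTower.algebraMap_apply A B L] at hxy
      obtain ⟨t, ht⟩ := (IsLocalization.eq_iff_exists Q.primeCompl L).1 hxy
      obtain ⟨s', hs1, hs1'⟩ := hQ t
      obtain ⟨d, hd⟩ := mem_denomIdeal.1 hs1'
      have hdq : d ∉ q := fun hdq => by
        have h3 : algebraMap A B d ∈ Q := hdq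
        rw [hd] at h3
        exact (Ideal.IsPrime.mul_notMem ‹Q.IsPrime› hs1 t.2) h3
      refine ⟨⟨d, hdq⟩, FaithfulSMul.algebraMap_injective A B ?_⟩
      simp only [map_mul, hd]
      linear_combination (algebraMap A B s') * ht
  have h1 := IsLocalization.AtPrime.ringKrullDim_eq_height q L
  have h2 := IsLocalization.AtPrime.ringKrullDim_eq_height Q L
  rw [h1] at h2
  exact_mod_cast h2

/-- Primes of height one of `B` lie over primes of height at most one of `A`. -/
theorem height_under_le_one [Module.Finite A B] {a : A}
    (ha : algebraMap A B a ∈ nonZeroDivisors B)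
    (h : ∀ b : B, ∃ n : ℕ, a ^ n ∈ denomIdeal A b)
    (hS2 : ∀ (q : Ideal A) [q.IsPrime], 1 < q.height → DepthTwo q) (Q : Ideal B) [Q.IsPrime]
    (hQ : Q.height ≤ 1) : (Q.comap (algebraMap A B)).height ≤ 1 := by
  by_cases hex : ∃ b : B, denomIdeal A b ≤ Q.comap (algebraMap A B)
  -- A strictly smaller prime over which the rings differ would be a minimal prime of `B` containing
  -- the nonzerodivisor `a`.
  · refine height_under_le_one_of_minimal ha h hS2 Q hex fun Q' hQ' hle ⟨b, hb⟩ => ?_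
    by_contra hne
    have hlt : Q' < Q := lt_of_le_of_ne hle hne
    have haQ' : algebraMap A B a ∈ Q' := by
      obtain ⟨n, hn⟩ := h b
      exact hQ'.mem_of_pow_mem n (by simpa using hb hn)
    have h0 : Q'.height + 1 ≤ 0 + 1 := by
      rw [zero_add]
      exact (Ideal.height_add_one_le_of_lt_of_isPrime hlt).trans hQ
    have hmin : Q' ∈ minimalPrimes B := Ideal.height_eq_zero_iff.1
      (nonpos_iff_eq_zero.1 ((ENat.add_le_add_iff_right ENat.one_ne_top).1 h0))
    exact Set.disjoint_left.1 (Ideal.disjoint_nonZeroDivisors_of_mem_minimalPrimes hmin) haQ' ha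
  · push Not at hex
    rw [height_eq_of_denomIdeal_not_le Q fun b => ?_]
    · exact hQ
    · obtain ⟨s, hs, hs'⟩ := SetLike.not_le_iff_exists.1 (hex b)
      exact ⟨s, hs', hs⟩

end Birational

/-- A noetherian normal local domain whose maximal ideal is of the form `(t : f)` with `t ≠ 0` has
principal maximal ideal. -/
theorem maximalIdeal_isPrincipal_of_colon {O : Type*} [CommRing O] [IsDomain O] [IsLocalRing O]
    [IsNoetherianRing O] [IsIntegrallyClosed O] (t f : O) (ht : t ≠ 0) (hf : ¬ t ∣ f)
    (h : ∀ x ∈ IsLocalRing.maximalIdeal O, t ∣ x * f) :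
    ∃ x, IsLocalRing.maximalIdeal O = Ideal.span {x} := by
  -- The fraction `g = f / t` satisfies `𝔪 g ⊆ O`. If `𝔪 g ⊆ 𝔪`, then `g` is integral by
  -- Cayley–Hamilton, hence in `O`, contrary to `hf`. Otherwise `x g` is a unit for some `x ∈ 𝔪`,
  -- and `x` generates `𝔪`.
  by_cases hall : ∀ x ∈ IsLocalRing.maximalIdeal O, ∃ y ∈ IsLocalRing.maximalIdeal O, x * f = t * y
  · by_cases hbot : IsLocalRing.maximalIdeal O = ⊥
    · exact ⟨0, by rw [hbot, Ideal.span_singleton_eq_bot.2 rfl]⟩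
    exfalso
    let K := FractionRing O
    let _ : Field K := inferInstanceAs (Field (FractionRing O))
    let g : K := algebraMap O K f / algebraMap O K t
    have ht' : algebraMap O K t ≠ 0 := (map_ne_zero_iff _ (IsFractionRing.injective O K)).2 ht
    let N : Submodule O K := Submodule.map (Algebra.linearMap O K) (IsLocalRing.maximalIdeal O)
    have hg : IsIntegral O g := by
      refine isIntegral_of_smul_mem_submodule N ?_ ?_ g ?_
      · obtain ⟨x, hx, hx0⟩ := Submodule.exists_mem_ne_zero_of_ne_bot hbot
        intro hN
        have h1 : algebraMap O K x ∈ N := ⟨x, hx, rfl⟩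
        rw [hN, Submodule.mem_bot, map_eq_zero_iff _ (IsFractionRing.injective O K)] at h1
        exact hx0 h1
      · exact Submodule.FG.map _ (IsNoetherian.noetherian _)
      · rintro _ ⟨x, hx, rfl⟩
        obtain ⟨y, hy, hxy⟩ := hall x hx
        refine ⟨y, hy, ?_⟩
        have := congrArg (algebraMap O K) hxy
        rw [map_mul, map_mul] at this
        change algebraMap O K y = algebraMap O K f / algebraMap O K t * algebraMap O K x
        rw [div_mul_eq_mul_div, eq_div_iff ht']
        linear_combination -this
    obtain ⟨z, hz⟩ := IsIntegrallyClosed.isIntegral_iff.1 hg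
    refine hf ⟨z, IsFractionRing.injective O K ?_⟩
    rw [map_mul, hz, mul_div_cancel₀ _ ht']
  · push Not at hall
    obtain ⟨x, hx, hxy⟩ := hall
    obtain ⟨u, hu⟩ := h x hx
    have hunit : IsUnit u := by
      by_contra hnu
      exact hxy u ((IsLocalRing.mem_maximalIdeal u).2 hnu) hu
    obtain ⟨w, hw⟩ := hunit.exists_right_inv
    refine ⟨x, le_antisymm (fun y hy => ?_) ((Ideal.span_singleton_le_iff_mem _).2 hx)⟩
    obtain ⟨v, hv⟩ := h y hy
    rw [Ideal.mem_span_singleton]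
    refine ⟨v * w, mul_left_cancel₀ ht ?_⟩
    have hf0 : f ≠ 0 := fun h0 => hf (h0 ▸ dvd_zero t)
    refine mul_left_cancel₀ hf0 ?_
    linear_combination (t * y * f) * (-hw) + (t * w * u) * hv - v * w * t * hu

/-- After localizing at `Q` the maximal ideal is `(t : f)`, hence principal by
`maximalIdeal_isPrincipal_of_colon`, and Krull's principal ideal theorem applies. This is the `S₂`
property of normal rings in the form needed later. -/
theorem height_le_one_of_colon {R : Type*} [CommRing R] [IsNoetherianRing R] (hR : StalkNormal R)
    (t : R) (ht : t ∈ nonZeroDivisors R) (Q : Ideal R) [Q.IsPrime] (f : R)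
    (hQ : ∀ r, r ∈ Q ↔ t ∣ r * f) : Q.height ≤ 1 := by
  let O := Localization.AtPrime Q
  obtain ⟨_, _⟩ := hR Q
  have : IsNoetherianRing O := IsLocalization.isNoetherianRing Q.primeCompl O inferInstance
  have ht0 : algebraMap R O t ≠ 0 := fun h0 => by
    obtain ⟨⟨s, hs⟩, h⟩ := (IsLocalization.map_eq_zero_iff Q.primeCompl O t).1 h0
    exact hs ((mem_nonZeroDivisors_iff_right.1 ht s h) ▸ Q.zero_mem)
  obtain ⟨x, hx⟩ := maximalIdeal_isPrincipal_of_colon (algebraMap R O t) (algebraMap R O f) ht0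
    (by
      rintro ⟨z, hz⟩
      obtain ⟨⟨c, s⟩, hcs⟩ := IsLocalization.surj Q.primeCompl z
      have h1 : algebraMap R O (s * f) = algebraMap R O (t * c) := by
        rw [map_mul, map_mul, hz, ← hcs]; ring
      obtain ⟨s', hs'⟩ := (IsLocalization.eq_iff_exists Q.primeCompl O).1 h1
      exact Ideal.IsPrime.mul_notMem ‹_› s'.2 s.2 ((hQ _).2 ⟨s' * c, by
        linear_combination hs'⟩))
    (by
      intro y hy
      obtain ⟨⟨r, s⟩, hrs⟩ := IsLocalization.surj Q.primeCompl y
      have hr : r ∈ Q := by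
        rw [← IsLocalization.AtPrime.to_map_mem_maximal_iff O Q]
        rw [← hrs]
        exact Ideal.mul_mem_right _ _ hy
      obtain ⟨z, hz⟩ := (hQ r).1 hr
      obtain ⟨w, hw⟩ := (IsLocalization.map_units O s).exists_right_inv
      refine ⟨algebraMap R O z * w, ?_⟩
      have := congrArg (algebraMap R O) hz
      rw [map_mul, map_mul] at this
      simp only at hrs
      linear_combination (-(y * algebraMap R O f)) * hw + w * algebraMap R O f * hrs + w * this)
  have h1 := IsLocalization.AtPrime.ringKrullDim_eq_height Q O
  have h2 := IsLocalRing.maximalIdeal_height_eq_ringKrullDim (R := O)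
  rw [h1] at h2
  have h3 : (IsLocalRing.maximalIdeal O).height = Q.height := by exact_mod_cast h2
  rw [← h3]
  exact Ideal.height_le_one_of_isPrincipal_of_mem_minimalPrimes (Ideal.span {x}) _ (by
    rw [← hx, Ideal.minimalPrimes_eq_subsingleton_self]; rfl)

theorem mem_nonZeroDivisors_of_notMem_minimalPrimes {A : Type*} [CommRing A] [IsReduced A] {a : A}
    (ha : ∀ p ∈ minimalPrimes A, a ∉ p) : a ∈ nonZeroDivisors A := by
  refine mem_nonZeroDivisors_iff_right.2 fun x hx => ?_
  have : x ∈ nilradical A := by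
    rw [nilradical, ← Ideal.sInf_minimalPrimes, Ideal.mem_sInf]
    intro p hp
    exact (hp.1.1.mem_or_mem (by rw [hx]; exact p.zero_mem)).resolve_right (ha p hp)
  rwa [nilradical_eq_zero] at this

/-- An open subset of an affine reduced noetherian scheme that contains the generic points contains
the locus where some nonzerodivisor is invertible. -/
theorem exists_nonZeroDivisors_mem_of_forall_not_le {A : Type*} [CommRing A] [IsReduced A]
    [IsNoetherianRing A] (I : Ideal A) (hI : ∀ p ∈ minimalPrimes A, ¬ I ≤ p) :
    ∃ a ∈ I, a ∈ nonZeroDivisors A := by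
  by_contra! hcon
  have hfin : (minimalPrimes A).Finite := minimalPrimes.finite_of_isNoetherianRing A
  have h1 : (I : Set A) ⊆ ⋃ p ∈ hfin.toFinset, (p : Set A) := by
    intro a ha
    by_contra hna
    refine hcon a ha (mem_nonZeroDivisors_of_notMem_minimalPrimes fun p hp hap => hna ?_)
    exact Set.mem_biUnion (hfin.mem_toFinset.2 hp) hap
  obtain ⟨p, hp, hle⟩ := (Ideal.subset_union_prime (f := id) ⊥ ⊥
    (fun p hp _ _ => ((hfin.mem_toFinset.1 hp).1.1))).1 h1
  exact hI p (hfin.mem_toFinset.1 hp) hle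

end CommutativeAlgebra

/-! ### One-dimensional local rings and the normalization of a node. -/

section LocalRings

open IsLocalRing

theorem isRegularLocalRing_of_maximalIdeal_eq_span {R : Type*} [CommRing R] [IsLocalRing R]
    [IsNoetherianRing R] (hdim : ringKrullDim R = 1) (t : R)
    (ht : maximalIdeal R = Ideal.span {t}) : IsRegularLocalRing R := by
  rw [isRegularLocalRing_iff, hdim]
  have h1 : (maximalIdeal R).spanFinrank = 1 := by
    rw [Submodule.spanFinrank_eq_one_iff]
    refine ⟨⟨t, ht⟩, fun hbot => ?_⟩
    have h2 := maximalIdeal_height_eq_ringKrullDim (R := R)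
    rw [hdim, hbot] at h2
    have h3 : (⊥ : Ideal R).height = 0 := Ideal.height_bot
    rw [h3] at h2
    simp at h2
  rw [h1]
  rfl

theorem maximalIdeal_notMem_minimalPrimes {R : Type*} [CommRing R] [IsLocalRing R]
    (hdim : ringKrullDim R = 1) : maximalIdeal R ∉ minimalPrimes R := by
  intro h
  have h1 := Ideal.height_eq_zero_iff.2 h
  have h2 := maximalIdeal_height_eq_ringKrullDim (R := R)
  rw [hdim, h1] at h2
  simp at h2

/-- In dimension one the only prime containing a nonzero `t ∈ 𝔪` is `𝔪`, so `𝔪` is an associated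
prime `(t : f)` of `(t)`. -/
theorem exists_maximalIdeal_eq_span_of_isIntegrallyClosed {R : Type*} [CommRing R] [IsDomain R]
    [IsLocalRing R] [IsNoetherianRing R] [IsIntegrallyClosed R] (hdim : ringKrullDim R = 1) :
    ∃ x, maximalIdeal R = Ideal.span {x} := by
  have h2 : (maximalIdeal R).height = 1 := by
    have := maximalIdeal_height_eq_ringKrullDim (R := R)
    rw [hdim] at this
    exact_mod_cast this
  have hne : maximalIdeal R ≠ ⊥ := fun h => by
    rw [h, Ideal.height_bot] at h2
    exact zero_ne_one h2
  obtain ⟨t, ht, ht0⟩ := Submodule.exists_mem_ne_zero_of_ne_bot hne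
  obtain ⟨q, hq, hJ, hle, f, hf⟩ := exists_prime_mem_iff_mul_mem (Ideal.span {t}) (maximalIdeal R)
    ((Ideal.span_singleton_le_iff_mem _).2 ht)
  have hqm : q = maximalIdeal R := by
    by_contra hcon
    have h3 := Ideal.height_add_one_le_of_lt_of_isPrime (lt_of_le_of_ne hle hcon)
    rw [h2] at h3
    have h4 : q.height + 1 ≤ 0 + 1 := by simpa using h3
    have h5 := Ideal.height_eq_zero_iff_eq_bot.1
      (nonpos_iff_eq_zero.1 ((ENat.add_le_add_iff_right ENat.one_ne_top).1 h4))
    rw [h5] at hJ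
    exact ht0 (by simpa using hJ)
  exact maximalIdeal_isPrincipal_of_colon t f ht0
    (fun hdvd => by
      have : (1 : R) ∈ q := (hf 1).2 (by rw [one_mul]; exact Ideal.mem_span_singleton.2 hdvd)
      exact hq.ne_top ((Ideal.eq_top_iff_one _).2 this))
    (fun x hx => Ideal.mem_span_singleton.1 ((hf x).1 (hqm ▸ hx)))

theorem isRegularLocalRing_of_isIntegrallyClosed {R : Type*} [CommRing R] [IsDomain R]
    [IsLocalRing R] [IsNoetherianRing R] [IsIntegrallyClosed R] (hdim : ringKrullDim R = 1) :
    IsRegularLocalRing R := by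
  obtain ⟨x, hx⟩ := exists_maximalIdeal_eq_span_of_isIntegrallyClosed hdim
  exact isRegularLocalRing_of_maximalIdeal_eq_span hdim x hx

section Extension

variable {R B : Type*} [CommRing R] [IsLocalRing R] [IsNoetherianRing R] [IsReduced R] [CommRing B]
  [Algebra R B] [FaithfulSMul R B]

omit [IsLocalRing R] [IsNoetherianRing R] [IsReduced R] in
theorem algebraMap_mem_nonZeroDivisors {a : R} (ha : algebraMap R B a ∈ nonZeroDivisors B)
    (h : ∀ b : B, ∃ n : ℕ, a ^ n ∈ denomIdeal R b) {v : R} (hv : v ∈ nonZeroDivisors R) :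
    algebraMap R B v ∈ nonZeroDivisors B := by
  refine mem_nonZeroDivisors_iff_right.2 fun x hx => ?_
  obtain ⟨n, hn⟩ := h x
  obtain ⟨x', hx'⟩ := mem_denomIdeal.1 hn
  have h1 : x' = 0 := by
    refine mem_nonZeroDivisors_iff_right.1 hv _ (FaithfulSMul.algebraMap_injective R B ?_)
    rw [map_mul, hx', map_zero]
    linear_combination (algebraMap R B (a ^ n)) * hx
  rw [h1, map_zero, map_pow] at hx'
  refine mem_nonZeroDivisors_iff_right.1 (pow_mem ha n) _ ?_
  rw [mul_comm, ← hx']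

-- In dimension one every prime containing the nonzerodivisor `a` is the maximal ideal, so `a`
-- divides a power of `v`. Any `v ∈ 𝔪` can thus replace `a` as a denominator.
omit [IsNoetherianRing R] [IsReduced R] [FaithfulSMul R B] in
theorem exists_pow_mem_denomIdeal (hdim : ringKrullDim R = 1) {a : R}
    (ha : a ∈ nonZeroDivisors R)
    (h : ∀ b : B, ∃ n : ℕ, a ^ n ∈ denomIdeal R b) {v : R} (hv : v ∈ maximalIdeal R) (b : B) :
    ∃ n : ℕ, v ^ n ∈ denomIdeal R b := by
  have h2 : (maximalIdeal R).height = 1 := by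
    have := maximalIdeal_height_eq_ringKrullDim (R := R)
    rw [hdim] at this
    exact_mod_cast this
  have hrad : v ∈ (Ideal.span {a}).radical := by
    rw [Ideal.radical_eq_sInf, Ideal.mem_sInf]
    rintro p ⟨hp, hpp⟩
    have hap : a ∈ p := hp (Ideal.mem_span_singleton_self a)
    by_contra hvp
    have hlt : p < maximalIdeal R := lt_of_le_of_ne (le_maximalIdeal hpp.ne_top)
      (fun h => hvp (h ▸ hv))
    have h3 := Ideal.height_add_one_le_of_lt_of_isPrime hlt
    rw [h2] at h3
    have h4 : p.height + 1 ≤ 0 + 1 := by simpa using h3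
    have h5 := Ideal.height_eq_zero_iff.1
      (nonpos_iff_eq_zero.1 ((ENat.add_le_add_iff_right ENat.one_ne_top).1 h4))
    exact Set.disjoint_left.1 (Ideal.disjoint_nonZeroDivisors_of_mem_minimalPrimes h5) hap ha
  obtain ⟨n, hn⟩ := hrad
  obtain ⟨m, hm⟩ := h b
  refine ⟨n * m, ?_⟩
  obtain ⟨c, hc⟩ := Ideal.mem_span_singleton.1 hn
  rw [pow_mul, hc, mul_pow, mul_comm]
  exact Ideal.mul_mem_left _ _ hm

omit [IsNoetherianRing R] in
theorem notMem_minimalPrimes_of_span {t : R} (hdim : ringKrullDim R = 1)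
    (h : ∀ p : Ideal R, p.IsPrime → t ∈ p → maximalIdeal R ≤ p) : t ∈ nonZeroDivisors R := by
  refine mem_nonZeroDivisors_of_notMem_minimalPrimes fun p hp htp => ?_
  have hp1 := hp.1.1
  have := (h p hp1 htp).antisymm (le_maximalIdeal hp1.ne_top)
  exact maximalIdeal_notMem_minimalPrimes hdim (this ▸ hp)

variable [Algebra.IsIntegral R B]

omit [IsNoetherianRing R] [IsReduced R] [FaithfulSMul R B] in
theorem algebraMap_mem_of_isMaximal (Q : Ideal B) [Q.IsMaximal] {v : R} (hv : v ∈ maximalIdeal R) :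
    algebraMap R B v ∈ Q := by
  have h1 : (Q.comap (algebraMap R B)).IsMaximal :=
    Ideal.isMaximal_comap_of_isIntegral_of_isMaximal Q
  rw [← eq_maximalIdeal h1] at hv
  exact hv

omit [IsLocalRing R] [IsNoetherianRing R] [IsReduced R] in
theorem isUnit_of_isUnit_algebraMap {x : R} (hx : IsUnit (algebraMap R B x)) : IsUnit x :=
  isUnit_of_map_unit (algebraMap R B) x hx

/-- A regular local ring of dimension one coincides with its integral birational extensions. -/
theorem algebraMap_surjective_of_isRegularLocalRing (hreg : IsRegularLocalRing R)
    (hdim : ringKrullDim R = 1) {a : R} (ha : algebraMap R B a ∈ nonZeroDivisors B)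
    (haR : a ∈ nonZeroDivisors R)
    (h : ∀ b : B, ∃ n : ℕ, a ^ n ∈ denomIdeal R b) : Function.Surjective (algebraMap R B) := by
  have h1 : (maximalIdeal R).spanFinrank = 1 := by
    have := (isRegularLocalRing_iff R).1 hreg
    rw [hdim] at this
    exact_mod_cast this
  obtain ⟨⟨t, ht⟩, -⟩ := (Submodule.spanFinrank_eq_one_iff _).1 h1
  have ht' : maximalIdeal R = Ideal.span {t} := ht
  have htm : t ∈ maximalIdeal R := ht' ▸ Ideal.mem_span_singleton_self t
  have htR : t ∈ nonZeroDivisors R := notMem_minimalPrimes_of_span hdim fun p hp htp => by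
    rw [ht']; exact (Ideal.span_singleton_le_iff_mem _).2 htp
  have htB := algebraMap_mem_nonZeroDivisors ha h htR
  intro b
  obtain ⟨n, hn⟩ := exists_pow_mem_denomIdeal hdim haR h htm b
  -- Lower the exponent of `t` one step at a time: `t ^ (n + 1) * b = c` forces `c` to be a nonunit,
  -- because `t` stays a nonunit in an integral extension; hence `t` divides `c` in `R` and cancels.
  induction n with
  | zero =>
    obtain ⟨c, hc⟩ := mem_denomIdeal.1 hn
    exact ⟨c, by rw [hc]; simp⟩
  | succ n ih =>
    refine ih (mem_denomIdeal.2 ?_)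
    obtain ⟨c, hc⟩ := mem_denomIdeal.1 hn
    have hcm : c ∈ maximalIdeal R := by
      rw [mem_maximalIdeal]
      intro hcu
      have h3 := hcu.map (algebraMap R B)
      rw [hc, pow_succ', map_mul, mul_assoc] at h3
      exact (mem_maximalIdeal _).1 htm (isUnit_of_isUnit_algebraMap (isUnit_of_mul_isUnit_left h3))
    rw [ht'] at hcm
    obtain ⟨c', rfl⟩ := Ideal.mem_span_singleton.1 hcm
    refine ⟨c', ?_⟩
    have h4 : algebraMap R B t * (algebraMap R B c' - algebraMap R B (t ^ n) * b) = 0 := by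
      rw [map_mul, pow_succ', map_mul] at hc
      linear_combination hc
    rw [mul_comm] at h4
    exact sub_eq_zero.1 (mem_nonZeroDivisors_iff_right.1 htB _ h4)

end Extension

/-- Completing the square: `u' = 2 a u + b v` and `Δ` is the discriminant. -/
theorem exists_sq_eq_mul_sq_of_isUnit {R : Type*} [CommRing R] (h2 : IsUnit (2 : R)) {u v a b c : R}
    (h : a * u ^ 2 + b * (u * v) + c * v ^ 2 = 0) (hd : IsUnit (b ^ 2 - 4 * a * c))
    (ha : IsUnit a) :
    ∃ u' Δ : R, Ideal.span {u', v} = Ideal.span {u, v} ∧ IsUnit Δ ∧ u' ^ 2 = Δ * v ^ 2 := by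
  refine ⟨2 * a * u + b * v, b ^ 2 - 4 * a * c, ?_, hd, by linear_combination 4 * a * h⟩
  obtain ⟨w, hw⟩ := (h2.mul ha).exists_right_inv
  refine le_antisymm (Ideal.span_le.2 ?_) (Ideal.span_le.2 ?_)
  · rintro x (rfl | rfl)
    · exact Ideal.mem_span_pair.2 ⟨2 * a, b, rfl⟩
    · exact Ideal.mem_span_pair.2 ⟨0, 1, by ring⟩
  · rintro x (rfl | rfl)
    · exact Ideal.mem_span_pair.2 ⟨w, -(w * b), by linear_combination x * hw⟩
    · exact Ideal.mem_span_pair.2 ⟨0, 1, by ring⟩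

/-- Completing the square needs a unit as leading coefficient. If `a` and `c` both lie in the
maximal ideal, then `b` is a unit, and in the coordinates `u + v`, `u - v` the leading coefficient
becomes the unit `a + b + c`. -/
theorem exists_sq_eq_mul_sq {R : Type*} [CommRing R] [IsLocalRing R] (h2 : IsUnit (2 : R))
    {u v a b c : R}
    (h : a * u ^ 2 + b * (u * v) + c * v ^ 2 = 0) (hd : IsUnit (b ^ 2 - 4 * a * c)) :
    ∃ u' v' Δ : R, Ideal.span {u', v'} = Ideal.span {u, v} ∧ IsUnit Δ ∧ u' ^ 2 = Δ * v' ^ 2 := by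
  by_cases ha : IsUnit a
  · obtain ⟨u', Δ, h1, h3⟩ := exists_sq_eq_mul_sq_of_isUnit h2 h hd ha
    exact ⟨u', v, Δ, h1, h3⟩
  by_cases hc : IsUnit c
  · obtain ⟨u', Δ, h1, h3⟩ := exists_sq_eq_mul_sq_of_isUnit (u := v) (v := u) (a := c) (b := b)
      (c := a) h2 (by linear_combination h) (by convert hd using 1; ring) hc
    exact ⟨u', u, Δ, by rw [h1, Set.pair_comm], h3⟩
  have hbu : IsUnit (a + b + c) := by
    have ha' := (mem_maximalIdeal a).2 ha
    have hc' := (mem_maximalIdeal c).2 hc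
    by_contra hcon
    have h3 := (mem_maximalIdeal _).2 hcon
    have hb : b ∈ maximalIdeal R := by
      have := (maximalIdeal R).sub_mem ((maximalIdeal R).sub_mem h3 ha') hc'
      convert this using 1; ring
    refine (mem_maximalIdeal _).1 ?_ hd
    have h4 := (maximalIdeal R).sub_mem ((maximalIdeal R).mul_mem_left b hb)
      ((maximalIdeal R).mul_mem_left (4 * a) hc')
    convert h4 using 1; ring
  have hd' : IsUnit ((2 * (a - c)) ^ 2 - 4 * (a + b + c) * (a - b + c)) := by
    have := (h2.mul h2).mul hd
    convert this using 1; ring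
  obtain ⟨u', Δ, h1, h3⟩ := exists_sq_eq_mul_sq_of_isUnit (u := u + v) (v := u - v)
    (a := a + b + c) (b := 2 * (a - c)) (c := a - b + c) h2
    (by linear_combination 4 * h) hd' hbu
  refine ⟨u', u - v, Δ, ?_, h3⟩
  rw [h1]
  obtain ⟨w, hw⟩ := h2.exists_right_inv
  refine le_antisymm (Ideal.span_le.2 ?_) (Ideal.span_le.2 ?_)
  · rintro x (rfl | rfl)
    · exact Ideal.mem_span_pair.2 ⟨1, 1, by ring⟩
    · exact Ideal.mem_span_pair.2 ⟨1, -1, by ring⟩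
  · rintro x (rfl | rfl)
    · exact Ideal.mem_span_pair.2 ⟨w, w, by linear_combination x * hw⟩
    · exact Ideal.mem_span_pair.2 ⟨w, -w, by linear_combination x * hw⟩

/-- The normalization of a node is obtained by adjoining a square root `e` of a unit; the maximal
ideal of the node is an ideal of the normalization. -/
theorem exists_sqrt_of_isNode {R : Type u} {B : Type v} [CommRing R] [IsLocalRing R]
    [IsNoetherianRing R]
    (hR : IsNode R) (h2 : IsUnit (2 : R)) [CommRing B] [Algebra R B] [FaithfulSMul R B]
    [Algebra.IsIntegral R B] (hB : StalkNormal B) {a : R}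
    (ha : algebraMap R B a ∈ nonZeroDivisors B) (haR : a ∈ nonZeroDivisors R)
    (h : ∀ b : B, ∃ n : ℕ, a ^ n ∈ denomIdeal R b) :
    ∃ e : B, (∃ Δ, IsUnit Δ ∧ algebraMap R B Δ = e ^ 2) ∧
      (∀ p ∈ maximalIdeal R, ∃ p' ∈ maximalIdeal R, algebraMap R B p' = algebraMap R B p * e) ∧
      (∀ x, algebraMap R B x ≠ e) ∧ ∀ b, ∃ x y, b = algebraMap R B x + algebraMap R B y * e := by
  obtain ⟨hred, hdim, hnreg, u₀, v₀, hm₀, a₀, b₀, c₀, hrel, hdisc⟩ := hR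
  obtain ⟨u, v, Δ, hspan, hΔ, huv⟩ := exists_sq_eq_mul_sq h2 hrel hdisc
  rw [← hspan] at hm₀
  have hinj := FaithfulSMul.algebraMap_injective R B
  have hvm : v ∈ maximalIdeal R := hm₀ ▸ Ideal.subset_span (by simp)
  have hv : v ∈ nonZeroDivisors R := notMem_minimalPrimes_of_span hdim fun p hp hvp => by
    rw [hm₀, Ideal.span_le]
    rintro x (rfl | rfl)
    · exact hp.mem_of_pow_mem 2 (huv ▸ p.mul_mem_left _ (Ideal.pow_mem_of_mem p hvp 2 two_pos))
    · exact hvp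
  have hvB : algebraMap R B v ∈ nonZeroDivisors B := algebraMap_mem_nonZeroDivisors ha h hv
  -- The fraction `u / v` is integral because its square is `Δ`, so normality puts it in `B`.
  obtain ⟨e, he⟩ : ∃ e : B, algebraMap R B v * e = algebraMap R B u := by
    let S := Submonoid.powers (algebraMap R B v)
    let L := Localization S
    have hS : S ≤ nonZeroDivisors B := Submonoid.powers_le.2 hvB
    let x : L := IsLocalization.mk' L (algebraMap R B u) (⟨algebraMap R B v, 1, pow_one _⟩ : S)
    have hx : x * algebraMap B L (algebraMap R B v) = algebraMap B L (algebraMap R B u) :=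
      IsLocalization.mk'_spec L _ _
    have hvL : IsUnit (algebraMap B L (algebraMap R B v)) :=
      IsLocalization.map_units L (⟨algebraMap R B v, 1, pow_one _⟩ : S)
    have hx2 : x ^ 2 = algebraMap B L (algebraMap R B Δ) := by
      rw [← (hvL.pow 2).mul_left_inj, ← mul_pow, hx, ← map_pow, ← map_pow, huv]
      simp
    have hint : IsIntegral B x := by
      refine IsIntegral.of_pow two_pos ?_
      rw [hx2]
      exact isIntegral_algebraMap
    obtain ⟨e, he⟩ := hB.exists_algebraMap_eq S hS x hint
    refine ⟨e, IsLocalization.injective L hS ?_⟩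
    rw [map_mul, he, mul_comm, hx]
  have he2 : algebraMap R B Δ = e ^ 2 := by
    have h3 := congrArg (algebraMap R B) huv
    rw [map_pow, ← he, map_mul, map_pow] at h3
    have h4 : (algebraMap R B Δ - e ^ 2) * (algebraMap R B v) ^ 2 = 0 := by
      linear_combination -h3
    exact sub_eq_zero.1 (mem_nonZeroDivisors_iff_right.1 (pow_mem hvB 2) _ h4)
  have hme : ∀ p ∈ maximalIdeal R, ∃ p' ∈ maximalIdeal R,
      algebraMap R B p' = algebraMap R B p * e := by
    intro p hp
    rw [hm₀] at hp
    obtain ⟨α, β, rfl⟩ := Ideal.mem_span_pair.1 hp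
    refine ⟨α * Δ * v + β * u, ?_, ?_⟩
    · rw [hm₀]
      exact Ideal.mem_span_pair.2 ⟨β, α * Δ, by ring⟩
    · simp only [map_add, map_mul, ← he, he2]
      ring
  -- If `e` came from `R`, then `v` would divide `u` and generate the maximal ideal, and `R` would
  -- be regular.
  have heR : ∀ x, algebraMap R B x ≠ e := by
    rintro x rfl
    rw [← map_mul] at he
    have hu := hinj he
    refine hnreg (isRegularLocalRing_of_maximalIdeal_eq_span hdim v ?_)
    rw [hm₀]
    refine le_antisymm (Ideal.span_le.2 ?_) (Ideal.span_mono (by simp))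
    rintro y (rfl | rfl)
    · exact Ideal.mem_span_singleton.2 ⟨x, hu.symm⟩
    · exact Ideal.mem_span_singleton_self _
  refine ⟨e, ⟨Δ, hΔ, he2⟩, hme, heR, ?_⟩
  -- the subalgebra generated by `e`
  let M : Subalgebra R B :=
    { carrier := {b | ∃ x y, b = algebraMap R B x + algebraMap R B y * e}
      mul_mem' := by
        rintro _ _ ⟨x, y, rfl⟩ ⟨x', y', rfl⟩
        refine ⟨x * x' + y * y' * Δ, x * y' + x' * y, ?_⟩
        simp only [map_add, map_mul, he2]; ring
      add_mem' := by
        rintro _ _ ⟨x, y, rfl⟩ ⟨x', y', rfl⟩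
        exact ⟨x + x', y + y', by simp only [map_add]; ring⟩
      algebraMap_mem' := fun r => ⟨r, 0, by simp⟩ }
  have hmM : ∀ z ∈ maximalIdeal R, ∀ w ∈ M, ∃ z' ∈ maximalIdeal R,
      algebraMap R B z' = algebraMap R B z * w := by
    rintro z hz _ ⟨x, y, rfl⟩
    obtain ⟨z', hz', hzz'⟩ := hme z hz
    refine ⟨z * x + z' * y, Ideal.add_mem _ (Ideal.mul_mem_right _ _ hz)
      (Ideal.mul_mem_right _ _ hz'), ?_⟩
    rw [map_add, map_mul, map_mul, hzz']; ring
  have hindep : ∀ x y, ∀ z ∈ maximalIdeal R,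
      algebraMap R B x + algebraMap R B y * e = algebraMap R B z → x ∈ maximalIdeal R ∧
        y ∈ maximalIdeal R := by
    intro x y z hz hxy
    have hy : y ∈ maximalIdeal R := by
      rw [mem_maximalIdeal]
      intro hy
      obtain ⟨w, hw⟩ := hy.exists_right_inv
      refine heR (w * (z - x)) ?_
      have hw' := congrArg (algebraMap R B) hw
      rw [map_mul, map_one] at hw'
      rw [map_mul, map_sub]
      linear_combination e * hw' - algebraMap R B w * hxy
    obtain ⟨y', hy', hyy'⟩ := hme y hy
    refine ⟨?_, hy⟩
    have : x = z - y' := hinj (by rw [map_sub, hyy']; linear_combination hxy)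
    rw [this]
    exact Ideal.sub_mem _ hz hy'
  -- Dividing by `v` does not leave `M = R + R e`. Let `v b = x + y e`, with conjugate `z'` and norm
  -- `N = v b z' ∈ 𝔪`. If `z'` is a unit of `B`, its inverse lies in `M`, so `v b ∈ N M ⊆ 𝔪` and
  -- both `x` and `y` are in `𝔪`. Otherwise a maximal ideal of `B` contains `z'` and `v b`, hence `2
  -- x`; this is impossible when `x` is a unit. Once `x, y ∈ 𝔪 = (u, v)`, the right-hand side is
  -- visibly `v` times an element of `M`.
  have hkey : ∀ b : B, algebraMap R B v * b ∈ M → b ∈ M := by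
    rintro b ⟨x, y, hxy⟩
    have hxym : x ∈ maximalIdeal R ∧ y ∈ maximalIdeal R := by
      by_contra hcon
      let z' := algebraMap R B x - algebraMap R B y * e
      have hz'M : z' ∈ M := ⟨x, -y, by simp [z', sub_eq_add_neg]⟩
      let N := x ^ 2 - Δ * y ^ 2
      have hN : algebraMap R B N = algebraMap R B v * b * z' := by
        simp only [N, z', hxy, map_sub, map_mul, map_pow, he2]; ring
      have hNm : N ∈ maximalIdeal R := by
        rw [mem_maximalIdeal]
        intro hNu
        have h3 := hNu.map (algebraMap R B)
        rw [hN, mul_assoc] at h3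
        exact (mem_maximalIdeal _).1 hvm
          (isUnit_of_isUnit_algebraMap (isUnit_of_mul_isUnit_left h3))
      have hxu : IsUnit x := by
        by_contra hxu
        have hxm := (mem_maximalIdeal x).2 hxu
        refine hcon ⟨hxm, ?_⟩
        have h3 : Δ * y ^ 2 ∈ maximalIdeal R := by
          have := Ideal.sub_mem _ (Ideal.pow_mem_of_mem _ hxm 2 two_pos) hNm
          convert this using 1; simp only [N]; ring
        have h4 := ((inferInstance : (maximalIdeal R).IsPrime).mem_or_mem h3).resolve_left
          (fun h => (mem_maximalIdeal _).1 h hΔ)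
        exact (inferInstance : (maximalIdeal R).IsPrime).mem_of_pow_mem 2 h4
      by_cases hz'u : IsUnit z'
      · have : Algebra.IsIntegral M B := Algebra.IsIntegral.tower_top R
        have hu' : IsUnit (⟨z', hz'M⟩ : M) := by
          have : FaithfulSMul M B := (faithfulSMul_iff_algebraMap_injective M B).2
            Subtype.val_injective
          exact isUnit_of_map_unit (algebraMap M B) _ hz'u
        obtain ⟨⟨w, hwM⟩, hw⟩ := hu'.exists_right_inv
        have hw' : z' * w = 1 := congrArg Subtype.val hw
        obtain ⟨n', hn', hnn'⟩ := hmM N hNm w hwM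
        refine hcon (hindep x y n' hn' ?_)
        rw [hnn', hN, ← hxy]
        linear_combination (-(algebraMap R B v * b)) * hw'
      · obtain ⟨Q, hQ, hzQ⟩ := exists_max_ideal_of_mem_nonunits hz'u
        have h3 : algebraMap R B (2 * x) ∈ Q := by
          have h4 : algebraMap R B v * b ∈ Q :=
            Ideal.mul_mem_right _ _ (algebraMap_mem_of_isMaximal Q hvm)
          have := Ideal.add_mem _ h4 hzQ
          convert this using 1
          simp only [hxy, z', map_mul, map_ofNat]; ring
        exact hQ.ne_top (Ideal.eq_top_of_isUnit_mem _ h3 ((h2.mul hxu).map _))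
    obtain ⟨hx, hy⟩ := hxym
    rw [hm₀] at hx hy
    obtain ⟨α, β, rfl⟩ := Ideal.mem_span_pair.1 hx
    obtain ⟨α', β', rfl⟩ := Ideal.mem_span_pair.1 hy
    refine ⟨β + α' * Δ, α + β', ?_⟩
    have h3 : (b - (algebraMap R B (β + α' * Δ) + algebraMap R B (α + β') * e)) *
        algebraMap R B v = 0 := by
      simp only [map_add, map_mul, ← he, he2] at hxy ⊢
      linear_combination hxy
    exact sub_eq_zero.1 (mem_nonZeroDivisors_iff_right.1 hvB _ h3)
  intro b
  obtain ⟨n, hn⟩ := exists_pow_mem_denomIdeal hdim haR h hvm b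
  obtain ⟨c, hc⟩ := mem_denomIdeal.1 hn
  have h3 : (algebraMap R B v) ^ n * b ∈ M := by
    rw [← map_pow, ← hc]
    exact M.algebraMap_mem c
  clear hc hn
  induction n with
  | zero =>
    have h4 : b ∈ M := by simpa using h3
    exact h4
  | succ n ih => exact ih (hkey _ (by rwa [pow_succ', mul_assoc] at h3))

end LocalRings

/-! ### Spreading the structure of a node out from the local ring. -/

section Localization

theorem StalkNormal.of_isLocalization {B L : Type*} [CommRing B] [CommRing L] [Algebra B L]
    (M : Submonoid B) [IsLocalization M L] (hB : StalkNormal B) : StalkNormal L := by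
  intro Q hQ
  have := IsLocalization.isLocalization_isLocalization_atPrime_isLocalization M
    (Localization.AtPrime Q) Q
  let e := IsLocalization.algEquiv (Q.comap (algebraMap B L)).primeCompl
    (Localization.AtPrime (Q.comap (algebraMap B L))) (Localization.AtPrime Q)
  obtain ⟨_, _⟩ := hB (Q.comap (algebraMap B L))
  exact ⟨e.symm.toRingEquiv.toMulEquiv.isDomain _, IsIntegrallyClosed.of_equiv e.toRingEquiv⟩

/-- An integral birational extension of a reduced noetherian ring with a node at the prime `P` is,
near `P`, generated by a square root `e` of a unit, which multiplies `P` into itself. -/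
theorem exists_sqrt_of_isNode_localization {A : Type u} {B : Type v} [CommRing A] [CommRing B]
    [IsReduced A] [IsNoetherianRing A] [Algebra A B] [FaithfulSMul A B] [Module.Finite A B]
    (hB : StalkNormal B) (h2 : IsUnit (2 : A)) {a : A} (ha : algebraMap A B a ∈ nonZeroDivisors B)
    (haA : a ∈ nonZeroDivisors A) (h : ∀ b : B, ∃ n : ℕ, a ^ n ∈ denomIdeal A b)
    (P : Ideal A) [P.IsPrime] (hP : IsNode (Localization.AtPrime P)) :
    ∃ e : B, ∃ Δ ∉ P, algebraMap A B Δ = e ^ 2 ∧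
      (∃ s ∉ P, ∀ b, ∃ x y, algebraMap A B s * b = algebraMap A B x + algebraMap A B y * e) ∧
      (∃ s ∉ P, ∀ p ∈ P, ∃ p' ∈ P, algebraMap A B p' = algebraMap A B (s * p) * e) ∧
      ∀ s ∉ P, ∀ x, algebraMap A B x ≠ algebraMap A B s * e := by
  classical
  let AP := Localization.AtPrime P
  let N := Algebra.algebraMapSubmonoid B P.primeCompl
  let BP := Localization N
  have : IsLocalization (Algebra.algebraMapSubmonoid B P.primeCompl) BP :=
    inferInstanceAs (IsLocalization N (Localization N))
  let _ : Algebra AP BP := localizationAlgebra P.primeCompl B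
  have : IsScalarTower A AP BP := isScalarTower_localizationAlgebra P.primeCompl B
  have hinjAB : Function.Injective (algebraMap A B) := FaithfulSMul.algebraMap_injective A B
  have hinj : Function.Injective (algebraMap AP BP) :=
    localizationAlgebra_injective (Rₘ := AP) (Sₘ := BP) (M := P.primeCompl) hinjAB
  have : FaithfulSMul AP BP := (faithfulSMul_iff_algebraMap_injective AP BP).2 hinj
  have : Algebra.IsIntegral AP BP := ⟨isIntegral_localization (M := P.primeCompl) (R := A) (S := B)⟩
  have hden : ∀ z : BP, ∃ s ∉ P, ∃ b, algebraMap A BP s * z = algebraMap B BP b := fun z => by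
    obtain ⟨⟨b, ⟨_, s, hs, rfl⟩⟩, hb⟩ := IsLocalization.surj N z
    exact ⟨s, hs, b, by rw [IsScalarTower.algebraMap_apply A B BP, mul_comm]; exact hb⟩
  have hdenA : ∀ z : AP, ∃ s ∉ P, ∃ b, algebraMap A AP s * z = algebraMap A AP b := fun z => by
    obtain ⟨⟨b, s, hs⟩, hb⟩ := IsLocalization.surj P.primeCompl z
    exact ⟨s, hs, b, by rw [mul_comm]; exact hb⟩
  have hker : ∀ b b' : B, algebraMap B BP b = algebraMap B BP b' →
      ∃ s ∉ P, algebraMap A B s * b = algebraMap A B s * b' := fun b b' hb => by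
    obtain ⟨⟨_, s, hs, rfl⟩, h⟩ := (IsLocalization.eq_iff_exists N BP).1 hb
    exact ⟨s, hs, h⟩
  have hu : ∀ s ∉ P, IsUnit (algebraMap A AP s) := fun s hs =>
    IsLocalization.map_units AP (⟨s, hs⟩ : P.primeCompl)
  obtain ⟨e₀, ⟨Δ₀, hΔu, hΔ⟩, hm, hne, hgen⟩ := exists_sqrt_of_isNode (B := BP)
    (a := algebraMap A AP a) hP
    (by rw [← map_ofNat (algebraMap A AP) 2]; exact h2.map _)
    (hB.of_isLocalization N)
    (by
      rw [← IsScalarTower.algebraMap_apply A AP BP, IsScalarTower.algebraMap_apply A B BP]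
      exact IsLocalization.nonZeroDivisors_le_comap N BP ha)
    (IsLocalization.nonZeroDivisors_le_comap P.primeCompl AP haA)
    (fun z => by
      obtain ⟨s, hs, b, hb⟩ := hden z
      obtain ⟨n, hn⟩ := h b
      obtain ⟨c, hc⟩ := mem_denomIdeal.1 hn
      obtain ⟨w, hw⟩ := (hu s hs).exists_right_inv
      refine ⟨n, mem_denomIdeal.2 ⟨algebraMap A AP c * w, ?_⟩⟩
      have h1 := congrArg (algebraMap B BP) hc
      have h3 := congrArg (algebraMap AP BP) hw
      rw [map_mul, ← hb] at h1
      rw [map_mul (algebraMap AP BP)] at h3 ⊢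
      simp only [← map_pow (algebraMap A AP), ← IsScalarTower.algebraMap_apply, map_one] at h1 h3 ⊢
      rw [h1]
      linear_combination algebraMap A BP (a ^ n) * z * h3 +
        z * IsScalarTower.algebraMap_apply A AP BP (a ^ n))
  obtain ⟨s₁, hs₁, e₁, he₁⟩ := hden e₀
  obtain ⟨s₂, hs₂, D, hD⟩ := hdenA Δ₀
  -- `e₂ = s₁ s₂ e₀`
  have hmulP : ∀ {x y : A}, x ∉ P → y ∉ P → x * y ∉ P := fun hx hy hxy =>
    ((‹P.IsPrime›).mem_or_mem hxy).elim hx hy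
  have hDP : D ∉ P := fun hDP => by
    have h3 : IsUnit (algebraMap A AP D) := hD ▸ (hu s₂ hs₂).mul hΔu
    exact ((IsLocalization.AtPrime.isUnit_to_map_iff AP P D).1 h3) hDP
  have hsq : algebraMap B BP (algebraMap A B (s₁ ^ 2 * s₂ * D)) =
      algebraMap B BP ((algebraMap A B s₂ * e₁) ^ 2) := by
    have h4 := congrArg (algebraMap AP BP) hD
    simp only [map_pow, map_mul, ← IsScalarTower.algebraMap_apply, ← he₁] at h4 ⊢
    rw [← h4, hΔ]
    ring
  obtain ⟨s₃, hs₃, hsq'⟩ := hker _ _ hsq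
  -- Here `s₁` clears the denominator of `e₀`, `s₂` that of its square `Δ₀`, and `s₃` turns the
  -- equality of squares in the localization into one in `B`.
  let e := algebraMap A B (s₃ * s₂) * e₁
  have heBP : algebraMap B BP e = algebraMap A BP (s₃ * s₂ * s₁) * e₀ := by
    simp only [e, map_mul, ← IsScalarTower.algebraMap_apply, ← he₁]
    ring
  have htP : s₃ * s₂ * s₁ ∉ P := hmulP (hmulP hs₃ hs₂) hs₁
  refine ⟨e, s₃ ^ 2 * (s₁ ^ 2 * s₂ * D), ?_, ?_, ?_, ?_, ?_⟩
  · simp only [pow_two]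
    exact hmulP (hmulP hs₃ hs₃) (hmulP (hmulP (hmulP hs₁ hs₁) hs₂) hDP)
  · simp only [e, map_mul, map_pow] at hsq' ⊢
    linear_combination algebraMap A B s₃ * hsq'
  · let S : Submodule A B := LinearMap.range (Algebra.linearMap A B) ⊔ A ∙ e
    have hS : ∀ b, b ∈ S ↔ ∃ x y, b = algebraMap A B x + algebraMap A B y * e := fun b => by
      simp only [S, Submodule.mem_sup, LinearMap.mem_range, Submodule.mem_span_singleton,
        Algebra.linearMap_apply]
      constructor
      · rintro ⟨_, ⟨x, rfl⟩, _, ⟨y, rfl⟩, rfl⟩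
        exact ⟨x, y, by rw [Algebra.smul_def]⟩
      · rintro ⟨x, y, rfl⟩
        exact ⟨_, ⟨x, rfl⟩, _, ⟨y, rfl⟩, by rw [Algebra.smul_def]⟩
    obtain ⟨s, hs, hsS⟩ := exists_notMem_forall_smul_mem S P fun b => by
      obtain ⟨x, y, hxy⟩ := hgen (algebraMap B BP b)
      obtain ⟨s₄, hs₄, x', hx'⟩ := hdenA x
      obtain ⟨s₅, hs₅, y', hy'⟩ := hdenA y
      have h5 : algebraMap B BP (algebraMap A B (s₃ * s₂ * s₁ * s₄ * s₅) * b) =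
          algebraMap B BP (algebraMap A B (s₃ * s₂ * s₁ * s₅ * x') +
            algebraMap A B (s₄ * y') * e) := by
        have h6 := congrArg (algebraMap AP BP) hx'
        have h7 := congrArg (algebraMap AP BP) hy'
        simp only [map_add, map_mul, ← IsScalarTower.algebraMap_apply, heBP] at h6 h7 ⊢
        rw [hxy, ← h6, ← h7]
        ring
      obtain ⟨s₆, hs₆, h6⟩ := hker _ _ h5
      refine ⟨s₆ * (s₃ * s₂ * s₁ * s₄ * s₅),
        hmulP hs₆ (hmulP (hmulP htP hs₄) hs₅), (hS _).2
        ⟨s₆ * (s₃ * s₂ * s₁ * s₅ * x'), s₆ * (s₄ * y'), ?_⟩⟩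
      rw [Algebra.smul_def, map_mul _ s₆, mul_assoc, h6]
      simp only [map_mul]
      ring
    exact ⟨s, hs, fun b => by simpa only [Algebra.smul_def] using (hS _).1 (hsS b)⟩
  · let S : Submodule A B := Submodule.map (Algebra.linearMap A B) P
    let f : P →ₗ[A] B := (LinearMap.mulRight A e) ∘ₗ (Algebra.linearMap A B) ∘ₗ P.subtype
    have hfin : Module.Finite A (LinearMap.range f) := inferInstance
    obtain ⟨s, hs, hsS⟩ := exists_notMem_forall_smul_mem (S.comap f) P fun p => by
      obtain ⟨q, hq, hq'⟩ := hm (algebraMap A AP p)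
        ((IsLocalization.AtPrime.to_map_mem_maximal_iff AP P _).2 p.2)
      obtain ⟨s₄, hs₄, q', hq''⟩ := hdenA q
      have hq'P : q' ∈ P := by
        rw [← IsLocalization.AtPrime.to_map_mem_maximal_iff AP P, ← hq'']
        exact Ideal.mul_mem_left _ _ hq
      have h5 : algebraMap B BP (algebraMap A B (s₃ * s₂ * s₁ * q')) =
          algebraMap B BP (algebraMap A B (s₄ * p) * e) := by
        have h6 := congrArg (algebraMap AP BP) hq''
        simp only [map_mul, ← IsScalarTower.algebraMap_apply, heBP] at h6 hq' ⊢
        rw [← h6, hq', ← IsScalarTower.algebraMap_apply A AP BP]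
        ring
      obtain ⟨s₅, hs₅, h6⟩ := hker _ _ h5
      refine ⟨s₅ * s₄, hmulP hs₅ hs₄, s₅ * (s₃ * s₂ * s₁ * q'),
        Ideal.mul_mem_left _ _ (Ideal.mul_mem_left _ _ hq'P), ?_⟩
      simp only [Algebra.linearMap_apply, f, LinearMap.comp_apply, LinearMap.mulRight_apply,
        Submodule.subtype_apply, map_smul, map_mul,
        Algebra.smul_def] at h6 ⊢
      linear_combination h6
    refine ⟨s, hs, fun p hp => ?_⟩
    obtain ⟨p', hp', h⟩ := hsS ⟨p, hp⟩
    exact ⟨p', hp', by simpa [f] using h⟩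
  · intro s hs x hx
    obtain ⟨w, hw⟩ := (hu _ (hmulP hs htP)).exists_right_inv
    refine hne (algebraMap A AP x * w) ?_
    have h3 := congrArg (algebraMap B BP) hx
    have h4 := congrArg (algebraMap AP BP) hw
    rw [map_mul (algebraMap AP BP)] at h4 ⊢
    simp only [map_mul, ← IsScalarTower.algebraMap_apply, map_one, heBP] at h3 h4 ⊢
    rw [h3]
    linear_combination e₀ * h4

/-- If `B = A + A e` with `e ^ 2` a unit and `e` maps the prime `P` into itself, then
`x + y e` vanishes on the preimage of `V(P)` only if `x, y ∈ P`. -/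
theorem mem_of_pow_mem_of_sqrt {A B : Type*} [CommRing A] [CommRing B] [Algebra A B]
    [FaithfulSMul A B] (P : Ideal A) [P.IsPrime] (h2 : IsUnit (2 : A)) {e : B} {Δ : A}
    (hΔP : Δ ∉ P) (hΔ : algebraMap A B Δ = e ^ 2)
    (he : ∀ p ∈ P, ∃ p' ∈ P, algebraMap A B p' = algebraMap A B p * e) (hne : ∀ s ∉ P, ∀ x,
      algebraMap A B x ≠ algebraMap A B s * e)
    {x y p : A} {n : ℕ} (hp : p ∈ P)
    (h : (algebraMap A B x + algebraMap A B y * e) ^ n = algebraMap A B p) : x ∈ P ∧ y ∈ P := by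
  have hinj : Function.Injective (algebraMap A B) := FaithfulSMul.algebraMap_injective A B
  set z := algebraMap A B x + algebraMap A B y * e with hz
  have hmul : ∀ p ∈ P, ∀ u v : A, ∃ p' ∈ P,
      algebraMap A B p' = algebraMap A B p * (algebraMap A B u + algebraMap A B v * e) := by
    intro p hp u v
    obtain ⟨p', hp', h⟩ := he p hp
    refine ⟨p * u + v * p', add_mem (Ideal.mul_mem_right _ _ hp) (Ideal.mul_mem_left _ _ hp'), ?_⟩
    simp only [map_add, map_mul, h]
    ring
  have hpow : ∀ (u v : A) (k : ℕ), ∀ p ∈ P, ∃ p' ∈ P, algebraMap A B p' =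
      algebraMap A B p * (algebraMap A B u + algebraMap A B v * e) ^ k := by
    intro u v k
    induction k with
    | zero => exact fun p hp => ⟨p, hp, by simp⟩
    | succ k ih =>
      intro p hp
      obtain ⟨q, hq, hq'⟩ := hmul p hp u v
      obtain ⟨r, hr, hr'⟩ := ih q hq
      exact ⟨r, hr, by rw [hr', hq']; ring⟩
  -- Multiply the hypothesis by the `n`-th power of the conjugate `x - y e`: the left side becomes
  -- the `n`-th power of the norm, and the right side stays in `P`.
  have hN : x ^ 2 - Δ * y ^ 2 ∈ P := by
    obtain ⟨p', hp', h'⟩ := hpow x (-y) n p hp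
    rw [← h, hz, ← mul_pow] at h'
    have h3 : algebraMap A B p' = algebraMap A B ((x ^ 2 - Δ * y ^ 2) ^ n) := by
      rw [h', map_pow]
      congr 1
      simp only [map_sub, map_mul, map_pow, map_neg, hΔ]
      ring
    exact (‹P.IsPrime›).mem_of_pow_mem n (hinj h3 ▸ hp')
  -- Since `z² = 2 x z - (x² - Δ y²)` and the norm is in `P`, modulo the image of `P` one may
  -- replace `z ^ (m + 1)` by `(2 x) ^ m * z`.
  have hstep : ∀ m c, (∃ p ∈ P, algebraMap A B p = algebraMap A B c * z ^ (m + 1)) →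
      ∃ p ∈ P, algebraMap A B p = algebraMap A B (c * (2 * x) ^ m) * z := by
    intro m
    induction m with
    | zero => exact fun c ⟨p, hp, h⟩ => ⟨p, hp, by rw [h]; ring_nf⟩
    | succ m ih =>
      rintro c ⟨p, hp, h⟩
      obtain ⟨q, hq, hq'⟩ := hpow x y m _ (Ideal.mul_mem_left P c hN)
      obtain ⟨r, hr, hr'⟩ := ih (c * (2 * x)) ⟨p + q, add_mem hp hq, by
        rw [map_add, h, hq', ← hz]
        simp only [map_mul, map_sub, map_pow, map_ofNat, hΔ]
        rw [pow_succ z (m + 1), pow_succ z m, hz]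
        ring⟩
      exact ⟨r, hr, by rw [hr']; ring_nf⟩
  obtain ⟨q, hq, hq'⟩ := hpow x y 1 p hp
  obtain ⟨r, hr, hr'⟩ := hstep n 1 ⟨q, hq, by rw [hq', ← h, ← hz, map_one]; ring⟩
  rw [one_mul] at hr'
  have hy : (2 * x) ^ n * y ∈ P := by
    by_contra hcon
    refine hne _ hcon (r - (2 * x) ^ n * x) ?_
    simp only [map_sub, map_mul, hr', hz]
    ring
  have hx : x ∈ P := by
    obtain ⟨s, hs, hs'⟩ := he _ hy
    have h3 : (2 * x) ^ n * x = r - s := hinj (by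
      rw [map_sub, hr', hs', hz]
      simp only [map_mul]
      ring)
    have h4 : (2 * x) ^ n * x ∈ P := h3 ▸ sub_mem hr hs
    rcases (‹P.IsPrime›).mem_or_mem h4 with h5 | h5
    · rcases (‹P.IsPrime›).mem_or_mem ((‹P.IsPrime›).mem_of_pow_mem n h5) with h6 | h6
      · exact absurd (Ideal.eq_top_of_isUnit_mem _ h6 h2) (‹P.IsPrime›).ne_top
      · exact h6
    · exact h5
  refine ⟨hx, ?_⟩
  have h3 : Δ * y ^ 2 ∈ P := by
    have := sub_mem (Ideal.pow_mem_of_mem P hx 2 two_pos) hN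
    simpa using this
  exact (‹P.IsPrime›).mem_of_pow_mem 2 (((‹P.IsPrime›).mem_or_mem h3).resolve_left hΔP)

end Localization

/-! ### Regular sequences of length two. -/

section RegularSequences

open scoped Pointwise in
theorem isWeaklyRegular_pair {R : Type*} [CommRing R] {t s : R} :
    RingTheory.Sequence.IsWeaklyRegular R [t, s] ↔
      (∀ x, t * x = 0 → x = 0) ∧ ∀ x z, s * x = t * z → ∃ y, x = t * y := by
  rw [RingTheory.Sequence.isWeaklyRegular_cons_iff, RingTheory.Sequence.isWeaklyRegular_cons_iff]
  simp only [RingTheory.Sequence.IsWeaklyRegular.nil, and_true]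
  refine and_congr ?_ ?_
  · rw [isSMulRegular_iff_right_eq_zero_of_smul]
    simp only [smul_eq_mul]
  · rw [isSMulRegular_iff_right_eq_zero_of_smul]
    have hmem : ∀ x : R, x ∈ t • (⊤ : Submodule R R) ↔ ∃ y, x = t * y := fun x => by
      rw [Submodule.mem_smul_pointwise_iff_exists]
      simp only [Submodule.mem_top, true_and, smul_eq_mul, eq_comm]
    constructor
    · intro h x z hxz
      have h1 := h (Submodule.Quotient.mk x) (by
        rw [← Submodule.Quotient.mk_smul, Submodule.Quotient.mk_eq_zero]
        exact (hmem _).2 ⟨z, hxz⟩)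
      exact (hmem x).1 ((Submodule.Quotient.mk_eq_zero _).1 h1)
    · intro h x
      obtain ⟨x, rfl⟩ := Submodule.Quotient.mk_surjective _ x
      intro hx
      rw [← Submodule.Quotient.mk_smul, Submodule.Quotient.mk_eq_zero] at hx
      obtain ⟨z, hz⟩ := (hmem _).1 hx
      exact (Submodule.Quotient.mk_eq_zero _).2 ((hmem x).2 (h x z hz))

theorem depthTwo_of_isLocalization {A L : Type*} [CommRing A] [CommRing L] [Algebra A L]
    (q : Ideal A) [q.IsPrime] [IsLocalization.AtPrime L q] [IsLocalRing L] {t s : L}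
    (ht : t ∈ IsLocalRing.maximalIdeal L) (hs : s ∈ IsLocalRing.maximalIdeal L)
    (h : RingTheory.Sequence.IsWeaklyRegular L [t, s]) : DepthTwo q := by
  obtain ⟨h1, h2⟩ := isWeaklyRegular_pair.1 h
  obtain ⟨⟨t', u, hu⟩, htu⟩ := IsLocalization.surj q.primeCompl t
  obtain ⟨⟨s', v, hv⟩, hsv⟩ := IsLocalization.surj q.primeCompl s
  have huu := IsLocalization.map_units L (⟨u, hu⟩ : q.primeCompl)
  have hvu := IsLocalization.map_units L (⟨v, hv⟩ : q.primeCompl)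
  simp only at htu hsv huu hvu
  have hker : ∀ x : A, algebraMap A L x = 0 → ∃ r ∉ q, r * x = 0 := fun x hx => by
    obtain ⟨⟨r, hr⟩, h⟩ := (IsLocalization.map_eq_zero_iff q.primeCompl L x).1 hx
    exact ⟨r, hr, h⟩
  refine ⟨t', ?_, s', ?_, fun x hx => ?_, fun x z hxz => ?_⟩
  · rw [← IsLocalization.AtPrime.to_map_mem_maximal_iff L q, ← htu]
    exact Ideal.mul_mem_right _ _ ht
  · rw [← IsLocalization.AtPrime.to_map_mem_maximal_iff L q, ← hsv]
    exact Ideal.mul_mem_right _ _ hs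
  · refine hker x ?_
    have h3 := congrArg (algebraMap A L) hx
    rw [map_mul, ← htu, map_zero, mul_assoc] at h3
    exact (huu.mul_right_eq_zero).1 (h1 _ h3)
  · have h3 := congrArg (algebraMap A L) hxz
    rw [map_mul, map_mul, ← htu, ← hsv, mul_assoc, mul_assoc] at h3
    obtain ⟨y, hy⟩ := h2 _ _ h3
    obtain ⟨w, hw⟩ := huu.exists_right_inv
    obtain ⟨w', hw'⟩ := hvu.exists_right_inv
    obtain ⟨⟨y', r, hr⟩, hyr⟩ := IsLocalization.surj q.primeCompl (y * w * w')
    simp only at hyr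
    have h4 : algebraMap A L (r * x - t' * y') = 0 := by
      rw [map_sub, map_mul, map_mul, ← hyr, ← htu]
      linear_combination algebraMap A L r * w' * hy - algebraMap A L r * algebraMap A L x * hw' -
        algebraMap A L r * t * y * w' * hw
    obtain ⟨r', hr', h5⟩ := hker _ h4
    refine ⟨r' * r, fun h => ((‹q.IsPrime›).mem_or_mem h).elim hr' hr, r' * y', ?_⟩
    linear_combination h5

end RegularSequences

/-! ### Points of affine opens as prime ideals. -/

section Points

variable {X Y : Scheme.{u}}

/-- The prime ideal of the functions on `U` that vanish at `x`. -/
noncomputable def primeAt (U : X.Opens) (x : X) (hx : x ∈ U) : Ideal Γ(X, U) :=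
  (IsLocalRing.maximalIdeal (X.presheaf.stalk x)).comap (X.presheaf.germ U x hx).hom

instance (U : X.Opens) (x : X) (hx : x ∈ U) : (primeAt U x hx).IsPrime :=
  inferInstanceAs (Ideal.comap _ _).IsPrime

theorem mem_primeAt {U : X.Opens} {x : X} {hx : x ∈ U} {f : Γ(X, U)} :
    f ∈ primeAt U x hx ↔ x ∉ X.basicOpen f := by
  rw [Scheme.mem_basicOpen X f x hx, primeAt, Ideal.mem_comap, IsLocalRing.mem_maximalIdeal,
    mem_nonunits_iff]

theorem notMem_primeAt {U : X.Opens} {x : X} {hx : x ∈ U} {f : Γ(X, U)} :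
    f ∉ primeAt U x hx ↔ x ∈ X.basicOpen f := by
  rw [mem_primeAt, not_not]

theorem primeIdealOf_asIdeal {U : X.Opens} (hU : IsAffineOpen U) (x : X) (hx : x ∈ U) :
    (hU.primeIdealOf ⟨x, hx⟩).asIdeal = primeAt U x hx := by
  rw [hU.primeIdealOf_eq_map_closedPoint]
  rfl

theorem isLocalization_germ {U : X.Opens} (hU : IsAffineOpen U) (x : X) (hx : x ∈ U) :
    @IsLocalization.AtPrime Γ(X, U) _ (X.presheaf.stalk x) _ (X.presheaf.germ U x hx).hom.toAlgebra
      (primeAt U x hx) _ := by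
  have h := hU.isLocalization_stalk ⟨x, hx⟩
  simp only [primeIdealOf_asIdeal] at h
  exact h

/-- The local ring at a point of an affine open subset. -/
noncomputable def stalkEquiv {U : X.Opens} (hU : IsAffineOpen U) (x : X) (hx : x ∈ U) :
    Localization.AtPrime (primeAt U x hx) ≃+* X.presheaf.stalk x :=
  letI := (X.presheaf.germ U x hx).hom.toAlgebra
  haveI := isLocalization_germ hU x hx
  (IsLocalization.algEquiv (primeAt U x hx).primeCompl
    (Localization.AtPrime (primeAt U x hx)) (X.presheaf.stalk x)).toRingEquiv

theorem exists_primeAt_eq {U : X.Opens} (hU : IsAffineOpen U) (q : Ideal Γ(X, U)) [hq : q.IsPrime] :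
    ∃ (x : X) (hx : x ∈ U), primeAt U x hx = q := by
  have hmem : hU.fromSpec ⟨q, hq⟩ ∈ U := by
    rw [← SetLike.mem_coe, ← hU.range_fromSpec]
    exact ⟨_, rfl⟩
  refine ⟨hU.fromSpec ⟨q, hq⟩, hmem, ?_⟩
  rw [← primeIdealOf_asIdeal hU]
  have h : hU.primeIdealOf ⟨_, hmem⟩ = ⟨q, hq⟩ :=
    hU.fromSpec.isOpenEmbedding.injective (by rw [hU.fromSpec_primeIdealOf])
  rw [h]

theorem specializes_iff_primeAt_le {U : X.Opens} (hU : IsAffineOpen U) {x y : X} (hx : x ∈ U)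
    (hy : y ∈ U) : y ⤳ x ↔ primeAt U y hy ≤ primeAt U x hx := by
  constructor
  · intro h f hf
    rw [mem_primeAt] at hf ⊢
    exact fun hx' => hf (h.mem_open (X.basicOpen f).isOpen hx')
  · intro h
    have h1 : hU.primeIdealOf ⟨y, hy⟩ ⤳ hU.primeIdealOf ⟨x, hx⟩ := by
      rw [← PrimeSpectrum.le_iff_specializes, ← PrimeSpectrum.asIdeal_le_asIdeal,
        primeIdealOf_asIdeal, primeIdealOf_asIdeal]
      exact h
    have h2 := h1.map hU.fromSpec.continuous
    rwa [hU.fromSpec_primeIdealOf, hU.fromSpec_primeIdealOf] at h2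

theorem primeAt_injective {U : X.Opens} (hU : IsAffineOpen U) {x y : X} (hx : x ∈ U) (hy : y ∈ U)
    (h : primeAt U x hx = primeAt U y hy) : x = y :=
  (((specializes_iff_primeAt_le hU hy hx).2 h.le).antisymm
    ((specializes_iff_primeAt_le hU hx hy).2 h.ge)).eq

theorem mem_of_specializes {U : X.Opens} {x y : X} (h : y ⤳ x) (hx : x ∈ U) : y ∈ U :=
  h.mem_open U.isOpen hx

theorem comap_appLE_primeAt (f : X ⟶ Y) {U : Y.Opens} {V : X.Opens} (e : V ≤ f ⁻¹ᵁ U) {x : X}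
    (hx : x ∈ V) :
    (primeAt V x hx).comap (f.appLE U V e).hom =
      primeAt U (f x) (show f x ∈ U from e hx) := by
  ext s
  rw [Ideal.mem_comap, mem_primeAt, mem_primeAt, not_iff_not]
  change x ∈ X.basicOpen (f.appLE U V e s) ↔ _
  rw [Scheme.basicOpen_appLE]
  exact ⟨fun h => h.2, fun h => ⟨hx, h⟩⟩

theorem comap_app_primeAt (f : X ⟶ Y) {U : Y.Opens} {x : X} (hx : f x ∈ U) :
    (primeAt (f ⁻¹ᵁ U) x hx).comap (f.app U).hom = primeAt U (f x) hx := by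
  rw [Scheme.Hom.app_eq_appLE]
  exact comap_appLE_primeAt f le_rfl hx

theorem height_primeAt {U : X.Opens} (hU : IsAffineOpen U) (x : X) (hx : x ∈ U) :
    ((primeAt U x hx).height : WithBot ℕ∞) = ringKrullDim (X.presheaf.stalk x) := by
  rw [← ringKrullDim_eq_of_ringEquiv (stalkEquiv hU x hx),
    IsLocalization.AtPrime.ringKrullDim_eq_height (primeAt U x hx)]

theorem IsNode.of_ringEquiv {R S : Type u} [CommRing R] [IsLocalRing R] [CommRing S]
    [IsLocalRing S] (e : R ≃+* S) (h : IsNode R) : IsNode S := by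
  obtain ⟨h1, h2, h3, x, y, hm, a, b, c, hrel, hu⟩ := h
  refine ⟨isReduced_of_injective e.symm e.symm.injective, ?_, fun h => h3 ?_, e x, e y, ?_,
    e a, e b, e c, ?_, ?_⟩
  · rw [← ringKrullDim_eq_of_ringEquiv e, h2]
  · exact IsRegularLocalRing.of_ringEquiv e.symm
  · rw [← IsLocalRing.map_ringEquiv_maximalIdeal e, hm, Ideal.map_span, Set.image_pair]
  · simpa using congrArg e hrel
  · simpa [map_ofNat] using hu.map e

theorem stalkNormal_of_isNormalScheme (hX : IsNormalScheme X) {U : X.Opens} (hU : IsAffineOpen U) :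
    StalkNormal Γ(X, U) := by
  intro Q hQ
  obtain ⟨x, hx, rfl⟩ := exists_primeAt_eq hU Q
  obtain ⟨_, _⟩ := hX x
  let e := stalkEquiv hU x hx
  exact ⟨e.toMulEquiv.isDomain _, IsIntegrallyClosed.of_equiv e.symm⟩

theorem IsNormalScheme.isReduced (hX : IsNormalScheme X) : IsReduced X := by
  have : ∀ x : X, _root_.IsReduced (X.presheaf.stalk x) := fun x => by
    have := (hX x).1
    infer_instance
  exact isReduced_of_isReduced_stalk X

theorem depthTwo_primeAt (hX : SerreS2 X) {U : X.Opens} (hU : IsAffineOpen U) (q : Ideal Γ(X, U))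
    [q.IsPrime] (hq : 1 < q.height) : DepthTwo q := by
  obtain ⟨x, hx, rfl⟩ := exists_primeAt_eq hU q
  obtain ⟨rs, hlen, hmem, hreg⟩ := hX x 2 le_rfl (by
    rw [← height_primeAt hU x hx]
    have h2 : (2 : ℕ∞) ≤ (primeAt U x hx).height := Order.add_one_le_of_lt hq
    exact WithBot.coe_le_coe.2 h2)
  obtain ⟨t, s, rfl⟩ := List.length_eq_two.1 hlen
  let := (X.presheaf.germ U x hx).hom.toAlgebra
  have := isLocalization_germ hU x hx
  exact depthTwo_of_isLocalization (L := X.presheaf.stalk x) _ (hmem t (by simp)) (hmem s (by simp))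
    hreg.toIsWeaklyRegular

end Points

/-! ### Dense opens and nonzerodivisors. -/

section Density

/-- An element outside a given minimal prime and inside all the other ones. -/
theorem exists_notMem_forall_mem_minimalPrimes {A : Type*} [CommRing A] [IsNoetherianRing A]
    (I : Ideal A) {p : Ideal A} (hp : p ∈ I.minimalPrimes) :
    ∃ f ∉ p, ∀ q ∈ I.minimalPrimes, q ≠ p → f ∈ q := by
  classical
  have hpp := hp.1.1
  have hfin : I.minimalPrimes.Finite := Ideal.finite_minimalPrimes_of_isNoetherianRing A I
  have h1 : ∀ q : Ideal A, ∃ f ∉ p, q ∈ I.minimalPrimes → q ≠ p → f ∈ q := by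
    intro q
    by_cases hq : q ∈ I.minimalPrimes ∧ q ≠ p
    · obtain ⟨f, hfq, hfp⟩ := SetLike.not_le_iff_exists.1 fun h : q ≤ p =>
        hq.2 (le_antisymm h (hp.2 hq.1.1 h))
      exact ⟨f, hfp, fun _ _ => hfq⟩
    · exact ⟨1, fun h => hpp.ne_top ((Ideal.eq_top_iff_one _).2 h), fun h h' => absurd ⟨h, h'⟩ hq⟩
  choose f hf hf' using h1
  refine ⟨∏ q ∈ hfin.toFinset, f q, fun h => ?_, fun q hq hqp => ?_⟩
  · obtain ⟨q, -, hq⟩ := (Ideal.IsPrime.prod_mem_iff).1 h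
    exact hf q hq
  · exact Ideal.mem_of_dvd _ (Finset.dvd_prod_of_mem f (hfin.mem_toFinset.2 hq)) (hf' q hq hqp)

variable {X : Scheme.{u}}

/-- A nonempty open subset of an affine open set meets `D(a)` for nonzerodivisors `a`. -/
theorem exists_mem_basicOpen_of_nonZeroDivisors [IsReduced X] {U : X.Opens} (hU : IsAffineOpen U)
    {a : Γ(X, U)} (ha : a ∈ nonZeroDivisors Γ(X, U)) {O : X.Opens} {x : X} (hxU : x ∈ U)
    (hx : x ∈ O) : ∃ y ∈ O, y ∈ X.basicOpen a := by
  obtain ⟨g, hgO, hxg⟩ := hU.exists_basicOpen_le ⟨x, hx⟩ hxU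
  by_contra! hcon
  have h1 : X.basicOpen (g * a) = ⊥ := by
    rw [Scheme.basicOpen_mul, eq_bot_iff]
    rintro y ⟨hy, hy'⟩
    exact hcon y (hgO hy) hy'
  have h2 := mem_nonZeroDivisors_iff_right.1 ha g (eq_zero_of_basicOpen_eq_bot _ h1)
  rw [h2, Scheme.basicOpen_zero] at hxg
  exact hxg

/-- A dense open contains the generic points of `U`, so no minimal prime contains the ideal of
functions vanishing off `W`. Prime avoidance then finds a nonzerodivisor in this ideal. -/
theorem exists_nonZeroDivisors_basicOpen_le [IsReduced X] [IsLocallyNoetherian X] {W : X.Opens}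
    (hW : Dense (W : Set X)) {U : X.Opens} (hU : IsAffineOpen U) :
    ∃ a ∈ nonZeroDivisors Γ(X, U), X.basicOpen a ≤ W := by
  have : IsNoetherianRing Γ(X, U) := IsLocallyNoetherian.component_noetherian ⟨U, hU⟩
  let I : Ideal Γ(X, U) := ⨅ z : {z : X // z ∈ U ∧ z ∉ W}, primeAt U z.1 z.2.1
  have hI : ∀ f, f ∈ I ↔ X.basicOpen f ≤ W := fun f => by
    simp only [I, Ideal.mem_iInf, mem_primeAt, Subtype.forall]
    constructor
    · intro h y hy
      by_contra hyW
      exact h y ⟨X.basicOpen_le f hy, hyW⟩ hy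
    · intro h y hy hy'
      exact hy.2 (h hy')
  obtain ⟨a, haI, ha⟩ := exists_nonZeroDivisors_mem_of_forall_not_le I fun p hp hle => by
    have hpp := hp.1.1
    obtain ⟨f, hfp, hf⟩ := exists_notMem_forall_mem_minimalPrimes ⊥ hp
    obtain ⟨x, hx, rfl⟩ := exists_primeAt_eq hU p
    obtain ⟨y, hyf, hyW⟩ := hW.inter_open_nonempty _ (X.basicOpen f).isOpen
      ⟨x, notMem_primeAt.1 hfp⟩
    have hyU := X.basicOpen_le f hyf
    obtain ⟨q, hq, hqy⟩ := Ideal.exists_minimalPrimes_le (bot_le (a := primeAt U y hyU))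
    have hqx : q = primeAt U x hx := by
      by_contra hne
      exact (notMem_primeAt (hx := hyU)).2 hyf (hqy (hf q hq hne))
    have hxW : x ∈ W :=
      mem_of_specializes ((specializes_iff_primeAt_le hU hyU hx).2 (hqx ▸ hqy)) hyW
    obtain ⟨g, hgW, hxg⟩ := hU.exists_basicOpen_le ⟨x, hxW⟩ hx
    exact (notMem_primeAt (hx := hx)).2 hxg (hle ((hI g).2 hgW))
  exact ⟨a, ha, (hI a).1 haI⟩

end Density

/-! ### Normalization morphisms over affine opens. -/

section NormalizationAffine

variable {X X' : Scheme.{u}} {n : X' ⟶ X}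

theorem exists_app_eq_pow_mul (f : X' ⟶ X) {U : X.Opens} (hU : IsAffineOpen U)
    (hU' : IsCompact (f ⁻¹ᵁ U : Set X')) (a : Γ(X, U)) (b : Γ(X', f ⁻¹ᵁ U))
    (h : ∃ c, f.app (X.basicOpen a) c =
      X'.presheaf.map (homOfLE (f.preimage_mono (X.basicOpen_le a))).op b) :
    ∃ (m : ℕ) (c : Γ(X, U)), f.app U c = f.app U (a ^ m) * b := by
  obtain ⟨c', hc'⟩ := h
  obtain ⟨m, c, hc⟩ := exists_eq_pow_mul_of_isAffineOpen X U hU a c'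
  have hle : f ⁻¹ᵁ X.basicOpen a ≤ f ⁻¹ᵁ U := f.preimage_mono (X.basicOpen_le a)
  have h1 : X'.presheaf.map (homOfLE hle).op (f.app U c - f.app U (a ^ m) * b) = 0 := by
    have hnat : ∀ z, X'.presheaf.map (homOfLE hle).op (f.app U z) =
        f.app (X.basicOpen a) (X.presheaf.map (homOfLE (X.basicOpen_le a)).op z) := fun z =>
      (congr($(f.naturality (homOfLE (X.basicOpen_le a)).op) z)).symm
    rw [map_sub, map_mul, hnat, hnat, ← hc', sub_eq_zero, map_pow, ← map_mul]
    exact congrArg _ hc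
  obtain ⟨k, hk⟩ : ∃ k : ℕ, f.app U a ^ k * (f.app U c - f.app U (a ^ m) * b) = 0 := by
    refine exists_pow_mul_eq_zero_of_res_basicOpen_eq_zero_of_isCompact X' hU' _ _ ?_
    have h3 : X'.basicOpen (f.app U a) ≤ f ⁻¹ᵁ X.basicOpen a := (Scheme.preimage_basicOpen ..).ge
    have h4 := congrArg (X'.presheaf.map (homOfLE h3).op) h1
    rw [map_zero, ← CommRingCat.comp_apply, ← Functor.map_comp] at h4
    exact h4
  refine ⟨k + m, a ^ k * c, ?_⟩
  simp only [map_mul, map_pow, pow_add] at hk ⊢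
  linear_combination hk

theorem isIso_app_of_isIso_morphismRestrict (n : X' ⟶ X) {W V : X.Opens} [IsIso (n ∣_ W)]
    (h : V ≤ W) : IsIso (n.app V) := by
  obtain ⟨V, rfl⟩ : ∃ V' : W.toScheme.Opens, W.ι ''ᵁ V' = V :=
    ⟨W.ι ⁻¹ᵁ V, by
      rw [W.ι.image_preimage_eq_opensRange_inf, Scheme.Opens.opensRange_ι]; exact inf_eq_right.2 h⟩
  have h1 := morphismRestrict_app n W V
  have : IsIso (n.app (W.ι ''ᵁ V) ≫
      X'.presheaf.map (eqToHom (image_morphismRestrict_preimage n W V)).op) := by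
    rw [← h1]
    exact Scheme.Hom.isIso_app _ _ (by rw [Scheme.Hom.opensRange_of_isIso]; exact le_top)
  exact IsIso.of_isIso_comp_right _
    (X'.presheaf.map (eqToHom (image_morphismRestrict_preimage n W V)).op)

theorem morphismRestrict_apply (n : X' ⟶ X) (W : X.Opens) (x : (n ⁻¹ᵁ W).toScheme) :
    W.ι ((n ∣_ W) x) = n x.1 := by
  rw [← Scheme.Hom.comp_apply, morphismRestrict_ι, Scheme.Hom.comp_apply]
  rfl

theorem exists_apply_eq_of_isIso_morphismRestrict (n : X' ⟶ X) {W : X.Opens} [IsIso (n ∣_ W)]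
    {x : X} (hx : x ∈ W) : ∃ x' : X', n x' = x := by
  obtain ⟨x', hx'⟩ := (n ∣_ W).homeomorph.surjective ⟨x, hx⟩
  refine ⟨x'.1, ?_⟩
  have := congrArg Subtype.val hx'
  simpa using this

/-- Birationality as algebra: `a` is chosen with `D(a)` inside the open set where `n` is an
isomorphism, so functions upstairs become functions on `U` after multiplication by powers of `a`.
Density of the preimage keeps `a` a nonzerodivisor upstairs. -/
theorem IsNormalization.exists_nonZeroDivisors (hn : IsNormalization n) [IsReduced X]
    [IsLocallyNoetherian X] {U : X.Opens} (hU : IsAffineOpen U) :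
    ∃ a ∈ nonZeroDivisors Γ(X, U), n.app U a ∈ nonZeroDivisors Γ(X', n ⁻¹ᵁ U) ∧
      ∀ b, ∃ (m : ℕ) (c : Γ(X, U)), n.app U c = n.app U (a ^ m) * b := by
  have := hn.integral
  have := hn.normal.isReduced
  obtain ⟨W, hW, hW', _⟩ := hn.birational
  obtain ⟨a, ha, haW⟩ := exists_nonZeroDivisors_basicOpen_le hW hU
  have hU' : IsAffineOpen (n ⁻¹ᵁ U) := hU.preimage n
  have hnzd : n.app U a ∈ nonZeroDivisors Γ(X', n ⁻¹ᵁ U) := by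
    refine mem_nonZeroDivisors_iff_right.2 fun b hb => ?_
    refine eq_zero_of_basicOpen_eq_bot _ (eq_bot_iff.2 fun x hx => ?_)
    obtain ⟨x', hx', hx'W⟩ := hW'.inter_open_nonempty _ (X'.basicOpen b).isOpen ⟨x, hx⟩
    let O : (n ⁻¹ᵁ W).toScheme.Opens := (n ⁻¹ᵁ W).ι ⁻¹ᵁ X'.basicOpen b
    have hO : IsOpen ((n ∣_ W) '' (O : Set (n ⁻¹ᵁ W).toScheme)) :=
      (n ∣_ W).homeomorph.isOpenMap _ O.isOpen
    let O' : X.Opens := W.ι ''ᵁ ⟨_, hO⟩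
    have hmem : n x' ∈ O' := ⟨(n ∣_ W) ⟨x', hx'W⟩, ⟨⟨x', hx'W⟩, hx', rfl⟩,
      morphismRestrict_apply n W _⟩
    obtain ⟨y, ⟨_, ⟨y', hy', rfl⟩, hy⟩, hya⟩ := exists_mem_basicOpen_of_nonZeroDivisors hU ha
      (X'.basicOpen_le b hx') hmem
    have hy2 : n y'.1 = y := (morphismRestrict_apply n W y').symm.trans hy
    have h3 : y'.1 ∈ X'.basicOpen (b * n.app U a) := by
      rw [Scheme.basicOpen_mul, ← Scheme.preimage_basicOpen]
      refine ⟨hy', ?_⟩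
      change n y'.1 ∈ X.basicOpen a
      rwa [hy2]
    rw [hb, Scheme.basicOpen_zero] at h3
    exact h3.elim
  refine ⟨a, ha, hnzd, fun b => ?_⟩
  have hiso := isIso_app_of_isIso_morphismRestrict n haW
  obtain ⟨m, c, hc⟩ := exists_app_eq_pow_mul n hU hU'.isCompact a b
    ((ConcreteCategory.bijective_of_isIso (n.app (X.basicOpen a))).2 _)
  exact ⟨m, c, hc⟩

theorem IsNormalization.app_injective (hn : IsNormalization n) [IsReduced X] (U : X.Opens) :
    Function.Injective (n.app U) := by
  obtain ⟨W, hW, hW', _⟩ := hn.birational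
  refine (injective_iff_map_eq_zero (n.app U).hom).2 fun f hf => ?_
  refine eq_zero_of_basicOpen_eq_bot _ (eq_bot_iff.2 fun x hx => ?_)
  obtain ⟨y, hy, hyW⟩ := hW.inter_open_nonempty _ (X.basicOpen f).isOpen ⟨x, hx⟩
  obtain ⟨y', rfl⟩ := exists_apply_eq_of_isIso_morphismRestrict n hyW
  have h1 : y' ∈ X'.basicOpen (n.app U f) := by
    rw [← Scheme.preimage_basicOpen]
    exact hy
  change n.app U f = 0 at hf
  rw [hf, Scheme.basicOpen_zero] at h1
  exact h1.elim

end NormalizationAffine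

section Finiteness

variable {X X' : Scheme.{u}} {n : X' ⟶ X} {k : Type u} [Field k]

/-- The algebra structure on the functions on an open subset of a `k`-scheme. -/
noncomputable abbrev algebraOfHom (s : X ⟶ Spec (CommRingCat.of k)) (U : X.Opens) :
    Algebra k Γ(X, U) :=
  ((Scheme.ΓSpecIso (CommRingCat.of k)).inv ≫ s.appLE ⊤ U le_top).hom.toAlgebra

theorem finiteType_of_locallyOfFiniteType (s : X ⟶ Spec (CommRingCat.of k))
    [LocallyOfFiniteType s] {U : X.Opens} (hU : IsAffineOpen U) :
    @Algebra.FiniteType k Γ(X, U) _ _ (algebraOfHom s U) := by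
  have h1 := s.finiteType_appLE (isAffineOpen_top _) hU le_top
  have h2 : ((Scheme.ΓSpecIso (CommRingCat.of k)).inv ≫ s.appLE ⊤ U le_top).hom.FiniteType := by
    rw [CommRingCat.hom_comp]
    exact h1.comp (RingHom.FiniteType.of_surjective _ (ConcreteCategory.bijective_of_isIso
      (Scheme.ΓSpecIso (CommRingCat.of k)).inv).2)
  exact h2

theorem isUnit_two (s : X ⟶ Spec (CommRingCat.of k)) (hk : (2 : k) ≠ 0) (U : X.Opens) :
    IsUnit (2 : Γ(X, U)) := by
  have h := (IsUnit.mk0 _ hk).map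
    ((Scheme.ΓSpecIso (CommRingCat.of k)).inv ≫ s.appLE ⊤ U le_top).hom
  rwa [map_ofNat] at h

theorem isLocallyNoetherian_of_hom (s : X ⟶ Spec (CommRingCat.of k)) [LocallyOfFiniteType s] :
    IsLocallyNoetherian X :=
  LocallyOfFiniteType.isLocallyNoetherian s

theorem IsNormalization.isFinite [PerfectField k] (hn : IsNormalization n) [IsReduced X]
    (s : X ⟶ Spec (CommRingCat.of k)) [LocallyOfFiniteType s] : IsFinite n := by
  have := hn.integral
  have := isLocallyNoetherian_of_hom s
  refine ⟨fun U hU => ?_⟩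
  obtain ⟨a, ha, ha', hb⟩ := hn.exists_nonZeroDivisors hU
  let := (n.app U).hom.toAlgebra
  let := algebraOfHom s U
  have := finiteType_of_locallyOfFiniteType s hU
  have : FaithfulSMul Γ(X, U) Γ(X', n ⁻¹ᵁ U) :=
    (faithfulSMul_iff_algebraMap_injective _ _).2 (hn.app_injective U)
  have : Algebra.IsIntegral Γ(X, U) Γ(X', n ⁻¹ᵁ U) := ⟨n.isIntegral_app U hU⟩
  exact finite_of_isIntegral_of_away k a ha' fun b => by
    obtain ⟨m, c, h⟩ := hb b
    exact ⟨m, c, h.symm⟩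

end Finiteness

/-! ### Extension of morphisms over normal schemes. -/

section Extension

/-- The relative normalization of a normal scheme `Z` in a dense open `W` is `Z` itself. An integral
function on `W` restricts to a function on some `D(a) ⊆ W` integral over `Γ(Z, U)`, and normality
extends it to `U`. -/
theorem isIso_fromNormalization {W Z : Scheme.{u}} [IsLocallyNoetherian Z] (hZ : IsNormalScheme Z)
    (w : W ⟶ Z) [IsOpenImmersion w] [QuasiCompact w] [IsDominant w] :
    IsIso w.fromNormalization := by
  have := hZ.isReduced
  have : IsReduced W := isReduced_of_isOpenImmersion w
  refine (IsZariskiLocalAtTarget.iff_of_iSup_eq_top (P := .isomorphisms Scheme) _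
    (iSup_affineOpens_eq_top Z)).2 fun ⟨U, hU⟩ => ?_
  refine (isIso_morphismRestrict_iff_isIso_app (f := w.fromNormalization) hU).2 ?_
  rw [w.fromNormalization_app hU]
  let := (w.app U).hom.toAlgebra
  have hdense : Dense (w.opensRange : Set Z) := by
    simpa [DenseRange] using w.denseRange
  obtain ⟨a, ha, haW⟩ := exists_nonZeroDivisors_basicOpen_le hdense hU
  have hzero : ∀ s : Γ(W, w ⁻¹ᵁ U), (∀ y, w y ∈ Z.basicOpen a → y ∉ W.basicOpen s) → s = 0 := by
    intro s hs
    refine eq_zero_of_basicOpen_eq_bot _ (eq_bot_iff.2 fun x hx => ?_)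
    obtain ⟨_, ⟨y, hy, rfl⟩, hya⟩ := exists_mem_basicOpen_of_nonZeroDivisors hU ha
      (O := w ''ᵁ W.basicOpen s) (W.basicOpen_le s hx) ⟨x, hx, rfl⟩
    exact hs y hya hy
  have hbij : Function.Bijective
      (algebraMap Γ(Z, U) (integralClosure Γ(Z, U) Γ(W, w ⁻¹ᵁ U))) := by
    constructor
    · refine (injective_iff_map_eq_zero _).2 fun f hf => ?_
      have hf' : w.app U f = 0 := congrArg Subtype.val hf
      refine eq_zero_of_basicOpen_eq_bot _ (eq_bot_iff.2 fun x hx => ?_)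
      obtain ⟨_, hy, ⟨y, rfl⟩⟩ := hdense.inter_open_nonempty _ (Z.basicOpen f).isOpen ⟨x, hx⟩
      have h1 : y ∈ W.basicOpen (w.app U f) := by
        rw [← Scheme.preimage_basicOpen]
        exact hy
      rw [hf', Scheme.basicOpen_zero] at h1
      exact h1.elim
    · rintro ⟨x, hx⟩
      let L := Γ(Z, Z.basicOpen a)
      have := hU.isLocalization_basicOpen a
      have hle : w ⁻¹ᵁ Z.basicOpen a ≤ w ⁻¹ᵁ U := w.preimage_mono (Z.basicOpen_le a)
      have hiso : IsIso (w.app (Z.basicOpen a)) := Scheme.Hom.isIso_app _ _ haW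
      obtain ⟨y, hy⟩ : ∃ y, w.app (Z.basicOpen a) y = W.presheaf.map (homOfLE hle).op x :=
        (ConcreteCategory.bijective_of_isIso (w.app (Z.basicOpen a))).2 _
      have hnat : ∀ z, w.app (Z.basicOpen a) (algebraMap Γ(Z, U) Γ(Z, Z.basicOpen a) z) =
          W.presheaf.map (homOfLE hle).op (w.app U z) := fun z => by
        exact congr($(w.naturality (homOfLE (Z.basicOpen_le a)).op) z)
      have hyint : IsIntegral Γ(Z, U) y := by
        obtain ⟨p, hp, hp'⟩ := hx
        refine ⟨p, hp, ?_⟩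
        apply (ConcreteCategory.bijective_of_isIso (w.app (Z.basicOpen a))).1
        change (w.app (Z.basicOpen a)).hom _ = (w.app (Z.basicOpen a)).hom 0
        rw [Polynomial.hom_eval₂, map_zero]
        have h1 : ((w.app (Z.basicOpen a)).hom.comp (algebraMap Γ(Z, U) Γ(Z, Z.basicOpen a))) =
            (W.presheaf.map (homOfLE hle).op).hom.comp (w.app U).hom := RingHom.ext hnat
        have h2 := congrArg (W.presheaf.map (homOfLE hle).op).hom hp'
        rw [Polynomial.hom_eval₂, map_zero] at h2
        rw [h1]
        change Polynomial.eval₂ _ (w.app (Z.basicOpen a) y) p = 0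
        rw [hy]
        exact h2
      obtain ⟨b, hb⟩ := (stalkNormal_of_isNormalScheme hZ hU).exists_algebraMap_eq
        (Submonoid.powers a) (Submonoid.powers_le.2 ha) y hyint
      refine ⟨b, Subtype.ext ?_⟩
      change w.app U b = x
      rw [← sub_eq_zero]
      refine hzero _ fun z hz hz' => ?_
      have h1 : W.presheaf.map (homOfLE hle).op (w.app U b - x) = 0 := by
        rw [map_sub, ← hnat, hb, hy, sub_self]
      have h2 : z ∈ W.basicOpen (W.presheaf.map (homOfLE hle).op (w.app U b - x)) := by
        rw [Scheme.basicOpen_res]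
        exact ⟨hz, hz'⟩
      rw [h1, Scheme.basicOpen_zero] at h2
      exact h2
  have : IsIso (CommRingCat.ofHom
      (algebraMap Γ(Z, U) (integralClosure Γ(Z, U) Γ(W, w ⁻¹ᵁ U)))) :=
    (ConcreteCategory.isIso_iff_bijective _).2 hbij
  infer_instance

/-- A morphism to an integral scheme over `S` extends from a dense open subset of a normal scheme
over `S`. -/
theorem exists_extension {W Z T S : Scheme.{u}} [IsLocallyNoetherian Z] (hZ : IsNormalScheme Z)
    (w : W ⟶ Z) [IsOpenImmersion w] [QuasiCompact w] [IsDominant w] (t : T ⟶ S) [IsIntegralHom t]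
    (z : Z ⟶ S) (g : W ⟶ T) (h : g ≫ t = w ≫ z) : ∃ g' : Z ⟶ T, w ≫ g' = g ∧ g' ≫ t = z := by
  have := isIso_fromNormalization hZ w
  -- The base change of `t` to `Z` is integral, so the universal property of the relative
  -- normalization, which is `Z`, turns `f₁` into a section over `Z`.
  let f₁ : W ⟶ Limits.pullback t z := Limits.pullback.lift g w h
  have H : w = f₁ ≫ Limits.pullback.snd t z := (Limits.pullback.lift_snd g w h).symm
  refine ⟨inv w.fromNormalization ≫ w.normalizationDesc f₁ _ H ≫ Limits.pullback.fst t z, ?_, ?_⟩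
  · have h1 : w ≫ inv w.fromNormalization = w.toNormalization := by
      rw [IsIso.comp_inv_eq, w.toNormalization_fromNormalization]
    rw [reassoc_of% h1, w.toNormalization_normalizationDesc_assoc f₁ _ H,
      Limits.pullback.lift_fst]
  · rw [Category.assoc, Category.assoc, Limits.pullback.condition,
      w.normalizationDesc_comp_assoc f₁ _ H, IsIso.inv_hom_id_assoc]

end Extension

/-! ### Generic points of closed subsets. -/

section GenericPoints

variable {X Y : Scheme.{u}}

/-- `z` is a generic point of the closed subset `Z`. -/
def IsGenericIn (Z : Set X) (z : X) : Prop :=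
  z ∈ Z ∧ ∀ y ∈ Z, y ⤳ z → y = z

/-- The functions on `U` that vanish on `Z`. -/
noncomputable def idealAt (Z : Set X) (U : X.Opens) : Ideal Γ(X, U) :=
  ⨅ z : {z : X // z ∈ U ∧ z ∈ Z}, primeAt U z.1 z.2.1

theorem mem_idealAt {Z : Set X} {U : X.Opens} {f : Γ(X, U)} :
    f ∈ idealAt Z U ↔ ∀ z ∈ Z, z ∉ X.basicOpen f := by
  simp only [idealAt, Ideal.mem_iInf, mem_primeAt, Subtype.forall]
  exact ⟨fun h z hz hz' => h z ⟨X.basicOpen_le f hz', hz⟩ hz', fun h z hz => h z hz.2⟩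

theorem idealAt_le_primeAt_iff {Z : Set X} (hZ : IsClosed Z) {U : X.Opens} (hU : IsAffineOpen U)
    {x : X} (hx : x ∈ U) : idealAt Z U ≤ primeAt U x hx ↔ x ∈ Z := by
  constructor
  · intro h
    by_contra hxZ
    obtain ⟨g, hgW, hxg⟩ := hU.exists_basicOpen_le (V := ⟨Zᶜ, hZ.isOpen_compl⟩) ⟨x, hxZ⟩ hx
    exact notMem_primeAt.2 hxg (h (mem_idealAt.2 fun z hz hz' => hgW hz' hz))
  · exact fun h f hf => mem_primeAt.2 (mem_idealAt.1 hf x h)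

theorem isGenericIn_iff {Z : Set X} (hZ : IsClosed Z) {U : X.Opens} (hU : IsAffineOpen U)
    {x : X} (hx : x ∈ U) :
    IsGenericIn Z x ↔ primeAt U x hx ∈ (idealAt Z U).minimalPrimes := by
  constructor
  · rintro ⟨hxZ, h⟩
    refine ⟨⟨inferInstance, (idealAt_le_primeAt_iff hZ hU hx).2 hxZ⟩, fun q ⟨hq, hq'⟩ hle => ?_⟩
    obtain ⟨y, hy, rfl⟩ := exists_primeAt_eq hU q
    have := h y ((idealAt_le_primeAt_iff hZ hU hy).1 hq')
      ((specializes_iff_primeAt_le hU hx hy).2 hle)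
    subst this
    exact le_rfl
  · rintro ⟨⟨-, h1⟩, h2⟩
    refine ⟨(idealAt_le_primeAt_iff hZ hU hx).1 h1, fun y hy hyx => ?_⟩
    have hyU := mem_of_specializes hyx hx
    have hle := (specializes_iff_primeAt_le hU hx hyU).1 hyx
    exact primeAt_injective hU hyU hx
      (hle.antisymm (h2 ⟨inferInstance, (idealAt_le_primeAt_iff hZ hU hyU).2 hy⟩ hle))

theorem exists_isGenericIn {Z : Set X} (hZ : IsClosed Z) {x : X} (hx : x ∈ Z) :
    ∃ z, IsGenericIn Z z ∧ z ⤳ x := by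
  obtain ⟨_, ⟨U, hU, rfl⟩, hxU, -⟩ :=
    X.isBasis_affineOpens.exists_subset_of_mem_open (Set.mem_univ x) isOpen_univ
  obtain ⟨p, hp, hle⟩ := Ideal.exists_minimalPrimes_le ((idealAt_le_primeAt_iff hZ hU hxU).2 hx)
  have := hp.1.1
  obtain ⟨z, hz, rfl⟩ := exists_primeAt_eq hU p
  exact ⟨z, (isGenericIn_iff hZ hU hz).2 hp, (specializes_iff_primeAt_le hU hxU hz).2 hle⟩

theorem subset_closure_of_forall_isGenericIn {Z W : Set X} (hZ : IsClosed Z)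
    (h : ∀ z, IsGenericIn Z z → z ∈ W) : Z ⊆ closure (W ∩ Z) := by
  intro x hx
  obtain ⟨z, hz, hzx⟩ := exists_isGenericIn hZ hx
  exact hzx.mem_closed isClosed_closure (subset_closure ⟨h z hz, hz.1⟩)

theorem dense_of_forall_isGenericIn {W : Set X} (h : ∀ z, IsGenericIn Set.univ z → z ∈ W) :
    Dense W := by
  have := subset_closure_of_forall_isGenericIn isClosed_univ h
  rw [Set.inter_univ] at this
  exact fun x => this (Set.mem_univ x)

/-- Since locally there are finitely many components, some neighbourhood of `z` meets only those
parts of `Z` that lie in the closure of `z`. The open set `W` meets `Z` there, hence contains `z`,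
being stable under generization. -/
theorem IsGenericIn.mem_of_subset_closure [IsLocallyNoetherian X] {Z : Set X} (hZ : IsClosed Z)
    {W : X.Opens} (hW : Z ⊆ closure (W ∩ Z)) {z : X} (hz : IsGenericIn Z z) : z ∈ W := by
  obtain ⟨_, ⟨U, hU, rfl⟩, hzU, -⟩ :=
    X.isBasis_affineOpens.exists_subset_of_mem_open (Set.mem_univ z) isOpen_univ
  have : IsNoetherianRing Γ(X, U) := IsLocallyNoetherian.component_noetherian ⟨U, hU⟩
  obtain ⟨f, hfz, hf⟩ := exists_notMem_forall_mem_minimalPrimes _ ((isGenericIn_iff hZ hU hzU).1 hz)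
  obtain ⟨y, hyf, hyW, hyZ⟩ := mem_closure_iff.1 (hW hz.1) _ (X.basicOpen f).isOpen
    (notMem_primeAt.1 hfz)
  have hyU := X.basicOpen_le f hyf
  obtain ⟨q, hq, hqy⟩ := Ideal.exists_minimalPrimes_le ((idealAt_le_primeAt_iff hZ hU hyU).2 hyZ)
  have hqz : q = primeAt U z hzU := by
    by_contra hne
    exact (notMem_primeAt (hx := hyU)).2 hyf (hqy (hf q hq hne))
  exact mem_of_specializes ((specializes_iff_primeAt_le hU hyU hzU).2 (hqz ▸ hqy)) hyW

theorem IsGenericIn.mem_of_dense [IsLocallyNoetherian X] {W : X.Opens} (hW : Dense (W : Set X))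
    {z : X} (hz : IsGenericIn Set.univ z) : z ∈ W :=
  hz.mem_of_subset_closure isClosed_univ (by simp [hW.closure_eq])

theorem isGenericIn_univ_of_mem_genericPoints {z : X} (hz : z ∈ genericPoints X) :
    IsGenericIn Set.univ z := by
  refine ⟨Set.mem_univ z, fun y _ hyz => ?_⟩
  have h1 : closure {z} ⊆ closure {y} := specializes_iff_closure_subset.1 hyz
  have h2 : closure {y} ⊆ closure {z} :=
    (show closure {z} ∈ irreducibleComponents X from hz).2 isIrreducible_singleton.closure h1
  exact (hyz.antisymm (specializes_iff_closure_subset.2 h2)).eq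

/-- There are no specializations in the fibres of an integral morphism. -/
theorem eq_of_specializes_of_isIntegralHom (f : X ⟶ Y) [IsIntegralHom f] {x y : X} (h : y ⤳ x)
    (hf : f y = f x) : y = x := by
  obtain ⟨_, ⟨U, hU, rfl⟩, hxU, -⟩ :=
    Y.isBasis_affineOpens.exists_subset_of_mem_open (Set.mem_univ (f x)) isOpen_univ
  have hU' := hU.preimage f
  have hx : x ∈ f ⁻¹ᵁ U := hxU
  have hy : y ∈ f ⁻¹ᵁ U := mem_of_specializes h hx
  let := (f.app U).hom.toAlgebra
  have : Algebra.IsIntegral Γ(Y, U) Γ(X, f ⁻¹ᵁ U) := ⟨f.isIntegral_app U hU⟩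
  have hle := (specializes_iff_primeAt_le hU' hx hy).1 h
  refine primeAt_injective hU' hy hx (hle.eq_of_not_lt fun hlt => ?_)
  have h1 := Ideal.IsIntegral.comap_lt_comap (R := Γ(Y, U)) hlt
  have h2 : (primeAt (f ⁻¹ᵁ U) x hx).comap (f.app U).hom =
      (primeAt (f ⁻¹ᵁ U) y hy).comap (f.app U).hom :=
    (comap_app_primeAt f hx).trans (.trans (by simp only [hf]) (comap_app_primeAt f hy).symm)
  exact h1.ne' h2

/-- Points of an integral scheme over a generic point of a closed subset are generic points
of the preimage. -/
theorem isGenericIn_preimage (f : X ⟶ Y) [IsIntegralHom f] {Z : Set Y} {x : X}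
    (hx : IsGenericIn Z (f x)) : IsGenericIn (f ⁻¹' Z) x :=
  ⟨hx.1, fun _ hy hyx => eq_of_specializes_of_isIntegralHom f hyx
    (hx.2 _ hy (hyx.map f.continuous))⟩

end GenericPoints

/-! ### Reduced closed subschemes and their normalizations. -/

section ReducedSubscheme

theorem isReduced_of_forall_exists {X : Scheme.{u}}
    (h : ∀ x : X, ∃ U : X.Opens, IsAffineOpen U ∧ x ∈ U ∧ _root_.IsReduced Γ(X, U)) :
    IsReduced X := by
  have : ∀ x : X, _root_.IsReduced (X.presheaf.stalk x) := fun x => by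
    obtain ⟨U, hU, hx, hred⟩ := h x
    have : _root_.IsReduced (Localization.AtPrime (primeAt U x hx)) := inferInstance
    exact isReduced_of_injective (stalkEquiv hU x hx).symm (stalkEquiv hU x hx).symm.injective
  exact isReduced_of_isReduced_stalk X

variable {X : Scheme.{u}} (Z : Closeds X)

instance : IsClosedImmersion (reducedSubschemeι Z) :=
  inferInstanceAs (IsClosedImmersion (Scheme.IdealSheafData.subschemeι _))

theorem range_reducedSubschemeι : Set.range (reducedSubschemeι Z) = Z := by
  exact (Scheme.IdealSheafData.range_subschemeι _).trans
    (Scheme.IdealSheafData.coe_support_vanishingIdeal Z)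

theorem reducedSubschemeι_app_eq_zero_iff {U : X.Opens} (hU : IsAffineOpen U) (f : Γ(X, U)) :
    (reducedSubschemeι Z).app U f = 0 ↔ f ∈ idealAt (Z : Set X) U := by
  have h1 : (reducedSubschemeι Z).app U f = 0 ↔
      f ∈ (Scheme.IdealSheafData.vanishingIdeal Z).ideal ⟨U, hU⟩ := by
    rw [← Scheme.IdealSheafData.ker_subschemeι_app]
    rfl
  rw [h1, mem_idealAt]
  change f ∈ PrimeSpectrum.vanishingIdeal (hU.fromSpec ⁻¹' (Z : Set X)) ↔ _
  rw [PrimeSpectrum.mem_vanishingIdeal]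
  constructor
  · intro h z hz hz'
    have hzU := X.basicOpen_le f hz'
    have h2 := h (hU.primeIdealOf ⟨z, hzU⟩) (by
      have h3 := hU.fromSpec_primeIdealOf ⟨z, hzU⟩
      exact (h3 ▸ hz : hU.fromSpec (hU.primeIdealOf ⟨z, hzU⟩) ∈ (Z : Set X)))
    rw [primeIdealOf_asIdeal, mem_primeAt] at h2
    exact h2 hz'
  · intro h p hp
    obtain ⟨z, hz, hzp⟩ := exists_primeAt_eq hU p.asIdeal
    have h2 : hU.primeIdealOf ⟨z, hz⟩ = p :=
      PrimeSpectrum.ext ((primeIdealOf_asIdeal hU z hz).trans hzp)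
    have h3 : hU.fromSpec p = z := by rw [← h2, hU.fromSpec_primeIdealOf]
    rw [← hzp, mem_primeAt]
    refine h z ?_
    rw [← h3]
    exact hp

instance : IsReduced (reducedSubscheme Z) := by
  refine isReduced_of_forall_exists fun x => ?_
  obtain ⟨_, ⟨U, hU, rfl⟩, hxU, -⟩ := X.isBasis_affineOpens.exists_subset_of_mem_open
    (Set.mem_univ (reducedSubschemeι Z x)) isOpen_univ
  refine ⟨reducedSubschemeι Z ⁻¹ᵁ U, hU.preimage _, hxU, ⟨fun f ⟨n, hn⟩ => ?_⟩⟩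
  obtain ⟨g, rfl⟩ := (reducedSubschemeι Z).app_surjective U hU f
  rw [← map_pow, reducedSubschemeι_app_eq_zero_iff Z hU, mem_idealAt] at hn
  rw [reducedSubschemeι_app_eq_zero_iff Z hU, mem_idealAt]
  intro z hz hz'
  cases n with
  | zero => exact hn z hz (by rw [pow_zero, Scheme.basicOpen_one]; exact X.basicOpen_le g hz')
  | succ n => exact hn z hz (by rwa [X.basicOpen_pow g n.succ_pos])

end ReducedSubscheme

section NormalizationOf

theorem app_surjective_of_isClosedImmersion {X T : Scheme.{u}} (δ : T ⟶ X) {Ω V : X.Opens}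
    [IsClosedImmersion (δ ∣_ Ω)] (hV : IsAffineOpen V) (h : V ≤ Ω) :
    Function.Surjective (δ.app V) := by
  obtain ⟨W, rfl⟩ : ∃ W : Ω.toScheme.Opens, Ω.ι ''ᵁ W = V :=
    ⟨Ω.ι ⁻¹ᵁ V, by
      rw [Ω.ι.image_preimage_eq_opensRange_inf, Scheme.Opens.opensRange_ι]
      exact inf_eq_right.2 h⟩
  have hW : IsAffineOpen W := (Ω.ι.isAffineOpen_iff_of_isOpenImmersion).1 hV
  have h1 := (δ ∣_ Ω).app_surjective W hW
  intro σ
  obtain ⟨b, hb⟩ := h1 (T.presheaf.map (eqToHom (image_morphismRestrict_preimage δ Ω W)).op σ)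
  refine ⟨b, ?_⟩
  rw [morphismRestrict_app] at hb
  exact (ConcreteCategory.bijective_of_isIso
    (T.presheaf.map (eqToHom (image_morphismRestrict_preimage δ Ω W)).op)).1 hb

variable {X T : Scheme.{u}}

/-- `δ` is the normalization of the closed subset `Z` with its reduced structure, composed with the
inclusion of `Z`. -/
structure IsNormalizationOf (Z : Set X) (δ : T ⟶ X) : Prop where
  normal : IsNormalScheme T
  noetherian : IsLocallyNoetherian T
  integral : IsIntegralHom δ
  range_eq : Set.range δ = Z
  birational : ∃ Ω : X.Opens, Z ⊆ closure (Ω ∩ Z) ∧ Dense ((δ ⁻¹ᵁ Ω : T.Opens) : Set T) ∧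
    IsClosedImmersion (δ ∣_ Ω)

theorem IsNormalization.surjective {X X' : Scheme.{u}} {n : X' ⟶ X} (hn : IsNormalization n) :
    Function.Surjective n := by
  have := hn.integral
  obtain ⟨W, hW, -, _⟩ := hn.birational
  have h1 : IsClosed (Set.range n) := n.isClosedMap.isClosed_range
  refine Set.range_eq_univ.1 (h1.closure_eq ▸ (hW.mono fun x hx => ?_).closure_eq)
  exact exists_apply_eq_of_isIso_morphismRestrict n hx

theorem IsNormalization.isNormalizationOf {Z : Closeds X} {d : T ⟶ reducedSubscheme Z}
    (hd : IsNormalization d) [IsLocallyNoetherian T] :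
    IsNormalizationOf (Z : Set X) (d ≫ reducedSubschemeι Z) := by
  have := hd.integral
  obtain ⟨W, hW, hW', hiso⟩ := hd.birational
  refine ⟨hd.normal, inferInstance, inferInstance, ?_, ?_⟩
  · rw [← range_reducedSubschemeι Z]
    refine Set.Subset.antisymm ?_ ?_
    · rintro _ ⟨t, rfl⟩
      exact ⟨d t, by simp⟩
    · rintro _ ⟨t, rfl⟩
      obtain ⟨t, rfl⟩ := hd.surjective t
      exact ⟨t, by simp⟩
  · obtain ⟨Ω, rfl⟩ : ∃ Ω : X.Opens, reducedSubschemeι Z ⁻¹ᵁ Ω = W := by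
      obtain ⟨Ω, hΩ, hΩW⟩ := (reducedSubschemeι Z).isClosedEmbedding.isOpen_iff.1 W.isOpen
      exact ⟨⟨Ω, hΩ⟩, Opens.ext hΩW⟩
    refine ⟨Ω, ?_, hW', ?_⟩
    · intro x hx
      rw [← range_reducedSubschemeι Z] at hx
      obtain ⟨z, rfl⟩ := hx
      refine closure_mono ?_ (image_closure_subset_closure_image (reducedSubschemeι Z).continuous
        ⟨z, hW z, rfl⟩)
      rintro _ ⟨w, hw, rfl⟩
      refine ⟨?_, ?_⟩
      · exact hw
      · rw [← range_reducedSubschemeι Z]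
        exact ⟨w, rfl⟩
    · rw [morphismRestrict_comp]
      have h1 : IsClosedImmersion (d ∣_ (reducedSubschemeι Z ⁻¹ᵁ Ω)) :=
        @IsClosedImmersion.instOfIsIsoScheme _ _ (d ∣_ (reducedSubschemeι Z ⁻¹ᵁ Ω)) hiso
      have h2 : IsClosedImmersion (reducedSubschemeι Z ∣_ Ω) := inferInstance
      exact IsClosedImmersion.comp (d ∣_ (reducedSubschemeι Z ⁻¹ᵁ Ω)) (reducedSubschemeι Z ∣_ Ω)

namespace IsNormalizationOf

variable {Z : Set X} {δ : T ⟶ X} (h : IsNormalizationOf Z δ)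

include h

theorem isClosed : IsClosed Z := by
  have := h.integral
  rw [← h.range_eq]
  exact δ.isClosedMap.isClosed_range

theorem app_eq_zero_iff {U : X.Opens} (f : Γ(X, U)) : δ.app U f = 0 ↔ f ∈ idealAt Z U := by
  have := h.normal.isReduced
  rw [← basicOpen_eq_bot_iff, ← Scheme.preimage_basicOpen, mem_idealAt, ← h.range_eq,
    eq_bot_iff]
  constructor
  · rintro hf _ ⟨t, rfl⟩ ht
    exact hf ht
  · exact fun hf t ht => hf _ ⟨t, rfl⟩ ht

omit h in
theorem specializes_of_isClosedImmersion {Ω : X.Opens} (hΩ : IsClosedImmersion (δ ∣_ Ω))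
    {s t : T} (hs : δ s ∈ Ω)
    (ht : δ t ∈ Ω) (hst : δ s ⤳ δ t) : s ⤳ t := by
  let s' : (δ ⁻¹ᵁ Ω).toScheme := ⟨s, hs⟩
  let t' : (δ ⁻¹ᵁ Ω).toScheme := ⟨t, ht⟩
  have h1 : (δ ∣_ Ω) s' ⤳ (δ ∣_ Ω) t' := by
    rw [← Ω.ι.isOpenEmbedding.isInducing.specializes_iff, morphismRestrict_apply,
      morphismRestrict_apply]
    exact hst
  exact ((δ ∣_ Ω).isClosedEmbedding.isInducing.specializes_iff.1 h1).map
    (δ ⁻¹ᵁ Ω).ι.continuous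

theorem isGenericIn {t : T} (ht : IsGenericIn Set.univ t) : IsGenericIn Z (δ t) := by
  have := h.noetherian
  obtain ⟨Ω, -, hΩ, hcl⟩ := h.birational
  have htΩ : δ t ∈ Ω := ht.mem_of_dense hΩ
  refine ⟨h.range_eq ▸ ⟨t, rfl⟩, fun y hy hyt => ?_⟩
  rw [← h.range_eq] at hy
  obtain ⟨s, rfl⟩ := hy
  rw [ht.2 s trivial (specializes_of_isClosedImmersion hcl (mem_of_specializes hyt htΩ) htΩ hyt)]

/-- A morphism from a normal scheme to `Z` that sends generic points to generic points lifts to the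
normalization of `Z`. -/
theorem exists_lift [IsLocallyNoetherian X] {N : Scheme.{u}} [IsLocallyNoetherian N]
    (hN : IsNormalScheme N) (f : N ⟶ X) (hf : ∀ x, f x ∈ Z)
    (hgen : ∀ x, IsGenericIn Set.univ x → IsGenericIn Z (f x)) : ∃ g : N ⟶ T, g ≫ δ = f := by
  have := h.integral
  have := hN.isReduced
  have := h.normal.isReduced
  obtain ⟨Ω, hΩ, -, hcl⟩ := h.birational
  have hdense : Dense ((f ⁻¹ᵁ Ω : N.Opens) : Set N) := dense_of_forall_isGenericIn fun x hx =>
    (hgen x hx).mem_of_subset_closure h.isClosed hΩ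
  have : IsDominant (f ⁻¹ᵁ Ω).ι := ⟨by
    simpa [DenseRange] using hdense⟩
  -- Over `Ω` the morphism `f` has reduced source and set-theoretic image in `Z`, so it factors
  -- through the closed immersion `δ ∣_ Ω`. Since `f ⁻¹ᵁ Ω` is dense in the normal scheme `N`, this
  -- partial lift extends.
  have hker : (δ ∣_ Ω).ker ≤ (f ∣_ Ω).ker := by
    refine Scheme.IdealSheafData.le_ofIdeals_iff.2 fun V s hs => ?_
    have h1 : (δ ∣_ Ω).app V s = 0 := (δ ∣_ Ω).ideal_ker_le V hs
    change (f ∣_ Ω).app V s = 0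
    rw [← basicOpen_eq_bot_iff, ← Scheme.preimage_basicOpen, eq_bot_iff] at h1 ⊢
    intro x hx
    obtain ⟨t, ht⟩ : f x.1 ∈ Set.range δ := h.range_eq ▸ hf x.1
    have htΩ : δ t ∈ Ω := by
      rw [ht]
      exact x.2
    let t' : (δ ⁻¹ᵁ Ω).toScheme := ⟨t, htΩ⟩
    have hxt : (f ∣_ Ω) x = (δ ∣_ Ω) t' := by
      apply Ω.ι.isOpenEmbedding.injective
      exact (morphismRestrict_apply f Ω x).trans
        (ht.symm.trans (morphismRestrict_apply δ Ω t').symm)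
    have h2 : (δ ∣_ Ω) t' ∈ Ω.toScheme.basicOpen s := hxt ▸ hx
    exact (h1 h2).elim
  obtain ⟨g, hg, hg'⟩ := exists_extension hN (f ⁻¹ᵁ Ω).ι δ f
    (IsClosedImmersion.lift (δ ∣_ Ω) (f ∣_ Ω) hker ≫ (δ ⁻¹ᵁ Ω).ι) (by
      rw [Category.assoc, ← morphismRestrict_ι, IsClosedImmersion.lift_fac_assoc,
        morphismRestrict_ι])
  exact ⟨g, hg'⟩

/-- Near the generic points of `Z`, the functions on the normalization extend. -/
theorem exists_app_surjective : ∃ Ω : X.Opens, Z ⊆ closure (Ω ∩ Z) ∧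
    ∀ V : X.Opens, IsAffineOpen V → (V ∩ Z : Set X) ⊆ Ω → Function.Surjective (δ.app V) := by
  have := h.integral
  obtain ⟨Ω, hΩ, -, hcl⟩ := h.birational
  refine ⟨Ω, hΩ, fun V hV hVZ σ => ?_⟩
  -- The functions `a` for which `a σ` comes from `V`. At points of `Z` the closed immersion over
  -- `Ω` provides elements outside the prime; off `Z` any function vanishing on `Z` kills `σ`. So
  -- the ideal is everything.
  let I : Ideal Γ(X, V) :=
    { carrier := {a | ∃ b, δ.app V b = δ.app V a * σ}
      add_mem' := by
        rintro a a' ⟨b, hb⟩ ⟨b', hb'⟩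
        exact ⟨b + b', by rw [map_add, map_add, hb, hb', add_mul]⟩
      zero_mem' := ⟨0, by simp⟩
      smul_mem' := by
        rintro c a ⟨b, hb⟩
        exact ⟨c * b, by rw [map_mul, hb, smul_eq_mul, map_mul, mul_assoc]⟩ }
  have hI : I = ⊤ := by
    by_contra hne
    obtain ⟨p, hp, hle⟩ := Ideal.exists_le_maximal I hne
    have hpp := hp.isPrime
    obtain ⟨x, hx, rfl⟩ := exists_primeAt_eq hV p
    by_cases hxZ : x ∈ Z
    · obtain ⟨g, hg, hxg⟩ := hV.exists_basicOpen_le (V := Ω) ⟨x, hVZ ⟨hx, hxZ⟩⟩ hx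
      have hsurj := app_surjective_of_isClosedImmersion δ (hV.basicOpen g) hg
      obtain ⟨m, c, hc⟩ := exists_app_eq_pow_mul δ hV (hV.preimage δ).isCompact g σ (hsurj _)
      have h2 : g ^ m ∈ primeAt V x hx := hle ⟨c, hc⟩
      exact notMem_primeAt.2 hxg (hpp.mem_of_pow_mem m h2)
    · obtain ⟨g, hg, hxg⟩ := hV.exists_basicOpen_le (V := ⟨Zᶜ, h.isClosed.isOpen_compl⟩)
        ⟨x, hxZ⟩ hx
      have h1 : δ.app V g = 0 := (h.app_eq_zero_iff g).2
        (mem_idealAt.2 fun z hz hz' => hg hz' hz)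
      exact notMem_primeAt.2 hxg (hle ⟨0, by rw [h1, map_zero, zero_mul]⟩)
  obtain ⟨b, hb⟩ := (Ideal.eq_top_iff_one I).1 hI
  exact ⟨b, by rw [hb, map_one, one_mul]⟩

end IsNormalizationOf

end NormalizationOf

/-! ### The double locus as the non-normal locus. -/

section RegularLocus

/-- At height one regular means normal, and a reduced local ring equal to its finite or integral
birational normal extension is normal. So regularity at `P` becomes a statement about denominators
of elements of `B`. -/
theorem isRegularLocalRing_localization_iff {A : Type u} {B : Type v} [CommRing A] [CommRing B]
    [IsReduced A] [IsNoetherianRing A] [Algebra A B] [FaithfulSMul A B] [Algebra.IsIntegral A B]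
    (hB : StalkNormal B) {a : A} (ha : algebraMap A B a ∈ nonZeroDivisors B)
    (haA : a ∈ nonZeroDivisors A) (h : ∀ b : B, ∃ n : ℕ, a ^ n ∈ denomIdeal A b)
    (P : Ideal A) [P.IsPrime] (hP : P.height = 1) :
    IsRegularLocalRing (Localization.AtPrime P) ↔ ∀ b : B, ∃ s ∉ P, s ∈ denomIdeal A b := by
  have hdim : ringKrullDim (Localization.AtPrime P) = 1 := by
    rw [IsLocalization.AtPrime.ringKrullDim_eq_height P, hP]
    rfl
  let N := Algebra.algebraMapSubmonoid B P.primeCompl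
  let AP := Localization.AtPrime P
  let BP := Localization N
  have : IsLocalization (Algebra.algebraMapSubmonoid B P.primeCompl) BP :=
    inferInstanceAs (IsLocalization N (Localization N))
  let _ : Algebra AP BP := localizationAlgebra P.primeCompl B
  have : IsScalarTower A AP BP := isScalarTower_localizationAlgebra P.primeCompl B
  have hinj : Function.Injective (algebraMap AP BP) :=
    localizationAlgebra_injective (Rₘ := AP) (Sₘ := BP) (M := P.primeCompl)
      (FaithfulSMul.algebraMap_injective A B)
  have : FaithfulSMul AP BP := (faithfulSMul_iff_algebraMap_injective AP BP).2 hinj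
  have : Algebra.IsIntegral AP BP := ⟨isIntegral_localization (M := P.primeCompl) (R := A) (S := B)⟩
  have hu : ∀ s ∉ P, IsUnit (algebraMap A AP s) := fun s hs =>
    IsLocalization.map_units AP (⟨s, hs⟩ : P.primeCompl)
  have hden : ∀ z : BP, ∃ s ∉ P, ∃ b, algebraMap A BP s * z = algebraMap B BP b := fun z => by
    obtain ⟨⟨b, ⟨_, s, hs, rfl⟩⟩, hb⟩ := IsLocalization.surj N z
    exact ⟨s, hs, b, by rw [IsScalarTower.algebraMap_apply A B BP, mul_comm]; exact hb⟩
  have hfrac : ∀ (z : BP) (b : B) (s t c : A), s ∉ P →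
      algebraMap A BP s * z = algebraMap B BP b → algebraMap A B c = algebraMap A B t * b →
      algebraMap A AP t ∈ denomIdeal AP z := fun z b s t c hs hb hc => by
    obtain ⟨w, hw⟩ := (hu s hs).exists_right_inv
    refine mem_denomIdeal.2 ⟨algebraMap A AP c * w, ?_⟩
    have h1 := congrArg (algebraMap B BP) hc
    have h3 := congrArg (algebraMap AP BP) hw
    rw [map_mul, ← hb] at h1
    rw [map_mul (algebraMap AP BP)] at h3 ⊢
    simp only [← IsScalarTower.algebraMap_apply, map_one] at h1 h3 ⊢
    rw [h1]
    linear_combination algebraMap A BP t * z * h3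
  constructor
  · intro hreg b
    have hsurj : Function.Surjective (algebraMap AP BP) := by
      refine algebraMap_surjective_of_isRegularLocalRing (B := BP)
        (a := algebraMap A AP a) hreg hdim ?_
        (IsLocalization.nonZeroDivisors_le_comap P.primeCompl AP haA) fun z => ?_
      · rw [← IsScalarTower.algebraMap_apply A AP BP, IsScalarTower.algebraMap_apply A B BP]
        exact IsLocalization.nonZeroDivisors_le_comap N BP ha
      · obtain ⟨s, hs, b, hb⟩ := hden z
        obtain ⟨n, hn⟩ := h b
        obtain ⟨c, hc⟩ := mem_denomIdeal.1 hn
        exact ⟨n, by rw [← map_pow]; exact hfrac z b s _ c hs hb hc⟩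
    obtain ⟨z, hz⟩ := hsurj (algebraMap B BP b)
    obtain ⟨⟨x, s, hs⟩, hx⟩ := IsLocalization.surj P.primeCompl z
    have h1 : algebraMap B BP (algebraMap A B s * b) = algebraMap B BP (algebraMap A B x) := by
      have h2 : algebraMap AP BP (z * algebraMap A AP s) = algebraMap AP BP (algebraMap A AP x) :=
        congrArg (algebraMap AP BP) hx
      rw [map_mul, hz] at h2
      simp only [map_mul, ← IsScalarTower.algebraMap_apply] at h2 ⊢
      rw [← h2, mul_comm]
    obtain ⟨⟨_, t, ht, rfl⟩, h2⟩ := (IsLocalization.eq_iff_exists N BP).1 h1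
    refine ⟨t * s, P.primeCompl.mul_mem ht hs, mem_denomIdeal.2 ⟨t * x, ?_⟩⟩
    rw [map_mul, map_mul, mul_assoc]
    exact h2.symm
  · intro hP'
    have hsurj : Function.Surjective (algebraMap AP BP) := fun z => by
      obtain ⟨s, hs, b, hb⟩ := hden z
      obtain ⟨t, ht, htb⟩ := hP' b
      obtain ⟨c, hc⟩ := mem_denomIdeal.1 htb
      obtain ⟨x, hx⟩ := mem_denomIdeal.1 (hfrac z b s t c hs hb hc)
      obtain ⟨w, hw⟩ := (hu t ht).exists_right_inv
      refine ⟨w * x, ?_⟩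
      rw [map_mul, hx, ← mul_assoc, ← map_mul, mul_comm w, hw, map_one, one_mul]
    let e : AP ≃+* BP := RingEquiv.ofBijective _ ⟨hinj, hsurj⟩
    have hAP : StalkNormal AP := by
      let _ : Algebra BP AP := e.symm.toRingHom.toAlgebra
      have : IsLocalization (⊥ : Submonoid BP) AP :=
        IsLocalization.of_le_isUnit_of_bijective
          (by simp [Algebra.algebraMapSubmonoid]) e.symm.bijective
      exact (hB.of_isLocalization N).of_isLocalization (⊥ : Submonoid BP)
    have h1 := hAP (IsLocalRing.maximalIdeal AP)
    let e' : AP ≃+* Localization.AtPrime (IsLocalRing.maximalIdeal AP) :=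
      (IsLocalization.atUnits AP (IsLocalRing.maximalIdeal AP).primeCompl
        (fun x hx => by simpa using! hx)).toRingEquiv
    have := h1.1
    have := h1.2
    have : IsDomain AP := e'.injective.isDomain e'.toRingHom
    have : IsIntegrallyClosed AP := .of_equiv e'.symm
    exact isRegularLocalRing_of_isIntegrallyClosed hdim

/-- `B` is a finite birational extension of the reduced noetherian ring `A`, and `B` is normal. -/
structure IsFiniteNormalization (A B : Type*) [CommRing A] [CommRing B] [Algebra A B] : Prop where
  reduced : _root_.IsReduced A
  noetherian : IsNoetherianRing A
  faithful : FaithfulSMul A B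
  finite : Module.Finite A B
  normal : StalkNormal B
  exists_pow_mem : ∃ a ∈ nonZeroDivisors A, algebraMap A B a ∈ nonZeroDivisors B ∧
    ∀ b : B, ∃ n : ℕ, a ^ n ∈ denomIdeal A b

theorem IsFiniteNormalization.one_le_height {A B : Type*} [CommRing A] [CommRing B] [Algebra A B]
    (h : IsFiniteNormalization A B) (P : Ideal A) [P.IsPrime] {b : B} (hb : denomIdeal A b ≤ P) :
    1 ≤ P.height := by
  obtain ⟨a, ha, -, h⟩ := h.exists_pow_mem
  obtain ⟨n, hn⟩ := h b
  rw [Order.one_le_iff_ne_zero]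
  intro h0
  rw [Ideal.height_eq_zero_iff] at h0
  have haP : a ∈ P := Ideal.IsPrime.mem_of_pow_mem ‹_› n (hb hn)
  exact Set.disjoint_left.1 (Ideal.disjoint_nonZeroDivisors_of_mem_minimalPrimes h0) haP ha

end RegularLocus

section DoubleLocus

/-- The points of codimension one that are not regular. -/
def singularCodimOne (Y : Scheme.{u}) : Set Y :=
  {y : Y | ringKrullDim (Y.presheaf.stalk y) = 1 ∧ ¬ IsRegularLocalRing (Y.presheaf.stalk y)}

variable {Y Y' : Scheme.{u}} {ν : Y' ⟶ Y}

theorem IsNormalization.isFiniteNormalization (hν : IsNormalization ν) [IsReduced Y]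
    [IsLocallyNoetherian Y] [IsFinite ν] {U : Y.Opens} (hU : IsAffineOpen U) :
    @IsFiniteNormalization Γ(Y, U) Γ(Y', ν ⁻¹ᵁ U) _ _ (ν.app U).hom.toAlgebra := by
  let := (ν.app U).hom.toAlgebra
  obtain ⟨a, ha, ha', h⟩ := hν.exists_nonZeroDivisors hU
  exact ⟨inferInstance, IsLocallyNoetherian.component_noetherian ⟨U, hU⟩,
    (faithfulSMul_iff_algebraMap_injective _ _).2 (hν.app_injective U),
    IsFinite.finite_app ν U hU, stalkNormal_of_isNormalScheme hν.normal (hU.preimage ν),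
    a, ha, ha', fun b => (h b).imp fun n hn => mem_denomIdeal.2 hn⟩

/-- Height at most one is enough: an ideal of denominators contains a power of a nonzerodivisor and
so lies in no minimal prime. -/
theorem mem_singularCodimOne_iff (hν : IsNormalization ν) [IsReduced Y] [IsLocallyNoetherian Y]
    [IsFinite ν] {U : Y.Opens} (hU : IsAffineOpen U) {P : Y} (hP : P ∈ U) :
    P ∈ singularCodimOne Y ↔ (primeAt U P hP).height ≤ 1 ∧
      ∃ b, @denomIdeal Γ(Y, U) Γ(Y', ν ⁻¹ᵁ U) _ _ (ν.app U).hom.toAlgebra b ≤ primeAt U P hP := by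
  let := (ν.app U).hom.toAlgebra
  have h := hν.isFiniteNormalization hU
  have := h.noetherian
  have := h.faithful
  have := h.finite
  obtain ⟨a, ha, ha', hab⟩ := h.exists_pow_mem
  have hreg : IsRegularLocalRing (Localization.AtPrime (primeAt U P hP)) ↔
      IsRegularLocalRing (Y.presheaf.stalk P) :=
    ⟨fun _ => .of_ringEquiv (stalkEquiv hU P hP), fun _ => .of_ringEquiv (stalkEquiv hU P hP).symm⟩
  have hle : ∀ b : Γ(Y', ν ⁻¹ᵁ U), denomIdeal Γ(Y, U) b ≤ primeAt U P hP ↔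
      ¬ ∃ s ∉ primeAt U P hP, s ∈ denomIdeal Γ(Y, U) b := fun b => by
    simp only [SetLike.le_def]
    push Not
    exact ⟨fun h s hs hs' => hs (h hs'), fun h s hs => by_contra fun hs' => h s hs' hs⟩
  have hht : ringKrullDim (Y.presheaf.stalk P) = 1 ↔ (primeAt U P hP).height = 1 := by
    rw [← height_primeAt hU P hP]
    exact WithBot.coe_inj
  constructor
  · rintro ⟨hdim, hns⟩
    rw [hht] at hdim
    rw [← hreg, isRegularLocalRing_localization_iff h.normal ha' ha hab _ hdim, not_forall] at hns
    exact ⟨hdim.le, hns.imp fun b hb => (hle b).2 hb⟩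
  · rintro ⟨hh, b, hb⟩
    have h1 := le_antisymm hh (h.one_le_height _ hb)
    refine ⟨hht.2 h1, ?_⟩
    rw [← hreg, isRegularLocalRing_localization_iff h.normal ha' ha hab _ h1, not_forall]
    exact ⟨b, (hle b).1 hb⟩

/-- The non-normal locus is closed because `ν` is finite: if every function has a denominator at
`P`, one `s` works for all of them, and `D(s)` is then a neighbourhood of `P` without singular
points of codimension one. -/
theorem exists_denomIdeal_le_of_mem_doubleLocus (hν : IsNormalization ν) [IsReduced Y]
    [IsLocallyNoetherian Y] [IsFinite ν] {U : Y.Opens} (hU : IsAffineOpen U) {P : Y} (hP : P ∈ U)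
    (hPC : P ∈ doubleLocus Y) :
    ∃ b, @denomIdeal Γ(Y, U) Γ(Y', ν ⁻¹ᵁ U) _ _ (ν.app U).hom.toAlgebra b ≤ primeAt U P hP := by
  let := (ν.app U).hom.toAlgebra
  have h := hν.isFiniteNormalization hU
  have := h.finite
  by_contra! hcon
  let S : Submodule Γ(Y, U) Γ(Y', ν ⁻¹ᵁ U) := LinearMap.range (Algebra.linearMap _ _)
  obtain ⟨s, hs, hsS⟩ := exists_notMem_forall_smul_mem S (primeAt U P hP) fun b => by
    obtain ⟨s, hs, hs'⟩ := SetLike.not_le_iff_exists.1 (hcon b)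
    obtain ⟨c, hc⟩ := mem_denomIdeal.1 hs
    exact ⟨s, hs', c, by rw [Algebra.smul_def]; exact hc⟩
  have hPC' : P ∈ closure (singularCodimOne Y) := hPC
  obtain ⟨Q, hQs, hQ⟩ := mem_closure_iff.1 hPC' _ (Y.basicOpen s).isOpen (notMem_primeAt.1 hs)
  have hQU : Q ∈ U := Y.basicOpen_le s hQs
  obtain ⟨-, b, hb⟩ := (mem_singularCodimOne_iff hν hU hQU).1 hQ
  obtain ⟨c, hc⟩ := hsS b
  exact (notMem_primeAt (hx := hQU)).2 hQs (hb (mem_denomIdeal.2 ⟨c, by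
    rw [← Algebra.smul_def]; exact hc⟩))

/-- This is where `S₂` enters: failure to be normal at `P` is inherited from a generization of
codimension one. -/
theorem exists_singularCodimOne_specializes (hY : SerreS2 Y) (hν : IsNormalization ν) [IsReduced Y]
    [IsLocallyNoetherian Y] [IsFinite ν] {U : Y.Opens} (hU : IsAffineOpen U) {P : Y} (hP : P ∈ U)
    {b} (hb : @denomIdeal Γ(Y, U) Γ(Y', ν ⁻¹ᵁ U) _ _ (ν.app U).hom.toAlgebra b ≤ primeAt U P hP) :
    ∃ Q ∈ singularCodimOne Y, Q ⤳ P := by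
  let := (ν.app U).hom.toAlgebra
  have h := hν.isFiniteNormalization hU
  have := h.noetherian
  have := h.faithful
  obtain ⟨a, ha, ha', hab⟩ := h.exists_pow_mem
  obtain ⟨q, hq, hqP, hq1, hqb⟩ := exists_height_le_one_denomIdeal_le ha' hab
    (fun q _ hq => depthTwo_primeAt hY hU q hq) b _ hb
  obtain ⟨Q, hQ, rfl⟩ := exists_primeAt_eq hU q
  exact ⟨Q, (mem_singularCodimOne_iff hν hU hQ).2 ⟨hq1, b, hqb⟩,
    (specializes_iff_primeAt_le hU hP hQ).2 hqP⟩

theorem mem_doubleLocus_iff (hY : SerreS2 Y) (hν : IsNormalization ν) [IsReduced Y]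
    [IsLocallyNoetherian Y] [IsFinite ν] {U : Y.Opens} (hU : IsAffineOpen U) {P : Y} (hP : P ∈ U) :
    P ∈ doubleLocus Y ↔ ∃ b,
      @denomIdeal Γ(Y, U) Γ(Y', ν ⁻¹ᵁ U) _ _ (ν.app U).hom.toAlgebra b ≤ primeAt U P hP := by
  refine ⟨exists_denomIdeal_le_of_mem_doubleLocus hν hU hP, fun ⟨b, hb⟩ => ?_⟩
  obtain ⟨Q, hQ, hQP⟩ := exists_singularCodimOne_specializes hY hν hU hP hb
  exact hQP.mem_closed (doubleLocus Y).isClosed (subset_closure hQ)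

/-- Every point of `C` is a specialization of a singular point of codimension one. Two such points
cannot specialize properly to one another, both having height one. -/
theorem isGenericIn_doubleLocus_iff (hY : SerreS2 Y) (hν : IsNormalization ν) [IsReduced Y]
    [IsLocallyNoetherian Y] [IsFinite ν] {P : Y} :
    IsGenericIn (doubleLocus Y : Set Y) P ↔ P ∈ singularCodimOne Y := by
  obtain ⟨_, ⟨U, hU, rfl⟩, hP, -⟩ :=
    Y.isBasis_affineOpens.exists_subset_of_mem_open (Set.mem_univ P) isOpen_univ
  have key : ∀ {P : Y}, P ∈ U → IsGenericIn (doubleLocus Y : Set Y) P → P ∈ singularCodimOne Y := by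
    rintro P hP ⟨hPC, hmin⟩
    obtain ⟨b, hb⟩ := (mem_doubleLocus_iff hY hν hU hP).1 hPC
    obtain ⟨Q, hQ, hQP⟩ := exists_singularCodimOne_specializes hY hν hU hP hb
    exact hmin Q (subset_closure hQ) hQP ▸ hQ
  refine ⟨key hP, fun h => ?_⟩
  obtain ⟨Q, hQ, hQP⟩ := exists_isGenericIn (doubleLocus Y).isClosed (subset_closure h)
  have hQU : Q ∈ U := mem_of_specializes hQP hP
  have hle := (specializes_iff_primeAt_le hU hP hQU).1 hQP
  obtain ⟨-, b, hb⟩ := (mem_singularCodimOne_iff hν hU hQU).1 (key hQU hQ)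
  have h1 := @IsFiniteNormalization.one_le_height _ _ _ _ (ν.app U).hom.toAlgebra
    (hν.isFiniteNormalization hU) _ _ b hb
  have h2 := ((mem_singularCodimOne_iff hν hU hP).1 h).1
  have : Q = P := primeAt_injective hU hQU hP (by
    have := IsLocallyNoetherian.component_noetherian (X := Y) ⟨U, hU⟩
    exact Ideal.eq_of_le_of_height_le _ hle (h2.trans h1))
  exact this ▸ hQ

/-- No component of `ν⁻¹(C)` maps to a smaller-dimensional part of `C`: its generic point is minimal
among the primes over which the two rings differ, and `height_under_le_one_of_minimal` bounds the
height of the image. -/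
theorem isGenericIn_doubleLocus_of_preimage (hY : SerreS2 Y) (hν : IsNormalization ν) [IsReduced Y]
    [IsLocallyNoetherian Y] [IsFinite ν] {Q : Y'}
    (hQ : IsGenericIn (ν ⁻¹' (doubleLocus Y : Set Y)) Q) :
    IsGenericIn (doubleLocus Y : Set Y) (ν Q) := by
  obtain ⟨_, ⟨U, hU, rfl⟩, hP, -⟩ :=
    Y.isBasis_affineOpens.exists_subset_of_mem_open (Set.mem_univ (ν Q)) isOpen_univ
  let := (ν.app U).hom.toAlgebra
  have h := hν.isFiniteNormalization hU
  have := h.noetherian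
  have := h.faithful
  have := h.finite
  obtain ⟨a, ha, ha', hab⟩ := h.exists_pow_mem
  have hcomap : ∀ {x : Y'} (hx : ν x ∈ U), (primeAt (ν ⁻¹ᵁ U) x hx).comap (algebraMap Γ(Y, U) _) =
      primeAt U (ν x) hx := fun hx => comap_app_primeAt ν hx
  have hb := (mem_doubleLocus_iff hY hν hU hP).1 hQ.1
  rw [isGenericIn_doubleLocus_iff hY hν, mem_singularCodimOne_iff hν hU hP]
  refine ⟨?_, hb⟩
  rw [← hcomap hP]
  refine height_under_le_one_of_minimal ha' hab (fun q _ hq => depthTwo_primeAt hY hU q hq)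
    (primeAt (ν ⁻¹ᵁ U) Q (show Q ∈ ν ⁻¹ᵁ U from hP)) (by rwa [hcomap hP]) fun q hq hqQ hbq => ?_
  obtain ⟨x, hx, rfl⟩ := exists_primeAt_eq (hU.preimage ν) q
  rw [hcomap hx] at hbq
  have := hQ.2 x ((mem_doubleLocus_iff hY hν hU hx).2 hbq)
    ((specializes_iff_primeAt_le (hU.preimage ν) hP hx).2 hqQ)
  subst this
  rfl

end DoubleLocus

/-! ### Coordinates at a node and the sign change of `e`. -/

section SwapChart

/-- Coordinates near a node: `B = A + A e` with `e ^ 2` a unit of `A`, the ring `S` is the quotient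
of `B` by the functions `x + y e` with `x, y ∈ 𝔭`, and `𝔭 e ⊆ 𝔭`. -/
structure IsSwapChart {A B S : Type*} [CommRing A] [CommRing B] [CommRing S] (φ : A →+* B)
    (σ : B →+* S) (𝔭 : Ideal A) (e : B) : Prop where
  prime : 𝔭.IsPrime
  sq : ∃ Δ, IsUnit Δ ∧ φ Δ = e ^ 2
  gen : ∀ b, ∃ x y, b = φ x + φ y * e
  surj : Function.Surjective σ
  zero : ∀ x y, σ (φ x + φ y * e) = 0 ↔ x ∈ 𝔭 ∧ y ∈ 𝔭
  mul : ∀ x ∈ 𝔭, ∃ x' ∈ 𝔭, φ x' = φ x * e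

/-- Inverting `s`, a multiple of `Δ * s₁ * s₂`, makes the node structure available without
denominators. The kernel of `σ` is controlled only up to radical by `hrad`; `mem_of_pow_mem_of_sqrt`
removes the radical. -/
theorem isSwapChart_of_localization {A₀ B₀ A B S : Type*} [CommRing A₀] [CommRing B₀] [CommRing A]
    [CommRing B] [CommRing S] {φ₀ : A₀ →+* B₀} {φ : A →+* B} {α : A₀ →+* A} {β : B₀ →+* B}
    {σ : B →+* S} (hcomm : ∀ a, β (φ₀ a) = φ (α a)) (hφ : Function.Injective φ) {s : A₀}
    (hA : ∀ a, ∃ (n : ℕ) (a₀ : A₀), α (s ^ n) * a = α a₀)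
    (hB : ∀ b, ∃ (n : ℕ) (b₀ : B₀), β (φ₀ (s ^ n)) * b = β b₀) (hs : IsUnit (α s))
    (hker : ∀ b b', β b = β b' → ∃ n : ℕ, φ₀ (s ^ n) * b = φ₀ (s ^ n) * b')
    (h2 : IsUnit (2 : A)) {𝔭₀ : Ideal A₀} [𝔭₀.IsPrime] {𝔭 : Ideal A} [𝔭.IsPrime]
    (h𝔭 : ∀ a, α a ∈ 𝔭 ↔ a ∈ 𝔭₀) {e : B₀} {Δ s₁ s₂ : A₀}
    (hΔ : φ₀ Δ = e ^ 2) (h₁ : ∀ b, ∃ x y, φ₀ s₁ * b = φ₀ x + φ₀ y * e)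
    (h₂ : ∀ p ∈ 𝔭₀, ∃ p' ∈ 𝔭₀, φ₀ p' = φ₀ (s₂ * p) * e)
    (h₃ : ∀ t ∉ 𝔭₀, ∀ x, φ₀ x ≠ φ₀ t * e) (hdvd : Δ * s₁ * s₂ ∣ s)
    (hσ : Function.Surjective σ) (hσ𝔭 : ∀ x, σ (φ x) = 0 ↔ x ∈ 𝔭)
    (hrad : ∀ b, σ b = 0 → ∃ n : ℕ, b ^ n ∈ Ideal.map φ 𝔭) :
    IsSwapChart φ σ 𝔭 (β e) := by
  have hinv : ∀ a, a ∣ s → ∃ w, w * α a = 1 := fun a ha => by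
    obtain ⟨w, hw⟩ := (isUnit_of_dvd_unit ((map_dvd α ha)) hs).exists_right_inv
    exact ⟨w, by rw [mul_comm, hw]⟩
  obtain ⟨w, hw⟩ := hinv s dvd_rfl
  have hwn : ∀ n : ℕ, w ^ n * α (s ^ n) = 1 := fun n => by rw [map_pow, ← mul_pow, hw, one_pow]
  obtain ⟨w₁, hw₁⟩ := hinv s₁ ((Dvd.intro_left _ rfl).trans ((Dvd.intro _ rfl).trans hdvd))
  obtain ⟨w₂, hw₂⟩ := hinv s₂ ((Dvd.intro_left _ rfl).trans hdvd)
  have hΔs : Δ ∣ s := (Dvd.intro _ rfl).trans ((Dvd.intro _ rfl).trans hdvd)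
  have hsq : φ (α Δ) = β e ^ 2 := by rw [← hcomm, hΔ, map_pow]
  have hΔu : IsUnit (α Δ) := isUnit_of_dvd_unit (map_dvd α hΔs) hs
  have hgen : ∀ b, ∃ x y, b = φ x + φ y * β e := fun b => by
    obtain ⟨n, b₀, hb⟩ := hB b
    obtain ⟨x, y, hxy⟩ := h₁ b₀
    have h4 := congrArg β hxy
    have h5 := congrArg φ hw₁
    have h6 := congrArg φ (hwn n)
    simp only [map_add, map_mul, hcomm, map_one] at h4 h5 h6 hb
    refine ⟨w ^ n * w₁ * α x, w ^ n * w₁ * α y, ?_⟩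
    simp only [map_mul]
    linear_combination (-φ w₁ * φ (α s₁) * b) * h6 - b * h5 +
      (φ (w ^ n) * φ w₁ * φ (α s₁)) * hb + φ (w ^ n) * φ w₁ * h4
  have hmul : ∀ x ∈ 𝔭, ∃ x' ∈ 𝔭, φ x' = φ x * β e := fun x hx => by
    obtain ⟨n, x₀, hx₀⟩ := hA x
    obtain ⟨p', hp', h⟩ := h₂ x₀ ((h𝔭 _).1 (hx₀ ▸ Ideal.mul_mem_left _ _ hx))
    refine ⟨w ^ n * w₂ * α p', Ideal.mul_mem_left _ _ ((h𝔭 _).2 hp'), ?_⟩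
    have h4 := congrArg β h
    have h5 := congrArg φ hw₂
    have h6 := congrArg φ (hwn n)
    have h7 := congrArg φ hx₀
    simp only [map_mul, hcomm, map_one] at h4 h5 h6 h7 ⊢
    linear_combination (φ (w ^ n) * φ w₂) * h4 - (φ (w ^ n) * φ w₂ * φ (α s₂) * β e) * h7 +
      (φ x * β e * φ w₂ * φ (α s₂)) * h6 + φ x * β e * h5
  have hne : ∀ t ∉ 𝔭, ∀ x, φ x ≠ φ t * β e := fun t ht x hx => by
    obtain ⟨n, x₀, hx₀⟩ := hA x
    obtain ⟨m, t₀, ht₀⟩ := hA t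
    have hs𝔭 : s ∉ 𝔭₀ := fun h => ‹𝔭.IsPrime›.ne_top (Ideal.eq_top_of_isUnit_mem _ ((h𝔭 _).2 h) hs)
    have ht₀' : t₀ ∉ 𝔭₀ := fun h => by
      rcases ‹𝔭.IsPrime›.mem_or_mem (ht₀.symm ▸ (h𝔭 _).2 h) with h | h
      · rw [map_pow] at h
        exact hs𝔭 ((h𝔭 _).1 (‹𝔭.IsPrime›.mem_of_pow_mem _ h))
      · exact ht h
    obtain ⟨k, hk⟩ := hker (φ₀ (s ^ m * x₀)) (φ₀ (s ^ n * t₀) * e) (by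
      have h7 := congrArg φ hx₀
      have h8 := congrArg φ ht₀
      simp only [map_mul, hcomm] at h7 h8 ⊢
      linear_combination φ (α (s ^ m)) * (φ (α (s ^ n)) * hx - h7) +
        φ (α (s ^ n)) * β e * h8)
    refine h₃ (s ^ k * (s ^ n * t₀)) ?_ (s ^ k * (s ^ m * x₀)) ?_
    · have := 𝔭₀.primeCompl.mul_mem (𝔭₀.primeCompl.pow_mem hs𝔭 k)
        (𝔭₀.primeCompl.mul_mem (𝔭₀.primeCompl.pow_mem hs𝔭 n) ht₀')
      exact this
    · rw [map_mul φ₀ (s ^ k), map_mul φ₀ (s ^ k), hk, mul_assoc]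
  -- Because `𝔭 e ⊆ 𝔭` and `B = A + A e`, the ideal generated by `𝔭` in `B` is just its image.
  have hmapP : ∀ b ∈ Ideal.map φ 𝔭, ∃ p ∈ 𝔭, φ p = b := fun b hb => by
    refine Submodule.span_induction (p := fun b _ => ∃ p ∈ 𝔭, φ p = b) ?_
      ⟨0, 𝔭.zero_mem, map_zero φ⟩
      ?_ ?_ hb
    · rintro _ ⟨p, hp, rfl⟩
      exact ⟨p, hp, rfl⟩
    · rintro _ _ - - ⟨p, hp, rfl⟩ ⟨q, hq, rfl⟩
      exact ⟨p + q, 𝔭.add_mem hp hq, map_add φ p q⟩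
    · rintro c _ - ⟨p, hp, rfl⟩
      obtain ⟨x, y, rfl⟩ := hgen c
      obtain ⟨p', hp', h⟩ := hmul p hp
      refine ⟨x * p + y * p', 𝔭.add_mem (Ideal.mul_mem_left _ _ hp)
        (Ideal.mul_mem_left _ _ hp'), ?_⟩
      rw [map_add, map_mul, map_mul, h, smul_eq_mul]
      ring
  refine ⟨‹_›, ⟨α Δ, hΔu, hsq⟩, hgen, hσ, fun x y => ⟨fun h => ?_, fun ⟨hx, hy⟩ => ?_⟩, hmul⟩
  · obtain ⟨n, hn⟩ := hrad _ h
    obtain ⟨p, hp, hpn⟩ := hmapP _ hn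
    let := φ.toAlgebra
    have : FaithfulSMul A B := (faithfulSMul_iff_algebraMap_injective _ _).2 hφ
    exact mem_of_pow_mem_of_sqrt 𝔭 h2
      (fun h => ‹𝔭.IsPrime›.ne_top (Ideal.eq_top_of_isUnit_mem _ h hΔu)) hsq hmul hne hp hpn.symm
  · rw [map_add, map_mul, (hσ𝔭 x).2 hx, (hσ𝔭 y).2 hy, zero_mul, add_zero]

namespace IsSwapChart

variable {A B S : Type*} [CommRing A] [CommRing B] [CommRing S] {φ : A →+* B} {σ : B →+* S}
  {𝔭 : Ideal A} {e : B} (h : IsSwapChart φ σ 𝔭 e)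

include h

theorem apply_eq_zero_iff (x : A) : σ (φ x) = 0 ↔ x ∈ 𝔭 := by
  simpa using h.zero x 0

theorem exists_eq (z : S) : ∃ x y, z = σ (φ x + φ y * e) := by
  obtain ⟨b, rfl⟩ := h.surj z
  obtain ⟨x, y, rfl⟩ := h.gen b
  exact ⟨x, y, rfl⟩

theorem isUnit : IsUnit (σ e) := by
  obtain ⟨Δ, hΔ, h⟩ := h.sq
  refine isUnit_pow_iff two_ne_zero |>.1 (?_ : IsUnit (σ e ^ 2))
  rw [← map_pow, ← h]
  exact (hΔ.map φ).map σ

/-- An endomorphism over `A` is trivial or changes the sign of `e`. -/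
theorem eq_or_eq_neg (h2 : IsUnit (2 : A)) (ι : S →+* S) (hι : ∀ x, ι (σ (φ x)) = σ (φ x))
    (hιι : ∀ z, ι (ι z) = z) : ι (σ e) = σ e ∨ ι (σ e) = - σ e := by
  have := h.prime
  obtain ⟨Δ, hΔ, hsq⟩ := h.sq
  -- Write `ι e = x + y e`. Modulo `𝔭`, `ι² = 1` gives `y² = 1` and `(ι e)² = Δ` gives `2 x y = 0`;
  -- hence `x = 0` and `y = ±1`.
  obtain ⟨x, y, hxy⟩ := h.exists_eq (ι (σ e))
  have h1 := hιι (σ e)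
  have hsq' : σ e ^ 2 = σ (φ Δ) := by rw [hsq, map_pow]
  have h1' := congrArg ι hsq'
  rw [map_pow, hι] at h1'
  rw [hxy, map_add, map_add, map_mul, map_mul, hι, hι, hxy] at h1
  rw [hxy] at h1'
  simp only [map_add, map_mul] at h1 h1'
  have h3 : σ (φ (x + y * x) + φ (y * y - 1) * e) = 0 := by
    simp only [map_add, map_mul, map_sub, map_one]
    linear_combination h1
  have h5 := ((h.zero _ _).1 h3).2
  rw [show y * y - 1 = (y - 1) * (y + 1) by ring] at h5
  have h6 : σ (φ (x * x + y * y * Δ - Δ) + φ (2 * x * y) * e) = 0 := by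
    simp only [map_add, map_mul, map_sub, map_ofNat]
    linear_combination h1' - σ (φ y) ^ 2 * hsq'
  have h7 := ((h.zero _ _).1 h6).2
  have h2P : (2 : A) ∉ 𝔭 := fun hh => h.prime.ne_top (Ideal.eq_top_of_isUnit_mem _ hh h2)
  have hyP : y ∉ 𝔭 := fun hy => by
    have : (1 : A) ∈ 𝔭 := by
      have h8 := ((h.zero _ _).1 h3).2
      have := 𝔭.sub_mem (Ideal.mul_mem_left _ y hy) h8
      rwa [sub_sub_cancel] at this
    exact h.prime.ne_top ((Ideal.eq_top_iff_one _).2 this)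
  have hx : σ (φ x) = 0 := (h.apply_eq_zero_iff x).2
    (((h.prime.mem_or_mem h7).resolve_right hyP |> h.prime.mem_or_mem).resolve_left h2P)
  rw [hxy, map_add, hx, zero_add, map_mul]
  rcases h.prime.mem_or_mem h5 with h5 | h5
  · left
    have := (h.apply_eq_zero_iff _).2 h5
    rw [map_sub, map_sub, map_one, map_one, sub_eq_zero] at this
    rw [this, one_mul]
  · right
    have := (h.apply_eq_zero_iff _).2 h5
    rw [map_add, map_add, map_one, map_one, add_eq_zero_iff_eq_neg] at this
    rw [this, neg_one_mul]

theorem ringHom_ext {R : Type*} [CommRing R] {f g : S →+* R}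
    (hA : ∀ x, f (σ (φ x)) = g (σ (φ x))) (he : f (σ e) = g (σ e)) : f = g := by
  ext z
  obtain ⟨x, y, rfl⟩ := h.exists_eq z
  simp only [map_add, map_mul, hA, he]

/-- The involution over `A` that changes the sign of `e`. -/
theorem exists_involution : ∃ ι : S →+* S, (∀ x, ι (σ (φ x)) = σ (φ x)) ∧ ι (σ e) = - σ e := by
  choose x y hxy using h.exists_eq
  -- Conjugation is well defined since the kernel of `σ` is `𝔭 + 𝔭 e`, which is stable under
  -- changing the sign of `e`.
  have hwd : ∀ {x y x' y'}, σ (φ x + φ y * e) = σ (φ x' + φ y' * e) →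
      σ (φ x - φ y * e) = σ (φ x' - φ y' * e) := fun {x y x' y'} hh => by
    have h1 : σ (φ (x - x') + φ (y - y') * e) = 0 := by
      rw [← sub_eq_zero, ← map_sub] at hh
      rw [← hh]
      congr 1
      simp only [map_sub]
      ring
    have h2 : σ (φ (x - x') + φ (-(y - y')) * e) = 0 :=
      (h.zero _ _).2 (((h.zero _ _).1 h1).imp id 𝔭.neg_mem)
    rw [← sub_eq_zero, ← map_sub, ← h2]
    congr 1
    simp only [map_sub, map_neg]
    ring
  obtain ⟨Δ, -, hsq⟩ := h.sq
  let ι : S → S := fun z => σ (φ (x z) - φ (y z) * e)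
  have hι : ∀ x y, ι (σ (φ x + φ y * e)) = σ (φ x - φ y * e) := fun x y =>
    hwd (hxy _).symm
  refine ⟨{ toFun := ι, map_one' := ?_, map_mul' := ?_, map_zero' := ?_, map_add' := ?_ }, ?_, ?_⟩
  · simpa using hι 1 0
  · intro z w
    have : z * w = σ (φ (x z * x w + y z * y w * Δ) + φ (x z * y w + y z * x w) * e) := by
      conv_lhs => rw [hxy z, hxy w]
      rw [← map_mul]
      congr 1
      simp only [map_add, map_mul, hsq]
      ring
    rw [this, hι, ← map_mul]
    congr 1
    simp only [map_add, map_mul, hsq]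
    ring
  · simpa using hι 0 0
  · intro z w
    have : z + w = σ (φ (x z + x w) + φ (y z + y w) * e) := by
      conv_lhs => rw [hxy z, hxy w]
      rw [← map_add]
      congr 1
      simp only [map_add]
      ring
    rw [this, hι, ← map_add]
    congr 1
    simp only [map_add]
    ring
  · intro x
    simpa using hι x 0
  · simpa using hι 0 1

end IsSwapChart

end SwapChart

/-! ### Node charts on schemes. -/

section NodalAlong

variable {Y Y' T : Scheme.{u}}

/-- The reduced noetherian scheme `Y` with normalization `ν` has nodes at the generic points of the
closed subset `Z`, and `δ` is the normalization of the preimage of `Z`. -/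
structure IsNodalAlong (ν : Y' ⟶ Y) (Z : Set Y) (δ : T ⟶ Y') : Prop where
  reduced : IsReduced Y
  noetherian : IsLocallyNoetherian Y
  two : ∀ U : Y.Opens, IsUnit (2 : Γ(Y, U))
  normalization : IsNormalization ν
  finite : IsFinite ν
  closed : IsClosed Z
  node : ∀ P, IsGenericIn Z P → IsNode (Y.presheaf.stalk P)
  generic : ∀ Q, IsGenericIn (ν ⁻¹' Z) Q → IsGenericIn Z (ν Q)
  normalizationOf : IsNormalizationOf (ν ⁻¹' Z) δ

/-- A chart for the node of `Y` at `P`. -/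
structure IsNodeChart (ν : Y' ⟶ Y) (δ : T ⟶ Y') (P : Y) (U : Y.Opens) (hP : P ∈ U)
    (e : Γ(Y', ν ⁻¹ᵁ U)) : Prop where
  affine : IsAffineOpen U
  swap : IsSwapChart (ν.app U).hom (δ.app (ν ⁻¹ᵁ U)).hom (primeAt U P hP) e

theorem mem_basicOpen_iff_of_res {X : Scheme.{u}} {U V : X.Opens} (h : V ≤ U) (f : Γ(X, U)) {x : X}
    (hx : x ∈ V) : X.presheaf.map (homOfLE h).op f ∈ primeAt V x hx ↔ f ∈ primeAt U x (h hx) := by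
  rw [mem_primeAt, mem_primeAt, Scheme.basicOpen_res]
  exact not_congr ⟨fun h => h.2, fun h => ⟨hx, h⟩⟩

theorem app_naturality (f : Y' ⟶ Y) {U V : Y.Opens} (h : V ≤ U) (z : Γ(Y, U)) :
    f.app V (Y.presheaf.map (homOfLE h).op z) =
      Y'.presheaf.map (homOfLE (f.preimage_mono h)).op (f.app U z) :=
  congr($(f.naturality (homOfLE h).op) z)

theorem isLocalization_preimage_basicOpen (f : Y' ⟶ Y) {U : Y.Opens} (hU : IsAffineOpen (f ⁻¹ᵁ U))
    (s : Γ(Y, U)) : @IsLocalization.Away _ _ (f.app U s) Γ(Y', f ⁻¹ᵁ Y.basicOpen s) _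
      (Y'.presheaf.map (homOfLE (f.preimage_mono (Y.basicOpen_le s))).op).hom.toAlgebra :=
  hU.isLocalization_of_eq_basicOpen _ (homOfLE (f.preimage_mono (Y.basicOpen_le s)))
    (Scheme.preimage_basicOpen ..)

theorem exists_app_pow_mul_eq_res (f : Y' ⟶ Y) {U : Y.Opens} (hU : IsAffineOpen (f ⁻¹ᵁ U))
    (s : Γ(Y, U)) (z : Γ(Y', f ⁻¹ᵁ Y.basicOpen s)) : ∃ (n : ℕ) (z₀ : Γ(Y', f ⁻¹ᵁ U)),
      Y'.presheaf.map (homOfLE (f.preimage_mono (Y.basicOpen_le s))).op (f.app U (s ^ n)) * z =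
        Y'.presheaf.map (homOfLE (f.preimage_mono (Y.basicOpen_le s))).op z₀ := by
  let := (Y'.presheaf.map (homOfLE (f.preimage_mono (Y.basicOpen_le s))).op).hom.toAlgebra
  have := isLocalization_preimage_basicOpen f hU s
  obtain ⟨⟨z₀, _, n, rfl⟩, h⟩ := IsLocalization.surj (Submonoid.powers (f.app U s)) z
  refine ⟨n, z₀, ?_⟩
  rw [map_pow, mul_comm]
  exact h

theorem exists_app_pow_mul_eq_of_res_eq (f : Y' ⟶ Y) {U : Y.Opens} (hU : IsAffineOpen (f ⁻¹ᵁ U))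
    (s : Γ(Y, U)) {b b' : Γ(Y', f ⁻¹ᵁ U)}
    (h : Y'.presheaf.map (homOfLE (f.preimage_mono (Y.basicOpen_le s))).op b =
      Y'.presheaf.map (homOfLE (f.preimage_mono (Y.basicOpen_le s))).op b') :
    ∃ n : ℕ, f.app U (s ^ n) * b = f.app U (s ^ n) * b' := by
  let := (Y'.presheaf.map (homOfLE (f.preimage_mono (Y.basicOpen_le s))).op).hom.toAlgebra
  have := isLocalization_preimage_basicOpen f hU s
  obtain ⟨⟨_, n, rfl⟩, h⟩ := (IsLocalization.eq_iff_exists (Submonoid.powers (f.app U s)) _).1 h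
  exact ⟨n, by rw [map_pow]; exact h⟩

namespace IsNodalAlong

variable {ν : Y' ⟶ Y} {Z : Set Y} {δ : T ⟶ Y'} (h : IsNodalAlong ν Z δ)

include h

/-- The chart is a basic open set `D(s)` with `s` a product: `f` makes `δ` surjective on functions,
`g` removes the components of `Z` not passing through `P` as generic point, and `Δ * s₁ * s₂`
removes the denominators from the structure of the node. -/
theorem exists_nodeChart {P : Y} (hP : IsGenericIn Z P) {W : Y.Opens} (hW : P ∈ W) :
    ∃ (U : Y.Opens) (hPU : P ∈ U) (e : Γ(Y', ν ⁻¹ᵁ U)), U ≤ W ∧ IsNodeChart ν δ P U hPU e := by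
  have := h.reduced
  have := h.noetherian
  have := h.finite
  have hδ := h.normalizationOf.integral
  obtain ⟨_, ⟨U₀, hU₀, rfl⟩, hP₀, hU₀W⟩ :=
    Y.isBasis_affineOpens.exists_subset_of_mem_open (u := W) hW W.isOpen
  have hU₀ : IsAffineOpen U₀ := hU₀
  have hP₀ : P ∈ U₀ := hP₀
  let := (ν.app U₀).hom.toAlgebra
  have hN := h.normalization.isFiniteNormalization hU₀
  have := hN.noetherian
  have := hN.faithful
  have := hN.finite
  obtain ⟨a, ha, ha', hab⟩ := hN.exists_pow_mem
  obtain ⟨e, Δ, hΔP, hΔ, ⟨s₁, hs₁, h₁⟩, ⟨s₂, hs₂, h₂⟩, h₃⟩ :=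
    exists_sqrt_of_isNode_localization hN.normal (h.two U₀) ha' ha hab (primeAt U₀ P hP₀)
      ((h.node P hP).of_ringEquiv (stalkEquiv hU₀ P hP₀).symm)
  obtain ⟨Ω, hΩ, hΩs⟩ := h.normalizationOf.exists_app_surjective
  -- shrink so that `δ` is surjective on functions
  obtain ⟨f, hf, hPf⟩ : ∃ f : Γ(Y, U₀), (∀ z, ν z ∈ Y.basicOpen f → ν z ∈ Z → z ∈ Ω) ∧
      P ∈ Y.basicOpen f := by
    have hcl : IsClosed (ν '' (ν ⁻¹' Z ∩ (Ω : Set Y')ᶜ)) := ν.isClosedMap _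
      ((h.closed.preimage ν.continuous).inter Ω.isOpen.isClosed_compl)
    have hPcl : P ∈ (ν '' (ν ⁻¹' Z ∩ (Ω : Set Y')ᶜ))ᶜ := by
      rintro ⟨z, ⟨hzZ, hzΩ⟩, rfl⟩
      have := LocallyOfFiniteType.isLocallyNoetherian ν
      exact hzΩ ((isGenericIn_preimage ν hP).mem_of_subset_closure
        (h.closed.preimage ν.continuous) hΩ)
    obtain ⟨f, hf, hPf⟩ := hU₀.exists_basicOpen_le (V := ⟨_, hcl.isOpen_compl⟩) ⟨P, hPcl⟩ hP₀
    exact ⟨f, fun z hz hzZ => by_contra fun hzΩ => hf hz ⟨z, ⟨hzZ, hzΩ⟩, rfl⟩, hPf⟩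
  -- shrink so that `Z` is irreducible
  obtain ⟨g, hg, hgmin⟩ := exists_notMem_forall_mem_minimalPrimes (idealAt Z U₀)
    ((isGenericIn_iff h.closed hU₀ hP₀).1 hP)
  let s := f * g * (Δ * s₁ * s₂)
  let U := Y.basicOpen s
  have hle : U ≤ U₀ := Y.basicOpen_le s
  have hmulP : ∀ {x y : Γ(Y, U₀)}, x ∉ primeAt U₀ P hP₀ → y ∉ primeAt U₀ P hP₀ →
    x * y ∉ primeAt U₀ P hP₀ := fun hx hy => (primeAt U₀ P hP₀).primeCompl.mul_mem hx hy
  have hPU : P ∈ U := notMem_primeAt.1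
    (hmulP (hmulP (notMem_primeAt.2 hPf) hg) (hmulP (hmulP hΔP hs₁) hs₂))
  have hU : IsAffineOpen U := hU₀.basicOpen s
  have hUf : U ≤ Y.basicOpen f := by
    refine ((Scheme.basicOpen_mul ..).trans_le inf_le_left).trans
      ((Scheme.basicOpen_mul ..).trans_le ?_)
    exact inf_le_left
  have hUg : U ≤ Y.basicOpen g := by
    refine ((Scheme.basicOpen_mul ..).trans_le inf_le_left).trans
      ((Scheme.basicOpen_mul ..).trans_le ?_)
    exact inf_le_right
  have hle' : ν ⁻¹ᵁ U ≤ ν ⁻¹ᵁ U₀ := ν.preimage_mono hle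
  let α := (Y.presheaf.map (homOfLE hle).op).hom
  let β := (Y'.presheaf.map (homOfLE hle').op).hom
  have hcomm : ∀ z, β (ν.app U₀ z) = ν.app U (α z) := fun z => (app_naturality ν hle z).symm
  have hbo : ν ⁻¹ᵁ U = Y'.basicOpen (ν.app U₀ s) := Scheme.preimage_basicOpen ..
  have hZU : ∀ z ∈ Z, z ∈ U → P ⤳ z := fun z hz hzU => by
    obtain ⟨z', hz', hzz'⟩ := exists_isGenericIn h.closed hz
    have hz'U := mem_of_specializes hzz' hzU
    have hz'₀ := hle hz'U
    suffices z' = P from this ▸ hzz'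
    refine primeAt_injective hU₀ hz'₀ hP₀ (by_contra fun hne => ?_)
    exact notMem_primeAt.2 (hUg hz'U) (hgmin _ ((isGenericIn_iff h.closed hU₀ hz'₀).1 hz') hne)
  have hzero : ∀ b, δ.app (ν ⁻¹ᵁ U) b = 0 ↔ ∀ z, ν z ∈ Z → z ∉ Y'.basicOpen b := fun b =>
    (h.normalizationOf.app_eq_zero_iff b).trans mem_idealAt
  have hσ𝔭 : ∀ x, δ.app (ν ⁻¹ᵁ U) (ν.app U x) = 0 ↔ x ∈ primeAt U P hPU := fun x => by
    rw [hzero, mem_primeAt]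
    have hbx : ∀ z, z ∈ Y'.basicOpen (ν.app U x) ↔ ν z ∈ Y.basicOpen x := fun z => by
      rw [← Scheme.preimage_basicOpen]; rfl
    simp only [hbx]
    constructor
    · intro hz hPx
      obtain ⟨z, rfl⟩ := h.normalization.surjective P
      exact hz z hP.1 hPx
    · intro hPx z hz hzx
      exact hPx (mem_of_specializes (hZU _ hz (Y.basicOpen_le x hzx)) hzx)
  refine ⟨U, hPU, β e, hle.trans hU₀W, hU, ?_⟩
  refine isSwapChart_of_localization (φ₀ := (ν.app U₀).hom) (φ := (ν.app U).hom) (α := α) (β := β)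
    (𝔭₀ := primeAt U₀ P hP₀) (s := s) (Δ := Δ) (s₁ := s₁) (s₂ := s₂) hcomm
    (h.normalization.app_injective U) ?_ ?_ ?_ ?_ (h.two U) (fun a => ?_) hΔ h₁ h₂ h₃
    (Dvd.intro_left _ rfl) ?_ hσ𝔭 ?_
  · intro z
    obtain ⟨n, y, hy⟩ := exists_eq_pow_mul_of_isAffineOpen Y U₀ hU₀ s z
    refine ⟨n, y, ?_⟩
    rw [map_pow]
    exact hy.symm
  · exact exists_app_pow_mul_eq_res ν (hU₀.preimage ν) s
  · exact RingedSpace.isUnit_res_basicOpen _ s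
  · intro b b' hbb
    exact exists_app_pow_mul_eq_of_res_eq ν (hU₀.preimage ν) s hbb
  · exact mem_basicOpen_iff_of_res hle a hPU
  · refine hΩs _ (hU.preimage ν) ?_
    rintro z ⟨hz, hzZ⟩
    exact hf z (hUf hz) hzZ
  · intro b hb
    -- A function killed by `δ` vanishes on the preimage of `Z`. Every prime containing the image of
    -- `𝔭` belongs to a point of this preimage, so `b` lies in the radical.
    have hb' : b ∈ (Ideal.map (ν.app U).hom (primeAt U P hPU)).radical := by
      rw [Ideal.radical_eq_sInf, Ideal.mem_sInf]
      rintro q ⟨hq, hqp⟩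
      obtain ⟨z, hz, rfl⟩ := exists_primeAt_eq (hU.preimage ν) q
      rw [mem_primeAt]
      refine (hzero b).1 hb z ?_
      rw [Ideal.map_le_iff_le_comap, comap_app_primeAt ν hz] at hq
      exact ((specializes_iff_primeAt_le hU _ _).2 hq).mem_closed h.closed hP.1
    exact hb'

end IsNodalAlong

end NodalAlong

/-! ### Comparing morphisms near generic points. -/

section Tools

/-- The test morphisms `v` together form a dominant morphism to the reduced scheme `X`, and `π` is
separated. -/
theorem hom_ext_of_forall_isGenericIn {X T Y : Scheme.{u}} [IsReduced X] (π : T ⟶ Y) [IsSeparated π]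
    {f g : X ⟶ T} (hfg : f ≫ π = g ≫ π) (h : ∀ x, IsGenericIn Set.univ x →
      ∃ (V : Scheme.{u}) (v : V ⟶ X), x ∈ Set.range v ∧ v ≫ f = v ≫ g) : f = g := by
  choose V v hv hvfg using h
  let w : (∐ fun x : {x : X // IsGenericIn Set.univ x} => V x.1 x.2) ⟶ X :=
    Sigma.desc fun x => v x.1 x.2
  have : IsDominant w := ⟨dense_of_forall_isGenericIn fun x hx => by
    obtain ⟨y, hy⟩ := hv x hx
    refine ⟨Sigma.ι (fun x : {x : X // IsGenericIn Set.univ x} => V x.1 x.2) ⟨x, hx⟩ y, ?_⟩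
    rw [← Scheme.Hom.comp_apply, Sigma.ι_desc]
    exact hy⟩
  refine ext_of_isDominant_of_isSeparated π hfg w (Sigma.hom_ext _ _ fun x => ?_)
  rw [Sigma.ι_desc_assoc, Sigma.ι_desc_assoc, hvfg]

variable {X T : Scheme.{u}}

theorem appLE_eq_of_ι_comp_eq {f g : X ⟶ T} {O W : X.Opens} (h : O.ι ≫ f = O.ι ≫ g) (hW : W ≤ O)
    {V : T.Opens} (hf : W ≤ f ⁻¹ᵁ V) (hg : W ≤ g ⁻¹ᵁ V) : f.appLE V W hf = g.appLE V W hg := by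
  have h1 : W.ι ≫ f = W.ι ≫ g := by
    rw [← Scheme.homOfLE_ι _ hW, Category.assoc, Category.assoc, h]
  have key : ∀ (k : X ⟶ T) (hk : W ≤ k ⁻¹ᵁ V) (e : ⊤ ≤ (W.ι ≫ k) ⁻¹ᵁ V),
      k.appLE V W hk = (W.ι ≫ k).appLE V ⊤ e ≫ W.topIso.hom := fun k hk e => by
    have e' : (⊤ : W.toScheme.Opens) ≤ W.ι ⁻¹ᵁ W := by simp
    have h2 : W.ι.appLE W ⊤ e' ≫ W.topIso.hom = 𝟙 _ := by
      rw [Scheme.Opens.ι_appLE]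
      exact (X.presheaf.map_comp _ _).symm.trans (X.presheaf.map_id _)
    rw [← Scheme.Hom.appLE_comp_appLE W.ι k V W ⊤ hk e', Category.assoc, h2, Category.comp_id]
  have e : ∀ (k : X ⟶ T) (hk : W ≤ k ⁻¹ᵁ V), ⊤ ≤ (W.ι ≫ k) ⁻¹ᵁ V := fun k hk x _ => hk x.2
  rw [key f hf (e f hf), key g hg (e g hg)]
  simp only [h1]

theorem fromSpec_comp_eq_of_appLE_eq {f g : X ⟶ T} {V : T.Opens} (hV : IsAffineOpen V)
    {W : X.Opens} (hW : IsAffineOpen W) (hf : W ≤ f ⁻¹ᵁ V) (hg : W ≤ g ⁻¹ᵁ V)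
    (h : f.appLE V W hf = g.appLE V W hg) : hW.fromSpec ≫ f = hW.fromSpec ≫ g := by
  rw [← hV.SpecMap_appLE_fromSpec f hW hf, h, hV.SpecMap_appLE_fromSpec g hW hg]

theorem ι_comp_eq_of_fromSpec_comp_eq {f g : X ⟶ T} {W : X.Opens} (hW : IsAffineOpen W)
    (h : hW.fromSpec ≫ f = hW.fromSpec ≫ g) : W.ι ≫ f = W.ι ≫ g := by
  rw [← hW.isoSpec_hom_fromSpec, Category.assoc, h, Category.assoc]

end Tools

/-! ### Existence and uniqueness of the swap of branches. -/

section Swap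

variable {Y Y' T : Scheme.{u}}

/-- An involution of `T` over `Y` that is not the identity over any open subset of `Y` meeting
`Z`. -/
structure IsSwap (π : T ⟶ Y) (Z : Set Y) (ι : T ⟶ T) : Prop where
  involution : ι ≫ ι = 𝟙 T
  comp_eq : ι ≫ π = π
  ne : ∀ U : Y.Opens, (U ∩ Z : Set Y).Nonempty → (π ⁻¹ᵁ U).ι ≫ ι ≠ (π ⁻¹ᵁ U).ι

variable {ν : Y' ⟶ Y} {Z : Set Y} {δ : T ⟶ Y'}

theorem preimage_le_of_over {ι : T ⟶ T} (hι : ι ≫ δ ≫ ν = δ ≫ ν) (U : Y.Opens) :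
    δ ⁻¹ᵁ ν ⁻¹ᵁ U ≤ ι ⁻¹ᵁ δ ⁻¹ᵁ ν ⁻¹ᵁ U := by
  have h : (ι ≫ δ ≫ ν) ⁻¹ᵁ U = (δ ≫ ν) ⁻¹ᵁ U := by rw [hι]
  exact h.ge

theorem app_comp_app_eq_appLE (ν : Y' ⟶ Y) (δ : T ⟶ Y') (U : Y.Opens)
    (h : δ ⁻¹ᵁ ν ⁻¹ᵁ U ≤ (δ ≫ ν) ⁻¹ᵁ U) :
    ν.app U ≫ δ.app (ν ⁻¹ᵁ U) = (δ ≫ ν).appLE U (δ ⁻¹ᵁ ν ⁻¹ᵁ U) h := by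
  rw [Scheme.Hom.app_eq_appLE, Scheme.Hom.app_eq_appLE, Scheme.Hom.appLE_comp_appLE]

theorem appLE_app_app_of_over {ι : T ⟶ T} (hι : ι ≫ δ ≫ ν = δ ≫ ν) (U : Y.Opens) (x : Γ(Y, U)) :
    ι.appLE (δ ⁻¹ᵁ ν ⁻¹ᵁ U) (δ ⁻¹ᵁ ν ⁻¹ᵁ U) (preimage_le_of_over hι U) (δ.app _ (ν.app U x)) =
      δ.app _ (ν.app U x) := by
  have h1 : ν.app U ≫ δ.app (ν ⁻¹ᵁ U) ≫ ι.appLE (δ ⁻¹ᵁ ν ⁻¹ᵁ U) (δ ⁻¹ᵁ ν ⁻¹ᵁ U)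
      (preimage_le_of_over hι U) = ν.app U ≫ δ.app (ν ⁻¹ᵁ U) := by
    have hle : δ ⁻¹ᵁ ν ⁻¹ᵁ U ≤ (δ ≫ ν) ⁻¹ᵁ U := le_rfl
    rw [← Category.assoc, app_comp_app_eq_appLE ν δ U hle, Scheme.Hom.appLE_comp_appLE]
    simp only [hι]
  exact congr($h1 x)

namespace IsNodeChart

variable {P : Y} {U : Y.Opens} {hP : P ∈ U} {e : Γ(Y', ν ⁻¹ᵁ U)} (h : IsNodeChart ν δ P U hP e)

include h

/-- Functions in `𝔭` pull back to zero on `T`, so over the chart `T` lives over the closure of `P`.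
-/
theorem specializes {t : T} (ht : ν (δ t) ∈ U) : P ⤳ ν (δ t) := by
  rw [specializes_iff_primeAt_le h.affine ht hP]
  intro x hx
  have h1 : δ.app (ν ⁻¹ᵁ U) (ν.app U x) = 0 := (h.swap.apply_eq_zero_iff x).2 hx
  rw [mem_primeAt]
  intro h2
  have h3 : t ∈ T.basicOpen (δ.app (ν ⁻¹ᵁ U) (ν.app U x)) := by
    rw [← Scheme.preimage_basicOpen, ← Scheme.preimage_basicOpen]
    exact h2
  rw [h1, Scheme.basicOpen_zero] at h3
  exact h3

/-- The alternative in `IsSwapChart.eq_or_eq_neg` is that `e` is fixed; then `ι` is the identity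
over the chart, which `IsSwap.ne` forbids. -/
theorem appLE_eq_neg (h2 : IsUnit (2 : Γ(Y, U))) (hPZ : P ∈ Z) {ι : T ⟶ T}
    (hι : IsSwap (δ ≫ ν) Z ι) (hδ : IsAffineOpen (δ ⁻¹ᵁ ν ⁻¹ᵁ U)) :
    ι.appLE (δ ⁻¹ᵁ ν ⁻¹ᵁ U) (δ ⁻¹ᵁ ν ⁻¹ᵁ U) (preimage_le_of_over hι.comp_eq U) (δ.app _ e) =
      - δ.app _ e := by
  have hle := preimage_le_of_over hι.comp_eq U
  have h1 : ι.appLE _ _ hle ≫ ι.appLE _ _ hle = 𝟙 _ := by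
    rw [Scheme.Hom.appLE_comp_appLE]
    simp only [hι.involution]
    exact (𝟙 T : T ⟶ T).appLE_eq_app.trans (by simp; rfl)
  refine (h.swap.eq_or_eq_neg h2 (ι.appLE _ _ hle).hom (appLE_app_app_of_over hι.comp_eq U)
    fun z => congr($h1 z)).resolve_left fun h3 => hι.ne U ⟨P, hP, hPZ⟩ ?_
  have h4 : ι.appLE (δ ⁻¹ᵁ ν ⁻¹ᵁ U) (δ ⁻¹ᵁ ν ⁻¹ᵁ U) hle = (𝟙 T : T ⟶ T).appLE _ _ le_rfl := by
    refine CommRingCat.hom_ext (h.swap.ringHom_ext (fun x => ?_) ?_)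
    · refine (appLE_app_app_of_over hι.comp_eq U x).trans ?_
      rw [(𝟙 T : T ⟶ T).appLE_eq_app]; simp
    · refine h3.trans ?_
      rw [(𝟙 T : T ⟶ T).appLE_eq_app]; simp
  have h5 := ι_comp_eq_of_fromSpec_comp_eq hδ (fromSpec_comp_eq_of_appLE_eq hδ hδ _ _ h4)
  rw [Category.comp_id] at h5
  exact h5

end IsNodeChart

namespace IsNodalAlong

variable (h : IsNodalAlong ν Z δ)

include h

theorem isReduced : IsReduced T := h.normalizationOf.normal.isReduced

theorem isAffineOpen_preimage {U : Y.Opens} (hU : IsAffineOpen U) :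
    IsAffineOpen (δ ⁻¹ᵁ ν ⁻¹ᵁ U) := by
  have := h.normalizationOf.integral
  have := h.finite
  exact (hU.preimage ν).preimage δ

theorem isGenericIn_apply {t : T} (ht : IsGenericIn Set.univ t) : IsGenericIn Z (ν (δ t)) :=
  h.generic _ (h.normalizationOf.isGenericIn ht)

theorem exists_apply_eq {P : Y} (hP : P ∈ Z) : ∃ t, ν (δ t) = P := by
  obtain ⟨z, rfl⟩ := h.normalization.surjective P
  obtain ⟨t, rfl⟩ : z ∈ Set.range δ := h.normalizationOf.range_eq.symm ▸ hP
  exact ⟨t, rfl⟩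

/-- On a chart both involutions fix the functions from `Y` and negate `e`, and the charts reach
every generic point of `T`. -/
theorem swap_unique {ι ι' : T ⟶ T} (hι : IsSwap (δ ≫ ν) Z ι) (hι' : IsSwap (δ ≫ ν) Z ι') :
    ι = ι' := by
  have := h.isReduced
  have := h.finite
  have := h.normalizationOf.integral
  refine hom_ext_of_forall_isGenericIn (δ ≫ ν) (hι.comp_eq.trans hι'.comp_eq.symm) fun t ht => ?_
  have hP := h.isGenericIn_apply ht
  obtain ⟨U, hPU, e, -, hc⟩ := h.exists_nodeChart hP (W := ⊤) trivial
  have hW := h.isAffineOpen_preimage hc.affine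
  refine ⟨_, hW.fromSpec, ?_, fromSpec_comp_eq_of_appLE_eq hW hW (preimage_le_of_over hι.comp_eq U)
    (preimage_le_of_over hι'.comp_eq U)
    (CommRingCat.hom_ext (hc.swap.ringHom_ext (fun x => ?_) ?_))⟩
  · rw [hW.range_fromSpec]
    exact hPU
  · exact (appLE_app_app_of_over hι.comp_eq U x).trans (appLE_app_app_of_over hι'.comp_eq U x).symm
  · exact (hc.appLE_eq_neg (h.two U) hP.1 hι hW).trans (hc.appLE_eq_neg (h.two U) hP.1 hι' hW).symm

/-- Take one chart for each generic point of `Z`; the sign changes of `e` on these disjoint charts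
define an involution of a dense open subset of `T`, which extends because `T` is normal and integral
over `Y`. -/
theorem exists_swap : ∃ ι : T ⟶ T, IsSwap (δ ≫ ν) Z ι := by
  have := h.isReduced
  have := h.finite
  have := h.normalizationOf.integral
  have := h.normalizationOf.noetherian
  choose U hPU e _ hc using fun P : {P : Y // IsGenericIn Z P} =>
    h.exists_nodeChart P.2 (W := ⊤) trivial
  choose σ hσ hσe using fun P => (hc P).swap.exists_involution
  have hW := fun P => h.isAffineOpen_preimage (hc P).affine
  let w : (∐ fun P : {P : Y // IsGenericIn Z P} => Spec Γ(T, δ ⁻¹ᵁ ν ⁻¹ᵁ U P)) ⟶ T :=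
    Sigma.desc fun P => (hW P).fromSpec
  let g : (∐ fun P : {P : Y // IsGenericIn Z P} => Spec Γ(T, δ ⁻¹ᵁ ν ⁻¹ᵁ U P)) ⟶ T :=
    Sigma.desc fun P => Spec.map (CommRingCat.ofHom (σ P)) ≫ (hW P).fromSpec
  have hrange : ∀ P, Set.range (hW P).fromSpec = (δ ⁻¹ᵁ ν ⁻¹ᵁ U P : T.Opens) := fun P =>
    (hW P).range_fromSpec
  have hw : IsOpenImmersion w := by
    -- Charts at different generic points do not meet in `T`: a common point specializes from `P`,
    -- so `P` lies in the chart of `Q`, hence `Q` specializes to `P`, and then `Q = P`.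
    refine isOpenImmersion_sigmaDesc _ _ fun P Q hPQ => ?_
    simp only [Function.onFun, hrange]
    refine Set.disjoint_left.2 fun t htP htQ => hPQ (Subtype.ext ?_)
    have hPt := (hc P).specializes htP
    have hPQ : P.1 ∈ U Q := mem_of_specializes hPt htQ
    obtain ⟨t', ht'⟩ := h.exists_apply_eq P.2.1
    have hQP := (hc Q).specializes (t := t') (ht' ▸ hPQ)
    rw [ht'] at hQP
    exact (P.2.2 _ Q.2.1 hQP).symm
  have hmem : ∀ t : T, IsGenericIn Set.univ t → ∃ P, t ∈ δ ⁻¹ᵁ ν ⁻¹ᵁ U P := fun t ht =>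
    ⟨⟨_, h.isGenericIn_apply ht⟩, hPU _⟩
  have hdom : IsDominant w := ⟨dense_of_forall_isGenericIn fun t ht => by
    obtain ⟨P, hP⟩ := hmem t ht
    obtain ⟨y, hy⟩ : t ∈ Set.range (hW P).fromSpec := by rw [hrange]; exact hP
    refine ⟨Sigma.ι (fun P => Spec Γ(T, δ ⁻¹ᵁ ν ⁻¹ᵁ U P)) P y, ?_⟩
    rw [← Scheme.Hom.comp_apply, Sigma.ι_desc]
    exact hy⟩
  obtain ⟨ι, hι, hιπ⟩ := exists_extension h.normalizationOf.normal w (δ ≫ ν) (δ ≫ ν) g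
    (Sigma.hom_ext _ _ fun P => by
      simp only [w, g, Sigma.ι_desc_assoc, Category.assoc]
      have hle : δ ⁻¹ᵁ ν ⁻¹ᵁ U P ≤ (δ ≫ ν) ⁻¹ᵁ U P := le_rfl
      rw [← (hc P).affine.SpecMap_appLE_fromSpec (δ ≫ ν) (hW P) hle, ← Spec.map_comp_assoc]
      congr 2
      refine CommRingCat.hom_ext (RingHom.ext fun x => ?_)
      have h1 : (δ ≫ ν).appLE (U P) _ hle = ν.app (U P) ≫ δ.app _ :=
        (app_comp_app_eq_appLE ν δ (U P) hle).symm
      rw [h1]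
      exact hσ P x)
  have hιP : ∀ P, (hW P).fromSpec ≫ ι = Spec.map (CommRingCat.ofHom (σ P)) ≫ (hW P).fromSpec :=
    fun P => by
      have := congr(Sigma.ι (fun P => Spec Γ(T, δ ⁻¹ᵁ ν ⁻¹ᵁ U P)) P ≫ $hι)
      simpa only [w, g, Sigma.ι_desc_assoc, Sigma.ι_desc] using this
  refine ⟨ι, ?_, hιπ, ?_⟩
  · refine hom_ext_of_forall_isGenericIn (δ ≫ ν)
      (by simp only [Category.assoc, hιπ, Category.id_comp])
      fun t ht => ?_
    obtain ⟨P, hP⟩ := hmem t ht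
    refine ⟨_, (hW P).fromSpec, by rw [hrange]; exact hP, ?_⟩
    rw [Category.comp_id, reassoc_of% (hιP P), hιP P, ← Spec.map_comp_assoc]
    have hσσ : CommRingCat.ofHom (σ P) ≫ CommRingCat.ofHom (σ P) = 𝟙 _ := by
      refine CommRingCat.hom_ext ((hc P).swap.ringHom_ext (fun x => ?_) ?_)
      · exact (congrArg (σ P) (hσ P x)).trans (hσ P x)
      · exact (congrArg (σ P) (hσe P)).trans ((map_neg (σ P) _).trans (by rw [hσe P, neg_neg]; rfl))
    rw [hσσ, Spec.map_id, Category.id_comp]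
  -- If the involution were trivial over `O`, then `e = -e` on a nonempty open set, although `2` and
  -- `e` are units there.
  · rintro O ⟨x, hxO, hxZ⟩ hcon
    obtain ⟨P, hP, hPx⟩ := exists_isGenericIn h.closed hxZ
    have hPO := mem_of_specializes hPx hxO
    obtain ⟨t, rfl⟩ := h.exists_apply_eq hP.1
    let P' : {P : Y // IsGenericIn Z P} := ⟨_, hP⟩
    let W := δ ⁻¹ᵁ ν ⁻¹ᵁ U P'
    let W' := W ⊓ (δ ≫ ν) ⁻¹ᵁ O
    have hle : W ≤ ι ⁻¹ᵁ W := preimage_le_of_over hιπ _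
    have hιe : ι.appLE W W hle (δ.app _ (e P')) = - δ.app _ (e P') := by
      have h1 : ι.appLE W W hle = CommRingCat.ofHom (σ P') := by
        refine Spec.map_injective ?_
        rw [← cancel_mono (hW P').fromSpec,
          IsAffineOpen.SpecMap_appLE_fromSpec ι (hW P') (hW P') hle, hιP]
      rw [h1]
      exact hσe P'
    have h2 : ι.appLE W W' (inf_le_left.trans hle) = (𝟙 T : T ⟶ T).appLE W W' inf_le_left :=
      appLE_eq_of_ι_comp_eq (O := (δ ≫ ν) ⁻¹ᵁ O) (by rw [hcon, Category.comp_id]) inf_le_right _ _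
    have h3 : T.presheaf.map (homOfLE (inf_le_left : W' ≤ W)).op (δ.app _ (e P')) =
        - T.presheaf.map (homOfLE (inf_le_left : W' ≤ W)).op (δ.app _ (e P')) := by
      have h4 := congrArg (T.presheaf.map (homOfLE (inf_le_left : W' ≤ W)).op) hιe
      rw [map_neg] at h4
      have h5 : ι.appLE W W hle ≫ T.presheaf.map (homOfLE (inf_le_left : W' ≤ W)).op =
          T.presheaf.map (homOfLE (inf_le_left : W' ≤ W)).op := by
        rw [Scheme.Hom.appLE_map]
        exact h2.trans (by simp [Scheme.Hom.appLE]; exact Category.id_comp _)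
      exact congr($h5 (δ.app _ (e P'))).symm.trans h4
    have h5 : IsUnit (T.presheaf.map (homOfLE (inf_le_left : W' ≤ W)).op (δ.app _ (e P'))) :=
      (hc P').swap.isUnit.map (T.presheaf.map (homOfLE (inf_le_left : W' ≤ W)).op).hom
    have h6 : IsUnit (2 : Γ(T, W')) := by
      have h7 := (((h.two (U P')).map (ν.app _).hom).map (δ.app _).hom).map
        (T.presheaf.map (homOfLE (inf_le_left : W' ≤ W)).op).hom
      simpa only [map_ofNat] using h7
    have h8 : (0 : Γ(T, W')) = 1 := by
      obtain ⟨y, hy⟩ := (h6.mul h5).exists_right_inv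
      rw [← hy, two_mul, eq_neg_iff_add_eq_zero.1 h3, zero_mul]
    have h9 : t ∈ T.basicOpen (1 : Γ(T, W')) := by
      rw [Scheme.basicOpen_of_isUnit _ isUnit_one]
      exact ⟨hPU P', hPO⟩
    rw [← h8, Scheme.basicOpen_zero] at h9
    exact h9

end IsNodalAlong

end Swap

/-! ### Descent of invariant functions. -/

section Descent

variable {X T : Scheme.{u}} (p : T ⟶ X)

theorem app_injective_of_surjective [IsReduced X] (hp : Function.Surjective p) (V : X.Opens) :
    Function.Injective (p.app V) := by
  refine (injective_iff_map_eq_zero (p.app V).hom).2 fun f hf => ?_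
  refine eq_zero_of_basicOpen_eq_bot f (le_bot_iff.1 fun x hx => ?_)
  obtain ⟨t, rfl⟩ := hp x
  have h1 : t ∈ T.basicOpen (p.app V f) := by
    rw [← Scheme.preimage_basicOpen]
    exact hx
  have h2 : p.app V f = 0 := hf
  rw [h2, Scheme.basicOpen_zero] at h1
  exact h1

theorem exists_app_eq_of_locally (hp : ∀ V, Function.Injective (p.app V)) {V : X.Opens}
    (s : Γ(T, p ⁻¹ᵁ V)) (h : ∀ z ∈ V, ∃ (V' : X.Opens) (hV' : V' ≤ V), z ∈ V' ∧
      ∃ t, p.app V' t = T.presheaf.map (homOfLE (p.preimage_mono hV')).op s) :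
    ∃ t, p.app V t = s := by
  choose U hU hzU t ht using fun z : V => h z.1 z.2
  have hcov : V ≤ iSup U := fun z hz => Opens.mem_iSup.2 ⟨⟨z, hz⟩, hzU _⟩
  have hcomp : TopCat.Presheaf.IsCompatible X.sheaf.1 U t := fun i j => by
    refine hp _ ?_
    have h1 : ∀ (k : V) (hk : U i ⊓ U j ≤ U k), p.app (U i ⊓ U j) (X.presheaf.map (homOfLE hk).op
        (t k)) = T.presheaf.map (homOfLE (p.preimage_mono (hk.trans (hU k)))).op s := fun k hk => by
      rw [app_naturality, ht, ← CommRingCat.comp_apply, ← Functor.map_comp]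
      rfl
    exact (h1 i inf_le_left).trans (h1 j inf_le_right).symm
  obtain ⟨g, hg, -⟩ := X.sheaf.existsUnique_gluing' U V (fun i => homOfLE (hU i)) hcov t hcomp
  refine ⟨g, T.sheaf.eq_of_locally_eq' (fun i => p ⁻¹ᵁ U i) _
    (fun i => homOfLE (p.preimage_mono (hU i))) (fun z hz => ?_) _ _ fun i => ?_⟩
  · obtain ⟨i, hi⟩ := Opens.mem_iSup.1 (hcov hz)
    exact Opens.mem_iSup.2 ⟨i, hi⟩
  · refine (app_naturality p (hU i) g).symm.trans ?_
    exact (congrArg (p.app (U i)) (hg i)).trans (ht i)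

theorem exists_lift_reducedSubscheme [IsReduced T] [QuasiCompact p] {Z : Closeds X}
    (h : ∀ t, p t ∈ Z) : ∃ q : T ⟶ reducedSubscheme Z, q ≫ reducedSubschemeι Z = p := by
  have hle : (reducedSubschemeι Z).ker ≤ p.ker := by
    refine fun U => ?_
    rw [Scheme.Hom.ker_apply, Scheme.Hom.ker_apply]
    intro f hf
    have h1 := (reducedSubschemeι_app_eq_zero_iff Z U.2 f).1 hf
    rw [mem_idealAt] at h1
    refine eq_zero_of_basicOpen_eq_bot _ (le_bot_iff.1 fun t ht => ?_)
    have h2 : t ∈ p ⁻¹ᵁ X.basicOpen f := by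
      rw [Scheme.preimage_basicOpen]
      exact ht
    exact h1 _ (h t) h2
  exact ⟨IsClosedImmersion.lift _ p hle, IsClosedImmersion.lift_fac _ p hle⟩

end Descent

/-- After inverting `f ∉ 𝔭`, the invariant elements come from `A`. -/
theorem IsSwapChart.exists_apply_eq_of_invariant {A B S : Type*} [CommRing A] [CommRing B]
    [CommRing S] {φ : A →+* B} {σ : B →+* S} {𝔭 : Ideal A} {e : B} (h : IsSwapChart φ σ 𝔭 e)
    (h2 : IsUnit (2 : A)) (ι : S →+* S) (hι : ∀ x, ι (σ (φ x)) = σ (φ x)) (hιe : ι (σ e) = - σ e)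
    {A' S' : Type*} [CommRing A'] [CommRing S'] (α : A →+* A') (ψ : A' →+* S') (τ : S →+* S')
    (hτ : ∀ x, τ (σ (φ x)) = ψ (α x)) {f : A} (hf : f ∉ 𝔭) (hu : IsUnit (α f)) (ι' : S' →+* S')
    (hι' : ∀ z, ι' (τ z) = τ (ι z)) (hsurj : ∀ s, ∃ (n : ℕ) (r : S), τ (σ (φ (f ^ n))) * s = τ r)
    (hinj : ∀ r r', τ r = τ r' → ∃ n : ℕ, σ (φ (f ^ n)) * r = σ (φ (f ^ n)) * r') (s : S')
    (hs : ι' s = s) : ∃ x, ψ x = s := by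
  have := h.prime
  obtain ⟨n, r, hr⟩ := hsurj s
  obtain ⟨x, y, rfl⟩ := h.exists_eq r
  obtain ⟨m, hm⟩ := hinj (ι (σ (φ x + φ y * e))) (σ (φ x + φ y * e)) (by
    rw [← hι', ← hr, map_mul, hs, hι', hι])
  -- Invariance of `x + y e` after multiplication by a power of `f` says `2 f ^ m y ∈ 𝔭`.
  have hy : y ∈ 𝔭 := by
    have h3 : σ (φ 0 + φ (f ^ m * 2 * y) * e) = 0 := by
      simp only [map_add, map_mul, hι, hιe, map_ofNat, map_zero] at hm ⊢
      linear_combination -hm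
    have h4 := ((h.zero _ _).1 h3).2
    refine (this.mem_or_mem h4).resolve_left fun h5 => ?_
    rcases this.mem_or_mem h5 with h5 | h5
    · exact hf (this.mem_of_pow_mem _ h5)
    · exact this.ne_top (Ideal.eq_top_of_isUnit_mem _ h5 h2)
  have hrx : σ (φ x + φ y * e) = σ (φ x) := by
    have h4 := (h.zero 0 y).2 ⟨Ideal.zero_mem _, hy⟩
    rw [map_zero, zero_add] at h4
    rw [map_add, h4, add_zero]
  obtain ⟨w, hw⟩ := hu.exists_right_inv
  refine ⟨w ^ n * α x, ?_⟩
  rw [hrx, hτ, hτ] at hr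
  have h5 := congrArg ψ hw
  simp only [map_mul, map_pow, map_one] at hr h5 ⊢
  rw [← hr, ← mul_assoc, ← mul_pow, mul_comm (ψ w), h5, one_pow, one_mul]

namespace IsNodeChart

variable {Y Y' T : Scheme.{u}} {ν : Y' ⟶ Y} {δ : T ⟶ Y'} {P : Y} {U : Y.Opens} {hP : P ∈ U}
  {e : Γ(Y', ν ⁻¹ᵁ U)} (h : IsNodeChart ν δ P U hP e)

include h

/-- The invariant functions come from `Y`. -/
theorem exists_app_app_eq (h2 : IsUnit (2 : Γ(Y, U))) (hT : IsAffineOpen (δ ⁻¹ᵁ ν ⁻¹ᵁ U))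
    {ι : T ⟶ T} (hι : ι ≫ δ ≫ ν = δ ≫ ν) (hιe : ι.appLE (δ ⁻¹ᵁ ν ⁻¹ᵁ U) (δ ⁻¹ᵁ ν ⁻¹ᵁ U)
      (preimage_le_of_over hι U) (δ.app _ e) = - δ.app _ e) (f : Γ(Y, U)) (hPf : P ∈ Y.basicOpen f)
    (s : Γ(T, δ ⁻¹ᵁ ν ⁻¹ᵁ Y.basicOpen f))
    (hs : ι.appLE _ _ (preimage_le_of_over hι (Y.basicOpen f)) s = s) :
    ∃ x, δ.app _ (ν.app (Y.basicOpen f) x) = s := by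
  let D := Y.basicOpen f
  have hle : D ≤ U := Y.basicOpen_le f
  let res := T.presheaf.map (homOfLE ((δ ≫ ν).preimage_mono hle)).op
  have happ : ∀ V : Y.Opens, ∀ x, (δ ≫ ν).app V x = δ.app _ (ν.app V x) := fun V x => by
    rw [Scheme.Hom.comp_app]; rfl
  refine h.swap.exists_apply_eq_of_invariant h2
    (ι.appLE _ _ (preimage_le_of_over hι U)).hom (appLE_app_app_of_over hι U) hιe
    (Y.presheaf.map (homOfLE hle).op).hom ((δ.app _).hom.comp (ν.app D).hom) res.hom
    (fun z => ?_) (notMem_primeAt.2 hPf) (RingedSpace.isUnit_res_basicOpen _ f)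
    (ι.appLE _ _ (preimage_le_of_over hι D)).hom (fun z => ?_) (fun z => ?_)
    (fun r r' hr => ?_) s hs
  · refine Eq.trans ?_ ((app_naturality (δ ≫ ν) hle z).symm.trans (happ D _))
    exact congrArg _ (happ U z).symm
  · have h1 : res ≫ ι.appLE _ _ (preimage_le_of_over hι D) =
        ι.appLE _ _ (preimage_le_of_over hι U) ≫ res :=
      (Scheme.Hom.map_appLE ..).trans (Scheme.Hom.appLE_map ..).symm
    exact congr($h1 z)
  · obtain ⟨n, r, hr⟩ := exists_app_pow_mul_eq_res (δ ≫ ν) hT f z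
    rw [happ] at hr
    exact ⟨n, r, hr⟩
  · obtain ⟨n, hn⟩ := exists_app_pow_mul_eq_of_res_eq (δ ≫ ν) hT f hr
    rw [happ] at hn
    exact ⟨n, hn⟩

end IsNodeChart

/-! ### Branch involutions are the same as swaps. -/

section BranchInvolution

variable {Y Y' T : Scheme.{u}} {ν : Y' ⟶ Y} {Z : Closeds Y} {δ : T ⟶ Y'}

theorem reducedSubscheme_app_surjective {U : Y.Opens} (hU : IsAffineOpen U) :
    Function.Surjective ((reducedSubschemeι Z).app U) :=
  app_surjective_of_isClosedImmersion (Ω := ⊤) (V := U) (reducedSubschemeι Z) hU le_top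

theorem map_app_app_eq {C : Scheme.{u}} {p : T ⟶ C} {i : C ⟶ Y} (hp : p ≫ i = δ ≫ ν) (U : Y.Opens)
    (hle : δ ⁻¹ᵁ ν ⁻¹ᵁ U ≤ p ⁻¹ᵁ i ⁻¹ᵁ U) (x : Γ(Y, U)) :
    T.presheaf.map (homOfLE hle).op (p.app _ (i.app U x)) = δ.app _ (ν.app U x) := by
  have h1 : i.app U ≫ p.app (i ⁻¹ᵁ U) ≫ T.presheaf.map (homOfLE hle).op =
      ν.app U ≫ δ.app (ν ⁻¹ᵁ U) := by
    have h2 : δ ⁻¹ᵁ ν ⁻¹ᵁ U ≤ (δ ≫ ν) ⁻¹ᵁ U := le_rfl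
    have h3 : p ⁻¹ᵁ i ⁻¹ᵁ U ≤ (p ≫ i) ⁻¹ᵁ U := le_rfl
    rw [app_comp_app_eq_appLE ν δ U h2, ← Category.assoc, app_comp_app_eq_appLE i p U h3,
      Scheme.Hom.appLE_map]
    simp only [hp]
  exact congr($h1 x)

theorem preimage_preimage_eq {C : Scheme.{u}} {p : T ⟶ C} {i : C ⟶ Y} (hp : p ≫ i = δ ≫ ν)
    (U : Y.Opens) : p ⁻¹ᵁ i ⁻¹ᵁ U = δ ⁻¹ᵁ ν ⁻¹ᵁ U := by
  have h : (p ≫ i) ⁻¹ᵁ U = (δ ≫ ν) ⁻¹ᵁ U := by rw [hp]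
  exact h

theorem exists_preimage_eq (W : (reducedSubscheme Z).Opens) :
    ∃ Ω : Y.Opens, reducedSubschemeι Z ⁻¹ᵁ Ω = W := by
  obtain ⟨Ω, hΩ, hΩW⟩ := (reducedSubschemeι Z).isClosedEmbedding.isOpen_iff.1 W.isOpen
  exact ⟨⟨Ω, hΩ⟩, Opens.ext hΩW⟩

/-- If `ι` were trivial over an open set meeting `Z`, then `e` would be invariant there and descend
to `Z`, say to the class of `x`. But `x - e` has coefficient `-1 ∉ 𝔭` at `e`, so it is not zero on
`T`. -/
theorem IsNodalAlong.isSwap_of_isQuotientOver (h : IsNodalAlong ν (Z : Set Y) δ) {ι : T ⟶ T}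
    (hι : ι ≫ ι = 𝟙 T) {p : T ⟶ reducedSubscheme Z} (hp : p ≫ reducedSubschemeι Z = δ ≫ ν)
    {W : (reducedSubscheme Z).Opens} (hW : Dense (W : Set (reducedSubscheme Z)))
    (hq : IsQuotientOver {ι} p W) : IsSwap (δ ≫ ν) Z ι := by
  have := h.noetherian
  have hιp : ι ≫ p = p := hq.1 ι rfl
  refine ⟨hι, by rw [← hp, ← Category.assoc, hιp], ?_⟩
  rintro O ⟨x, hxO, hxZ⟩ hcon
  obtain ⟨P, hP, hPx⟩ := exists_isGenericIn h.closed hxZ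
  have hPO := mem_of_specializes hPx hxO
  obtain ⟨Ω, rfl⟩ := exists_preimage_eq W
  have hPΩ : P ∈ Ω := hP.mem_of_subset_closure h.closed (fun x hx => by
    rw [← range_reducedSubschemeι Z] at hx
    obtain ⟨z, rfl⟩ := hx
    refine closure_mono ?_ (image_closure_subset_closure_image (reducedSubschemeι Z).continuous
      ⟨z, hW z, rfl⟩)
    rintro _ ⟨w, hw, rfl⟩
    refine ⟨hw, ?_⟩
    rw [← range_reducedSubschemeι Z]
    exact ⟨w, rfl⟩)
  obtain ⟨U, hPU, e, hUle, hc⟩ := h.exists_nodeChart hP (W := O ⊓ Ω) ⟨hPO, hPΩ⟩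
  let V := reducedSubschemeι Z ⁻¹ᵁ U
  have hVW : V ≤ reducedSubschemeι Z ⁻¹ᵁ Ω :=
    (reducedSubschemeι Z).preimage_mono (hUle.trans inf_le_right)
  have heq : p ⁻¹ᵁ V = δ ⁻¹ᵁ ν ⁻¹ᵁ U := preimage_preimage_eq hp U
  let s : Γ(T, p ⁻¹ᵁ V) := T.presheaf.map (homOfLE heq.le).op (δ.app _ e)
  obtain ⟨t, ht, -⟩ := hq.2 V hVW s (by
    rintro φ rfl hle
    have h2 : φ.appLE (p ⁻¹ᵁ V) (p ⁻¹ᵁ V) hle = (𝟙 T : T ⟶ T).appLE (p ⁻¹ᵁ V) _ le_rfl :=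
      appLE_eq_of_ι_comp_eq (O := (δ ≫ ν) ⁻¹ᵁ O) (by rw [hcon, Category.comp_id])
        (heq.le.trans ((δ ≫ ν).preimage_mono (hUle.trans inf_le_left))) _ _
    rw [h2, (𝟙 T : T ⟶ T).appLE_eq_app]
    simp)
  obtain ⟨x, rfl⟩ := reducedSubscheme_app_surjective hc.affine t
  have h3 := congrArg (T.presheaf.map (homOfLE heq.ge).op) ht
  rw [map_app_app_eq hp] at h3
  have h4 : T.presheaf.map (homOfLE heq.ge).op s = δ.app _ e := by
    have : T.presheaf.map (homOfLE heq.le).op ≫ T.presheaf.map (homOfLE heq.ge).op = 𝟙 _ := by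
      rw [← Functor.map_comp]
      exact T.presheaf.map_id _
    exact congr($this (δ.app _ e))
  rw [h4] at h3
  have h5 : δ.app (ν ⁻¹ᵁ U) (ν.app U x + ν.app U (-1) * e) = 0 := by
    rw [map_neg, map_one, neg_one_mul, map_add, map_neg, h3]
    exact add_neg_cancel _
  have h6 := ((hc.swap.zero _ _).1 h5).2
  exact hc.swap.prime.ne_top ((Ideal.eq_top_iff_one _).2 (neg_mem_iff.1 h6))

/-- On a node chart the functions on `T` are `A/𝔭 ⊕ (A/𝔭) e`, with invariants `A/𝔭`, the functions
on `Z`. The union of the charts is the dense open set required. -/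
theorem IsNodalAlong.exists_isQuotientOver (h : IsNodalAlong ν (Z : Set Y) δ) {ι : T ⟶ T}
    (hι : IsSwap (δ ≫ ν) Z ι) : ∃ p : T ⟶ reducedSubscheme Z, p ≫ reducedSubschemeι Z = δ ≫ ν ∧
      ∃ W : (reducedSubscheme Z).Opens, Dense (W : Set (reducedSubscheme Z)) ∧
        IsQuotientOver {ι} p W := by
  have := h.isReduced
  have := h.finite
  have := h.normalizationOf.integral
  obtain ⟨p, hp⟩ := exists_lift_reducedSubscheme (δ ≫ ν) (Z := Z) fun t => by
    have h1 : δ t ∈ ν ⁻¹' (Z : Set Y) := h.normalizationOf.range_eq ▸ ⟨t, rfl⟩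
    exact h1
  have hpapp : ∀ t, reducedSubschemeι Z (p t) = ν (δ t) := fun t => by
    rw [← Scheme.Hom.comp_apply, hp, Scheme.Hom.comp_apply]
  have hιp : ι ≫ p = p := by
    rw [← cancel_mono (reducedSubschemeι Z), Category.assoc, hp, hι.comp_eq]
  have hinjι : Function.Injective (reducedSubschemeι Z) :=
    (reducedSubschemeι Z).isClosedEmbedding.injective
  have hsurj : Function.Surjective p := fun z => by
    have hz : reducedSubschemeι Z z ∈ Z := by
      have : reducedSubschemeι Z z ∈ (Z : Set Y) := range_reducedSubschemeι Z ▸ ⟨z, rfl⟩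
      exact this
    obtain ⟨t, ht⟩ := h.exists_apply_eq hz
    exact ⟨t, hinjι (by rw [hpapp, ht])⟩
  have hpinj := app_injective_of_surjective p hsurj
  choose U hPU e _ hc using fun P : {P : Y // IsGenericIn (Z : Set Y) P} =>
    h.exists_nodeChart P.2 (W := ⊤) trivial
  refine ⟨p, hp, ⨆ P, reducedSubschemeι Z ⁻¹ᵁ U P, fun z => ?_, ?_, fun V hV s hs => ?_⟩
  · have hz : reducedSubschemeι Z z ∈ (Z : Set Y) := range_reducedSubschemeι Z ▸ ⟨z, rfl⟩
    obtain ⟨P, hP, hPz⟩ := exists_isGenericIn h.closed hz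
    obtain ⟨w, rfl⟩ : P ∈ Set.range (reducedSubschemeι Z) := range_reducedSubschemeι Z ▸ hP.1
    have hwz : w ⤳ z := (reducedSubschemeι Z).isClosedEmbedding.isInducing.specializes_iff.1 hPz
    refine hwz.mem_closed isClosed_closure (subset_closure ?_)
    exact Opens.mem_iSup.2 ⟨⟨_, hP⟩, hPU _⟩
  · rintro φ rfl
    exact hιp
  · have key : ∃ t, p.app V t = s := by
      refine exists_app_eq_of_locally p hpinj s fun z hz => ?_
      obtain ⟨P, hzP⟩ := Opens.mem_iSup.1 (hV hz)
      obtain ⟨Ω, rfl⟩ := exists_preimage_eq V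
      obtain ⟨f, hf, hzf⟩ := (hc P).affine.exists_basicOpen_le (V := Ω)
        ⟨reducedSubschemeι Z z, hz⟩ hzP
      let D := Y.basicOpen f
      have heq : p ⁻¹ᵁ reducedSubschemeι Z ⁻¹ᵁ D = δ ⁻¹ᵁ ν ⁻¹ᵁ D := preimage_preimage_eq hp D
      have hle : reducedSubschemeι Z ⁻¹ᵁ D ≤ reducedSubschemeι Z ⁻¹ᵁ Ω :=
        (reducedSubschemeι Z).preimage_mono hf
      have hPf : P.1 ∈ Y.basicOpen f := by
        obtain ⟨t, rfl⟩ := hsurj z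
        have h1 : reducedSubschemeι Z (p t) ∈ U P := hzP
        have h2 : reducedSubschemeι Z (p t) ∈ Y.basicOpen f := hzf
        rw [hpapp] at h1 h2
        exact mem_of_specializes ((hc P).specializes h1) h2
      have hle' : δ ⁻¹ᵁ ν ⁻¹ᵁ D ≤ p ⁻¹ᵁ reducedSubschemeι Z ⁻¹ᵁ Ω :=
        heq.ge.trans (p.preimage_mono hle)
      have hιV : p ⁻¹ᵁ reducedSubschemeι Z ⁻¹ᵁ Ω ≤ ι ⁻¹ᵁ p ⁻¹ᵁ reducedSubschemeι Z ⁻¹ᵁ Ω := by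
        have h1 : (ι ≫ p) ⁻¹ᵁ reducedSubschemeι Z ⁻¹ᵁ Ω = p ⁻¹ᵁ reducedSubschemeι Z ⁻¹ᵁ Ω := by
          rw [hιp]
        exact h1.ge
      obtain ⟨x, hx⟩ := (hc P).exists_app_app_eq (h.two _)
        (h.isAffineOpen_preimage (hc P).affine) hι.comp_eq
        ((hc P).appLE_eq_neg (h.two _) P.2.1 hι (h.isAffineOpen_preimage (hc P).affine)) f hPf
        (T.presheaf.map (homOfLE hle').op s) (by
          have h1 := congrArg (T.presheaf.map (homOfLE hle').op) (hs ι rfl hιV)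
          refine Eq.trans ?_ h1
          have h2 : T.presheaf.map (homOfLE hle').op ≫
              ι.appLE _ _ (preimage_le_of_over hι.comp_eq (Y.basicOpen f)) =
              ι.appLE _ _ hιV ≫ T.presheaf.map (homOfLE hle').op :=
            (Scheme.Hom.map_appLE ..).trans (Scheme.Hom.appLE_map ..).symm
          exact congr($h2 s))
      refine ⟨_, hle, hzf, (reducedSubschemeι Z).app D x, ?_⟩
      have h3 := congrArg (T.presheaf.map (homOfLE heq.le).op)
        ((map_app_app_eq hp D heq.ge x).trans hx)
      have h4 : T.presheaf.map (homOfLE heq.ge).op ≫ T.presheaf.map (homOfLE heq.le).op = 𝟙 _ := by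
        rw [← Functor.map_comp]
        exact T.presheaf.map_id _
      have h5 : T.presheaf.map (homOfLE hle').op ≫ T.presheaf.map (homOfLE heq.le).op =
          T.presheaf.map (homOfLE (p.preimage_mono hle)).op := by
        rw [← Functor.map_comp]
        rfl
      exact (congr($h4 _)).symm.trans (h3.trans congr($h5 s))
    obtain ⟨t, ht⟩ := key
    exact ⟨t, ht, fun t' ht' => hpinj V (ht'.trans ht.symm)⟩

end BranchInvolution

/-! ### Quotients by a finite group. -/

section GroupAction

/-- A finite group acts transitively on the primes over a given prime of the invariants. -/
theorem exists_eq_comap_of_comap_eq {A B G : Type*} [CommRing A] [CommRing B] [Group G] [Finite G]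
    (φ : A →+* B) (hφ : φ.IsIntegral) (a : G → B →+* B) (a_one : ∀ b, a 1 b = b)
    (a_mul : ∀ g h b, a h (a g b) = a (g * h) b) (hinv : ∀ b, (∀ g, a g b = b) → ∃ c, φ c = b)
    (Q Q' : Ideal B) [Q.IsPrime] [Q'.IsPrime] (h : Q.comap φ = Q'.comap φ)
    (haφ : ∀ g x, a g (φ x) = φ x) : ∃ g, Q' = Q.comap (a g) := by
  classical
  have := Fintype.ofFinite G
  -- The norm `∏ g b` of an element `b ∈ Q'` is invariant, so it comes from the common contraction
  -- and lies in `Q`; hence some translate of `b` lies in `Q`. Prime avoidance and incomparability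
  -- finish.
  have hsub : (Q' : Set B) ⊆ ⋃ g ∈ (Finset.univ : Finset G), (Q.comap (a g) : Set B) := by
    intro b hb
    obtain ⟨c, hc⟩ := hinv (∏ g, a g b) fun k => by
      rw [map_prod]
      simp only [a_mul]
      exact Fintype.prod_equiv (Equiv.mulRight k) _ _ fun g => rfl
    have h1 : φ c ∈ Q' := by
      rw [hc, ← Finset.mul_prod_erase _ _ (Finset.mem_univ (1 : G)), a_one]
      exact Ideal.mul_mem_right _ _ hb
    have h2 : φ c ∈ Q := by
      have : c ∈ Q.comap φ := h ▸ h1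
      exact this
    rw [hc] at h2
    obtain ⟨g, -, hg⟩ := (Ideal.IsPrime.prod_mem_iff (p := Q)).1 h2
    exact Set.mem_biUnion (Finset.mem_coe.2 (Finset.mem_univ g)) hg
  obtain ⟨g, -, hg⟩ := (Ideal.subset_union_prime (s := (Finset.univ : Finset G)) 1 1
    (fun g _ _ _ => inferInstance)).1 hsub
  refine ⟨g, by_contra fun hne => ?_⟩
  let := φ.toAlgebra
  have : Algebra.IsIntegral A B := ⟨hφ⟩
  have h1 : Q'.comap φ < (Q.comap (a g)).comap φ :=
    Ideal.IsIntegral.comap_lt_comap (R := A) (lt_of_le_of_ne hg hne)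
  rw [← h, Ideal.comap_comap, show (a g).comp φ = φ from RingHom.ext (haφ g)] at h1
  exact lt_irrefl _ h1

end GroupAction

section GCover

variable {X Y : Scheme.{u}} {p : X ⟶ Y}

theorem preimage_le_of_comp_eq {f : X ⟶ X} (hf : f ≫ p = p) (V : Y.Opens) :
    p ⁻¹ᵁ V ≤ f ⁻¹ᵁ p ⁻¹ᵁ V := by
  have h : (f ≫ p) ⁻¹ᵁ V = p ⁻¹ᵁ V := by rw [hf]
  exact h.ge

/-- Pullback of functions by an endomorphism over `Y`. -/
noncomputable def appOver {f : X ⟶ X} (hf : f ≫ p = p) (V : Y.Opens) :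
    Γ(X, p ⁻¹ᵁ V) ⟶ Γ(X, p ⁻¹ᵁ V) :=
  f.appLE _ _ (preimage_le_of_comp_eq hf V)

theorem appOver_app {f : X ⟶ X} (hf : f ≫ p = p) (V : Y.Opens) (x : Γ(Y, V)) :
    appOver hf V (p.app V x) = p.app V x := by
  have h1 : p.app V ≫ appOver hf V = p.app V := by
    have h2 : p.appLE V (p ⁻¹ᵁ V) le_rfl ≫ f.appLE _ _ (preimage_le_of_comp_eq hf V) =
        p.appLE V (p ⁻¹ᵁ V) le_rfl := by
      rw [Scheme.Hom.appLE_comp_appLE]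
      simp only [hf]
    rwa [p.appLE_eq_app] at h2
  exact congr($h1 x)

theorem appOver_comp {f g : X ⟶ X} (hf : f ≫ p = p) (hg : g ≫ p = p) (hfg : (f ≫ g) ≫ p = p)
    (V : Y.Opens) (b : Γ(X, p ⁻¹ᵁ V)) : appOver hf V (appOver hg V b) = appOver hfg V b := by
  have h1 : appOver hg V ≫ appOver hf V = appOver hfg V := by
    rw [appOver, appOver, Scheme.Hom.appLE_comp_appLE]
    rfl
  exact congr($h1 b)

theorem appOver_id (h : 𝟙 X ≫ p = p) (V : Y.Opens) (b : Γ(X, p ⁻¹ᵁ V)) : appOver h V b = b := by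
  have h1 : appOver h V = 𝟙 _ := (𝟙 X : X ⟶ X).appLE_eq_app.trans (by simp; rfl)
  exact congr($h1 b)

theorem appOver_res {f : X ⟶ X} (hf : f ≫ p = p) {U V : Y.Opens} (hVU : V ≤ U)
    (b : Γ(X, p ⁻¹ᵁ U)) : appOver hf V (X.presheaf.map (homOfLE (p.preimage_mono hVU)).op b) =
      X.presheaf.map (homOfLE (p.preimage_mono hVU)).op (appOver hf U b) := by
  have h2 : X.presheaf.map (homOfLE (p.preimage_mono hVU)).op ≫ appOver hf V =
      appOver hf U ≫ X.presheaf.map (homOfLE (p.preimage_mono hVU)).op :=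
    (Scheme.Hom.map_appLE ..).trans (Scheme.Hom.appLE_map ..).symm
  exact congr($h2 b)

theorem comap_appOver_primeAt {f : X ⟶ X} (hf : f ≫ p = p) (V : Y.Opens) {x : X}
    (hx : x ∈ p ⁻¹ᵁ V) : (primeAt (p ⁻¹ᵁ V) x hx).comap (appOver hf V).hom =
      primeAt (p ⁻¹ᵁ V) (f x) (preimage_le_of_comp_eq hf V hx) :=
  comap_appLE_primeAt f _ hx

variable {G : Type v} [Group G] {ρ : G →* Aut X}

theorem IsGCover.comp_eq (h : IsGCover ρ p) (g : G) : (ρ g).hom ≫ p = p := h.quotient.1 _ ⟨g, rfl⟩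

theorem IsGCover.exists_app_eq (h : IsGCover ρ p) {V : Y.Opens} (s : Γ(X, p ⁻¹ᵁ V))
    (hs : ∀ g, appOver (h.comp_eq g) V s = s) : ∃ t, p.app V t = s :=
  (h.quotient.2 V le_top s (by rintro _ ⟨g, rfl⟩ -; exact hs g)).exists

theorem IsGCover.app_injective (h : IsGCover ρ p) (V : Y.Opens) : Function.Injective (p.app V) := by
  refine fun a b hab => (h.quotient.2 V le_top (p.app V b) ?_).unique hab rfl
  rintro _ ⟨g, rfl⟩ -
  exact appOver_app (h.comp_eq g) V b

theorem IsGCover.surjective (h : IsGCover ρ p) : Function.Surjective p := fun y => by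
  have := h.finite
  obtain ⟨_, ⟨U, hU, rfl⟩, hy, -⟩ :=
    Y.isBasis_affineOpens.exists_subset_of_mem_open (Set.mem_univ y) isOpen_univ
  have hU : IsAffineOpen U := hU
  let := (p.app U).hom.toAlgebra
  have : Algebra.IsIntegral Γ(Y, U) Γ(X, p ⁻¹ᵁ U) := ⟨p.isIntegral_app U hU⟩
  obtain ⟨Q, -, hQ, hQc⟩ := Ideal.exists_ideal_over_prime_of_isIntegral (S := Γ(X, p ⁻¹ᵁ U))
    (primeAt U y hy) ⊥ (by
      rw [← RingHom.ker_eq_comap_bot]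
      exact ((RingHom.injective_iff_ker_eq_bot (p.app U).hom).1 (h.app_injective U)).trans_le
        bot_le)
  obtain ⟨x, hx, rfl⟩ := exists_primeAt_eq (hU.preimage p) Q
  exact ⟨x, primeAt_injective hU hx hy ((comap_app_primeAt p hx).symm.trans hQc)⟩

variable [Finite G]

theorem IsGCover.exists_apply_eq (h : IsGCover ρ p) {x x' : X} (hxx : p x = p x') :
    ∃ g, (ρ g).hom x = x' := by
  have := h.finite
  obtain ⟨_, ⟨U, hU, rfl⟩, hy, -⟩ :=
    Y.isBasis_affineOpens.exists_subset_of_mem_open (Set.mem_univ (p x)) isOpen_univ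
  have hU : IsAffineOpen U := hU
  have hx : x ∈ p ⁻¹ᵁ U := hy
  have hx' : x' ∈ p ⁻¹ᵁ U := by
    have : p x' ∈ U := hxx ▸ hy
    exact this
  have h_one : ∀ b, appOver (h.comp_eq 1) U b = b := fun b => by
    have h1 : (ρ 1).hom = 𝟙 X := by rw [map_one]; rfl
    have h2 := appOver_id (p := p) (Category.id_comp _) U b
    simp only [h1]
    exact h2
  have h_mul : ∀ g k b, appOver (h.comp_eq k) U (appOver (h.comp_eq g) U b) =
      appOver (h.comp_eq (g * k)) U b := fun g k b => by
    have h1 : (ρ (g * k)).hom = (ρ k).hom ≫ (ρ g).hom := by rw [map_mul]; rfl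
    refine (appOver_comp (h.comp_eq k) (h.comp_eq g) (h1 ▸ h.comp_eq (g * k)) U b).trans ?_
    simp only [h1]
  obtain ⟨g, hg⟩ := exists_eq_comap_of_comap_eq (p.app U).hom (p.isIntegral_app U hU)
    (fun g => (appOver (h.comp_eq g) U).hom) h_one h_mul
    (fun b hb => h.exists_app_eq b hb) (primeAt _ x hx) (primeAt _ x' hx')
    (by rw [comap_app_primeAt p hx, comap_app_primeAt p hx']; simp only [hxx])
    (fun g x => appOver_app (h.comp_eq g) U x)
  exact ⟨g, (primeAt_injective (hU.preimage p) hx'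
    (preimage_le_of_comp_eq (h.comp_eq g) U hx)
    (hg.trans (comap_appOver_primeAt (h.comp_eq g) U hx))).symm⟩

/-- Going down for quotients: lift `z` anywhere, use that `p` is closed to find a specialization in
the fibre of `p x`, and move it to `x` by the transitive action. -/
theorem IsGCover.exists_specializes (h : IsGCover ρ p) {x : X} {z : Y} (hz : z ⤳ p x) :
    ∃ x', x' ⤳ x ∧ p x' = z := by
  have := h.finite
  obtain ⟨z', rfl⟩ := h.surjective z
  obtain ⟨x'', hx'', hpx⟩ : p x ∈ p '' closure {z'} := by
    have h1 : IsClosed (p '' closure {z'}) := p.isClosedMap _ isClosed_closure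
    exact hz.mem_closed h1 ⟨z', subset_closure rfl, rfl⟩
  obtain ⟨g, rfl⟩ := h.exists_apply_eq hpx
  refine ⟨(ρ g).hom z', (specializes_iff_mem_closure.2 hx'').map (ρ g).hom.continuous, ?_⟩
  rw [← Scheme.Hom.comp_apply, h.comp_eq]

theorem IsGCover.isGenericIn_apply (h : IsGCover ρ p) {E : Set Y} {x : X}
    (hx : IsGenericIn (p ⁻¹' E) x) : IsGenericIn E (p x) := by
  refine ⟨hx.1, fun z hz hzx => ?_⟩
  obtain ⟨x', hx', rfl⟩ := h.exists_specializes hzx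
  rw [hx.2 x' hz hx']

end GCover

/-! ### Heights along integral extensions. -/

section Height

theorem le_of_forall_natCast_le {a b : ℕ∞} (h : ∀ n : ℕ, a ≤ n → b ≤ n) : b ≤ a := by
  induction a using ENat.recTopCoe with
  | top => exact le_top
  | coe m => exact h m le_rfl

theorem lt_natCast_add_one_iff (a : ℕ∞) (n : ℕ) : a < ((n + 1 : ℕ) : ℕ∞) ↔ a ≤ n := by
  rw [Nat.cast_add, Nat.cast_one]
  exact Order.lt_add_one_iff_of_not_isMax (by simp)

/-- By incomparability, strict inclusions of primes contract to strict inclusions. -/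
theorem height_le_height_comap {A B : Type*} [CommRing A] [CommRing B] (φ : A →+* B)
    (hφ : φ.IsIntegral) (Q : Ideal B) [Q.IsPrime] : Q.height ≤ (Q.comap φ).height := by
  let := φ.toAlgebra
  have : Algebra.IsIntegral A B := ⟨hφ⟩
  have key : ∀ (n : ℕ) (Q : Ideal B) [Q.IsPrime], (Q.comap φ).height ≤ n → Q.height ≤ n := by
    intro n
    induction n with
    | zero =>
      intro Q _
      rw [Ideal.height_le_iff, Ideal.height_le_iff]
      intro h q hq hqQ
      exact absurd (h (q.comap φ) inferInstance (Ideal.IsIntegral.comap_lt_comap (R := A) hqQ))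
        (by simp)
    | succ n ih =>
      intro Q _
      rw [Ideal.height_le_iff, Ideal.height_le_iff]
      intro h q hq hqQ
      rw [lt_natCast_add_one_iff]
      exact ih q ((lt_natCast_add_one_iff _ _).1
        (h (q.comap φ) inferInstance (Ideal.IsIntegral.comap_lt_comap (R := A) hqQ)))
  exact le_of_forall_natCast_le fun n => key n Q

/-- Going down, assumed as `hgd`, lifts each prime below the contraction to a prime below `Q`;
induction on the height gives the missing inequality. -/
theorem height_comap_eq {A B : Type*} [CommRing A] [CommRing B] (φ : A →+* B) (hφ : φ.IsIntegral)
    (hgd : ∀ (Q : Ideal B) [Q.IsPrime] (q : Ideal A) [q.IsPrime], q ≤ Q.comap φ →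
      ∃ Q' : Ideal B, Q'.IsPrime ∧ Q' ≤ Q ∧ Q'.comap φ = q) (Q : Ideal B) [Q.IsPrime] :
    (Q.comap φ).height = Q.height := by
  have key : ∀ (n : ℕ) (Q : Ideal B) [Q.IsPrime], Q.height ≤ n → (Q.comap φ).height ≤ n := by
    intro n
    induction n with
    | zero =>
      intro Q _
      rw [Ideal.height_le_iff, Ideal.height_le_iff]
      intro h q hq hqQ
      obtain ⟨Q', hQ', hle, rfl⟩ := hgd Q q hqQ.le
      exact absurd (h Q' hQ' (lt_of_le_of_ne hle (by rintro rfl; exact hqQ.ne rfl))) (by simp)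
    | succ n ih =>
      intro Q _
      rw [Ideal.height_le_iff, Ideal.height_le_iff]
      intro h q hq hqQ
      obtain ⟨Q', hQ', hle, rfl⟩ := hgd Q q hqQ.le
      rw [lt_natCast_add_one_iff]
      exact ih Q' ((lt_natCast_add_one_iff _ _).1
        (h Q' hQ' (lt_of_le_of_ne hle (by rintro rfl; exact hqQ.ne rfl))))
  exact le_antisymm (le_of_forall_natCast_le fun n => key n Q) (height_le_height_comap φ hφ Q)

end Height

/-! ### Gluings, and why they are singular over the double locus. -/

section Glued

variable {G : Type v} [Group G] {Y Y' X' X : Scheme.{u}}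

theorem IsGCover.ringKrullDim_stalk_eq [Finite G] {ρ : G →* Aut X} {p : X ⟶ Y} (h : IsGCover ρ p)
    (x : X) : ringKrullDim (X.presheaf.stalk x) = ringKrullDim (Y.presheaf.stalk (p x)) := by
  have := h.finite
  obtain ⟨_, ⟨U, hU, rfl⟩, hy, -⟩ :=
    Y.isBasis_affineOpens.exists_subset_of_mem_open (Set.mem_univ (p x)) isOpen_univ
  have hU : IsAffineOpen U := hU
  have hx : x ∈ p ⁻¹ᵁ U := hy
  rw [← height_primeAt (hU.preimage p) x hx, ← height_primeAt hU (p x) hy, ← comap_app_primeAt p hx]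
  rw [height_comap_eq (p.app U).hom (p.isIntegral_app U hU)]
  intro Q hQ q hq hle
  obtain ⟨x, hx, rfl⟩ := exists_primeAt_eq (hU.preimage p) Q
  obtain ⟨z, hz, rfl⟩ := exists_primeAt_eq hU q
  rw [comap_app_primeAt p hx] at hle
  obtain ⟨x', hx', rfl⟩ := h.exists_specializes ((specializes_iff_primeAt_le hU hx hz).2 hle)
  have hx'U : x' ∈ p ⁻¹ᵁ U := hz
  exact ⟨primeAt (p ⁻¹ᵁ U) x' hx'U, inferInstance,
    (specializes_iff_primeAt_le (hU.preimage p) hx hx'U).1 hx',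
    comap_app_primeAt p hz⟩

theorem app_appOver {p : X ⟶ Y} {n : X' ⟶ X} {f : X ⟶ X} {f' : X' ⟶ X'} (hf : f ≫ p = p)
    (hf' : f' ≫ n ≫ p = n ≫ p) (hff : f' ≫ n = n ≫ f) (U : Y.Opens) (c : Γ(X, p ⁻¹ᵁ U)) :
    n.app (p ⁻¹ᵁ U) (appOver hf U c) = appOver hf' U (n.app (p ⁻¹ᵁ U) c) := by
  have hle : n ⁻¹ᵁ p ⁻¹ᵁ U ≤ f' ⁻¹ᵁ n ⁻¹ᵁ p ⁻¹ᵁ U := preimage_le_of_comp_eq hf' U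
  have h1 : f.appLE _ _ (preimage_le_of_comp_eq hf U) ≫ n.appLE (p ⁻¹ᵁ U) _ le_rfl =
      n.appLE (p ⁻¹ᵁ U) (n ⁻¹ᵁ p ⁻¹ᵁ U) le_rfl ≫ f'.appLE _ (n ⁻¹ᵁ p ⁻¹ᵁ U) hle := by
    rw [Scheme.Hom.appLE_comp_appLE, Scheme.Hom.appLE_comp_appLE]
    simp only [hff]
  rw [n.appLE_eq_app] at h1
  exact congr($h1 c)

/-- `X` is a `G`-cover of `Y` with normalization `X'`, compatibly with the `G`-cover `X'` of the
normalization of `Y`. -/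
structure IsGluing (ν : Y' ⟶ Y) (ρ' : G →* Aut X') (p' : X' ⟶ Y') (ρ : G →* Aut X) (p : X ⟶ Y)
    (n : X' ⟶ X) : Prop where
  reduced : IsReduced X
  cover : IsGCover ρ p
  normalization : IsNormalization n
  comm : n ≫ p = p' ≫ ν
  equivariant : ∀ g : G, (ρ' g).hom ≫ n = n ≫ (ρ g).hom

namespace IsGluing

variable {ν : Y' ⟶ Y} {ρ' : G →* Aut X'} {p' : X' ⟶ Y'} {ρ : G →* Aut X} {p : X ⟶ Y} {n : X' ⟶ X}
  (h : IsGluing ν ρ' p' ρ p n)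

include h

theorem isFinite_normalization (hp' : IsGCover ρ' p') [IsFinite ν] : IsFinite n := by
  have := hp'.finite
  have := h.cover.finite
  have : IsFinite (n ≫ p) := by rw [h.comm]; infer_instance
  exact IsFinite.of_comp n p

/-- The pullback of `b` is locally a function on `X` near `x` only if `b` is locally a function on
`Y` near `p x`. -/
theorem exists_app_eq_mul [Finite G] [IsReduced Y] (hp' : IsGCover ρ' p') {U : Y.Opens}
    (hU : IsAffineOpen U) {x : X} (hx : p x ∈ U) (b : Γ(Y', ν ⁻¹ᵁ U))
    (heq : n ⁻¹ᵁ p ⁻¹ᵁ U = p' ⁻¹ᵁ ν ⁻¹ᵁ U) (hb : ∃ s c : Γ(X, p ⁻¹ᵁ U), s ∉ primeAt (p ⁻¹ᵁ U) x hx ∧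
      n.app _ c = n.app _ s * X'.presheaf.map (homOfLE heq.le).op (p'.app _ b)) :
    ∃ s a : Γ(Y, U), s ∉ primeAt U (p x) hx ∧ ν.app U a = ν.app U s * b := by
  have := h.reduced
  have := h.cover.finite
  let r : Γ(X', n ⁻¹ᵁ p ⁻¹ᵁ U) := X'.presheaf.map (homOfLE heq.le).op (p'.app _ b)
  let := (n.app (p ⁻¹ᵁ U)).hom.toAlgebra
  let J : Ideal Γ(X, p ⁻¹ᵁ U) := denomIdeal _ r
  have hg' : ∀ g, (ρ' g).hom ≫ n ≫ p = n ≫ p := fun g => by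
    rw [h.comm, ← Category.assoc, hp'.comp_eq]
  have hr : ∀ g, appOver (hg' g) U r = r := fun g => by
    have h1 : X'.presheaf.map (homOfLE heq.le).op ≫ appOver (hg' g) U =
        appOver (hp'.comp_eq g) (ν ⁻¹ᵁ U) ≫ X'.presheaf.map (homOfLE heq.le).op :=
      (Scheme.Hom.map_appLE ..).trans (Scheme.Hom.appLE_map ..).symm
    refine congr($h1 (p'.app _ b)).trans ?_
    exact congrArg _ (appOver_app (hp'.comp_eq g) _ b)
  -- The ideal `J` of denominators of `r` on `X` is `G`-stable because `r` is invariant. If its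
  -- contraction lay in the prime of `p x`, lying over would put `J` in the prime of a conjugate of
  -- `x`, hence of `x` itself, against `hb`.
  have hJ : ¬ J.comap (p.app U).hom ≤ primeAt U (p x) hx := fun hJ => by
    let := (p.app U).hom.toAlgebra
    have : Algebra.IsIntegral Γ(Y, U) Γ(X, p ⁻¹ᵁ U) := ⟨p.isIntegral_app U hU⟩
    obtain ⟨Q, hJQ, hQ, hQc⟩ := Ideal.exists_ideal_over_prime_of_isIntegral (S := Γ(X, p ⁻¹ᵁ U))
      (primeAt U (p x) hx) J hJ
    obtain ⟨x₁, hx₁, rfl⟩ := exists_primeAt_eq (hU.preimage p) Q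
    have hpx : p x = p x₁ :=
      primeAt_injective hU hx hx₁ (hQc.symm.trans (comap_app_primeAt p hx₁))
    obtain ⟨g, rfl⟩ := h.cover.exists_apply_eq hpx.symm
    obtain ⟨s, c, hs, hc⟩ := hb
    refine hs ?_
    rw [← comap_appOver_primeAt (h.cover.comp_eq g) U hx₁]
    refine hJQ (mem_denomIdeal.2 ⟨appOver (h.cover.comp_eq g) U c, ?_⟩)
    refine (app_appOver (h.cover.comp_eq g) (hg' g) (h.equivariant g) U c).trans ?_
    rw [hc]
    refine (map_mul (appOver (hg' g) U).hom _ _).trans ?_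
    exact congrArg₂ _ (app_appOver (h.cover.comp_eq g) (hg' g) (h.equivariant g) U s).symm (hr g)
  obtain ⟨s, ⟨c, hc⟩, hs⟩ := SetLike.not_le_iff_exists.1 hJ
  have hc : n.app _ c = n.app _ (p.app U s) * r := hc
  -- The numerator `c = s r` is invariant, since `s` comes from `Y` and `r` from `Y'`; so it
  -- descends to `Y`.
  obtain ⟨a, rfl⟩ := h.cover.exists_app_eq c fun g => by
    refine h.normalization.app_injective _ ?_
    rw [app_appOver (h.cover.comp_eq g) (hg' g) (h.equivariant g), hc]
    refine (map_mul (appOver (hg' g) U).hom _ _).trans (congrArg₂ _ ?_ (hr g))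
    have h1 := appOver_app (hg' g) U s
    rwa [Scheme.Hom.comp_app] at h1
  refine ⟨s, a, hs, hp'.app_injective _ ?_⟩
  have h1 := congrArg (X'.presheaf.map (homOfLE heq.ge).op) hc
  rw [map_mul, map_app_app_eq h.comm, map_app_app_eq h.comm] at h1
  refine h1.trans (Eq.trans ?_ (map_mul (p'.app _).hom _ _).symm)
  congr 1
  have h2 : X'.presheaf.map (homOfLE heq.le).op ≫ X'.presheaf.map (homOfLE heq.ge).op = 𝟙 _ := by
    rw [← Functor.map_comp]
    exact X'.presheaf.map_id _
  exact congr($h2 (p'.app _ b))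

/-- The nodes of `Y` are not covered by regular points. -/
theorem not_isRegularLocalRing [Finite G] [IsReduced Y] [IsLocallyNoetherian Y] [IsFinite ν]
    (hν : IsNormalization ν) (hp' : IsGCover ρ' p') {x : X} (hx : p x ∈ singularCodimOne Y) :
    ¬ IsRegularLocalRing (X.presheaf.stalk x) := by
  intro hreg
  have := h.reduced
  have := h.cover.finite
  have := h.isFinite_normalization hp'
  have := LocallyOfFiniteType.isLocallyNoetherian p
  obtain ⟨_, ⟨U, hU, rfl⟩, hxU, -⟩ :=
    Y.isBasis_affineOpens.exists_subset_of_mem_open (Set.mem_univ (p x)) isOpen_univ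
  have hU : IsAffineOpen U := hU
  have hxU : p x ∈ U := hxU
  obtain ⟨-, b, hb⟩ := (mem_singularCodimOne_iff hν hU hxU).1 hx
  have heq : n ⁻¹ᵁ p ⁻¹ᵁ U = p' ⁻¹ᵁ ν ⁻¹ᵁ U := preimage_preimage_eq h.comm U
  let r : Γ(X', n ⁻¹ᵁ p ⁻¹ᵁ U) := X'.presheaf.map (homOfLE heq.le).op (p'.app _ b)
  have hns : x ∉ singularCodimOne X := fun hx => hx.2 hreg
  rw [mem_singularCodimOne_iff h.normalization (hU.preimage p) (show x ∈ p ⁻¹ᵁ U from hxU)] at hns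
  have hht : (primeAt (p ⁻¹ᵁ U) x hxU).height ≤ 1 := by
    have h2 := h.cover.ringKrullDim_stalk_eq x
    rw [hx.1, ← height_primeAt (hU.preimage p) x hxU] at h2
    exact (WithBot.coe_inj.1 h2).le
  -- Were `x` regular, the pullback of `b` would have a denominator at `x`, and then `b` itself
  -- would have one at `p x`.
  obtain ⟨s, hs, hsx⟩ := SetLike.not_le_iff_exists.1 fun hle => hns ⟨hht, r, hle⟩
  obtain ⟨c, hc⟩ := (@mem_denomIdeal _ _ _ _ (n.app (p ⁻¹ᵁ U)).hom.toAlgebra _ _).1 hs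
  obtain ⟨s, a, hs, ha⟩ := h.exists_app_eq_mul hp' hU hxU b heq ⟨s, c, hsx, hc⟩
  let := (ν.app U).hom.toAlgebra
  exact hs (hb (mem_denomIdeal.2 ⟨a, ha⟩))

end IsGluing

end Glued

/-! ### Lifting morphisms to the normalized double loci. -/

section Lifts

/-- Over `Ω` the morphism `δ` is a closed immersion, hence a monomorphism, and generic points land
there. -/
theorem IsNormalizationOf.hom_ext {X T N : Scheme.{u}} {Z : Set X} {δ : T ⟶ X}
    (h : IsNormalizationOf Z δ) [IsReduced N] [IsLocallyNoetherian X] {f g : N ⟶ T}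
    (hfg : f ≫ δ = g ≫ δ) (hgen : ∀ x, IsGenericIn Set.univ x → IsGenericIn Z (δ (f x))) :
    f = g := by
  have := h.integral
  obtain ⟨Ω, hΩ, -, hcl⟩ := h.birational
  have hfg' : ∀ x, δ (f x) = δ (g x) := fun x => by
    rw [← Scheme.Hom.comp_apply, hfg, Scheme.Hom.comp_apply]
  refine hom_ext_of_forall_isGenericIn δ hfg fun x hx => ?_
  have hxΩ : δ (f x) ∈ Ω := (hgen x hx).mem_of_subset_closure h.isClosed hΩ
  refine ⟨_, (f ⁻¹ᵁ δ ⁻¹ᵁ Ω).ι, ⟨⟨x, hxΩ⟩, rfl⟩, ?_⟩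
  have hf : Set.range ((f ⁻¹ᵁ δ ⁻¹ᵁ Ω).ι ≫ f) ⊆ Set.range (δ ⁻¹ᵁ Ω).ι := by
    rintro _ ⟨y, rfl⟩
    rw [Scheme.Opens.range_ι]
    exact y.2
  have hg : Set.range ((f ⁻¹ᵁ δ ⁻¹ᵁ Ω).ι ≫ g) ⊆ Set.range (δ ⁻¹ᵁ Ω).ι := by
    rintro _ ⟨y, rfl⟩
    rw [Scheme.Opens.range_ι]
    have h1 : δ (f y.1) ∈ Ω := y.2
    rw [hfg'] at h1
    exact h1
  have key : IsOpenImmersion.lift (δ ⁻¹ᵁ Ω).ι _ hf = IsOpenImmersion.lift (δ ⁻¹ᵁ Ω).ι _ hg := by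
    rw [← cancel_mono (δ ∣_ Ω), ← cancel_mono Ω.ι, Category.assoc, Category.assoc,
      morphismRestrict_ι, IsOpenImmersion.lift_fac_assoc, IsOpenImmersion.lift_fac_assoc,
      Category.assoc, Category.assoc, hfg]
  rw [← IsOpenImmersion.lift_fac (δ ⁻¹ᵁ Ω).ι _ hf, key, IsOpenImmersion.lift_fac]

end Lifts

/-- A `G`-cover `p' : X' ⟶ Y'` of the normalization `ν` of the scheme `Y` with nodes in codimension
one, and the normalizations of the preimages of the double locus. -/
structure IsSetting {G : Type v} [Group G] {Y Y' X' Ct Dt : Scheme.{u}} (ν : Y' ⟶ Y)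
    (ρ' : G →* Aut X') (p' : X' ⟶ Y') (δC : Ct ⟶ Y') (δ : Dt ⟶ X') : Prop where
  s2 : SerreS2 Y
  nodal : IsNodalAlong ν (doubleLocus Y : Set Y) δC
  normal : IsNormalScheme X'
  cover : IsGCover ρ' p'
  normalizationOf : IsNormalizationOf ((p' ≫ ν) ⁻¹' (doubleLocus Y : Set Y)) δ

namespace IsSetting

variable {G : Type v} [Group G] {Y Y' X' Ct Dt : Scheme.{u}} {ν : Y' ⟶ Y}
  {ρ' : G →* Aut X'} {p' : X' ⟶ Y'} {δC : Ct ⟶ Y'} {δ : Dt ⟶ X'} (h : IsSetting ν ρ' p' δC δ)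

include h

theorem isLocallyNoetherian_normalization : IsLocallyNoetherian Y' := by
  have := h.nodal.finite
  have := h.nodal.noetherian
  exact LocallyOfFiniteType.isLocallyNoetherian ν

theorem isLocallyNoetherian_cover : IsLocallyNoetherian X' := by
  have := h.cover.finite
  have := h.isLocallyNoetherian_normalization
  exact LocallyOfFiniteType.isLocallyNoetherian p'

theorem isReduced : IsReduced Dt := h.normalizationOf.normal.isReduced

theorem mem (t : Dt) : ν (p' (δ t)) ∈ (doubleLocus Y : Set Y) := by
  have h1 : δ t ∈ (p' ≫ ν) ⁻¹' (doubleLocus Y : Set Y) := h.normalizationOf.range_eq ▸ ⟨t, rfl⟩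
  simpa using h1

theorem lift_comp_lift {g : G} {γ γ' : Dt ⟶ Dt} (hγ : γ ≫ δ = δ ≫ (ρ' g).hom)
    (hγ' : γ' ≫ δ = δ ≫ (ρ' g⁻¹).hom) : γ ≫ γ' = 𝟙 Dt := by
  have := h.isReduced
  have := h.isLocallyNoetherian_cover
  have h1 : (γ ≫ γ') ≫ δ = 𝟙 Dt ≫ δ := by
    have h2 : (ρ' g).hom ≫ (ρ' g⁻¹).hom = 𝟙 X' := by
      have h3 : (ρ' (g⁻¹ * g)).hom = (ρ' g).hom ≫ (ρ' g⁻¹).hom := by rw [map_mul]; rfl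
      rw [← h3, inv_mul_cancel, map_one]
      rfl
    rw [Category.assoc, hγ', reassoc_of% hγ, h2, Category.id_comp, Category.comp_id]
  refine h.normalizationOf.hom_ext h1 fun t ht => ?_
  rw [← Scheme.Hom.comp_apply, h1, Category.id_comp]
  exact h.normalizationOf.isGenericIn ht

variable [Finite G]

/-- Downwards this combines going down for the quotient by `G` with the fact that components of
`ν⁻¹(C)` dominate components of `C`; upwards it is incomparability. -/
theorem isGenericIn_iff {x : X'} : IsGenericIn ((p' ≫ ν) ⁻¹' (doubleLocus Y : Set Y)) x ↔
    IsGenericIn (doubleLocus Y : Set Y) (ν (p' x)) := by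
  have := h.cover.finite
  have := h.nodal.finite
  refine ⟨fun hx => ?_, fun hx => isGenericIn_preimage (p' ≫ ν) (by rwa [Scheme.Hom.comp_apply])⟩
  refine h.nodal.generic _ (h.cover.isGenericIn_apply ?_)
  have h1 : (p' ≫ ν : X' ⟶ Y) ⁻¹' (doubleLocus Y : Set Y) =
      p' ⁻¹' (ν ⁻¹' (doubleLocus Y : Set Y)) := by
    ext; simp
  rwa [← h1]

theorem isGenericIn_apply {t : Dt} (ht : IsGenericIn Set.univ t) :
    IsGenericIn (doubleLocus Y : Set Y) (ν (p' (δ t))) :=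
  h.isGenericIn_iff.1 (h.normalizationOf.isGenericIn ht)

theorem exists_map : ∃ q : Dt ⟶ Ct, q ≫ δC = δ ≫ p' := by
  have := h.isLocallyNoetherian_normalization
  have := h.normalizationOf.noetherian
  have := h.cover.finite
  refine h.nodal.normalizationOf.exists_lift h.normalizationOf.normal (δ ≫ p') (fun t => ?_)
    fun t ht => ?_
  · rw [Scheme.Hom.comp_apply]
    exact h.mem t
  · have := h.nodal.finite
    rw [Scheme.Hom.comp_apply]
    exact isGenericIn_preimage ν (h.isGenericIn_apply ht)

theorem exists_lift (g : G) : ∃ γ : Dt ⟶ Dt, γ ≫ δ = δ ≫ (ρ' g).hom := by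
  have := h.isLocallyNoetherian_cover
  have := h.normalizationOf.noetherian
  have h1 : ∀ x, ν (p' ((ρ' g).hom x)) = ν (p' x) := fun x => by
    have h0 : p' ((ρ' g).hom x) = p' x := by rw [← Scheme.Hom.comp_apply, h.cover.comp_eq]
    exact congrArg (fun y => ν y) h0
  refine h.normalizationOf.exists_lift h.normalizationOf.normal (δ ≫ (ρ' g).hom) (fun t => ?_)
    fun t ht => ?_
  · rw [Scheme.Hom.comp_apply, Set.mem_preimage, Scheme.Hom.comp_apply, h1]
    exact h.mem t
  · rw [Scheme.Hom.comp_apply, h.isGenericIn_iff, h1]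
    exact h.isGenericIn_apply ht

end IsSetting

namespace IsGluing

variable {G : Type v} [Group G] [Finite G] {Y Y' X' X Ct Dt : Scheme.{u}} {ν : Y' ⟶ Y}
  {ρ' : G →* Aut X'} {p' : X' ⟶ Y'} {δC : Ct ⟶ Y'} {δ : Dt ⟶ X'}
  {ρ : G →* Aut X} {p : X ⟶ Y} {n : X' ⟶ X}
  (h : IsGluing ν ρ' p' ρ p n) (hs : IsSetting ν ρ' p' δC δ)

include h hs

/-- A point of `X` over a generic point of `C` has codimension one and is not regular, so normal
crossing makes it a node. Everything proved about swaps on `Y` thereby applies to `X`. -/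
theorem isNodalAlong (hnc : IsNormalCrossing X) :
    IsNodalAlong n (p ⁻¹' (doubleLocus Y : Set Y)) δ := by
  have := h.reduced
  have := h.cover.finite
  have := hs.nodal.noetherian
  have := hs.nodal.finite
  have := hs.nodal.reduced
  have hY : ∀ {P : Y}, IsGenericIn (doubleLocus Y : Set Y) P ↔ P ∈ singularCodimOne Y :=
    isGenericIn_doubleLocus_iff hs.s2 hs.nodal.normalization
  have hset : (p' ≫ ν : X' ⟶ Y) ⁻¹' (doubleLocus Y : Set Y) =
      n ⁻¹' (p ⁻¹' (doubleLocus Y : Set Y)) := by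
    rw [← h.comm]
    ext; simp
  have hpn : ∀ z, ν (p' z) = p (n z) := fun z => by
    rw [← Scheme.Hom.comp_apply, ← h.comm, Scheme.Hom.comp_apply]
  refine ⟨h.reduced, LocallyOfFiniteType.isLocallyNoetherian p, fun V => ?_, h.normalization,
    h.isFinite_normalization hs.cover, (doubleLocus Y).isClosed.preimage p.continuous,
    fun x hx => ?_, fun z hz => ?_, hset ▸ hs.normalizationOf⟩
  · have h1 : IsUnit (2 : Γ(X, p ⁻¹ᵁ ⊤)) := by
      have := (hs.nodal.two ⊤).map (p.app ⊤).hom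
      simpa only [map_ofNat] using this
    have h2 := h1.map (X.presheaf.map (homOfLE (le_top : V ≤ p ⁻¹ᵁ ⊤)).op).hom
    have h3 := map_ofNat (X.presheaf.map (homOfLE (le_top : V ≤ p ⁻¹ᵁ ⊤)).op).hom 2
    exact h3 ▸ h2
  · have h1 : p x ∈ singularCodimOne Y := hY.1 (h.cover.isGenericIn_apply hx)
    exact (hnc x ((h.cover.ringKrullDim_stalk_eq x).trans h1.1)).resolve_left
      (h.not_isRegularLocalRing hs.nodal.normalization hs.cover h1)
  · rw [← hset, hs.isGenericIn_iff, hpn] at hz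
    exact isGenericIn_preimage p hz

end IsGluing

/-! ### From a gluing to an involution covering `ι`. -/

section Swap

variable {G : Type v} [Group G] [Finite G] {Y Y' X' X Ct Dt : Scheme.{u}} {ν : Y' ⟶ Y}
  {ρ' : G →* Aut X'} {p' : X' ⟶ Y'} {δC : Ct ⟶ Y'} {δ : Dt ⟶ X'}
  {ρ : G →* Aut X} {p : X ⟶ Y} {n : X' ⟶ X}

/-- Conjugating `j` by the lift `γ` yields again a swap, because `G` preserves the preimage of the
double locus; swaps are unique. -/
theorem comp_swap_comm (hs : IsSetting ν ρ' p' δC δ) (h : IsGluing ν ρ' p' ρ p n)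
    (hnc : IsNormalCrossing X) {j : Dt ⟶ Dt} (hj : IsSwap (δ ≫ n) (p ⁻¹' (doubleLocus Y : Set Y)) j)
    {g : G} {γ : Dt ⟶ Dt} (hγ : γ ≫ δ = δ ≫ (ρ' g).hom) : γ ≫ j = j ≫ γ := by
  obtain ⟨γ', hγ'⟩ := hs.exists_lift g⁻¹
  have h1 := hs.lift_comp_lift hγ hγ'
  have h2 : γ' ≫ γ = 𝟙 Dt := hs.lift_comp_lift hγ' (by rwa [inv_inv])
  have hρ : ∀ g : G, (ρ g).hom ≫ (ρ g⁻¹).hom = 𝟙 X := fun g => by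
    have h3 : (ρ (g⁻¹ * g)).hom = (ρ g).hom ≫ (ρ g⁻¹).hom := by rw [map_mul]; rfl
    rw [← h3, inv_mul_cancel, map_one]
    rfl
  have hγn : γ ≫ δ ≫ n = (δ ≫ n) ≫ (ρ g).hom := by
    rw [reassoc_of% hγ, h.equivariant, Category.assoc]
  have hγn' : γ' ≫ δ ≫ n = (δ ≫ n) ≫ (ρ g⁻¹).hom := by
    rw [reassoc_of% hγ', h.equivariant, Category.assoc]
  have hswap : IsSwap (δ ≫ n) (p ⁻¹' (doubleLocus Y : Set Y)) (γ ≫ j ≫ γ') := by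
    refine ⟨?_, ?_, ?_⟩
    · simp only [Category.assoc]
      rw [reassoc_of% h2, reassoc_of% hj.involution, h1]
    · have h4 : j ≫ (δ ≫ n) ≫ (ρ g⁻¹).hom = (δ ≫ n) ≫ (ρ g⁻¹).hom := by
        rw [← Category.assoc, hj.comp_eq]
      have h5 : γ ≫ (δ ≫ n) ≫ (ρ g⁻¹).hom = δ ≫ n := by
        rw [← Category.assoc, hγn, Category.assoc, hρ, Category.comp_id]
      rw [Category.assoc, Category.assoc, hγn', h4, h5]
    · rintro U ⟨x, hxU, hxZ⟩ hcon
      refine hj.ne ((ρ g⁻¹).hom ⁻¹ᵁ U) ⟨(ρ g).hom x, ?_, ?_⟩ ?_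
      · have h3 : (ρ g⁻¹).hom ((ρ g).hom x) = x := by
          rw [← Scheme.Hom.comp_apply, hρ]
          rfl
        have h4 : (ρ g⁻¹).hom ((ρ g).hom x) ∈ U := by rwa [h3]
        exact h4
      · rw [Set.mem_preimage, ← Scheme.Hom.comp_apply, h.cover.comp_eq]
        exact hxZ
      · let O := (δ ≫ n) ⁻¹ᵁ U
        let O' := (δ ≫ n) ⁻¹ᵁ (ρ g⁻¹).hom ⁻¹ᵁ U
        have hO : O' ≤ γ' ⁻¹ᵁ O := by
          have h3 : (γ' ≫ δ ≫ n) ⁻¹ᵁ U = ((δ ≫ n) ≫ (ρ g⁻¹).hom) ⁻¹ᵁ U := by rw [hγn']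
          exact h3.ge
        have hr : Set.range (O'.ι ≫ γ') ⊆ Set.range O.ι := by
          rintro _ ⟨y, rfl⟩
          rw [Scheme.Opens.range_ι]
          exact hO y.2
        have h3 := congr(IsOpenImmersion.lift O.ι _ hr ≫ $hcon ≫ γ)
        simp only [Category.assoc] at h3
        rw [IsOpenImmersion.lift_fac_assoc, IsOpenImmersion.lift_fac_assoc, Category.assoc,
          Category.assoc, h2, Category.comp_id, reassoc_of% h2] at h3
        exact h3
  have := (h.isNodalAlong hs hnc).swap_unique hswap hj
  rw [← this]
  simp only [Category.assoc, h2, Category.comp_id]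
  rw [this]

end Swap

namespace IsSwapChart

variable {A B S : Type*} [CommRing A] [CommRing B] [CommRing S] {φ : A →+* B} {σ : B →+* S}
  {𝔭 : Ideal A} {e : B} (h : IsSwapChart φ σ 𝔭 e)

include h

/-- For `z = x + y e` the coefficient of `e` in `z²` is `2 x y`, so `x` or `y` lies in the prime
`𝔭`. -/
theorem eq_or_eq_mul_of_sq_eq (h2 : IsUnit (2 : A)) {z : S} {d : A} (hz : z ^ 2 = σ (φ d)) :
    (∃ x, z = σ (φ x)) ∨ ∃ y, z = σ (φ y) * σ e := by
  have := h.prime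
  obtain ⟨x, y, rfl⟩ := h.exists_eq z
  obtain ⟨Δ, -, hΔ⟩ := h.sq
  have h1 : σ (φ (x ^ 2 + y ^ 2 * Δ - d) + φ (2 * x * y) * e) = 0 := by
    have h3 : φ (x ^ 2 + y ^ 2 * Δ - d) + φ (2 * x * y) * e = (φ x + φ y * e) ^ 2 - φ d := by
      simp only [map_add, map_sub, map_mul, map_pow, map_ofNat, hΔ]
      ring
    rw [h3, map_sub, map_pow, hz, sub_self]
  have h3 := ((h.zero _ _).1 h1).2
  rw [mul_assoc] at h3
  rcases h.prime.mem_or_mem ((Ideal.unit_mul_mem_iff_mem _ h2).1 h3) with hx | hy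
  · exact .inr ⟨y, by rw [map_add, map_mul, (h.apply_eq_zero_iff x).2 hx, zero_add]⟩
  · exact .inl ⟨x, by rw [map_add, map_mul, (h.apply_eq_zero_iff y).2 hy, zero_mul, add_zero]⟩

/-- The kernel of `σ` is `𝔭 + 𝔭 e`, which is contained in the image of `A`. -/
theorem exists_apply_eq_of_apply_eq {b : B} {x : A} (hb : σ b = σ (φ x)) : ∃ a, φ a = b := by
  obtain ⟨x₁, y₁, h1⟩ := h.gen (b - φ x)
  have h3 := (h.zero x₁ y₁).1 (by rw [← h1, map_sub, hb, sub_self])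
  obtain ⟨x', -, hx'⟩ := h.mul y₁ h3.2
  exact ⟨x + x₁ + x', by rw [map_add, map_add, hx', add_assoc, ← h1]; ring⟩

theorem apply_ne_mul (s a : A) (hs : s ∉ 𝔭) : φ a ≠ φ s * e := fun ha => by
  refine hs ?_
  have h1 := (h.zero (-a) s).1 (by rw [map_neg, ha, neg_add_cancel, map_zero])
  exact h1.2

end IsSwapChart

section Compatibility

variable {G : Type v} [Group G] [Finite G] {Y Y' X' X Ct Dt : Scheme.{u}} {ν : Y' ⟶ Y}
  {ρ' : G →* Aut X'} {p' : X' ⟶ Y'} {δC : Ct ⟶ Y'} {δ : Dt ⟶ X'}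
  {ρ : G →* Aut X} {p : X ⟶ Y} {n : X' ⟶ X}

/-- If `e` were a function on `X` near `x`, then `IsGluing.exists_app_eq_mul` would make `s e` a
function on `Y` for some `s ∉ 𝔭`, against `IsSwapChart.apply_ne_mul`. -/
theorem IsGluing.forall_app_ne_appLE (h : IsGluing ν ρ' p' ρ p n) (hs : IsSetting ν ρ' p' δC δ)
    {x : X} {U : Y.Opens} {hU : p x ∈ U} {e : Γ(Y', ν ⁻¹ᵁ U)} (he : IsNodeChart ν δC (p x) U hU e)
    {V : X.Opens} (hx : x ∈ V) (hle : n ⁻¹ᵁ V ≤ p' ⁻¹ᵁ ν ⁻¹ᵁ U) (a : Γ(X, V)) :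
    n.app V a ≠ p'.appLE (ν ⁻¹ᵁ U) (n ⁻¹ᵁ V) hle e := by
  intro ha
  have := h.cover.finite
  have := hs.nodal.reduced
  have := hs.nodal.finite
  have := h.isFinite_normalization hs.cover
  have hpU : IsAffineOpen (p ⁻¹ᵁ U) := he.affine.preimage p
  have heq : n ⁻¹ᵁ p ⁻¹ᵁ U = p' ⁻¹ᵁ ν ⁻¹ᵁ U := by
    have h1 : (n ≫ p) ⁻¹ᵁ U = (p' ≫ ν) ⁻¹ᵁ U := by rw [h.comm]
    exact h1
  obtain ⟨f, hfV, hxf⟩ := hpU.exists_basicOpen_le ⟨x, hx⟩ hU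
  let b : Γ(X', n ⁻¹ᵁ p ⁻¹ᵁ U) := X'.presheaf.map (homOfLE heq.le).op (p'.app _ e)
  have hb : ∃ c, n.app (X.basicOpen f) c =
      X'.presheaf.map (homOfLE (n.preimage_mono (X.basicOpen_le f))).op b := by
    refine ⟨X.presheaf.map (homOfLE hfV).op a, ?_⟩
    rw [app_naturality, ha]
    simp only [b, Scheme.Hom.app_eq_appLE]
    have h1 : p'.appLE (ν ⁻¹ᵁ U) (n ⁻¹ᵁ V) hle ≫
        X'.presheaf.map (homOfLE (n.preimage_mono hfV)).op =
        (p'.appLE (ν ⁻¹ᵁ U) _ le_rfl ≫ X'.presheaf.map (homOfLE heq.le).op) ≫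
          X'.presheaf.map (homOfLE (n.preimage_mono (X.basicOpen_le f))).op := by
      rw [Scheme.Hom.appLE_map, Scheme.Hom.appLE_map, Scheme.Hom.appLE_map]
    exact congr($(h1).hom e)
  obtain ⟨m, c, hc⟩ := exists_app_eq_pow_mul n hpU (hpU.preimage n).isCompact f b hb
  have hxU : x ∈ p ⁻¹ᵁ U := hU
  have hf : f ^ m ∉ primeAt (p ⁻¹ᵁ U) x hxU := fun hm =>
    notMem_primeAt.2 hxf (Ideal.IsPrime.mem_of_pow_mem inferInstance m hm)
  obtain ⟨s, a, hs', ha'⟩ := h.exists_app_eq_mul hs.cover he.affine (x := x) hU e heq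
    ⟨f ^ m, c, hf, hc⟩
  exact he.swap.apply_ne_mul s a hs' ha'

/-- Compare a chart `e` of `Y` with a chart `ε` of `X`. The two composites agree on functions from
`Y`. The pullback `z` of `e` has its square among the functions from `X`, so `z` comes from `X` or
is a multiple of `ε` by such a function. The first case is excluded by
`IsGluing.forall_app_ne_appLE`; in the second `j` negates `z`, just as `ι` negates `e`. -/
theorem swap_comp_eq_comp_swap (hs : IsSetting ν ρ' p' δC δ) (h : IsGluing ν ρ' p' ρ p n)
    (hnc : IsNormalCrossing X) {ι : Ct ⟶ Ct} (hι : IsSwap (δC ≫ ν) (doubleLocus Y : Set Y) ι)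
    {j : Dt ⟶ Dt} (hj : IsSwap (δ ≫ n) (p ⁻¹' (doubleLocus Y : Set Y)) j)
    {q : Dt ⟶ Ct} (hq : q ≫ δC = δ ≫ p') : j ≫ q = q ≫ ι := by
  have hX := h.isNodalAlong hs hnc
  have := hX.isReduced
  have := hs.nodal.finite
  have := hs.nodal.normalizationOf.integral
  have h1 : (j ≫ q) ≫ δC ≫ ν = δ ≫ n ≫ p := by
    rw [Category.assoc, reassoc_of% hq, ← h.comm]
    have := hj.comp_eq
    rw [← Category.assoc] at this ⊢
    rw [← Category.assoc, ← Category.assoc, this, Category.assoc]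
  have h2 : (q ≫ ι) ≫ δC ≫ ν = δ ≫ n ≫ p := by
    rw [Category.assoc, hι.comp_eq, reassoc_of% hq, h.comm]
  have hqν : q ≫ δC ≫ ν = δ ≫ n ≫ p := by rw [reassoc_of% hq, h.comm]
  refine hom_ext_of_forall_isGenericIn (δC ≫ ν) (h1.trans h2.symm) fun t ht => ?_
  have hP : IsGenericIn (doubleLocus Y : Set Y) (p (n (δ t))) := by
    have h3 : p (n (δ t)) = ν (p' (δ t)) := by
      rw [← Scheme.Hom.comp_apply, h.comm, Scheme.Hom.comp_apply]
    rw [h3]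
    exact hs.isGenericIn_apply ht
  obtain ⟨U, hPU, e, -, he⟩ := hs.nodal.exists_nodeChart hP (W := ⊤) trivial
  obtain ⟨V, hxV, ε, hVU, hε⟩ := hX.exists_nodeChart (hX.isGenericIn_apply ht) (W := p ⁻¹ᵁ U) hPU
  have hW : IsAffineOpen (δ ⁻¹ᵁ n ⁻¹ᵁ V) := hX.isAffineOpen_preimage hε.affine
  have hWC : IsAffineOpen (δC ⁻¹ᵁ ν ⁻¹ᵁ U) := hs.nodal.isAffineOpen_preimage he.affine
  have hle : ∀ f : Dt ⟶ Ct, f ≫ δC ≫ ν = δ ≫ n ≫ p →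
      δ ⁻¹ᵁ n ⁻¹ᵁ V ≤ f ⁻¹ᵁ δC ⁻¹ᵁ ν ⁻¹ᵁ U := fun f hf => by
    have h3 : (f ≫ δC ≫ ν) ⁻¹ᵁ U = (δ ≫ n ≫ p) ⁻¹ᵁ U := by rw [hf]
    exact fun w hw => h3.ge (hVU hw)
  have hleX : n ⁻¹ᵁ V ≤ p' ⁻¹ᵁ ν ⁻¹ᵁ U := by
    have h3 : (n ≫ p) ⁻¹ᵁ U = (p' ≫ ν) ⁻¹ᵁ U := by rw [h.comm]
    exact fun w hw => h3.le (hVU hw)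
  have hA : ∀ (f : Dt ⟶ Ct) (hf : f ≫ δC ≫ ν = δ ≫ n ≫ p) (x : Γ(Y, U)),
      f.appLE (δC ⁻¹ᵁ ν ⁻¹ᵁ U) (δ ⁻¹ᵁ n ⁻¹ᵁ V) (hle f hf) (δC.app _ (ν.app U x)) =
        δ.app _ (n.app V (p.appLE U V hVU x)) := fun f hf x => by
    have h3 : (ν.app U ≫ δC.app _) ≫ f.appLE (δC ⁻¹ᵁ ν ⁻¹ᵁ U) (δ ⁻¹ᵁ n ⁻¹ᵁ V) (hle f hf) =
        (p.appLE U V hVU ≫ n.app V) ≫ δ.app _ := by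
      simp only [Scheme.Hom.app_eq_appLE, Scheme.Hom.appLE_comp_appLE, hf]
    exact congr($(h3).hom x)
  refine ⟨_, hW.fromSpec, by rw [hW.range_fromSpec]; exact hxV,
    fromSpec_comp_eq_of_appLE_eq hWC hW (hle _ h1) (hle _ h2) ?_⟩
  refine CommRingCat.hom_ext (he.swap.ringHom_ext
    (fun x => (hA _ h1 x).trans (hA _ h2 x).symm) ?_)
  have hι' := he.appLE_eq_neg (hs.nodal.two U) hP.1 hι hWC
  have hj' := hε.appLE_eq_neg (hX.two V) (hX.isGenericIn_apply ht).1 hj hW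
  set z := q.appLE _ _ (hle q hqν) (δC.app _ e) with hz
  have hl : (j ≫ q).appLE _ _ (hle _ h1) (δC.app _ e) =
      j.appLE _ _ (preimage_le_of_over hj.comp_eq V) z := by
    rw [hz]
    have h3 := Scheme.Hom.appLE_comp_appLE j q _ _ _ (hle q hqν) (preimage_le_of_over hj.comp_eq V)
    exact congr($(h3).hom (δC.app _ e)).symm
  have hr : (q ≫ ι).appLE _ _ (hle _ h2) (δC.app _ e) = - z := by
    have h3 := Scheme.Hom.appLE_comp_appLE q ι _ _ _ (preimage_le_of_over hι.comp_eq U) (hle q hqν)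
    refine congr($(h3).hom (δC.app _ e)).symm.trans ?_
    refine (congrArg (q.appLE _ _ (hle q hqν)).hom hι').trans ?_
    exact map_neg (q.appLE _ _ (hle q hqν)).hom _
  refine hl.trans (Eq.trans ?_ hr.symm)
  obtain ⟨Δ, -, hΔ⟩ := he.swap.sq
  have hzz : z ^ 2 = δ.app _ (n.app V (p.appLE U V hVU Δ)) := by
    rw [← hA q hqν, hz]
    refine (map_pow (q.appLE _ _ (hle q hqν)).hom _ 2).symm.trans (congrArg _ ?_)
    exact (map_pow (δC.app _).hom e 2).symm.trans (congrArg _ hΔ.symm)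
  rcases hε.swap.eq_or_eq_mul_of_sq_eq (hX.two V) hzz with ⟨x, hx⟩ | ⟨y, hy⟩
  · exfalso
    have hzb : δ.app _ (p'.appLE (ν ⁻¹ᵁ U) (n ⁻¹ᵁ V) hleX e) = z := by
      have h3 : p'.appLE (ν ⁻¹ᵁ U) (n ⁻¹ᵁ V) hleX ≫ δ.app _ =
          δC.app _ ≫ q.appLE _ _ (hle q hqν) := by
        simp only [Scheme.Hom.app_eq_appLE, Scheme.Hom.appLE_comp_appLE, hq]
      exact congr($(h3).hom e)
    obtain ⟨a, ha⟩ := hε.swap.exists_apply_eq_of_apply_eq (hzb.trans hx)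
    exact h.forall_app_ne_appLE hs he hxV hleX a ha
  · rw [hy]
    have hjV := appLE_app_app_of_over hj.comp_eq V y
    refine (map_mul (j.appLE _ _ (preimage_le_of_over hj.comp_eq V)).hom _ _).trans ?_
    refine (congr_arg₂ (· * ·) hjV hj').trans (mul_neg _ _)

end Compatibility

/-! ### The inertia condition. -/

section Inertia

/-- A field extension is faithfully flat. This lets an identity on `Spec κ(t)` be tested for the
smaller residue field of the image point. -/
theorem epi_specMap_residueFieldMap {X Y : Scheme.{u}} (f : X ⟶ Y) (x : X) :
    Epi (Spec.map (f.residueFieldMap x)) := by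
  algebraize [(f.residueFieldMap x).hom]
  have h1 : Flat (Spec.map (f.residueFieldMap x)) :=
    Flat.SpecMap_iff.2 (inferInstanceAs (Module.Flat (Y.residueField (f x)) (X.residueField x)))
  have h2 : Surjective (Spec.map (f.residueFieldMap x)) := ⟨fun y =>
    ⟨IsLocalRing.closedPoint (X.residueField x), Subsingleton.elim _ _⟩⟩
  exact Flat.epi_of_flat_of_surjective _

theorem IsNormalizationOf.eq_of_apply_eq {X T : Scheme.{u}} {Z : Set X} {δ : T ⟶ X}
    (h : IsNormalizationOf Z δ) [IsLocallyNoetherian X] {a b : T} (ha : IsGenericIn Z (δ a))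
    (hab : δ a = δ b) : a = b := by
  have := h.integral
  obtain ⟨Ω, hΩ, -, hcl⟩ := h.birational
  have haΩ : a ∈ δ ⁻¹ᵁ Ω := ha.mem_of_subset_closure h.isClosed hΩ
  have hbΩ : b ∈ δ ⁻¹ᵁ Ω := by
    have h1 : δ b ∈ Ω := hab ▸ haΩ
    exact h1
  have h1 : (δ ∣_ Ω) ⟨a, haΩ⟩ = (δ ∣_ Ω) ⟨b, hbΩ⟩ := by
    refine Ω.ι.isEmbedding.injective ?_
    exact (morphismRestrict_apply δ Ω ⟨a, haΩ⟩).trans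
      (hab.trans (morphismRestrict_apply δ Ω ⟨b, hbΩ⟩).symm)
  exact congrArg Subtype.val ((δ ∣_ Ω).isEmbedding.injective h1)

variable {G : Type v} [Group G] [Finite G] {Y Y' X' X Ct Dt : Scheme.{u}} {ν : Y' ⟶ Y}
  {ρ' : G →* Aut X'} {p' : X' ⟶ Y'} {δC : Ct ⟶ Y'} {δ : Dt ⟶ X'}

-- If `g` acts trivially on the residue field of `δ t`, its lift `γ` fixes the map from `Spec κ(t)`
-- to `Dt`, by uniqueness of lifts at generic points. As `γ` commutes with `j`, it also fixes the
-- composite with `j`, and the residue field extension can be cancelled.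
omit [Finite G] in
theorem IsSetting.inertia_subset (hs : IsSetting ν ρ' p' δC δ) {j : Dt ⟶ Dt}
    (hγ : ∀ g, ∃ γ : Dt ⟶ Dt, γ ≫ δ = δ ≫ (ρ' g).hom ∧ γ ≫ j = j ≫ γ) {t : Dt}
    (ht : IsGenericIn ((p' ≫ ν) ⁻¹' (doubleLocus Y : Set Y)) (δ t)) :
    inertia ρ' (δ t) ⊆ inertia ρ' (δ (j t)) := by
  intro g hg
  have := hs.isLocallyNoetherian_cover
  obtain ⟨γ, hγ, hγj⟩ := hγ g
  have h1 : Dt.fromSpecResidueField t ≫ γ = Dt.fromSpecResidueField t := by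
    have h2 : (Dt.fromSpecResidueField t ≫ γ) ≫ δ = Dt.fromSpecResidueField t ≫ δ := by
      have h3 : X'.fromSpecResidueField (δ t) ≫ (ρ' g).hom = X'.fromSpecResidueField (δ t) := hg
      rw [Category.assoc, hγ, ← Scheme.Hom.SpecMap_residueFieldMap_fromSpecResidueField_assoc, h3,
        Scheme.Hom.SpecMap_residueFieldMap_fromSpecResidueField]
    refine hs.normalizationOf.hom_ext h2 fun x _ => ?_
    rw [← Scheme.Hom.comp_apply, h2, Scheme.Hom.comp_apply, Scheme.fromSpecResidueField_apply]
    exact ht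
  have := epi_specMap_residueFieldMap (j ≫ δ) t
  have h2 : Spec.map ((j ≫ δ).residueFieldMap t) ≫ X'.fromSpecResidueField ((j ≫ δ) t) ≫
      (ρ' g).hom = Spec.map ((j ≫ δ).residueFieldMap t) ≫ X'.fromSpecResidueField ((j ≫ δ) t) := by
    rw [Scheme.Hom.SpecMap_residueFieldMap_fromSpecResidueField_assoc,
      Scheme.Hom.SpecMap_residueFieldMap_fromSpecResidueField, Category.assoc, ← hγ,
      ← reassoc_of% hγj, reassoc_of% h1]
  exact this.left_cancellation _ _ h2

theorem IsSetting.exists_apply_eq (hs : IsSetting ν ρ' p' δC δ) {x : X'} {η : Ct}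
    (hη : IsGenericIn Set.univ η) (hx : p' x = δC η) {q : Dt ⟶ Ct} (hq : q ≫ δC = δ ≫ p') :
    ∃ t, δ t = x ∧ q t = η ∧
      IsGenericIn ((p' ≫ ν) ⁻¹' (doubleLocus Y : Set Y)) (δ t) := by
  have := hs.isLocallyNoetherian_normalization
  have h1 : IsGenericIn ((p' ≫ ν) ⁻¹' (doubleLocus Y : Set Y)) x := by
    rw [hs.isGenericIn_iff, hx]
    exact hs.nodal.isGenericIn_apply hη
  obtain ⟨t, rfl⟩ : x ∈ Set.range δ := hs.normalizationOf.range_eq.symm ▸ h1.1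
  refine ⟨t, rfl, ?_, h1⟩
  refine (hs.nodal.normalizationOf.eq_of_apply_eq
    (hs.nodal.normalizationOf.isGenericIn hη) ?_).symm
  rw [← hx, ← Scheme.Hom.comp_apply, ← hq, Scheme.Hom.comp_apply]

theorem isGenericIn_univ_of_involution {T : Scheme.{u}} {ι : T ⟶ T} (hι : ι ≫ ι = 𝟙 T) {η : T}
    (hη : IsGenericIn Set.univ η) : IsGenericIn Set.univ (ι η) := by
  have h1 : ∀ x, ι (ι x) = x := fun x => by rw [← Scheme.Hom.comp_apply, hι]; rfl
  refine ⟨trivial, fun y _ hy => ?_⟩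
  have h2 := hy.map ι.continuous
  rw [h1] at h2
  rw [← hη.2 _ trivial h2, h1]

theorem IsSetting.image_inertia_subset (hs : IsSetting ν ρ' p' δC δ) {ι : Ct ⟶ Ct} {j : Dt ⟶ Dt}
    (hιν : ι ≫ δC ≫ ν = δC ≫ ν) (hj : j ≫ j = 𝟙 Dt)
    (hγ : ∀ g, ∃ γ : Dt ⟶ Dt, γ ≫ δ = δ ≫ (ρ' g).hom ∧ γ ≫ j = j ≫ γ)
    {q : Dt ⟶ Ct} (hq : q ≫ δC = δ ≫ p') (hjq : j ≫ q = q ≫ ι) {η : Ct}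
    (hη : IsGenericIn Set.univ η) :
    inertia ρ' '' {x | p' x = δC η} ⊆ inertia ρ' '' {x | p' x = δC (ι η)} := by
  rintro _ ⟨x, hx, rfl⟩
  obtain ⟨t, rfl, rfl, ht⟩ := hs.exists_apply_eq hη hx hq
  have h1 : p' (δ (j t)) = δC (ι (q t)) := by
    rw [← Scheme.Hom.comp_apply, ← hq, Scheme.Hom.comp_apply, ← Scheme.Hom.comp_apply j, hjq,
      Scheme.Hom.comp_apply]
  have h2 : IsGenericIn ((p' ≫ ν) ⁻¹' (doubleLocus Y : Set Y)) (δ (j t)) := by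
    rw [hs.isGenericIn_iff] at ht ⊢
    have h3 : ν (δC (ι (q t))) = ν (δC (q t)) := congr($hιν (q t))
    have h4 : p' (δ t) = δC (q t) := hx
    rwa [h1, h3, ← h4]
  have h3 : j (j t) = t := by rw [← Scheme.Hom.comp_apply, hj]; rfl
  refine ⟨δ (j t), h1, subset_antisymm ?_ (hs.inertia_subset hγ ht)⟩
  have h4 := hs.inertia_subset hγ h2
  rwa [h3] at h4

theorem IsSetting.image_inertia_eq (hs : IsSetting ν ρ' p' δC δ) {ι : Ct ⟶ Ct} {j : Dt ⟶ Dt}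
    (hι : ι ≫ ι = 𝟙 Ct) (hιν : ι ≫ δC ≫ ν = δC ≫ ν) (hj : j ≫ j = 𝟙 Dt)
    (hγ : ∀ g, ∃ γ : Dt ⟶ Dt, γ ≫ δ = δ ≫ (ρ' g).hom ∧ γ ≫ j = j ≫ γ)
    {q : Dt ⟶ Ct} (hq : q ≫ δC = δ ≫ p') (hjq : j ≫ q = q ≫ ι) {η : Ct}
    (hη : IsGenericIn Set.univ η) :
    inertia ρ' '' {x | p' x = δC η} = inertia ρ' '' {x | p' x = δC (ι η)} := by
  refine subset_antisymm (hs.image_inertia_subset hιν hj hγ hq hjq hη) ?_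
  have h1 := hs.image_inertia_subset hιν hj hγ hq hjq (isGenericIn_univ_of_involution hι hη)
  have h2 : ι (ι η) = η := by rw [← Scheme.Hom.comp_apply, hι]; rfl
  rwa [h2] at h1

end Inertia

/-! ### Relative spectra of quasi-coherent algebras. -/

section RelativeSpec

open Scheme.AffineZariskiSite

theorem exists_relativeSpec {Y : Scheme.{u}} {F : Y.AffineZariskiSiteᵒᵖ ⥤ CommRingCat.{u}}
    {α : (toOpensFunctor Y).op ⋙ Y.presheaf ⟶ F} (H : α.Coequifibered) :
    ∃ (X : Scheme.{u}) (p : X ⟶ Y) (i : ∀ U, Spec (F.obj (.op U)) ⟶ X),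
      (∀ U, IsOpenImmersion (i U)) ∧
      (∀ {U V : Y.AffineZariskiSite} (e : U ⟶ V), Spec.map (F.map e.op) ≫ i V = i U) ∧
      (∀ U, Set.range (i U) = p ⁻¹ᵁ U.1) ∧
      ∀ U, i U ≫ p = Spec.map (α.app (.op U)) ≫ U.2.fromSpec := by
  let D := relativeGluingData H
  have : (D.functor ⋙ Scheme.forget).IsLocallyDirected :=
    Scheme.Cover.RelativeGluingData.instIsLocallyDirectedI₀CompFunctorForgetOfIsThin D
  have : ∀ {i j} (hij : i ⟶ j), IsOpenImmersion (D.functor.map hij) := fun hij =>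
    Scheme.Cover.RelativeGluingData.instIsOpenImmersionMapI₀Functor D hij
  refine ⟨D.glued, D.toBase, fun U => colimit.ι D.functor U, fun U => ?_, fun {U V} e => ?_,
    fun U => ?_, fun U => ?_⟩
  · exact Scheme.Cover.map_prop D.cover U
  · exact colimit.w D.functor e
  · exact (D.preimage_toBase_eq_range_ι U).symm.trans
      (congrArg (D.toBase ⁻¹' ·) (Scheme.Opens.range_ι U.1))
  · exact colimit.ι_desc _ _

theorem exists_glued_hom {X' X Y : Scheme.{u}} (f : X' ⟶ Y)
    (g : ∀ U : Y.AffineZariskiSite, (f ⁻¹ᵁ U.1).toScheme ⟶ X)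
    (hg : ∀ {U V : Y.AffineZariskiSite} (e : U ⟶ V),
      X'.homOfLE (f.preimage_mono (leOfHom ((toOpensFunctor Y).map e))) ≫ g V = g U) :
    ∃ n : X' ⟶ X, ∀ U, (f ⁻¹ᵁ U.1).ι ≫ n = g U := by
  let 𝒰 : X'.OpenCover := (directedCover Y).pullback₁ f
  have h1 : ∀ {U V : Y.AffineZariskiSite} (e : U ⟶ V),
      𝒰.trans e ≫ (pullbackRestrictIsoRestrict f V.1).hom =
        (pullbackRestrictIsoRestrict f U.1).hom ≫
          X'.homOfLE (f.preimage_mono (leOfHom ((toOpensFunctor Y).map e))) := fun {U V} e => by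
    refine (cancel_mono (f ⁻¹ᵁ V.1).ι).1 ?_
    refine (Category.assoc _ _ _).trans ?_
    refine (congrArg (𝒰.trans e ≫ ·) (pullbackRestrictIsoRestrict_hom_ι f V.1)).trans ?_
    refine (Scheme.Cover.LocallyDirected.w e).trans ?_
    refine (pullbackRestrictIsoRestrict_hom_ι f U.1).symm.trans ?_
    exact (congrArg ((pullbackRestrictIsoRestrict f U.1).hom ≫ ·)
      (Scheme.homOfLE_ι _ _).symm).trans (Category.assoc _ _ _).symm
  let n := 𝒰.glueMorphismsOfLocallyDirected
    (fun U => (pullbackRestrictIsoRestrict f _).hom ≫ g U) fun {U V} e => by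
      refine (Category.assoc _ _ _).symm.trans ((congrArg (· ≫ g V) (h1 e)).trans ?_)
      exact (Category.assoc _ _ _).trans (congrArg (_ ≫ ·) (hg e))
  refine ⟨n, fun U => ?_⟩
  have h2 : 𝒰.f U ≫ n = (pullbackRestrictIsoRestrict f U.1).hom ≫ g U :=
    𝒰.map_glueMorphismsOfLocallyDirected _ _ U
  have h3 : 𝒰.f U = (pullbackRestrictIsoRestrict f U.1).hom ≫ (f ⁻¹ᵁ U.1).ι :=
    (pullbackRestrictIsoRestrict_hom_ι f U.1).symm
  refine (cancel_epi (pullbackRestrictIsoRestrict f U.1).hom).1 (Eq.trans ?_ h2)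
  exact (Category.assoc _ _ _).symm.trans (congrArg (· ≫ n) h3.symm)

end RelativeSpec

section RelativeSpec

theorem exists_iso_of_ι_comp_eq {X' X : Scheme.{u}} {O : X'.Opens} {W : X.Opens}
    {R : CommRingCat.{u}}
    (b : R ⟶ Γ(X', O)) (i : Spec R ⟶ X) [IsOpenImmersion i] (hi : Set.range i = W) {n : X' ⟶ X}
    (hn : O.ι ≫ n = O.toSpecΓ ≫ Spec.map b ≫ i) :
    ∃ θ : Γ(X, W) ≅ R, ∀ h : O ≤ n ⁻¹ᵁ W, n.appLE W O h = θ.hom ≫ b := by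
  have h1 : W = i.opensRange := (TopologicalSpace.Opens.ext hi).symm
  have htop : (⊤ : (Spec R).Opens) ≤ i ⁻¹ᵁ W := by
    rw [h1, Scheme.Hom.preimage_opensRange]
  have hiso : IsIso (i.appLE W ⊤ htop) := by
    have h2 : IsIso (i.app W) := Scheme.Hom.isIso_app _ _ h1.le
    rw [Scheme.Hom.appLE]
    have h3 : i ⁻¹ᵁ W = ⊤ := top_le_iff.1 htop
    have h4 : IsIso (homOfLE htop) := ⟨homOfLE h3.le, rfl, rfl⟩
    infer_instance
  refine ⟨asIso (i.appLE W ⊤ htop) ≪≫ Scheme.ΓSpecIso _, fun h => ?_⟩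
  have h2 : (⊤ : O.toScheme.Opens) ≤ O.ι ⁻¹ᵁ O := by simp
  have h3 : (⊤ : O.toScheme.Opens) ≤ (O.ι ≫ n) ⁻¹ᵁ W := fun z _ => h z.2
  have h4 : (O.ι ≫ n).appLE W ⊤ h3 = n.appLE W O h ≫ O.ι.appLE O ⊤ h2 := by
    rw [Scheme.Hom.appLE_comp_appLE]
  have h5 : O.ι.appLE O ⊤ h2 = O.topIso.inv := by
    simp only [Scheme.Hom.appLE, Scheme.Opens.ι_app, Scheme.Opens.topIso_inv, eqToHom_op]
    exact (X'.presheaf.map_comp _ _).symm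
  have h6 : (O.ι ≫ n).appLE W ⊤ h3 =
      (i.appLE W ⊤ htop ≫ (Spec.map b).appTop) ≫ O.toSpecΓ.appTop := by
    have hb : (⊤ : (Spec Γ(X', O)).Opens) ≤ Spec.map b ⁻¹ᵁ ⊤ := le_rfl
    have hO : (⊤ : O.toScheme.Opens) ≤ O.toSpecΓ ⁻¹ᵁ ⊤ := le_rfl
    have h7 : (Spec.map b).appTop = (Spec.map b).appLE ⊤ ⊤ hb := (Scheme.Hom.appLE_eq_app _).symm
    have h8 : O.toSpecΓ.appTop = O.toSpecΓ.appLE ⊤ ⊤ hO := (Scheme.Hom.appLE_eq_app _).symm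
    rw [h7, h8, Scheme.Hom.appLE_comp_appLE, Scheme.Hom.appLE_comp_appLE]
    simp only [hn]
  rw [h4, h5] at h6
  have h7 : (Spec.map b).appTop ≫ (Scheme.ΓSpecIso _).hom = (Scheme.ΓSpecIso _).hom ≫ b :=
    Scheme.ΓSpecIso_naturality b
  rw [← cancel_mono O.topIso.inv, h6, Scheme.Opens.toSpecΓ_appTop, Iso.trans_hom, asIso_hom,
    Category.assoc, Category.assoc, Category.assoc, reassoc_of% h7]

open Scheme.AffineZariskiSite

theorem toSpecΓ_specMap_app_fromSpec {X Y : Scheme.{u}} (f : X ⟶ Y) {U : Y.Opens}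
    (hU : IsAffineOpen U) :
    (f ⁻¹ᵁ U).toSpecΓ ≫ Spec.map (f.app U) ≫ hU.fromSpec = (f ⁻¹ᵁ U).ι ≫ f := by
  simp

theorem specMap_comp_eq {A B C : CommRingCat.{u}} {a : A ⟶ B} {b : B ⟶ C} {c : A ⟶ C}
    (h : a ≫ b = c) {X : Scheme.{u}} (i : Spec A ⟶ X) :
    Spec.map b ≫ Spec.map a ≫ i = Spec.map c ≫ i := by
  rw [← h, Spec.map_comp, Category.assoc]

/-- The morphism `n` is glued from the maps given by `β` on the preimages of affine opens; the
isomorphisms with `F` remember that `n` induces `β` on functions. -/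
theorem exists_relativeSpec_factorization {X' Y : Scheme.{u}} (f : X' ⟶ Y)
    {F : Y.AffineZariskiSiteᵒᵖ ⥤ CommRingCat.{u}}
    {α : (toOpensFunctor Y).op ⋙ Y.presheaf ⟶ F} (H : α.Coequifibered)
    (β : ∀ U : Y.AffineZariskiSite, F.obj (.op U) ⟶ Γ(X', f ⁻¹ᵁ U.1))
    (hβ : ∀ {U V : Y.AffineZariskiSite} (e : U ⟶ V), F.map e.op ≫ β U =
      β V ≫ X'.presheaf.map (homOfLE (f.preimage_mono (leOfHom ((toOpensFunctor Y).map e)))).op)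
    (hα : ∀ U : Y.AffineZariskiSite, α.app (.op U) ≫ β U = f.app U.1) :
    ∃ (X : Scheme.{u}) (p : X ⟶ Y) (n : X' ⟶ X), n ≫ p = f ∧ IsAffineHom p ∧
      ∀ U : Y.AffineZariskiSite, ∃ θ : Γ(X, p ⁻¹ᵁ U.1) ≅ F.obj (.op U),
        ∀ h : f ⁻¹ᵁ U.1 ≤ n ⁻¹ᵁ p ⁻¹ᵁ U.1, n.appLE (p ⁻¹ᵁ U.1) (f ⁻¹ᵁ U.1) h = θ.hom ≫ β U := by
  obtain ⟨X, p, i, hi, hic, hrange, hip⟩ := exists_relativeSpec H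
  obtain ⟨n, hn⟩ := exists_glued_hom f
    (fun U => (f ⁻¹ᵁ U.1).toSpecΓ ≫ Spec.map (β U) ≫ i U) fun {U V} e => by
      refine (Scheme.Opens.toSpecΓ_SpecMap_presheaf_map_assoc _ _ _ _).symm.trans
        (congrArg ((f ⁻¹ᵁ U.1).toSpecΓ ≫ ·) ?_)
      exact (specMap_comp_eq (hβ e).symm (i V)).trans
        ((specMap_comp_eq rfl (i V)).symm.trans (congrArg (Spec.map (β U) ≫ ·) (hic e)))
  have hnp : n ≫ p = f := by
    refine Scheme.Cover.hom_ext (X'.openCoverOfIsOpenCover _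
      (.comap (iSup_affineOpens_eq_top Y) f.base.hom)) _ _ fun U => ?_
    have h1 : (f ⁻¹ᵁ U.1).ι ≫ n ≫ p = (f ⁻¹ᵁ U.1).ι ≫ f := by
      refine (Category.assoc _ _ _).symm.trans ((congrArg (· ≫ p) (hn U)).trans ?_)
      have h2 : Spec.map (β U) ≫ i U ≫ p = Spec.map (f.app U.1) ≫ U.2.fromSpec :=
        (congrArg (Spec.map (β U) ≫ ·) (hip U)).trans (specMap_comp_eq (hα U) U.2.fromSpec)
      refine (Category.assoc _ _ _).trans ((congrArg ((f ⁻¹ᵁ U.1).toSpecΓ ≫ ·)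
        ((Category.assoc _ _ _).trans h2)).trans (toSpecΓ_specMap_app_fromSpec f U.2))
    exact h1
  refine ⟨X, p, n, hnp, ⟨fun U hU => ?_⟩, fun U => ?_⟩
  · have := hi ⟨U, hU⟩
    have h1 : (i ⟨U, hU⟩).opensRange = p ⁻¹ᵁ U := TopologicalSpace.Opens.ext (hrange ⟨U, hU⟩)
    exact h1 ▸ isAffineOpen_opensRange _
  · have := hi U
    exact exists_iso_of_ι_comp_eq (β U) (i U) (hrange U) (hn U)

end RelativeSpec

/-! ### Coequalizers of two morphisms over a base. -/

section EqLocus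

/-- Equalizers commute with localization: clear the denominator of an equalized element, then kill
the difference of its two images by a further power of `s`. -/
theorem isLocalization_away_eqLocus {R R' S S' : Type*} [CommRing R] [CommRing R'] [CommRing S]
    [CommRing S'] {σ τ : R →+* S} {σ' τ' : R' →+* S'} (φ : R →+* R') (ψ : S →+* S')
    (hσ : ∀ r, σ' (φ r) = ψ (σ r)) (hτ : ∀ r, τ' (φ r) = ψ (τ r))
    (φ₀ : σ.eqLocus τ →+* σ'.eqLocus τ') (hφ₀ : ∀ r, (φ₀ r : R') = φ r)
    (s : σ.eqLocus τ) (hs : IsUnit (φ s))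
    (hsurj : ∀ r', ∃ (n : ℕ) (r : R), φ ((s : R) ^ n) * r' = φ r)
    (hinj : ∀ r r', φ r = φ r' → ∃ n : ℕ, (s : R) ^ n * r = (s : R) ^ n * r')
    (hinj' : ∀ x y, ψ x = ψ y → ∃ n : ℕ, σ ((s : R) ^ n) * x = σ ((s : R) ^ n) * y) :
    @IsLocalization.Away _ _ s (σ'.eqLocus τ') _ φ₀.toAlgebra := by
  let := φ₀.toAlgebra
  have hst : ∀ n : ℕ, σ ((s : R) ^ n) = τ ((s : R) ^ n) := fun n => (s ^ n).2
  have hu : ∀ n : ℕ, IsUnit (ψ (σ ((s : R) ^ n))) := fun n => by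
    rw [← hσ, map_pow]
    exact (hs.pow n).map σ'
  refine IsLocalization.Away.mk (S := σ'.eqLocus τ') s ?_ ?_ ?_
  · obtain ⟨r, hr⟩ := hs.exists_right_inv
    have hr' : σ' r = τ' r := by
      have h1 : ψ (σ s) * σ' r = 1 := by rw [← hσ, ← map_mul, hr, map_one]
      have h2 : ψ (σ s) * τ' r = 1 := by rw [s.2, ← hτ, ← map_mul, hr, map_one]
      refine (IsUnit.of_mul_eq_one _ h1).mul_left_cancel (h1.trans h2.symm)
    refine IsUnit.of_mul_eq_one ⟨r, hr'⟩ (Subtype.ext ?_)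
    exact (congrArg (· * r) (hφ₀ s)).trans hr
  · rintro ⟨r', hr'⟩
    obtain ⟨n, r, hr⟩ := hsurj r'
    have h1 : ψ (σ r) = ψ (τ r) := by
      rw [← hσ, ← hτ, ← hr, map_mul, map_mul, hr', hσ, hτ, hst]
    obtain ⟨m, hm⟩ := hinj' _ _ h1
    refine ⟨m + n, ⟨(s : R) ^ m * r, ?_⟩, Subtype.ext ?_⟩
    · change σ _ = τ _
      rw [map_mul, map_mul, hm, hst]
    · refine Eq.trans ?_ (hφ₀ _).symm
      change r' * ((φ₀ s ^ (m + n) : σ'.eqLocus τ') : R') = φ ((s : R) ^ m * r)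
      rw [← map_pow, hφ₀, map_mul, ← hr, ← mul_assoc, ← map_mul, ← pow_add, mul_comm]
      rfl
  · rintro ⟨a, ha⟩ ⟨b, hb⟩ hab
    have h1 : φ a = φ b := by
      have := congrArg Subtype.val hab
      exact (hφ₀ ⟨a, ha⟩).symm.trans (this.trans (hφ₀ ⟨b, hb⟩))
    obtain ⟨n, hn⟩ := hinj _ _ h1
    exact ⟨n, Subtype.ext hn⟩

end EqLocus

section Coequalizer

open Scheme.AffineZariskiSite

variable {D X' Y : Scheme.{u}} {π : X' ⟶ Y} {θ : D ⟶ Y}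

theorem preimage_le_preimage {a : D ⟶ X'} (ha : a ≫ π = θ) (U : Y.Opens) :
    θ ⁻¹ᵁ U ≤ a ⁻¹ᵁ π ⁻¹ᵁ U := by
  have h1 : (a ≫ π) ⁻¹ᵁ U = θ ⁻¹ᵁ U := by rw [ha]
  exact h1.ge

/-- The pullback of functions on preimages of open subsets of the base. -/
noncomputable def pullbackOver {a : D ⟶ X'} (ha : a ≫ π = θ) (U : Y.Opens) :
    Γ(X', π ⁻¹ᵁ U) ⟶ Γ(D, θ ⁻¹ᵁ U) :=
  a.appLE (π ⁻¹ᵁ U) (θ ⁻¹ᵁ U) (preimage_le_preimage ha U)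

theorem app_comp_pullbackOver {a : D ⟶ X'} (ha : a ≫ π = θ) (U : Y.Opens) :
    π.app U ≫ pullbackOver ha U = θ.app U := by
  simp only [pullbackOver, Scheme.Hom.app_eq_appLE, Scheme.Hom.appLE_comp_appLE, ha]

theorem map_comp_pullbackOver {a : D ⟶ X'} (ha : a ≫ π = θ) {U V : Y.Opens} (h : U ≤ V) :
    X'.presheaf.map (homOfLE (π.preimage_mono h)).op ≫ pullbackOver ha U =
      pullbackOver ha V ≫ D.presheaf.map (homOfLE (θ.preimage_mono h)).op := by
  rw [pullbackOver, pullbackOver, Scheme.Hom.map_appLE, Scheme.Hom.appLE_map]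

variable {a b : D ⟶ X'} (ha : a ≫ π = θ) (hb : b ≫ π = θ)

/-- The functions on which two morphisms agree. -/
noncomputable def equalizerRing (U : Y.Opens) : Subring Γ(X', π ⁻¹ᵁ U) :=
  (pullbackOver ha U).hom.eqLocus (pullbackOver hb U).hom

theorem map_mem_equalizerRing {U V : Y.Opens} (h : U ≤ V) {r : Γ(X', π ⁻¹ᵁ V)}
    (hr : r ∈ equalizerRing ha hb V) :
    X'.presheaf.map (homOfLE (π.preimage_mono h)).op r ∈ equalizerRing ha hb U := by
  refine (congr($(map_comp_pullbackOver ha h) r)).trans (Eq.trans ?_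
    (congr($(map_comp_pullbackOver hb h) r)).symm)
  exact congrArg (D.presheaf.map (homOfLE (θ.preimage_mono h)).op) hr

theorem app_mem_equalizerRing {U : Y.Opens} (x : Γ(Y, U)) :
    π.app U x ∈ equalizerRing ha hb U :=
  (congr($(app_comp_pullbackOver ha U) x)).trans (congr($(app_comp_pullbackOver hb U) x)).symm

/-- The restriction maps of `equalizerRing`. -/
noncomputable def equalizerRingMap {U V : Y.Opens} (h : U ≤ V) :
    equalizerRing ha hb V →+* equalizerRing ha hb U :=
  (X'.presheaf.map (homOfLE (π.preimage_mono h)).op).hom.restrict _ _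
    fun _ hr => map_mem_equalizerRing ha hb h hr

/-- The sheaf of functions on which two morphisms agree. -/
noncomputable def equalizerFunctor : Y.AffineZariskiSiteᵒᵖ ⥤ CommRingCat.{u} where
  obj U := .of (equalizerRing ha hb U.unop.1)
  map e := CommRingCat.ofHom
    (equalizerRingMap ha hb (leOfHom ((toOpensFunctor Y).map e.unop)))
  map_id U := by
    refine CommRingCat.hom_ext (RingHom.ext fun r => Subtype.ext ?_)
    exact congr($(X'.presheaf.map_id _) r.1)
  map_comp e e' := by
    refine CommRingCat.hom_ext (RingHom.ext fun r => Subtype.ext ?_)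
    exact congr($(X'.presheaf.map_comp _ _) r.1)

/-- The structure map of `equalizerFunctor`. -/
noncomputable def toEqualizerFunctor :
    (toOpensFunctor Y).op ⋙ Y.presheaf ⟶ equalizerFunctor ha hb where
  app U := CommRingCat.ofHom ((π.app U.unop.1).hom.codRestrict _
    fun x => app_mem_equalizerRing ha hb x)
  naturality U V e := by
    refine CommRingCat.hom_ext (RingHom.ext fun r => Subtype.ext ?_)
    exact congr($(π.naturality ((toOpensFunctor Y).map e.unop).op) r)

/-- Quasi-coherence of the sheaf of equalized functions; affineness of `π` and `θ` supplies the
three localization properties. -/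
theorem coequifibered_toEqualizerFunctor [IsAffineHom π] [IsAffineHom θ] :
    (toEqualizerFunctor ha hb).Coequifibered := by
  refine coequifibered_iff_forall_isLocalizationAway.mpr fun U s => ?_
  refine isLocalization_away_eqLocus (σ := (pullbackOver ha U.1).hom)
    (τ := (pullbackOver hb U.1).hom) (σ' := (pullbackOver ha (Y.basicOpen s)).hom)
    (τ' := (pullbackOver hb (Y.basicOpen s)).hom)
    (X'.presheaf.map (homOfLE (π.preimage_mono (Y.basicOpen_le s))).op).hom
    (D.presheaf.map (homOfLE (θ.preimage_mono (Y.basicOpen_le s))).op).hom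
    (fun r => congr($(map_comp_pullbackOver ha (Y.basicOpen_le s)) r))
    (fun r => congr($(map_comp_pullbackOver hb (Y.basicOpen_le s)) r))
    (equalizerRingMap ha hb (Y.basicOpen_le s)) (fun r => rfl)
    ⟨π.app U.1 s, app_mem_equalizerRing ha hb s⟩ ?_ (fun r' => ?_) (fun r r' h => ?_)
    (fun x y h => ?_)
  · have h1 := app_naturality π (Y.basicOpen_le s) s
    have h2 := (RingedSpace.isUnit_res_basicOpen _ s).map (π.app (Y.basicOpen s)).hom
    exact h1 ▸ h2
  · obtain ⟨n, r, hr⟩ := exists_app_pow_mul_eq_res π (U.2.preimage π) s r'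
    refine ⟨n, r, Eq.trans ?_ hr⟩
    exact congrArg (fun z =>
      X'.presheaf.map (homOfLE (π.preimage_mono (Y.basicOpen_le s))).op z * r')
      (map_pow (π.app U.1).hom s n).symm
  · obtain ⟨n, hn⟩ := exists_app_pow_mul_eq_of_res_eq π (U.2.preimage π) s h
    have h1 := map_pow (π.app U.1).hom s n
    exact ⟨n, (congrArg (· * r) h1.symm).trans (hn.trans (congrArg (· * r') h1))⟩
  · obtain ⟨n, hn⟩ := exists_app_pow_mul_eq_of_res_eq θ (U.2.preimage θ) s h
    have h1 := map_pow (π.app U.1).hom s n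
    have h2 : pullbackOver ha U.1 (π.app U.1 s ^ n) = θ.app U.1 (s ^ n) :=
      (congrArg (pullbackOver ha U.1) h1.symm).trans
        (congr($(app_comp_pullbackOver ha U.1) (s ^ n)))
    exact ⟨n, (congrArg (· * x) h2).trans (hn.trans (congrArg (· * y) h2.symm))⟩

/-- The relative spectrum of the equalized functions. For `a = δ` and `b = j ≫ δ` it pinches `X'` by
identifying `δ t` with `δ (j t)`. -/
theorem exists_coequalizer [IsAffineHom π] [IsAffineHom θ] :
    ∃ (X : Scheme.{u}) (p : X ⟶ Y) (n : X' ⟶ X) (hnp : n ≫ p = π), IsAffineHom p ∧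
      ∀ U : Y.Opens, IsAffineOpen U → Function.Injective (pullbackOver hnp U) ∧
        ∀ r, (∃ c, pullbackOver hnp U c = r) ↔ pullbackOver ha U r = pullbackOver hb U r := by
  obtain ⟨X, p, n, hnp, hp, h⟩ := exists_relativeSpec_factorization π
    (coequifibered_toEqualizerFunctor ha hb)
    (fun U => CommRingCat.ofHom (equalizerRing ha hb U.1).subtype) (fun e => rfl) (fun U => rfl)
  refine ⟨X, p, n, hnp, hp, fun U hU => ?_⟩
  obtain ⟨θ, hθ⟩ := h ⟨U, hU⟩
  have hθ : pullbackOver hnp U = θ.hom ≫ CommRingCat.ofHom (equalizerRing ha hb U).subtype :=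
    hθ (preimage_le_preimage hnp U)
  have h1 : ∀ c, pullbackOver hnp U c = (θ.hom c : equalizerRing ha hb U).1 := fun c =>
    congr($hθ c)
  have hinv : ∀ z, θ.hom (θ.inv z) = z := fun z => congr($(θ.inv_hom_id) z)
  refine ⟨fun c c' hc => ?_, fun r => ⟨?_, fun hr => ⟨θ.inv ⟨r, hr⟩, ?_⟩⟩⟩
  · rw [h1, h1] at hc
    have h2 := congrArg θ.inv (Subtype.ext hc)
    have h3 : ∀ z, θ.inv (θ.hom z) = z := fun z => congr($(θ.hom_inv_id) z)
    exact (h3 c).symm.trans (h2.trans (h3 c'))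
  · rintro ⟨c, rfl⟩
    rw [h1]
    exact (θ.hom c : equalizerRing ha hb U).2
  · rw [h1]
    exact congrArg Subtype.val (hinv ⟨r, hr⟩)

end Coequalizer

/-! ### Morphisms to a scheme affine over the base. -/

section HomOver

theorem toSpecΓ_specMap_appLE_fromSpec {X Y : Scheme.{u}} (f : X ⟶ Y) {U : Y.Opens}
    (hU : IsAffineOpen U) {O : X.Opens} (h : O ≤ f ⁻¹ᵁ U) :
    O.toSpecΓ ≫ Spec.map (f.appLE U O h) ≫ hU.fromSpec = O.ι ≫ f := by
  simp

theorem toSpecΓ_specMap_injective {X : Scheme.{u}} {O : X.Opens} {R : CommRingCat.{u}}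
    {a b : R ⟶ Γ(X, O)} (h : O.toSpecΓ ≫ Spec.map a = O.toSpecΓ ≫ Spec.map b) : a = b := by
  have h1 : ∀ a : R ⟶ Γ(X, O), (O.toSpecΓ ≫ Spec.map a).appTop =
      (Scheme.ΓSpecIso R).hom ≫ a ≫ O.topIso.inv := fun a => by
    have h2 : (Spec.map a).appTop ≫ (Scheme.ΓSpecIso _).hom = (Scheme.ΓSpecIso _).hom ≫ a :=
      Scheme.ΓSpecIso_naturality a
    have h3 : (O.toSpecΓ ≫ Spec.map a).appTop = (Spec.map a).appTop ≫ O.toSpecΓ.appTop :=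
      Scheme.Hom.comp_app _ _ _
    rw [h3, Scheme.Opens.toSpecΓ_appTop, reassoc_of% h2]
  have h2 := (h1 a).symm.trans ((congrArg Scheme.Hom.appTop h).trans (h1 b))
  exact (cancel_mono _).1 ((cancel_epi _).1 h2)

variable {S T Y : Scheme.{u}} {p : T ⟶ Y} {f : S ⟶ Y} [IsAffineHom p]

theorem hom_ext_of_pullbackOver_eq {m m' : S ⟶ T} (hm : m ≫ p = f) (hm' : m' ≫ p = f)
    (h : ∀ U, IsAffineOpen U → pullbackOver hm U = pullbackOver hm' U) : m = m' := by
  refine Scheme.Cover.hom_ext (S.openCoverOfIsOpenCover _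
    (.comap (iSup_affineOpens_eq_top Y) f.base.hom)) _ _ fun U => ?_
  have h1 : (f ⁻¹ᵁ U.1).ι ≫ m = (f ⁻¹ᵁ U.1).ι ≫ m' := by
    rw [← toSpecΓ_specMap_appLE_fromSpec m (U.2.preimage p) (preimage_le_preimage hm U.1),
      ← toSpecΓ_specMap_appLE_fromSpec m' (U.2.preimage p) (preimage_le_preimage hm' U.1)]
    exact congrArg (fun z =>
      (f ⁻¹ᵁ U.1).toSpecΓ ≫ Spec.map z ≫ (U.2.preimage p).fromSpec) (h U.1 U.2)
  exact h1

theorem exists_hom_of_pullback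
    (φ : ∀ U : Y.Opens, IsAffineOpen U → (Γ(T, p ⁻¹ᵁ U) ⟶ Γ(S, f ⁻¹ᵁ U)))
    (hres : ∀ U V (hU : IsAffineOpen U) (hV : IsAffineOpen V) (h : U ≤ V),
      φ V hV ≫ S.presheaf.map (homOfLE (f.preimage_mono h)).op =
        T.presheaf.map (homOfLE (p.preimage_mono h)).op ≫ φ U hU)
    (hφ : ∀ U hU, p.app U ≫ φ U hU = f.app U) :
    ∃ (m : S ⟶ T) (hm : m ≫ p = f), ∀ U hU, pullbackOver hm U = φ U hU := by
  obtain ⟨m, hm⟩ := exists_glued_hom f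
    (fun U => (f ⁻¹ᵁ U.1).toSpecΓ ≫ Spec.map (φ U.1 U.2) ≫ (U.2.preimage p).fromSpec)
    fun {U V} e => by
      refine (Scheme.Opens.toSpecΓ_SpecMap_presheaf_map_assoc _ _ _ _).symm.trans
        (congrArg ((f ⁻¹ᵁ U.1).toSpecΓ ≫ ·) ?_)
      have h := leOfHom ((Scheme.AffineZariskiSite.toOpensFunctor Y).map e)
      exact (specMap_comp_eq (hres U.1 V.1 U.2 V.2 h) (V.2.preimage p).fromSpec).trans
        ((specMap_comp_eq rfl (V.2.preimage p).fromSpec).symm.trans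
          (congrArg (Spec.map (φ U.1 U.2) ≫ ·) ((V.2.preimage p).map_fromSpec (U.2.preimage p) _)))
  have hmp : m ≫ p = f := by
    refine Scheme.Cover.hom_ext (S.openCoverOfIsOpenCover _
      (.comap (iSup_affineOpens_eq_top Y) f.base.hom)) _ _ fun U => ?_
    have h1 : (f ⁻¹ᵁ U.1).ι ≫ m ≫ p = (f ⁻¹ᵁ U.1).ι ≫ f := by
      refine (Category.assoc _ _ _).symm.trans ((congrArg (· ≫ p) (hm ⟨U.1, U.2⟩)).trans ?_)
      have h3 : (U.2.preimage p).fromSpec ≫ p = Spec.map (p.app U.1) ≫ U.2.fromSpec := by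
        rw [← U.2.SpecMap_appLE_fromSpec p (U.2.preimage p) le_rfl, Scheme.Hom.app_eq_appLE]
      have h2 : Spec.map (φ U.1 U.2) ≫ (U.2.preimage p).fromSpec ≫ p =
          Spec.map (f.app U.1) ≫ U.2.fromSpec :=
        (congrArg (Spec.map (φ U.1 U.2) ≫ ·) h3).trans (specMap_comp_eq (hφ U.1 U.2) U.2.fromSpec)
      exact (Category.assoc _ _ _).trans ((congrArg ((f ⁻¹ᵁ U.1).toSpecΓ ≫ ·)
        ((Category.assoc _ _ _).trans h2)).trans (toSpecΓ_specMap_app_fromSpec f U.2))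
    exact h1
  refine ⟨m, hmp, fun U hU => toSpecΓ_specMap_injective ?_⟩
  rw [← cancel_mono (hU.preimage p).fromSpec, Category.assoc, Category.assoc]
  exact (toSpecΓ_specMap_appLE_fromSpec m (hU.preimage p) _).trans (hm ⟨U, hU⟩)

end HomOver

/-! ### The pinched scheme: finiteness, normalization and group action. -/

section Pinching

theorem exists_ringHom_comp_eq {A B : Type*} [CommRing A] [CommRing B] (φ : A →+* B)
    (hφ : Function.Injective φ) (ψ : B →+* B) (h : ∀ x, ∃ y, φ y = ψ (φ x)) :
    ∃ ψ₀ : A →+* A, ∀ x, φ (ψ₀ x) = ψ (φ x) := by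
  choose f hf using h
  refine ⟨{ toFun := f, map_one' := ?_, map_mul' := ?_, map_zero' := ?_, map_add' := ?_ }, hf⟩
  all_goals intros; apply hφ; simp [hf]

/-- The morphism `n : X' ⟶ X` over `Y` is the coequalizer of `a` and `b`, compatibly with
the restriction to open subsets of `Y`. -/
structure IsPinching {D X' X Y : Scheme.{u}} {π : X' ⟶ Y} {θ : D ⟶ Y} {a b : D ⟶ X'} {p : X ⟶ Y}
    {n : X' ⟶ X} (hn : n ≫ p = π) (ha : a ≫ π = θ) (hb : b ≫ π = θ) : Prop where
  affine : IsAffineHom p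
  injective : ∀ U : Y.Opens, IsAffineOpen U → Function.Injective (pullbackOver hn U)
  range : ∀ U : Y.Opens, IsAffineOpen U →
    ∀ r, (∃ c, pullbackOver hn U c = r) ↔ pullbackOver ha U r = pullbackOver hb U r

namespace IsPinching

variable {D X' X Y : Scheme.{u}} {π : X' ⟶ Y} {θ : D ⟶ Y} {a b : D ⟶ X'} {p : X ⟶ Y}
  {n : X' ⟶ X} {hn : n ≫ p = π} {ha : a ≫ π = θ} {hb : b ≫ π = θ} (h : IsPinching hn ha hb)

include h

/-- The functions on `X` form a submodule of the finite module of functions on `X'` over a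
noetherian ring. -/
theorem isFinite_base [IsLocallyNoetherian Y] [IsFinite π] : IsFinite p := by
  have := h.affine
  refine { finite_app := fun U hU => ?_ }
  have hnoeth : IsNoetherianRing Γ(Y, U) := IsLocallyNoetherian.component_noetherian ⟨U, hU⟩
  have h1 : (π.app U).hom.Finite := IsFinite.finite_app π U hU
  algebraize [(π.app U).hom, (p.app U).hom]
  let l : Γ(X, p ⁻¹ᵁ U) →ₐ[Γ(Y, U)] Γ(X', π ⁻¹ᵁ U) :=
    { (pullbackOver hn U).hom with
      commutes' := fun x => congr($(app_comp_pullbackOver hn U) x) }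
  have h2 : Module.Finite Γ(Y, U) Γ(X, p ⁻¹ᵁ U) :=
    Module.Finite.of_injective l.toLinearMap (h.injective U hU)
  exact h2

theorem isReduced [IsReduced X'] : IsReduced X := by
  have := h.affine
  refine isReduced_of_forall_exists fun x => ?_
  obtain ⟨_, ⟨U, hU, rfl⟩, hxU, -⟩ :=
    Y.isBasis_affineOpens.exists_subset_of_mem_open (Set.mem_univ (p x)) isOpen_univ
  have hU : IsAffineOpen U := hU
  exact ⟨p ⁻¹ᵁ U, hU.preimage p, hxU,
    isReduced_of_injective (pullbackOver hn U).hom (h.injective U hU)⟩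

theorem isFinite [IsLocallyNoetherian Y] [IsFinite π] : IsFinite n := by
  have := h.affine
  have : IsFinite (n ≫ p) := by rw [hn]; infer_instance
  exact IsFinite.of_comp n p

theorem surjective [IsLocallyNoetherian Y] [IsFinite π] : Function.Surjective n := fun x => by
  have := h.affine
  have := h.isFinite
  obtain ⟨_, ⟨U, hU, rfl⟩, hxU, -⟩ :=
    Y.isBasis_affineOpens.exists_subset_of_mem_open (Set.mem_univ (p x)) isOpen_univ
  have hU : IsAffineOpen U := hU
  have hxU : x ∈ p ⁻¹ᵁ U := hxU
  have h1 : π ⁻¹ᵁ U = n ⁻¹ᵁ p ⁻¹ᵁ U := by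
    have h2 : (n ≫ p) ⁻¹ᵁ U = π ⁻¹ᵁ U := by rw [hn]
    exact h2.symm
  have hinj : Function.Injective (n.app (p ⁻¹ᵁ U)) := by
    have h2 : n.app (p ⁻¹ᵁ U) ≫ X'.presheaf.map (homOfLE h1.le).op = pullbackOver hn U := by
      rw [pullbackOver, Scheme.Hom.app_eq_appLE, Scheme.Hom.appLE_map]
    refine Function.Injective.of_comp (f := X'.presheaf.map (homOfLE h1.le).op) ?_
    have h3 := h.injective U hU
    rw [← h2] at h3
    exact h3
  have hint : (n.app (p ⁻¹ᵁ U)).hom.IsIntegral := n.isIntegral_app _ (hU.preimage p)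
  algebraize [(n.app (p ⁻¹ᵁ U)).hom]
  obtain ⟨Q, -, hQ, hQx⟩ := Ideal.exists_ideal_over_prime_of_isIntegral
    (S := Γ(X', n ⁻¹ᵁ p ⁻¹ᵁ U)) (primeAt (p ⁻¹ᵁ U) x hxU) ⊥ (by
      have h3 := (RingHom.injective_iff_ker_eq_bot (n.app (p ⁻¹ᵁ U)).hom).1 hinj
      exact h3.le.trans bot_le)
  obtain ⟨z, hz, rfl⟩ := exists_primeAt_eq ((hU.preimage p).preimage n) Q
  refine ⟨z, primeAt_injective (hU.preimage p) hz hxU ?_⟩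
  rw [← hQx]
  exact (comap_app_primeAt n hz).symm

/-- Away from the image of `D` both pullbacks take values in the zero ring, so every function is
equalized. -/
theorem isIso_pullbackOver {U : Y.Opens} (hU : IsAffineOpen U) (hθ : ∀ t, θ t ∉ U) :
    IsIso (pullbackOver hn U) := by
  have h1 : Subsingleton Γ(D, θ ⁻¹ᵁ U) := by
    have h2 : θ ⁻¹ᵁ U = ⊥ := TopologicalSpace.Opens.ext (Set.eq_empty_of_forall_notMem hθ)
    rw [h2]
    infer_instance
  rw [ConcreteCategory.isIso_iff_bijective]
  exact ⟨h.injective U hU, fun r => (h.range U hU r).2 (Subsingleton.elim _ _)⟩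

/-- An endomorphism that lifts to `D` compatibly with both `a` and `b` preserves the equalized
functions, and these maps on affine opens glue. -/
theorem exists_map {f : X' ⟶ X'} {γ : D ⟶ D} (hf : f ≫ π = π) (hγa : γ ≫ a = a ≫ f)
    (hγb : γ ≫ b = b ≫ f) : ∃ m : X ⟶ X, m ≫ p = p ∧ n ≫ m = f ≫ n := by
  have := h.affine
  have hγ : γ ≫ θ = θ := by rw [← ha, reassoc_of% hγa, hf]
  have h1 : ∀ (U : Y.Opens) (hU : IsAffineOpen U), ∃ ψ : Γ(X, p ⁻¹ᵁ U) →+* Γ(X, p ⁻¹ᵁ U),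
      ∀ x, pullbackOver hn U (ψ x) = appOver hf U (pullbackOver hn U x) := fun U hU => by
    refine exists_ringHom_comp_eq (pullbackOver hn U).hom (h.injective U hU) (appOver hf U).hom
      fun x => (h.range U hU _).2 ?_
    have h2 : ∀ (c : D ⟶ X') (hc : c ≫ π = θ), γ ≫ c = c ≫ f →
        appOver hf U ≫ pullbackOver hc U = pullbackOver hc U ≫ appOver hγ U := fun c hc hγc => by
      simp only [appOver, pullbackOver, Scheme.Hom.appLE_comp_appLE, hγc]
    refine (congr($(h2 a ha hγa) (pullbackOver hn U x))).trans (Eq.trans ?_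
      (congr($(h2 b hb hγb) (pullbackOver hn U x))).symm)
    exact congrArg (appOver hγ U) ((h.range U hU _).1 ⟨x, rfl⟩)
  choose ψ hψ using h1
  have hres : ∀ U V (hU : IsAffineOpen U) (hV : IsAffineOpen V) (hUV : U ≤ V),
      CommRingCat.ofHom (ψ V hV) ≫ X.presheaf.map (homOfLE (p.preimage_mono hUV)).op =
        X.presheaf.map (homOfLE (p.preimage_mono hUV)).op ≫ CommRingCat.ofHom (ψ U hU) := by
    refine fun U V hU hV hUV => CommRingCat.hom_ext (RingHom.ext fun x => h.injective U hU ?_)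
    have h1 := fun z => congr($(map_comp_pullbackOver hn hUV) z)
    refine (h1 (ψ V hV x)).trans ?_
    refine (congrArg _ (hψ V hV x)).trans (Eq.trans ?_ (hψ U hU _).symm)
    exact (appOver_res hf hUV _).symm.trans (congrArg (appOver hf U) (h1 x).symm)
  have hstr : ∀ U hU, p.app U ≫ CommRingCat.ofHom (ψ U hU) = p.app U := by
    refine fun U hU => CommRingCat.hom_ext (RingHom.ext fun x => h.injective U hU ?_)
    have h1 := congr($(app_comp_pullbackOver hn U) x)
    refine (hψ U hU _).trans (Eq.trans ?_ h1.symm)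
    exact (congrArg (appOver hf U) h1).trans (appOver_app hf U x)
  obtain ⟨m, hm, hmψ⟩ := exists_hom_of_pullback (p := p) (f := p)
    (fun U hU => CommRingCat.ofHom (ψ U hU)) hres hstr
  refine ⟨m, hm, ?_⟩
  have h1 : (n ≫ m) ≫ p = π := by rw [Category.assoc, hm, hn]
  have h2 : (f ≫ n) ≫ p = π := by rw [Category.assoc, hn, hf]
  refine hom_ext_of_pullbackOver_eq h1 h2 fun U hU => ?_
  have h3 : pullbackOver h1 U = pullbackOver hm U ≫ pullbackOver hn U := by
    simp only [pullbackOver, Scheme.Hom.appLE_comp_appLE]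
  have h4 : pullbackOver h2 U = pullbackOver hn U ≫ appOver hf U := by
    simp only [pullbackOver, appOver, Scheme.Hom.appLE_comp_appLE]
  rw [h3, h4, hmψ U hU]
  exact CommRingCat.hom_ext (RingHom.ext (hψ U hU))

end IsPinching

end Pinching

section LocalIso

theorem isIso_morphismRestrict_of_iSup {X Y : Scheme.{u}} (f : X ⟶ Y) {Ω : Y.Opens} {I : Type*}
    (V : I → Y.Opens) (hV : ∀ i, V i ≤ Ω) (hΩ : ∀ y ∈ Ω, ∃ i, y ∈ V i)
    (h : ∀ i, IsIso (f ∣_ V i)) : IsIso (f ∣_ Ω) := by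
  refine (IsZariskiLocalAtTarget.iff_of_iSup_eq_top (P := MorphismProperty.isomorphisms Scheme.{u})
    (fun i => Ω.ι ⁻¹ᵁ V i) ?_).2 fun i => ?_
  · refine top_le_iff.1 fun y _ => ?_
    obtain ⟨i, hi⟩ := hΩ y.1 y.2
    exact TopologicalSpace.Opens.mem_iSup.2 ⟨i, hi⟩
  · have h1 : Ω.ι ''ᵁ Ω.ι ⁻¹ᵁ V i = V i := by
      rw [Scheme.Hom.image_preimage_eq_opensRange_inf, Scheme.Opens.opensRange_ι]
      exact inf_eq_right.2 (hV i)
    exact ((MorphismProperty.isomorphisms Scheme.{u}).arrow_mk_iso_iff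
      (morphismRestrictRestrict f Ω _ ≪≫ morphismRestrictEq f h1)).2 (h i)

theorem IsNormalization.isNormalizationOf_univ {X X' : Scheme.{u}} {n : X' ⟶ X}
    (hn : IsNormalization n) [IsLocallyNoetherian X'] : IsNormalizationOf Set.univ n := by
  obtain ⟨Ω, hΩ, hΩ', hiso⟩ := hn.birational
  refine ⟨hn.normal, inferInstance, hn.integral, Set.range_eq_univ.2 hn.surjective, Ω, ?_, hΩ',
    inferInstance⟩
  rw [Set.inter_univ, hΩ.closure_eq]

end LocalIso

namespace IsPinching

variable {D X' X Y : Scheme.{u}} {π : X' ⟶ Y} {θ : D ⟶ Y} {a b : D ⟶ X'} {p : X ⟶ Y}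
  {n : X' ⟶ X} {hn : n ≫ p = π} {ha : a ≫ π = θ} {hb : b ≫ π = θ} (h : IsPinching hn ha hb)

include h

theorem isIso_app {U : Y.Opens} (hU : IsAffineOpen U) (hθ : ∀ t, θ t ∉ U) :
    IsIso (n.app (p ⁻¹ᵁ U)) := by
  have h1 : IsIso (pullbackOver hn U) := h.isIso_pullbackOver hU hθ
  have h2 : π ⁻¹ᵁ U = n ⁻¹ᵁ p ⁻¹ᵁ U := by
    have h2 : (n ≫ p) ⁻¹ᵁ U = π ⁻¹ᵁ U := by rw [hn]
    exact h2.symm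
  have h3 : n.app (p ⁻¹ᵁ U) ≫ X'.presheaf.map (homOfLE h2.le).op = pullbackOver hn U := by
    rw [pullbackOver, Scheme.Hom.app_eq_appLE, Scheme.Hom.appLE_map]
  have h4 : IsIso (homOfLE h2.le) := ⟨homOfLE h2.ge, rfl, rfl⟩
  have h5 : IsIso (n.app (p ⁻¹ᵁ U) ≫ X'.presheaf.map (homOfLE h2.le).op) := h3 ▸ h1
  exact IsIso.of_isIso_comp_right (n.app (p ⁻¹ᵁ U)) (X'.presheaf.map (homOfLE h2.le).op)

/-- Pinching changes nothing off `Z`, and by `hgen` the complement of `Z` has dense preimage in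
`X'`. -/
theorem isNormalization [IsLocallyNoetherian Y] [IsFinite π] (hX' : IsNormalScheme X')
    (Z : Closeds Y) (hθ : ∀ t, θ t ∈ Z) (hgen : ∀ x, IsGenericIn Set.univ x → π x ∉ Z) :
    IsNormalization n := by
  have := h.affine
  have := h.isFinite
  have hdense : Dense ((n ⁻¹ᵁ p ⁻¹ᵁ Z.compl : X'.Opens) : Set X') :=
    dense_of_forall_isGenericIn fun x hx => by
      have h1 := hgen x hx
      rw [← hn, Scheme.Hom.comp_apply] at h1
      exact h1
  refine ⟨hX', inferInstance, p ⁻¹ᵁ Z.compl, ?_, hdense, ?_⟩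
  · have h1 := (h.surjective.denseRange).dense_image n.continuous hdense
    refine h1.mono ?_
    rintro _ ⟨x, hx, rfl⟩
    exact hx
  · refine isIso_morphismRestrict_of_iSup n
      (fun U : {U : Y.Opens // IsAffineOpen U ∧ U ≤ Z.compl} => p ⁻¹ᵁ U.1)
      (fun U => p.preimage_mono U.2.2) (fun x hx => ?_) fun U => ?_
    · obtain ⟨_, ⟨U, hU, rfl⟩, hxU, hUZ⟩ :=
        Y.isBasis_affineOpens.exists_subset_of_mem_open (a := p x) (u := Z.compl) hx Z.compl.isOpen
      have hU : IsAffineOpen U := hU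
      have hUZ : U ≤ Z.compl := hUZ
      exact ⟨⟨U, hU, hUZ⟩, hxU⟩
    · exact (isIso_morphismRestrict_iff_isIso_app n (U.2.1.preimage p)).2
        (h.isIso_app U.2.1 fun t ht => U.2.2 ht (hθ t))

theorem hom_ext {f g : X ⟶ X} (hf : f ≫ p = p) (hg : g ≫ p = p) (hfg : n ≫ f = n ≫ g) : f = g := by
  have := h.affine
  refine hom_ext_of_pullbackOver_eq hf hg fun U hU =>
    CommRingCat.hom_ext (RingHom.ext fun x => h.injective U hU ?_)
  have h1 : pullbackOver hf U ≫ pullbackOver hn U = pullbackOver hg U ≫ pullbackOver hn U := by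
    simp only [pullbackOver, Scheme.Hom.appLE_comp_appLE, hfg]
  exact congr($h1 x)

theorem exists_action {G : Type v} [Group G] (ρ' : G →* Aut X') (hπ : ∀ g, (ρ' g).hom ≫ π = π)
    (hγ : ∀ g, ∃ γ : D ⟶ D, γ ≫ a = a ≫ (ρ' g).hom ∧ γ ≫ b = b ≫ (ρ' g).hom) :
    ∃ ρ : G →* Aut X, ∀ g, (ρ g).hom ≫ p = p ∧ (ρ' g).hom ≫ n = n ≫ (ρ g).hom := by
  have hm : ∀ g, ∃ m : X ⟶ X, m ≫ p = p ∧ n ≫ m = (ρ' g).hom ≫ n := fun g => by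
    obtain ⟨γ, hγa, hγb⟩ := hγ g
    exact h.exists_map (hπ g) hγa hγb
  choose m hmp hmn using hm
  have h_one : m 1 = 𝟙 X := by
    refine h.hom_ext (hmp 1) (Category.id_comp p) ?_
    rw [hmn, map_one, Category.comp_id]
    exact Category.id_comp n
  have h_mul : ∀ g g', m (g * g') = m g' ≫ m g := fun g g' => by
    have h1 : (m g' ≫ m g) ≫ p = p := by rw [Category.assoc, hmp, hmp]
    refine h.hom_ext (hmp _) h1 ?_
    have h2 : (ρ' (g * g')).hom = (ρ' g').hom ≫ (ρ' g).hom := by rw [map_mul]; rfl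
    rw [hmn, ← Category.assoc n, hmn, Category.assoc, hmn, h2, Category.assoc]
  let ρ : G →* Aut X :=
    { toFun := fun g => ⟨m g, m g⁻¹, by rw [← h_mul, inv_mul_cancel, h_one],
        by rw [← h_mul, mul_inv_cancel, h_one]⟩
      map_one' := Iso.ext h_one
      map_mul' := fun g g' => Iso.ext (h_mul g g') }
  exact ⟨ρ, fun g => ⟨hmp g, (hmn g).symm⟩⟩

theorem injective_action [IsLocallyNoetherian Y] [IsFinite π] (hn' : IsNormalization n)
    {G : Type v} [Group G] {ρ' : G →* Aut X'} (hρ' : Function.Injective ρ') {ρ : G →* Aut X}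
    (hρ : ∀ g, (ρ' g).hom ≫ n = n ≫ (ρ g).hom) : Function.Injective ρ := by
  have := hn'.normal.isReduced
  have : IsLocallyNoetherian X' := LocallyOfFiniteType.isLocallyNoetherian π
  have := h.isFinite_base
  have : IsLocallyNoetherian X := LocallyOfFiniteType.isLocallyNoetherian p
  have huniv := hn'.isNormalizationOf_univ
  refine (injective_iff_map_eq_one ρ).2 fun g hg => (injective_iff_map_eq_one ρ').1 hρ' g ?_
  refine Iso.ext ?_
  have h1 : (ρ' g).hom ≫ n = 𝟙 X' ≫ n := by
    rw [hρ, hg, Category.id_comp]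
    exact Category.comp_id n
  refine huniv.hom_ext h1 fun x hx => ?_
  rw [← Scheme.Hom.comp_apply, h1, Category.id_comp]
  exact huniv.isGenericIn hx

end IsPinching

/-- For `b = x + y e`, equality of the two images says `E(2 y e) = 0`. As `2` and `e` are units and
`E` detects `𝔭`, this gives `y ∈ 𝔭`, and then `y e` comes from `A`. -/
theorem IsSwapChart.exists_apply_eq_of_comp_eq {A B S : Type*} [CommRing A] [CommRing B]
    [CommRing S] {φ : A →+* B} {σ : B →+* S} {𝔭 : Ideal A} {e : B} (h : IsSwapChart φ σ 𝔭 e)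
    (h2 : IsUnit (2 : A)) {S' : Type*} [CommRing S'] (ι : S →+* S)
    (hι : ∀ x, ι (σ (φ x)) = σ (φ x)) (hιe : ι (σ e) = - σ e) (E : S →+* S')
    (hE : ∀ y, E (σ (φ y)) = 0 → y ∈ 𝔭) {b : B} (hb : E (σ b) = E (ι (σ b))) :
    ∃ a, φ a = b := by
  obtain ⟨x, y, rfl⟩ := h.gen b
  have h3 : IsUnit (E (σ (φ 2) * σ e)) := (((h2.map φ).map σ).mul h.isUnit).map E
  have h4 : E (σ (φ y)) = 0 := by
    refine (h3.mul_left_eq_zero).1 ?_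
    simp only [map_add, map_mul, hι, hιe, map_neg, map_ofNat] at hb ⊢
    linear_combination hb
  obtain ⟨y', -, hy'⟩ := h.mul y (hE y h4)
  exact ⟨x + y', by rw [map_add, hy']⟩

/-! ### The quotient of the pinched scheme by `G` is `Y`. -/

section Quotient

theorem app_comp_pullbackOver_comp {D X' Y' Y : Scheme.{u}} {p' : X' ⟶ Y'} {ν : Y' ⟶ Y}
    {a : D ⟶ X'} {θ : D ⟶ Y} (ha : a ≫ p' ≫ ν = θ) (U : Y.Opens)
    (hle : θ ⁻¹ᵁ U ≤ (a ≫ p') ⁻¹ᵁ ν ⁻¹ᵁ U) :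
    p'.app (ν ⁻¹ᵁ U) ≫ pullbackOver ha U = (a ≫ p').appLE (ν ⁻¹ᵁ U) (θ ⁻¹ᵁ U) hle := by
  rw [Scheme.Hom.app_eq_appLE]
  exact Scheme.Hom.appLE_comp_appLE _ _ _ _ _ _ _

theorem app_comp_appLE_eq_pullbackOver {D C X' Y' Y : Scheme.{u}} {p' : X' ⟶ Y'} {ν : Y' ⟶ Y}
    {a : D ⟶ X'} {θ : D ⟶ Y} {q : D ⟶ C} {c : C ⟶ Y'} (hq : q ≫ c = a ≫ p') (ha : a ≫ p' ≫ ν = θ)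
    (U : Y.Opens) (hle : θ ⁻¹ᵁ U ≤ q ⁻¹ᵁ c ⁻¹ᵁ ν ⁻¹ᵁ U) :
    c.app (ν ⁻¹ᵁ U) ≫ q.appLE (c ⁻¹ᵁ ν ⁻¹ᵁ U) (θ ⁻¹ᵁ U) hle =
      p'.app (ν ⁻¹ᵁ U) ≫ pullbackOver ha U := by
  have h1 : θ ⁻¹ᵁ U ≤ (a ≫ p') ⁻¹ᵁ ν ⁻¹ᵁ U := preimage_le_preimage ha U
  rw [app_comp_pullbackOver_comp ha U h1]
  simp only [Scheme.Hom.app_eq_appLE, Scheme.Hom.appLE_comp_appLE, hq]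

theorem app_comp_map_preimage {X' Y' Y : Scheme.{u}} (p' : X' ⟶ Y') (ν : Y' ⟶ Y) {U V : Y.Opens}
    (h : V ≤ U) : p'.app (ν ⁻¹ᵁ U) ≫ X'.presheaf.map (homOfLE ((p' ≫ ν).preimage_mono h)).op =
      Y'.presheaf.map (homOfLE (ν.preimage_mono h)).op ≫ p'.app (ν ⁻¹ᵁ V) :=
  (p'.naturality (homOfLE (ν.preimage_mono h)).op).symm

variable {G : Type v} [Group G] [Finite G] {Y Y' X' X Ct Dt : Scheme.{u}} {ν : Y' ⟶ Y}
  {ρ' : G →* Aut X'} {p' : X' ⟶ Y'} {δC : Ct ⟶ Y'} {δ : Dt ⟶ X'}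
  (hs : IsSetting ν ρ' p' δC δ) {ι : Ct ⟶ Ct}
  (hι : IsSwap (δC ≫ ν) (doubleLocus Y : Set Y) ι) {j : Dt ⟶ Dt} {q : Dt ⟶ Ct}
  (hq : q ≫ δC = δ ≫ p') (hjq : j ≫ q = q ≫ ι)

include hι hq hjq in
omit [Group G] [Finite G] in
theorem comp_comp_eq_of_isSwap : (j ≫ δ) ≫ p' ≫ ν = δ ≫ p' ≫ ν := by
  have h1 := hι.comp_eq
  have h2 : (q ≫ δC) ≫ ν = (δ ≫ p') ≫ ν := by rw [hq]
  rw [Category.assoc] at h2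
  rw [Category.assoc, ← Category.assoc δ, ← hq, Category.assoc, ← Category.assoc j, hjq,
    Category.assoc, h1]

include hs

omit [Finite G] in
theorem IsSetting.exists_apply_eq_base {P : Y} (hP : P ∈ doubleLocus Y) :
    ∃ t, (δ ≫ p' ≫ ν) t = P := by
  obtain ⟨y, rfl⟩ := hs.nodal.normalization.surjective P
  obtain ⟨x, rfl⟩ := hs.cover.surjective y
  have h1 : x ∈ Set.range δ := by
    rw [hs.normalizationOf.range_eq]
    exact hP
  obtain ⟨t, rfl⟩ := h1
  exact ⟨t, rfl⟩

include hι hq hjq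

variable (ha : δ ≫ p' ≫ ν = δ ≫ p' ≫ ν) (hb : (j ≫ δ) ≫ p' ≫ ν = δ ≫ p' ≫ ν)

-- Since `j` covers `ι`, symmetry under `j` after pulling back by `q` is symmetry under `ι` up to
-- the kernel of `q`. That kernel meets the functions from `Y` only in `𝔭`, because `Dt` has a point
-- over `P`.
omit [Finite G] in
theorem IsNodeChart.exists_app_eq_of_pullbackOver_eq {P : Y} {U : Y.Opens} {hP : P ∈ U}
    {e : Γ(Y', ν ⁻¹ᵁ U)} (he : IsNodeChart ν δC P U hP e) (hPC : P ∈ doubleLocus Y)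
    (b : Γ(Y', ν ⁻¹ᵁ U))
    (hab : pullbackOver ha U (p'.app (ν ⁻¹ᵁ U) b) = pullbackOver hb U (p'.app (ν ⁻¹ᵁ U) b)) :
    ∃ a, ν.app U a = b := by
  have h1 := he.appLE_eq_neg (hs.nodal.two U) hPC hι (hs.nodal.isAffineOpen_preimage he.affine)
  have hle : (δ ≫ p' ≫ ν) ⁻¹ᵁ U ≤ q ⁻¹ᵁ δC ⁻¹ᵁ ν ⁻¹ᵁ U := by
    have h2 : (δ ≫ p' ≫ ν) ⁻¹ᵁ U = (q ≫ δC ≫ ν) ⁻¹ᵁ U := by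
      rw [← Category.assoc, ← hq, Category.assoc]
    exact h2.le
  have hιle := preimage_le_of_over hι.comp_eq U
  have hE := app_comp_appLE_eq_pullbackOver hq ha U hle
  have hF : δC.app (ν ⁻¹ᵁ U) ≫ ι.appLE _ _ hιle ≫ q.appLE _ _ hle =
      p'.app (ν ⁻¹ᵁ U) ≫ pullbackOver hb U := by
    have h3 : (q ≫ ι) ≫ δC = (j ≫ δ) ≫ p' := by
      rw [← hjq, Category.assoc, hq, Category.assoc]
    rw [← app_comp_appLE_eq_pullbackOver h3 hb U (hle.trans (q.preimage_mono hιle)),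
      Scheme.Hom.appLE_comp_appLE]
  refine he.swap.exists_apply_eq_of_comp_eq (hs.nodal.two U) (ι.appLE _ _ hιle).hom
    (appLE_app_app_of_over hι.comp_eq U) h1 (q.appLE _ _ hle).hom (fun y hy => ?_) ?_
  · obtain ⟨t, ht⟩ := hs.exists_apply_eq_base hPC
    have htU : (δ ≫ p' ≫ ν) t ∈ U := ht ▸ hP
    have h4 : (δ ≫ p' ≫ ν).app U y = 0 := by
      refine Eq.trans ?_ hy
      have h5 : ν.app U ≫ δC.app (ν ⁻¹ᵁ U) ≫ q.appLE _ _ hle = (δ ≫ p' ≫ ν).app U := by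
        rw [hE, ← app_comp_pullbackOver ha U]
        rfl
      exact congr($h5.symm y)
    have h6 : y ∈ (primeAt ((δ ≫ p' ≫ ν) ⁻¹ᵁ U) t htU).comap ((δ ≫ p' ≫ ν).app U).hom := by
      refine Ideal.mem_comap.2 ?_
      have h7 : ((δ ≫ p' ≫ ν).app U).hom y = 0 := h4
      rw [h7]
      exact zero_mem _
    rw [comap_app_primeAt] at h6
    exact mem_primeAt.2 (ht ▸ mem_primeAt.1 h6)
  · have h8 : q.appLE _ _ hle (δC.app (ν ⁻¹ᵁ U) b) =
        pullbackOver ha U (p'.app (ν ⁻¹ᵁ U) b) := congr($hE b)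
    have h9 : q.appLE _ _ hle (ι.appLE _ _ hιle (δC.app (ν ⁻¹ᵁ U) b)) =
        pullbackOver hb U (p'.app (ν ⁻¹ᵁ U) b) := congr($hF b)
    exact h8.trans (hab.trans h9.symm)

-- By `S₂` it suffices to find denominators at primes of height at most one. Where they are not
-- automatic the point is generic in `C`, and a node chart shows that `b` comes from `Y` near it.
omit [Finite G] in
theorem IsSetting.exists_app_eq_of_pullbackOver_eq {U : Y.Opens} (hU : IsAffineOpen U)
    (b : Γ(Y', ν ⁻¹ᵁ U))
    (hab : pullbackOver ha U (p'.app (ν ⁻¹ᵁ U) b) = pullbackOver hb U (p'.app (ν ⁻¹ᵁ U) b)) :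
    ∃ a, ν.app U a = b := by
  have := hs.nodal.reduced
  have := hs.nodal.noetherian
  have := hs.nodal.finite
  have hN := hs.nodal.normalization.isFiniteNormalization hU
  algebraize [(ν.app U).hom]
  obtain ⟨a, -, haB, hpow⟩ := hN.exists_pow_mem
  have := hN.noetherian
  have := hN.faithful
  refine exists_algebraMap_eq_of_height_le_one haB hpow
    (fun Q _ hQ => depthTwo_primeAt hs.s2 hU Q hQ) b fun Q hQ hht => ?_
  by_contra hcon
  push Not at hcon
  obtain ⟨P, hP, rfl⟩ := exists_primeAt_eq hU Q
  have hbP : denomIdeal Γ(Y, U) b ≤ primeAt U P hP := fun s hsb => by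
    by_contra h1
    exact hcon s h1 hsb
  have hPs := (mem_singularCodimOne_iff hs.nodal.normalization hU hP).2 ⟨hht, b, hbP⟩
  have hPg := (isGenericIn_doubleLocus_iff hs.s2 hs.nodal.normalization).2 hPs
  obtain ⟨U₁, hP₁, e, hle, he⟩ := hs.nodal.exists_nodeChart hPg hP
  have h1 := map_comp_pullbackOver ha hle
  have h2 := map_comp_pullbackOver hb hle
  have h3 : (p'.app (ν ⁻¹ᵁ U)) ≫ X'.presheaf.map (homOfLE ((p' ≫ ν).preimage_mono hle)).op =
      Y'.presheaf.map (homOfLE (ν.preimage_mono hle)).op ≫ p'.app (ν ⁻¹ᵁ U₁) :=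
    app_comp_map_preimage p' ν hle
  have h4 : p'.app (ν ⁻¹ᵁ U₁) (Y'.presheaf.map (homOfLE (ν.preimage_mono hle)).op b) =
      X'.presheaf.map (homOfLE ((p' ≫ ν).preimage_mono hle)).op (p'.app (ν ⁻¹ᵁ U) b) :=
    congr($h3.symm b)
  obtain ⟨t₁, ht₁⟩ := he.exists_app_eq_of_pullbackOver_eq hs hι hq hjq ha hb hPg.1
    (Y'.presheaf.map (homOfLE (ν.preimage_mono hle)).op b) (by
      rw [h4]
      exact congr($h1 (p'.app (ν ⁻¹ᵁ U) b)).trans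
        ((congrArg _ hab).trans congr($h2.symm (p'.app (ν ⁻¹ᵁ U) b))))
  obtain ⟨f, hf, hPf⟩ := hU.exists_basicOpen_le ⟨P, hP₁⟩ hP
  obtain ⟨m, c, hc⟩ := exists_app_eq_pow_mul ν hU (hU.preimage ν).isCompact f b
    ⟨Y.presheaf.map (homOfLE hf).op t₁, by
      rw [app_naturality ν hf, ht₁, ← CommRingCat.comp_apply, ← Functor.map_comp]
      rfl⟩
  exact hcon (f ^ m) (fun h5 => notMem_primeAt.2 hPf
    (Ideal.IsPrime.mem_of_pow_mem inferInstance m h5))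
    (mem_denomIdeal.2 ⟨c, hc⟩)

end Quotient

theorem idealAt_univ {X : Scheme.{u}} [IsReduced X] (U : X.Opens) :
    idealAt Set.univ U = ⊥ := by
  refine eq_bot_iff.2 fun f hf => ?_
  exact (basicOpen_eq_bot_iff f).1 (eq_bot_iff.2 fun z hz => mem_idealAt.1 hf z trivial hz)

section Pinching

theorem pullbackOver_appOver {X' X Y : Scheme.{u}} {π : X' ⟶ Y} {p : X ⟶ Y} {n : X' ⟶ X}
    (hn : n ≫ p = π) {f : X ⟶ X} {f' : X' ⟶ X'} (hf : f ≫ p = p) (hf' : f' ≫ π = π)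
    (hff : f' ≫ n = n ≫ f) (U : Y.Opens) :
    appOver hf U ≫ pullbackOver hn U = pullbackOver hn U ≫ appOver hf' U := by
  simp only [appOver, pullbackOver, Scheme.Hom.appLE_comp_appLE, hff]

variable {G : Type v} [Group G] [Finite G] {Y Y' X' X Ct Dt : Scheme.{u}} {ν : Y' ⟶ Y}
  {ρ' : G →* Aut X'} {p' : X' ⟶ Y'} {δC : Ct ⟶ Y'} {δ : Dt ⟶ X'}
  (hs : IsSetting ν ρ' p' δC δ) {ι : Ct ⟶ Ct}
  (hι : IsSwap (δC ≫ ν) (doubleLocus Y : Set Y) ι) {j : Dt ⟶ Dt} {q : Dt ⟶ Ct}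
  (hq : q ≫ δC = δ ≫ p') (hjq : j ≫ q = q ≫ ι)

include hs

omit [Finite G] in
theorem IsSetting.isFinite_comp : IsFinite (p' ≫ ν) := by
  have := hs.nodal.finite
  have := hs.cover.finite
  infer_instance

/-- Generic points of `X'` map to generic points of `Y`. One lying in `C` would be generic in `C`
and so have codimension one. -/
theorem IsSetting.apply_notMem_of_isGenericIn {x : X'} (hx : IsGenericIn Set.univ x) :
    (p' ≫ ν) x ∉ doubleLocus Y := by
  have := hs.nodal.reduced
  have := hs.nodal.noetherian
  have := hs.nodal.finite
  have := hs.isLocallyNoetherian_normalization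
  intro hC
  have h1 : IsGenericIn (Set.univ : Set Y') (p' x) := hs.cover.isGenericIn_apply hx
  have h2 : IsGenericIn (Set.univ : Set Y) (ν (p' x)) :=
    hs.nodal.normalization.isNormalizationOf_univ.isGenericIn h1
  have h3 : IsGenericIn (doubleLocus Y : Set Y) (ν (p' x)) :=
    ⟨hC, fun z hz hzx => h2.2 z trivial hzx⟩
  obtain ⟨h4, -⟩ := (isGenericIn_doubleLocus_iff hs.s2 hs.nodal.normalization).1 h3
  obtain ⟨_, ⟨U, hU, rfl⟩, hxU, -⟩ :=
    Y.isBasis_affineOpens.exists_subset_of_mem_open (Set.mem_univ (ν (p' x))) isOpen_univ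
  have hU : IsAffineOpen U := hU
  have hxU : ν (p' x) ∈ U := hxU
  rw [← height_primeAt hU _ hxU] at h4
  have h5 := (GCoverGluing.isGenericIn_iff isClosed_univ hU hxU).1 h2
  rw [idealAt_univ] at h5
  have h8 : (primeAt U (ν (p' x)) hxU).height = 0 := Ideal.height_eq_zero_iff.2 h5
  rw [h8] at h4
  exact zero_ne_one h4

include hι hq hjq

variable {p : X ⟶ Y} {n : X' ⟶ X} {hn : n ≫ p = p' ≫ ν} {ha : δ ≫ p' ≫ ν = δ ≫ p' ≫ ν}
  {hb : (j ≫ δ) ≫ p' ≫ ν = δ ≫ p' ≫ ν} (h : IsPinching hn ha hb)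

include h

-- An invariant function descends to `Y'` by the cover `p'`; being equalized on `Dt`, it descends
-- further to `Y`.
omit [Finite G] in
theorem IsPinching.exists_app_eq {ρ : G →* Aut X} (hρp : ∀ g, (ρ g).hom ≫ p = p)
    (hρ : ∀ g, (ρ' g).hom ≫ n = n ≫ (ρ g).hom) {U : Y.Opens} (hU : IsAffineOpen U)
    (s : Γ(X, p ⁻¹ᵁ U)) (hinv : ∀ g, appOver (hρp g) U s = s) : ∃ t, p.app U t = s := by
  have hρ' : ∀ g, (ρ' g).hom ≫ p' ≫ ν = p' ≫ ν := fun g => by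
    rw [← Category.assoc, hs.cover.comp_eq]
  have h1 : ∀ g, appOver (hs.cover.comp_eq g) (ν ⁻¹ᵁ U) (pullbackOver hn U s) =
      pullbackOver hn U s := fun g => by
    have h2 := pullbackOver_appOver hn (hρp g) (hρ' g) (hρ g) U
    have h3 : appOver (hρ' g) U (pullbackOver hn U s) = pullbackOver hn U s :=
      congr($h2.symm s).trans (congrArg (pullbackOver hn U) (hinv g))
    exact h3
  obtain ⟨b, hb'⟩ := hs.cover.exists_app_eq (V := ν ⁻¹ᵁ U) (pullbackOver hn U s) h1
  obtain ⟨t, ht⟩ := hs.exists_app_eq_of_pullbackOver_eq hι hq hjq ha hb hU b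
    (by rw [hb']; exact (h.range U hU _).1 ⟨s, rfl⟩)
  refine ⟨t, h.injective U hU ?_⟩
  have h4 := app_comp_pullbackOver hn U
  have h5 : (p' ≫ ν).app U t = p'.app (ν ⁻¹ᵁ U) (ν.app U t) := rfl
  exact congr($h4 t).trans (h5.trans ((congrArg _ ht).trans hb'))

theorem IsPinching.exists_isGluing
    (hγ : ∀ g : G, ∃ γ : Dt ⟶ Dt, γ ≫ δ = δ ≫ (ρ' g).hom ∧ γ ≫ j = j ≫ γ) :
    ∃ ρ : G →* Aut X, IsGluing ν ρ' p' ρ p n := by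
  have := hs.nodal.reduced
  have := hs.nodal.noetherian
  have := hs.isFinite_comp
  have := hs.normal.isReduced
  have hsurj : Function.Surjective p := fun y => by
    obtain ⟨y, rfl⟩ := hs.nodal.normalization.surjective y
    obtain ⟨x, rfl⟩ := hs.cover.surjective y
    refine ⟨n x, ?_⟩
    rw [← Scheme.Hom.comp_apply, hn, Scheme.Hom.comp_apply]
  obtain ⟨ρ, hρ⟩ := h.exists_action ρ'
    (fun g => by rw [← Category.assoc, hs.cover.comp_eq]) fun g => by
      obtain ⟨γ, h1, h2⟩ := hγ g
      exact ⟨γ, h1, by rw [← Category.assoc, h2, Category.assoc, h1, Category.assoc]⟩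
  have hnorm : IsNormalization n := h.isNormalization hs.normal (doubleLocus Y) hs.mem
    fun x hx => hs.apply_notMem_of_isGenericIn hx
  have hinj := app_injective_of_surjective p hsurj
  refine ⟨ρ, h.isReduced, ⟨h.isFinite_base, ?_, ?_, fun V _ s hV => ?_⟩, hnorm, hn,
    fun g => (hρ g).2⟩
  · exact h.injective_action hnorm hs.cover.faithful fun g => (hρ g).2
  · rintro _ ⟨g, rfl⟩
    exact (hρ g).1
  · refine existsUnique_of_exists_of_unique ?_ fun t t' ht ht' => hinj V (ht.trans ht'.symm)
    refine exists_app_eq_of_locally p hinj s fun z hz => ?_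
    obtain ⟨_, ⟨U, hU, rfl⟩, hzU, hUV⟩ :=
      Y.isBasis_affineOpens.exists_subset_of_mem_open (a := z) (u := V) hz V.isOpen
    have hU : IsAffineOpen U := hU
    have hUV : U ≤ V := hUV
    refine ⟨U, hUV, hzU, h.exists_app_eq hs hι hq hjq (fun g => (hρ g).1) (fun g => (hρ g).2) hU
      _ fun g => ?_⟩
    exact (appOver_res (hρ g).1 hUV s).trans
      (congrArg _ (hV _ ⟨g, rfl⟩ (preimage_le_of_comp_eq (hρ g).1 V)))

end Pinching

/-! ### Depth criteria. -/

section Depth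

/-- Otherwise some prime over `I` avoids both the complement of `𝔭` and the powers of `r`; it is
contained in `𝔭` but lacks `r`, against minimality. -/
theorem exists_notMem_mul_mem_of_mem_minimalPrimes {R : Type*} [CommRing R] {I 𝔭 : Ideal R}
    (hI : I.IsRadical) (h𝔭 : 𝔭 ∈ I.minimalPrimes) {r : R} (hr : r ∈ 𝔭) : ∃ s ∉ 𝔭, s * r ∈ I := by
  have := h𝔭.1.1
  by_contra! hcon
  have hdisj : Disjoint (I : Set R) (𝔭.primeCompl ⊔ Submonoid.powers r : Submonoid R) := by
    refine Set.disjoint_left.2 fun x hx hxM => ?_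
    obtain ⟨s, hs, _, ⟨n, rfl⟩, rfl⟩ := Submonoid.mem_sup.1 hxM
    refine hcon s hs (hI ⟨n + 1, ?_⟩)
    have h1 : (s * r) ^ (n + 1) = s ^ n * r * (s * r ^ n) := by ring
    rw [h1]
    exact I.mul_mem_left _ hx
  obtain ⟨𝔮, h𝔮, hI𝔮, h1⟩ := Ideal.exists_le_prime_disjoint I _ hdisj
  have h2 : 𝔮 ≤ 𝔭 := fun x hx => by
    by_contra h3
    exact Set.disjoint_left.1 h1 hx (Submonoid.mem_sup_left h3)
  exact Set.disjoint_left.1 h1 (h𝔭.2 ⟨h𝔮, hI𝔮⟩ h2 hr)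
    (Submonoid.mem_sup_right (Submonoid.mem_powers r))

/-- The zero divisors modulo `t` are the union of finitely many associated primes `(t : f)`. By
prime avoidance, `𝔮` lies in one of them unless it contains a nonzerodivisor modulo `t`. -/
theorem exists_mem_forall_dvd {R : Type*} [CommRing R] [IsNoetherianRing R] (𝔮 : Ideal R) (t : R)
    (h : ∀ f, ¬ t ∣ f → ∃ r ∈ 𝔮, ¬ t ∣ r * f) : ∃ s ∈ 𝔮, ∀ x, t ∣ s * x → t ∣ x := by
  have hmk : ∀ x : R, (Ideal.Quotient.mk (Ideal.span {t}) x) = 0 ↔ t ∣ x := fun x => by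
    rw [Ideal.Quotient.eq_zero_iff_mem, Ideal.mem_span_singleton]
  by_contra! hcon
  have h1 : (𝔮 : Set R) ⊆ ⋃ 𝔭 ∈ associatedPrimes R (R ⧸ Ideal.span {t}), (id 𝔭 : Ideal R) := by
    simp only [id, biUnion_associatedPrimes_eq_zero_divisors]
    intro s hs
    obtain ⟨x, hx, hx'⟩ := hcon s hs
    exact ⟨Ideal.Quotient.mk _ x, fun h2 => hx' ((hmk x).1 h2), (hmk (s * x)).2 hx⟩
  obtain ⟨𝔭, h𝔭, hle⟩ := (Ideal.subset_union_prime_finite (associatedPrimes.finite R _) (f := id)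
    0 0 fun 𝔭 h𝔭 _ _ => (isAssociatedPrime_iff.1 h𝔭).1).1 h1
  obtain ⟨hprime, f, hf⟩ := isAssociatedPrime_iff.1 h𝔭
  obtain ⟨f, rfl⟩ := Ideal.Quotient.mk_surjective f
  have hmem : ∀ r, r ∈ 𝔭 ↔ t ∣ r * f := fun r => by
    rw [hf, Submodule.mem_colon_singleton]
    exact hmk (r * f)
  obtain ⟨r, hr, hrf⟩ := h f fun h2 => hprime.ne_top
    ((Ideal.eq_top_iff_one _).2 ((hmem 1).2 (by rwa [one_mul])))
  exact hrf ((hmem r).1 (hle hr))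

theorem exists_isRegular_of_isLocalization {R L : Type*} [CommRing R] [IsNoetherianRing R]
    [IsReduced R] [CommRing L] [IsLocalRing L] [Algebra R L] (𝔮 : Ideal R) [𝔮.IsPrime]
    [IsLocalization.AtPrime L 𝔮]
    (h : 1 < 𝔮.height → ∀ t ∈ nonZeroDivisors R, ∀ f, ¬ t ∣ f → ∃ r ∈ 𝔮, ¬ t ∣ r * f)
    {n : ℕ} (hn : n ≤ 2) (hn' : (n : ℕ∞) ≤ 𝔮.height) :
    ∃ rs : List L, rs.length = n ∧ (∀ r ∈ rs, r ∈ IsLocalRing.maximalIdeal L) ∧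
      RingTheory.Sequence.IsRegular L rs := by
  suffices h1 : ∃ rs : List R, rs.length = n ∧ (∀ r ∈ rs, r ∈ 𝔮) ∧
      RingTheory.Sequence.IsWeaklyRegular R rs by
    obtain ⟨rs, hlen, hmem, hreg⟩ := h1
    refine ⟨rs.map (algebraMap R L), by rw [List.length_map, hlen], fun r hr => ?_,
      hreg.isRegular_of_isLocalization_of_mem L 𝔮 hmem⟩
    obtain ⟨r, h2, rfl⟩ := List.mem_map.1 hr
    exact (IsLocalization.AtPrime.to_map_mem_maximal_iff L 𝔮 r).2 (hmem r h2)
  have hnzd : 1 ≤ 𝔮.height → ∃ t ∈ 𝔮, t ∈ nonZeroDivisors R := fun h1 =>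
    exists_nonZeroDivisors_mem_of_forall_not_le 𝔮 fun 𝔭 h𝔭 hle => by
      have h2 : 𝔮 ∈ minimalPrimes R := by
        rwa [le_antisymm hle (h𝔭.2 ⟨inferInstance, bot_le⟩ hle)]
      rw [Ideal.height_eq_zero_iff.2 h2] at h1
      exact not_lt_of_ge h1 zero_lt_one
  have hreg : ∀ t ∈ nonZeroDivisors R, ∀ x, t * x = 0 → x = 0 := fun t ht x hx =>
    (mem_nonZeroDivisors_iff.1 ht).1 x hx
  interval_cases n
  · exact ⟨[], rfl, by simp, .nil R R⟩
  · obtain ⟨t, ht, ht'⟩ := hnzd (by exact_mod_cast hn')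
    refine ⟨[t], rfl, by simpa using ht, (RingTheory.Sequence.isWeaklyRegular_cons_iff R t []).2
      ⟨?_, .nil R _⟩⟩
    exact (isSMulRegular_iff_right_eq_zero_of_smul (M := R)).2 fun x hx => hreg t ht' x hx
  · have h2 : 1 < 𝔮.height := lt_of_lt_of_le (by norm_num) hn'
    obtain ⟨t, ht, ht'⟩ := hnzd h2.le
    obtain ⟨s, hs, hs'⟩ := exists_mem_forall_dvd 𝔮 t (h h2 t ht')
    refine ⟨[t, s], rfl, by simpa using ⟨ht, hs⟩, isWeaklyRegular_pair.2 ⟨hreg t ht',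
      fun x z hxz => ?_⟩⟩
    obtain ⟨y, hy⟩ := hs' x ⟨z, hxz⟩
    exact ⟨y, hy⟩

end Depth

/-! ### Algebra of a ring `A + A e` over a node. -/

section Node

/-- The localization at `Q` is a discrete valuation ring, and `N` consists of the elements of
valuation at least two. Elements of `Q` outside `N` are uniformizers; an ideal generating `Q`
locally must contain one. -/
theorem exists_ideal_forall_notMem {R : Type*} [CommRing R] [IsNoetherianRing R]
    (hR : StalkNormal R) (Q : Ideal R) [Q.IsPrime] (hQ : Q.height = 1) :
    ∃ N : Ideal R, (∀ J : Ideal R, (∀ r ∈ Q, ∃ s ∉ Q, s * r ∈ J) → ¬ J ≤ N) ∧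
      ∀ t ∈ Q, t ∉ N → ∀ r ∈ Q, ∃ s ∉ Q, t ∣ s * r := by
  obtain ⟨h1, h2⟩ := hR Q
  let L := Localization.AtPrime Q
  have hdim : ringKrullDim L = 1 := by
    rw [IsLocalization.AtPrime.ringKrullDim_eq_height Q L, hQ]
    rfl
  have : IsNoetherianRing L := IsLocalization.isNoetherianRing Q.primeCompl L inferInstance
  obtain ⟨ϖ, hϖ⟩ := exists_maximalIdeal_eq_span_of_isIntegrallyClosed hdim
  have hϖm : ϖ ∈ IsLocalRing.maximalIdeal L := hϖ ▸ Ideal.mem_span_singleton_self ϖ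
  have hϖ0 : ϖ ≠ 0 := fun h0 => by
    have h3 := IsLocalRing.maximalIdeal_height_eq_ringKrullDim (R := L)
    rw [hϖ, h0, Ideal.span_singleton_zero, Ideal.height_bot, hdim] at h3
    exact zero_ne_one h3
  have hmem : ∀ r, algebraMap R L r ∈ IsLocalRing.maximalIdeal L ↔ r ∈ Q :=
    IsLocalization.AtPrime.to_map_mem_maximal_iff L Q
  have hunit : ∀ s ∉ Q, IsUnit (algebraMap R L s) := fun s hs =>
    IsLocalization.map_units L (⟨s, hs⟩ : Q.primeCompl)
  have hdvd : ∀ x, x ∈ IsLocalRing.maximalIdeal L ↔ ϖ ∣ x := fun x => by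
    rw [hϖ, Ideal.mem_span_singleton]
  refine ⟨(Ideal.span {ϖ ^ 2}).comap (algebraMap R L), fun J hJ hle => ?_, fun t ht htN r hr => ?_⟩
  · obtain ⟨⟨x, s, hs⟩, hxs⟩ := IsLocalization.surj Q.primeCompl ϖ
    have hxQ : x ∈ Q := by
      rw [← hmem]
      exact hxs ▸ Ideal.mul_mem_right _ _ hϖm
    obtain ⟨s', hs', hJ'⟩ := hJ x hxQ
    have h3 := Ideal.mem_span_singleton.1 (Ideal.mem_comap.1 (hle hJ'))
    rw [map_mul, ← hxs, mul_left_comm, (((hunit s' hs').mul (hunit s hs)).dvd_mul_right)] at h3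
    obtain ⟨c, hc⟩ := h3
    have h4 : ϖ * (1 - ϖ * c) = 0 := by linear_combination hc
    rcases mul_eq_zero.1 h4 with h5 | h5
    · exact hϖ0 h5
    · exact hϖm (IsUnit.of_mul_eq_one c (sub_eq_zero.1 h5).symm)
  · obtain ⟨c, hc⟩ := (hdvd _).1 ((hmem t).2 ht)
    obtain ⟨d, hd⟩ := (hdvd _).1 ((hmem r).2 hr)
    have hcu : IsUnit c := by
      by_contra h3
      obtain ⟨c', hc'⟩ := (hdvd c).1 h3
      exact htN (Ideal.mem_comap.2 (Ideal.mem_span_singleton.2 ⟨c', by rw [hc, hc']; ring⟩))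
    obtain ⟨c', hc'⟩ := hcu.exists_right_inv
    obtain ⟨⟨a, s, hs⟩, has⟩ := IsLocalization.surj Q.primeCompl (d * c')
    have h4 : algebraMap R L (s * r) = algebraMap R L (t * a) := by
      have h5 : d * c' * algebraMap R L s = algebraMap R L a := has
      rw [map_mul, map_mul, hd, hc, ← h5]
      linear_combination (-algebraMap R L s * ϖ * d) * hc'
    obtain ⟨⟨s', hs'⟩, h5⟩ := (IsLocalization.eq_iff_exists Q.primeCompl L).1 h4
    have h6 : s' * (s * r) = s' * (t * a) := h5
    exact ⟨s' * s, fun h7 => ((‹Q.IsPrime›).mem_or_mem h7).elim hs' hs, s' * a, by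
      linear_combination h6⟩

variable {A R : Type*} [CommRing A] [CommRing R] [Algebra A R] {e : R} {Δ : A}
  (he : e ^ 2 = algebraMap A R Δ)
  (hgen : ∀ r : R, ∃ x y : A, r = algebraMap A R x + algebraMap A R y * e)

include he hgen

/-- At most two primes lie over `𝔮`. An element `x + y e` of `Q₁` outside `Q₂` has `y ∉ 𝔮`, so it
determines `e` modulo each prime over `𝔮` that contains it. Its norm lies in `𝔮`, so `Q₃` contains
it or its conjugate; the conjugate lies in `Q₂`. -/
theorem eq_or_eq_of_comap_eq {𝔮 : Ideal A} {Q₁ Q₂ Q₃ : Ideal R} [Q₁.IsPrime] [Q₂.IsPrime]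
    [Q₃.IsPrime] (h₁ : Q₁.comap (algebraMap A R) = 𝔮) (h₂ : Q₂.comap (algebraMap A R) = 𝔮)
    (h₃ : Q₃.comap (algebraMap A R) = 𝔮) (hne : ¬ Q₁ ≤ Q₂) : Q₃ = Q₁ ∨ Q₃ = Q₂ := by
  have key : ∀ (Q Q' : Ideal R) [Q.IsPrime] [Q'.IsPrime], Q.comap (algebraMap A R) = 𝔮 →
      Q'.comap (algebraMap A R) = 𝔮 → ∀ x y : A, algebraMap A R x + algebraMap A R y * e ∈ Q →
      algebraMap A R x + algebraMap A R y * e ∈ Q' → y ∉ 𝔮 → Q ≤ Q' := by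
    intro Q Q' _ _ hQ hQ' x y hxQ hxQ' hy r hr
    obtain ⟨z, w, rfl⟩ := hgen r
    have h4 : algebraMap A R (y * z - w * x) ∈ Q := by
      have h5 : algebraMap A R (y * z - w * x) = algebraMap A R y *
          (algebraMap A R z + algebraMap A R w * e) - algebraMap A R w *
          (algebraMap A R x + algebraMap A R y * e) := by
        rw [map_sub, map_mul, map_mul]
        ring
      rw [h5]
      exact Q.sub_mem (Q.mul_mem_left _ hr) (Q.mul_mem_left _ hxQ)
    have h6 : algebraMap A R (y * z - w * x) ∈ Q' := by
      have h7 : y * z - w * x ∈ 𝔮 := hQ ▸ h4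
      rw [← hQ'] at h7
      exact h7
    have h8 : algebraMap A R y * (algebraMap A R z + algebraMap A R w * e) ∈ Q' := by
      have h5 : algebraMap A R y * (algebraMap A R z + algebraMap A R w * e) =
          algebraMap A R (y * z - w * x) + algebraMap A R w *
          (algebraMap A R x + algebraMap A R y * e) := by
        rw [map_sub, map_mul, map_mul]
        ring
      rw [h5]
      exact Q'.add_mem h6 (Q'.mul_mem_left _ hxQ')
    refine ((‹Q'.IsPrime›).mem_or_mem h8).resolve_left fun h9 => hy ?_
    rw [← hQ']
    exact h9
  obtain ⟨r, hr₁, hr₂⟩ := Set.not_subset.1 hne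
  obtain ⟨x, y, rfl⟩ := hgen r
  have hy : y ∉ 𝔮 := fun hy => by
    have hy₁ : algebraMap A R y ∈ Q₁ := by rw [← h₁] at hy; exact hy
    have hy₂ : algebraMap A R y ∈ Q₂ := by rw [← h₂] at hy; exact hy
    have hx₁ : x ∈ 𝔮 := by
      rw [← h₁]
      exact (Q₁.add_mem_iff_left (Q₁.mul_mem_right e hy₁)).1 hr₁
    rw [← h₂] at hx₁
    exact hr₂ (Q₂.add_mem hx₁ (Q₂.mul_mem_right e hy₂))
  have hN : ∀ Q : Ideal R, Q.comap (algebraMap A R) = 𝔮 →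
      (algebraMap A R x + algebraMap A R y * e) * (algebraMap A R x + algebraMap A R (-y) * e) ∈
        Q := by
    intro Q hQ
    have h4 : (algebraMap A R x + algebraMap A R y * e) *
        (algebraMap A R x + algebraMap A R (-y) * e) = algebraMap A R (x ^ 2 - y ^ 2 * Δ) := by
      rw [map_sub, map_mul, map_pow, map_pow, ← he, map_neg]
      ring
    have h5 : x ^ 2 - y ^ 2 * Δ ∈ 𝔮 := by
      rw [← h₁]
      refine Ideal.mem_comap.2 ?_
      rw [← h4]
      exact Q₁.mul_mem_right _ hr₁
    rw [← hQ] at h5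
    rw [h4]
    exact h5
  have hy' : -y ∉ 𝔮 := fun h => hy (neg_mem_iff.1 h)
  have h2' := ((‹Q₂.IsPrime›).mem_or_mem (hN Q₂ h₂)).resolve_left hr₂
  rcases (‹Q₃.IsPrime›).mem_or_mem (hN Q₃ h₃) with h3' | h3'
  · exact .inl (le_antisymm (key Q₃ Q₁ h₃ h₁ x y h3' hr₁ hy) (key Q₁ Q₃ h₁ h₃ x y hr₁ h3' hy))
  · exact .inr (le_antisymm (key Q₃ Q₂ h₃ h₂ x (-y) h3' h2' hy')
      (key Q₂ Q₃ h₂ h₃ x (-y) h2' h3' hy'))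

/-- There are at most two primes over `𝔮`, so one `t ∈ J` can be chosen as a uniformizer at all of
them: an ideal inside the union of two ideals lies in one of them. As `J` consists of elements of
`A`, both `u = t` and `v = t e` come from `A`. An element of `𝔮` is locally divisible by `t` in `A +
A e`, which expresses it through `u` and `v`. -/
theorem exists_node_generators [Algebra.IsIntegral A R] [IsNoetherianRing R] (hR : StalkNormal R)
    (𝔮 : Ideal A) [𝔮.IsPrime] (J : Ideal R) (hJ : ∀ r ∈ J, ∃ c, algebraMap A R c = r)
    (hJ𝔮 : ∀ c, algebraMap A R c ∈ J → c ∈ 𝔮) (h𝔮 : ∀ r ∈ 𝔮, ∃ s ∉ 𝔮, algebraMap A R (s * r) ∈ J)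
    (hinj : Function.Injective (algebraMap A R))
    (hQ : ∀ (Q : Ideal R) [Q.IsPrime], Q.comap (algebraMap A R) = 𝔮 →
      Q.height = 1 ∧ ∀ r ∈ Q, ∃ s ∉ Q, s * r ∈ J) :
    ∃ u ∈ 𝔮, ∃ v ∈ 𝔮, v ^ 2 = Δ * u ^ 2 ∧
      ∀ r ∈ 𝔮, ∃ s ∉ 𝔮, ∃ x y, s * r = x * u + y * v := by
  have hJQ : ∀ Q : Ideal R, Q.comap (algebraMap A R) = 𝔮 → J ≤ Q := fun Q hQ' r hr => by
    obtain ⟨c, rfl⟩ := hJ r hr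
    have h1 := hJ𝔮 c hr
    rw [← hQ'] at h1
    exact h1
  have ht : ∃ t ∈ J, ∀ (Q : Ideal R) [Q.IsPrime], Q.comap (algebraMap A R) = 𝔮 →
      ∀ r ∈ Q, ∃ s ∉ Q, t ∣ s * r := by
    obtain ⟨Q₁, -, hQ₁, hQ₁'⟩ := Ideal.exists_ideal_over_prime_of_isIntegral (S := R) 𝔮 ⊥ (by
      rw [← RingHom.ker_eq_comap_bot, (RingHom.injective_iff_ker_eq_bot _).1 hinj]
      exact bot_le)
    obtain ⟨N₁, hN₁, hN₁'⟩ := exists_ideal_forall_notMem hR Q₁ (hQ Q₁ hQ₁').1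
    by_cases hall : ∀ (Q : Ideal R) [Q.IsPrime], Q.comap (algebraMap A R) = 𝔮 → Q = Q₁
    · obtain ⟨t, htJ, htN⟩ := Set.not_subset.1 (hN₁ J (hQ Q₁ hQ₁').2)
      refine ⟨t, htJ, fun Q _ hQ' => ?_⟩
      obtain rfl := hall Q hQ'
      exact hN₁' t (hJQ _ hQ' htJ) htN
    · push Not at hall
      obtain ⟨Q₂, hQ₂, hQ₂', hne⟩ := hall
      obtain ⟨N₂, hN₂, hN₂'⟩ := exists_ideal_forall_notMem hR Q₂ (hQ Q₂ hQ₂').1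
      have h1 : ¬ (J : Set R) ⊆ N₁ ∪ N₂ := fun h => (Ideal.subset_union.1 h).elim
        (hN₁ J (hQ Q₁ hQ₁').2) (hN₂ J (hQ Q₂ hQ₂').2)
      obtain ⟨t, htJ, htN⟩ := Set.not_subset.1 h1
      refine ⟨t, htJ, fun Q _ hQ' => ?_⟩
      have h2 : Q = Q₁ ∨ Q = Q₂ := by
        by_cases h3 : Q₁ ≤ Q₂
        · have h4 : ¬ Q₂ ≤ Q₁ := fun h4 => hne (le_antisymm h4 h3)
          exact (eq_or_eq_of_comap_eq he hgen hQ₂' hQ₁' hQ' h4).symm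
        · exact eq_or_eq_of_comap_eq he hgen hQ₁' hQ₂' hQ' h3
      rcases h2 with rfl | rfl
      · exact hN₁' t (hJQ _ hQ' htJ) fun h3 => htN (.inl h3)
      · exact hN₂' t (hJQ _ hQ' htJ) fun h3 => htN (.inr h3)
  obtain ⟨t, htJ, ht⟩ := ht
  obtain ⟨u, hu⟩ := hJ t htJ
  obtain ⟨v, hv⟩ := hJ (t * e) (J.mul_mem_right e htJ)
  refine ⟨u, hJ𝔮 u (hu ▸ htJ), v, hJ𝔮 v (hv ▸ J.mul_mem_right e htJ), hinj ?_, fun r hr => ?_⟩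
  · rw [map_pow, map_mul, map_pow, hu, hv, ← he]
    ring
  · obtain ⟨s, hs, hsJ⟩ := h𝔮 r hr
    let I : Ideal R := (Ideal.span {t}).colon {algebraMap A R (s * r)}
    have hI : ∀ z, z ∈ I ↔ t ∣ z * algebraMap A R (s * r) := fun z => by
      rw [Submodule.mem_colon_singleton, smul_eq_mul, Ideal.mem_span_singleton]
    have h1 : ¬ I.comap (algebraMap A R) ≤ 𝔮 := fun hle => by
      obtain ⟨Q, hIQ, hQp, hQ'⟩ := Ideal.exists_ideal_over_prime_of_isIntegral 𝔮 I hle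
      obtain ⟨z, hz, hzt⟩ := ht Q hQ' _ (hJQ Q hQ' hsJ)
      exact hz (hIQ ((hI z).2 hzt))
    obtain ⟨s', hs'I, hs'⟩ := Set.not_subset.1 h1
    obtain ⟨w, hw⟩ := (hI _).1 (Ideal.mem_comap.1 hs'I)
    obtain ⟨x, y, rfl⟩ := hgen w
    refine ⟨s' * s, fun h2 => ((‹𝔮.IsPrime›).mem_or_mem h2).elim hs' hs, x, y, hinj ?_⟩
    rw [map_add, map_mul, map_mul, map_mul, map_mul, hu, hv]
    rw [map_mul] at hw
    linear_combination hw

-- Split `a r` into its even and odd parts under `τ`; the odd part divided by the odd unit `a e` is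
-- even.
omit he hgen in
theorem exists_eq_add_mul_of_involution {R S : Type*} [CommRing R] [CommRing S] (a : R →+* S)
    (ha : Function.Surjective a) (τ : S →+* S) (hτ : ∀ z, τ (τ z) = z) (h2 : IsUnit (2 : S))
    {e : R} (he : IsUnit (a e)) (hτe : τ (a e) = - a e) (r : R) :
    ∃ x y, τ (a x) = a x ∧ τ (a y) = a y ∧ r = x + y * e := by
  obtain ⟨w, hw⟩ := h2.exists_right_inv
  obtain ⟨f, hf⟩ := he.exists_right_inv
  have hτw : τ w = w := h2.mul_left_cancel (by
    rw [hw, ← map_ofNat τ 2, ← map_mul, hw, map_one])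
  have hτf : τ f = - f := he.neg.mul_left_cancel (by
    rw [← hτe, ← map_mul, hf, map_one, hτe, neg_mul_neg, hf])
  obtain ⟨y, hy⟩ := ha ((a r - τ (a r)) * w * f)
  have hτy : τ (a y) = a y := by
    rw [hy, map_mul, map_mul, map_sub, hτ, hτw, hτf]
    ring
  refine ⟨r - y * e, y, ?_, hτy, by ring⟩
  rw [map_sub, map_mul, map_sub, map_mul, hτe, hτy, hy]
  linear_combination (a r - τ (a r)) * hw + 2 * w * (a r - τ (a r)) * hf

end Node

theorem IsNormalization.app_mem_nonZeroDivisors {X' X : Scheme.{u}} {n : X' ⟶ X}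
    (h : IsNormalization n) [IsReduced X] [IsLocallyNoetherian X] {V : X.Opens}
    (hV : IsAffineOpen V) {t : Γ(X, V)} (ht : t ∈ nonZeroDivisors Γ(X, V)) :
    n.app V t ∈ nonZeroDivisors Γ(X', n ⁻¹ᵁ V) := by
  obtain ⟨a, -, ha, hpow⟩ := h.exists_nonZeroDivisors hV
  refine mem_nonZeroDivisors_iff_right.2 fun x hx => ?_
  obtain ⟨m, c, hc⟩ := hpow x
  have h2 : n.app V (c * t) = 0 := by rw [map_mul, hc, mul_assoc, hx, mul_zero]
  have h3 : c * t = 0 := h.app_injective V (h2.trans (map_zero (n.app V).hom).symm)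
  have h4 : c = 0 := mem_nonZeroDivisors_iff_right.1 ht c h3
  rw [h4, map_zero, map_pow] at hc
  exact (mem_nonZeroDivisors_iff.1 (pow_mem ha m)).1 x hc.symm

theorem IsNormalization.pullbackOver_mem_nonZeroDivisors {X' X Y : Scheme.{u}} {π : X' ⟶ Y}
    {p : X ⟶ Y} {n : X' ⟶ X} (hn : n ≫ p = π) (h : IsNormalization n) [IsReduced X]
    [IsLocallyNoetherian X] [IsAffineHom p] {U : Y.Opens} (hU : IsAffineOpen U)
    {t : Γ(X, p ⁻¹ᵁ U)} (ht : t ∈ nonZeroDivisors Γ(X, p ⁻¹ᵁ U)) :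
    pullbackOver hn U t ∈ nonZeroDivisors Γ(X', π ⁻¹ᵁ U) := by
  subst hn
  have h1 : pullbackOver rfl U = n.app (p ⁻¹ᵁ U) := Scheme.Hom.appLE_eq_app _
  rw [h1]
  exact h.app_mem_nonZeroDivisors (hU.preimage p) ht

/-! ### The pinched scheme satisfies Serre's condition. -/

section SerreS2

variable {G : Type v} [Group G] [Finite G] {Y Y' X' X Ct Dt : Scheme.{u}} {ν : Y' ⟶ Y}
  {ρ' : G →* Aut X'} {p' : X' ⟶ Y'} {δC : Ct ⟶ Y'} {δ : Dt ⟶ X'}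
  (hs : IsSetting ν ρ' p' δC δ) {ρ : G →* Aut X} {p : X ⟶ Y} {n : X' ⟶ X}
  (hg : IsGluing ν ρ' p' ρ p n)

include hs hg

/-- Codimension is preserved by both `G`-covers, so this is `height_under_le_one` for `ν`, which
relies on `Y` being `S₂`. -/
theorem IsGluing.ringKrullDim_stalk_le_one {x : X'} (hx : ringKrullDim (X'.presheaf.stalk x) ≤ 1) :
    ringKrullDim (X.presheaf.stalk (n x)) ≤ 1 := by
  have := hs.nodal.reduced
  have := hs.nodal.noetherian
  have := hs.nodal.finite
  have hnx : p (n x) = ν (p' x) := by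
    rw [← Scheme.Hom.comp_apply, hg.comm, Scheme.Hom.comp_apply]
  rw [hs.cover.ringKrullDim_stalk_eq] at hx
  rw [hg.cover.ringKrullDim_stalk_eq, hnx]
  obtain ⟨_, ⟨U, hU, rfl⟩, hxU, -⟩ :=
    Y.isBasis_affineOpens.exists_subset_of_mem_open (Set.mem_univ (ν (p' x))) isOpen_univ
  have hU : IsAffineOpen U := hU
  have hxU : ν (p' x) ∈ U := hxU
  have hxU' : p' x ∈ ν ⁻¹ᵁ U := hxU
  have hN := hs.nodal.normalization.isFiniteNormalization hU
  algebraize [(ν.app U).hom]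
  obtain ⟨a, -, haB, hpow⟩ := hN.exists_pow_mem
  have := hN.noetherian
  have := hN.faithful
  have := hN.finite
  rw [← height_primeAt (hU.preimage ν) _ hxU'] at hx
  have h1 := height_under_le_one haB hpow (fun Q _ hQ => depthTwo_primeAt hs.s2 hU Q hQ)
    (primeAt (ν ⁻¹ᵁ U) (p' x) hxU') (by exact_mod_cast hx)
  have h2 := comap_app_primeAt ν hxU
  rw [← height_primeAt hU _ hxU, ← h2]
  exact_mod_cast h1

variable {j : Dt ⟶ Dt}  {hn : n ≫ p = p' ≫ ν} {ha : δ ≫ p' ≫ ν = δ ≫ p' ≫ ν}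
  {hb : (j ≫ δ) ≫ p' ≫ ν = δ ≫ p' ≫ ν} (h : IsPinching hn ha hb)

include h

/-- If `f = t g` on `X'`, then `g` is not equalized; at a generic point `τ` of `Dt` where its two
pullbacks differ, any `r` with `r g` equalized vanishes, so `z = n (δ τ)` works. If `t` does not
divide `f` on `X'`, the colon ideal there lies in an associated prime, of height at most one by
normality, and `z` is its image. -/
theorem IsPinching.exists_ringKrullDim_le_one_of_colon {U : Y.Opens} (hU : IsAffineOpen U)
    {t : Γ(X, p ⁻¹ᵁ U)} (ht : t ∈ nonZeroDivisors Γ(X, p ⁻¹ᵁ U)) {f : Γ(X, p ⁻¹ᵁ U)}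
    (hf : ¬ t ∣ f) : ∃ (z : X) (hz : z ∈ p ⁻¹ᵁ U), ringKrullDim (X.presheaf.stalk z) ≤ 1 ∧
      ∀ r, t ∣ r * f → r ∈ primeAt (p ⁻¹ᵁ U) z hz := by
  have := hs.nodal.noetherian
  have := hs.isFinite_comp
  have := hs.isReduced
  have := hg.reduced
  have := h.affine
  have := h.isFinite_base
  have : IsLocallyNoetherian X := LocallyOfFiniteType.isLocallyNoetherian p
  have := hs.isLocallyNoetherian_cover
  have hU' : IsAffineOpen ((p' ≫ ν) ⁻¹ᵁ U) := hU.preimage (p' ≫ ν)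
  have : IsNoetherianRing Γ(X', (p' ≫ ν) ⁻¹ᵁ U) :=
    IsLocallyNoetherian.component_noetherian ⟨_, hU'⟩
  have htn := hg.normalization.pullbackOver_mem_nonZeroDivisors hn hU ht
  have hpn : ∀ {x : X'} (_ : x ∈ (p' ≫ ν) ⁻¹ᵁ U), n x ∈ p ⁻¹ᵁ U := fun {x} hx =>
    preimage_le_preimage hn U hx
  have hcomap : ∀ {x : X'} (hx : x ∈ (p' ≫ ν) ⁻¹ᵁ U) (r : Γ(X, p ⁻¹ᵁ U)),
      pullbackOver hn U r ∈ primeAt _ x hx → r ∈ primeAt _ (n x) (hpn hx) := fun {x} hx r hr => by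
    rw [← comap_appLE_primeAt n (preimage_le_preimage hn U) hx]
    exact hr
  by_cases hdvd : pullbackOver hn U t ∣ pullbackOver hn U f
  · obtain ⟨g, hfg⟩ := hdvd
    have hgab : pullbackOver hb U g - pullbackOver ha U g ≠ 0 := fun h0 => by
      obtain ⟨c, hc⟩ := (h.range U hU g).2 (sub_eq_zero.1 h0).symm
      refine hf ⟨c, h.injective U hU ?_⟩
      rw [hfg, ← hc]
      exact (map_mul (pullbackOver hn U).hom _ _).symm
    have h1 : (Dt.basicOpen (pullbackOver hb U g - pullbackOver ha U g)) ≠ ⊥ := fun h0 =>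
      hgab ((basicOpen_eq_bot_iff _).1 h0)
    obtain ⟨t₀, ht₀⟩ := (TopologicalSpace.Opens.ne_bot_iff_nonempty _).1 h1
    obtain ⟨τ, hτ, hτt⟩ := exists_isGenericIn isClosed_univ (Set.mem_univ t₀)
    have hτh := mem_of_specializes hτt ht₀
    have hτU : τ ∈ (δ ≫ p' ≫ ν) ⁻¹ᵁ U := Dt.basicOpen_le _ hτh
    have hδU : δ τ ∈ (p' ≫ ν) ⁻¹ᵁ U := preimage_le_preimage ha U hτU
    have hnδ : p (n (δ τ)) = ν (p' (δ τ)) := by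
      rw [← Scheme.Hom.comp_apply, hn, Scheme.Hom.comp_apply]
    have := hs.nodal.reduced
    have := hs.nodal.finite
    have hsing := (isGenericIn_doubleLocus_iff hs.s2 hs.nodal.normalization).1
      (hs.isGenericIn_apply hτ)
    refine ⟨n (δ τ), hpn hδU, ?_, fun r hr => hcomap hδU r ?_⟩
    · rw [hg.cover.ringKrullDim_stalk_eq, hnδ]
      exact hsing.1.le
    · obtain ⟨c, hc⟩ := hr
      have h2 : pullbackOver hn U r * g = pullbackOver hn U c := by
        have h3 : pullbackOver hn U r * pullbackOver hn U f =
            pullbackOver hn U t * pullbackOver hn U c :=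
          (map_mul (pullbackOver hn U).hom _ _).symm.trans
            ((congrArg _ hc).trans (map_mul (pullbackOver hn U).hom _ _))
        refine sub_eq_zero.1 ((mem_nonZeroDivisors_iff.1 htn).1 _ ?_)
        rw [hfg] at h3
        linear_combination h3
      have h4 := (h.range U hU _).1 ⟨r, rfl⟩
      have h5 := (h.range U hU _).1 ⟨c, rfl⟩
      rw [← h2] at h5
      have h6 : pullbackOver ha U (pullbackOver hn U r) *
          (pullbackOver hb U g - pullbackOver ha U g) = 0 := by
        have h7 := map_mul (pullbackOver ha U).hom (pullbackOver hn U r) g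
        have h8 := map_mul (pullbackOver hb U).hom (pullbackOver hn U r) g
        have h9 := (h7.symm.trans h5).trans h8
        rw [mul_sub, sub_eq_zero]
        refine Eq.trans ?_ h9.symm
        exact congrArg (· * pullbackOver hb U g) h4
      have h10 := comap_appLE_primeAt δ (preimage_le_preimage ha U) hτU
      have h11 : pullbackOver ha U (pullbackOver hn U r) ∈ primeAt _ τ hτU :=
        ((inferInstance : (primeAt _ τ hτU).IsPrime).mem_or_mem
          (h6 ▸ zero_mem (primeAt _ τ hτU))).resolve_right (notMem_primeAt.2 hτh)
      have h12 : pullbackOver hn U r ∈ (primeAt _ τ hτU).comap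
        (δ.appLE ((p' ≫ ν) ⁻¹ᵁ U) ((δ ≫ p' ≫ ν) ⁻¹ᵁ U) (preimage_le_preimage ha U)).hom := h11
      rw [h10] at h12
      exact h12
  · let K : Ideal Γ(X', (p' ≫ ν) ⁻¹ᵁ U) :=
      (Ideal.span {pullbackOver hn U t}).colon {pullbackOver hn U f}
    have hK : ∀ z, z ∈ K ↔ pullbackOver hn U t ∣ z * pullbackOver hn U f := fun z => by
      rw [Submodule.mem_colon_singleton, smul_eq_mul, Ideal.mem_span_singleton]
    have hKtop : K ≠ ⊤ := fun h0 => hdvd (by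
      have h1 := (hK 1).1 (h0 ▸ Submodule.mem_top)
      rwa [one_mul] at h1)
    obtain ⟨M, hM, hKM⟩ := Ideal.exists_le_maximal K hKtop
    have := hM.isPrime
    obtain ⟨Q, hQ, hKQ, -, g, hg'⟩ := exists_prime_mem_iff_mul_mem K M hKM
    have h1 := height_le_one_of_colon (stalkNormal_of_isNormalScheme hs.normal hU') _ htn Q
      (g * pullbackOver hn U f) fun r => by rw [hg', hK, mul_assoc]
    obtain ⟨x, hx, rfl⟩ := exists_primeAt_eq hU' Q
    refine ⟨n x, hpn hx, hg.ringKrullDim_stalk_le_one hs ?_, fun r hr => hcomap hx r (hKQ ?_)⟩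
    · rw [← height_primeAt hU' x hx]
      exact_mod_cast h1
    · obtain ⟨c, hc⟩ := hr
      refine (hK _).2 ⟨pullbackOver hn U c, ?_⟩
      exact (map_mul (pullbackOver hn U).hom _ _).symm.trans
        ((congrArg _ hc).trans (map_mul (pullbackOver hn U).hom _ _))

/-- A prime of height above one cannot annihilate `f` modulo `t`: the colon ideal, hence this prime,
would lie in one of height at most one. -/
theorem IsPinching.serreS2 : SerreS2 X := by
  have := hs.nodal.noetherian
  have := hs.isFinite_comp
  have := hg.reduced
  have := h.affine
  have := h.isFinite_base
  have : IsLocallyNoetherian X := LocallyOfFiniteType.isLocallyNoetherian p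
  intro x m hm hdim
  obtain ⟨_, ⟨U, hU, rfl⟩, hxU, -⟩ :=
    Y.isBasis_affineOpens.exists_subset_of_mem_open (Set.mem_univ (p x)) isOpen_univ
  have hU : IsAffineOpen U := hU
  have hxU : x ∈ p ⁻¹ᵁ U := hxU
  have hV : IsAffineOpen (p ⁻¹ᵁ U) := hU.preimage p
  have : IsNoetherianRing Γ(X, p ⁻¹ᵁ U) := IsLocallyNoetherian.component_noetherian ⟨_, hV⟩
  algebraize [(X.presheaf.germ (p ⁻¹ᵁ U) x hxU).hom]
  have : IsLocalization.AtPrime (X.presheaf.stalk x) (primeAt (p ⁻¹ᵁ U) x hxU) :=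
    isLocalization_germ hV x hxU
  rw [← height_primeAt hV x hxU] at hdim
  refine exists_isRegular_of_isLocalization (primeAt (p ⁻¹ᵁ U) x hxU) (fun hht t ht f hf => ?_) hm
    (by exact_mod_cast hdim)
  obtain ⟨z, hz, hz1, hcolon⟩ := h.exists_ringKrullDim_le_one_of_colon hs hg hU ht hf
  by_contra! hcon
  have h1 : primeAt (p ⁻¹ᵁ U) x hxU ≤ primeAt (p ⁻¹ᵁ U) z hz := fun r hr => hcolon r (hcon r hr)
  rw [← height_primeAt hV z hz] at hz1
  have h2 : (primeAt (p ⁻¹ᵁ U) z hz).height ≤ 1 := by exact_mod_cast hz1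
  exact not_lt_of_ge ((Ideal.height_mono h1).trans h2) hht

end SerreS2

theorem isNode_of_isLocalization {R L : Type u} [CommRing R] [CommRing L] [IsLocalRing L]
    [Algebra R L] (𝔮 : Ideal R) [𝔮.IsPrime] [IsLocalization.AtPrime L 𝔮] [_root_.IsReduced L]
    (hdim : ringKrullDim L = 1) (hreg : ¬ IsRegularLocalRing L) (h2 : IsUnit (2 : R)) {Δ u v : R}
    (hΔ : IsUnit Δ) (hu : u ∈ 𝔮) (hv : v ∈ 𝔮) (huv : v ^ 2 = Δ * u ^ 2)
    (hgen : ∀ r ∈ 𝔮, ∃ s ∉ 𝔮, ∃ x y, s * r = x * u + y * v) : IsNode L := by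
  have hmem : ∀ r, algebraMap R L r ∈ IsLocalRing.maximalIdeal L ↔ r ∈ 𝔮 :=
    IsLocalization.AtPrime.to_map_mem_maximal_iff L 𝔮
  refine ⟨inferInstance, hdim, hreg, algebraMap R L u, algebraMap R L v, le_antisymm ?_ ?_,
    algebraMap R L (-Δ), 0, 1, ?_, ?_⟩
  · intro z hz
    obtain ⟨⟨r, s, hs⟩, hrs⟩ := IsLocalization.surj 𝔮.primeCompl z
    have hr : r ∈ 𝔮 := by
      rw [← hmem]
      exact hrs ▸ Ideal.mul_mem_right _ _ hz
    obtain ⟨s', hs', x, y, hxy⟩ := hgen r hr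
    have hunit : ∀ s ∉ 𝔮, IsUnit (algebraMap R L s) := fun s hs =>
      IsLocalization.map_units L (⟨s, hs⟩ : 𝔮.primeCompl)
    refine (Ideal.unit_mul_mem_iff_mem _ ((hunit s' hs').mul (hunit s hs))).1 ?_
    have h3 : z * algebraMap R L s = algebraMap R L r := hrs
    have h4 := congrArg (algebraMap R L) hxy
    rw [map_mul, map_add, map_mul, map_mul] at h4
    refine Ideal.mem_span_pair.2 ⟨algebraMap R L x, algebraMap R L y, ?_⟩
    linear_combination -h4 - algebraMap R L s' * h3
  · rw [Ideal.span_le]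
    rintro _ (rfl | rfl)
    · exact (hmem u).2 hu
    · exact (hmem v).2 hv
  · have h3 := congrArg (algebraMap R L) huv
    rw [map_mul, map_pow, map_pow] at h3
    rw [map_neg]
    linear_combination h3
  · have h3 : (0 : L) ^ 2 - 4 * algebraMap R L (-Δ) * 1 = algebraMap R L (2 * 2 * Δ) := by
      rw [map_neg, map_mul, map_mul, map_ofNat]
      ring
    rw [h3]
    exact ((h2.mul h2).mul hΔ).map _

theorem pullbackOver_isIntegral {X' X Y : Scheme.{u}} {π : X' ⟶ Y} {p : X ⟶ Y} {n : X' ⟶ X}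
    (hn : n ≫ p = π) [IsAffineHom p] [IsIntegralHom n] {U : Y.Opens} (hU : IsAffineOpen U) :
    (pullbackOver hn U).hom.IsIntegral := by
  subst hn
  have h1 : pullbackOver rfl U = n.app (p ⁻¹ᵁ U) := Scheme.Hom.appLE_eq_app _
  rw [h1]
  exact IsIntegralHom.isIntegral_app n _ (hU.preimage p)

theorem isRadical_idealAt {X : Scheme.{u}} (Z : Set X) (U : X.Opens) : (idealAt Z U).IsRadical :=
  Ideal.isRadical_iInf _ fun _ => Ideal.IsPrime.isRadical inferInstance

theorem IsGenericIn.exists_notMem_mul_mem {X : Scheme.{u}} {Z : Set X} {x : X}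
    (h : IsGenericIn Z x) (hZ : IsClosed Z) {U : X.Opens} (hU : IsAffineOpen U) (hx : x ∈ U)
    {r : Γ(X, U)} (hr : r ∈ primeAt U x hx) : ∃ s ∉ primeAt U x hx, s * r ∈ idealAt Z U :=
  exists_notMem_mul_mem_of_mem_minimalPrimes (isRadical_idealAt Z U)
    ((isGenericIn_iff hZ hU hx).1 h) hr

/-! ### The pinched scheme has nodes in codimension one. -/

section Node

variable {G : Type v} [Group G] [Finite G] {Y Y' X' X Ct Dt : Scheme.{u}} {ν : Y' ⟶ Y}
  {ρ' : G →* Aut X'} {p' : X' ⟶ Y'} {δC : Ct ⟶ Y'} {δ : Dt ⟶ X'}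
  (hs : IsSetting ν ρ' p' δC δ)

include hs

/-- The part of the preimage of `C` outside the good open set `Ω` has closed image in `Y`, and this
image misses `P` since all points over `P` are generic. -/
theorem IsSetting.exists_surjective {P : Y} (hP : IsGenericIn (doubleLocus Y : Set Y) P) :
    ∃ W : Y.Opens, P ∈ W ∧ ∀ U ≤ W, IsAffineOpen U →
      Function.Surjective (δ.app ((p' ≫ ν) ⁻¹ᵁ U)) := by
  have := hs.isFinite_comp
  have := hs.isLocallyNoetherian_cover
  obtain ⟨Ω, hΩ, hsurj⟩ := hs.normalizationOf.exists_app_surjective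
  have hcl : IsClosed ((p' ≫ ν) ⁻¹' (doubleLocus Y : Set Y) \ Ω) :=
    hs.normalizationOf.isClosed.sdiff Ω.isOpen
  refine ⟨⟨((p' ≫ ν) '' ((p' ≫ ν) ⁻¹' (doubleLocus Y : Set Y) \ Ω))ᶜ,
    ((p' ≫ ν).isClosedMap _ hcl).isOpen_compl⟩, ?_, fun U hUW hU =>
    hsurj _ (hU.preimage (p' ≫ ν)) fun x hx => ?_⟩
  · rintro ⟨x, ⟨-, hxΩ⟩, rfl⟩
    exact hxΩ (IsGenericIn.mem_of_subset_closure hs.normalizationOf.isClosed hΩ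
      (hs.isGenericIn_iff.2 hP))
  · by_contra hxΩ
    exact hUW hx.1 ⟨x, ⟨hx.2, hxΩ⟩, rfl⟩

theorem IsSetting.height_primeAt_eq_one {U : Y.Opens} (hU : IsAffineOpen U) {x : X'}
    (hx : x ∈ (p' ≫ ν) ⁻¹ᵁ U) (hP : IsGenericIn (doubleLocus Y : Set Y) ((p' ≫ ν) x)) :
    (primeAt ((p' ≫ ν) ⁻¹ᵁ U) x hx).height = 1 := by
  have := hs.nodal.reduced
  have := hs.nodal.noetherian
  have := hs.nodal.finite
  have := hs.isFinite_comp
  have := hs.normal.isReduced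
  have hxU : (p' ≫ ν) x ∈ U := hx
  have h1 := ((isGenericIn_doubleLocus_iff hs.s2 hs.nodal.normalization).1 hP).1
  rw [← height_primeAt hU _ hxU] at h1
  have h2 : (primeAt U ((p' ≫ ν) x) hxU).height = 1 := by exact_mod_cast h1
  refine le_antisymm ?_ (Order.one_le_iff_ne_zero.2 fun h0 => ?_)
  · have h3 := height_le_height_comap ((p' ≫ ν).app U).hom
      (IsIntegralHom.isIntegral_app (p' ≫ ν) U hU) (primeAt ((p' ≫ ν) ⁻¹ᵁ U) x hx)
    exact h3.trans ((congrArg Ideal.height (comap_app_primeAt (p' ≫ ν) hxU)).trans h2).le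
  · refine hs.apply_notMem_of_isGenericIn ?_ hP.1
    rw [GCoverGluing.isGenericIn_iff isClosed_univ (hU.preimage (p' ≫ ν)) hx, idealAt_univ]
    exact Ideal.height_eq_zero_iff.1 h0

variable {ι : Ct ⟶ Ct}
  (hι : IsSwap (δC ≫ ν) (doubleLocus Y : Set Y) ι) {j : Dt ⟶ Dt} (hjj : j ≫ j = 𝟙 Dt)
  {q : Dt ⟶ Ct} (hq : q ≫ δC = δ ≫ p') (hjq : j ≫ q = q ≫ ι)

include hι hq hjq

-- The relation `ι e = -e` on the normalized double locus of `Y'`, transported to `Dt` through `j ≫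
-- q = q ≫ ι`.
omit [Finite G] in
theorem IsNodeChart.pullbackOver_eq_neg (ha : δ ≫ p' ≫ ν = δ ≫ p' ≫ ν)
    (hb : (j ≫ δ) ≫ p' ≫ ν = δ ≫ p' ≫ ν) {P : Y} {U : Y.Opens} {hP : P ∈ U}
    {e : Γ(Y', ν ⁻¹ᵁ U)} (he : IsNodeChart ν δC P U hP e) (hPC : P ∈ doubleLocus Y) :
    IsUnit (pullbackOver ha U (p'.app (ν ⁻¹ᵁ U) e)) ∧
      pullbackOver hb U (p'.app (ν ⁻¹ᵁ U) e) = - pullbackOver ha U (p'.app (ν ⁻¹ᵁ U) e) := by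
  have h1 := he.appLE_eq_neg (hs.nodal.two U) hPC hι (hs.nodal.isAffineOpen_preimage he.affine)
  have hle : (δ ≫ p' ≫ ν) ⁻¹ᵁ U ≤ q ⁻¹ᵁ δC ⁻¹ᵁ ν ⁻¹ᵁ U := by
    have h2 : (δ ≫ p' ≫ ν) ⁻¹ᵁ U = (q ≫ δC ≫ ν) ⁻¹ᵁ U := by
      rw [← Category.assoc, ← hq, Category.assoc]
    exact h2.le
  have hιle := preimage_le_of_over hι.comp_eq U
  have hE := app_comp_appLE_eq_pullbackOver hq ha U hle
  have hF : δC.app (ν ⁻¹ᵁ U) ≫ ι.appLE _ _ hιle ≫ q.appLE _ _ hle =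
      p'.app (ν ⁻¹ᵁ U) ≫ pullbackOver hb U := by
    have h3 : (q ≫ ι) ≫ δC = (j ≫ δ) ≫ p' := by
      rw [← hjq, Category.assoc, hq, Category.assoc]
    rw [← app_comp_appLE_eq_pullbackOver h3 hb U (hle.trans (q.preimage_mono hιle)),
      Scheme.Hom.appLE_comp_appLE]
  have h4 : q.appLE _ _ hle (δC.app _ e) = pullbackOver ha U (p'.app _ e) := congr($hE e)
  have h5 : q.appLE _ _ hle (ι.appLE _ _ hιle (δC.app _ e)) = pullbackOver hb U (p'.app _ e) :=
    congr($hF e)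
  refine ⟨h4 ▸ he.swap.isUnit.map (q.appLE _ _ hle).hom, ?_⟩
  rw [← h4, ← h5]
  exact (congrArg _ h1).trans (map_neg (q.appLE _ _ hle).hom _)

variable {ρ : G →* Aut X} {p : X ⟶ Y} {n : X' ⟶ X} (hg : IsGluing ν ρ' p' ρ p n)
  {hn : n ≫ p = p' ≫ ν} {ha : δ ≫ p' ≫ ν = δ ≫ p' ≫ ν}
  {hb : (j ≫ δ) ≫ p' ≫ ν = δ ≫ p' ≫ ν} (h : IsPinching hn ha hb)

-- Even functions on `Dt` lift to equalized functions, that is, to functions on `X`.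
omit hs hι hq hjq in
include hjj h in
theorem IsPinching.exists_eq_add_mul {U : Y.Opens} (hU : IsAffineOpen U) (h2 : IsUnit (2 : Γ(Y, U)))
    (hsurj : Function.Surjective (pullbackOver ha U)) {e : Γ(X', (p' ≫ ν) ⁻¹ᵁ U)}
    (he : IsUnit (pullbackOver ha U e)) (hab : pullbackOver hb U e = - pullbackOver ha U e)
    (r : Γ(X', (p' ≫ ν) ⁻¹ᵁ U)) :
    ∃ x y, r = pullbackOver hn U x + pullbackOver hn U y * e := by
  have hjθ : j ≫ δ ≫ p' ≫ ν = δ ≫ p' ≫ ν := (Category.assoc _ _ _).symm.trans hb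
  have hba : ∀ r, appOver hjθ U (pullbackOver ha U r) = pullbackOver hb U r := fun r => by
    have h3 : pullbackOver ha U ≫ appOver hjθ U = pullbackOver hb U := by
      simp only [pullbackOver, appOver, Scheme.Hom.appLE_comp_appLE]
    exact congr($h3 r)
  have hid : ∀ (f : Dt ⟶ Dt) (hf : f ≫ δ ≫ p' ≫ ν = δ ≫ p' ≫ ν), f = 𝟙 Dt →
      ∀ z, appOver hf U z = z := by
    rintro _ hf rfl z
    exact appOver_id hf U z
  obtain ⟨x, y, hx, hy, hr⟩ := exists_eq_add_mul_of_involution (pullbackOver ha U).hom hsurj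
    (appOver hjθ U).hom (fun z =>
      (appOver_comp hjθ hjθ (by rw [hjj, Category.id_comp]) U z).trans (hid _ _ hjj z)) (by
      have h3 := h2.map ((δ ≫ p' ≫ ν).app U).hom
      rwa [map_ofNat] at h3) he ((hba _).trans hab) r
  obtain ⟨x, rfl⟩ := (h.range U hU x).2 (hx.symm.trans (hba x))
  obtain ⟨y, rfl⟩ := (h.range U hU y).2 (hy.symm.trans (hba y))
  exact ⟨x, y, hr⟩

include hjj h
include hg

/-- Apply `exists_node_generators` with `A` the functions on `X` and `E` the pullback of `e`. The
ideal `J` of functions vanishing on the preimage of `C` consists of functions on `X`, since both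
pullbacks vanish. It generates each prime over the point locally, because these primes are minimal
over the radical ideal `J`. -/
theorem IsPinching.isNode {x : X} (hx : IsGenericIn (doubleLocus Y : Set Y) (p x)) :
    IsNode (X.presheaf.stalk x) := by
  have := hs.nodal.reduced
  have := hs.nodal.noetherian
  have := hs.nodal.finite
  have := hs.isFinite_comp
  have := hg.reduced
  have := h.affine
  have := h.isFinite_base
  have := h.isFinite
  have := hs.isLocallyNoetherian_cover
  obtain ⟨W, hPW, hW⟩ := hs.exists_surjective hx
  obtain ⟨U, hPU, e, hUW, he⟩ := hs.nodal.exists_nodeChart hx hPW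
  have hU := he.affine
  have hsurj : Function.Surjective (pullbackOver ha U) := by
    have h1 : pullbackOver ha U = δ.app ((p' ≫ ν) ⁻¹ᵁ U) := Scheme.Hom.appLE_eq_app _
    rw [h1]
    exact hW U hUW hU
  have hxV : x ∈ p ⁻¹ᵁ U := hPU
  have hV : IsAffineOpen (p ⁻¹ᵁ U) := hU.preimage p
  have hV' : IsAffineOpen ((p' ≫ ν) ⁻¹ᵁ U) := hU.preimage (p' ≫ ν)
  have : IsNoetherianRing Γ(X', (p' ≫ ν) ⁻¹ᵁ U) :=
    IsLocallyNoetherian.component_noetherian ⟨_, hV'⟩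
  have hsing := (isGenericIn_doubleLocus_iff hs.s2 hs.nodal.normalization).1 hx
  have hdim : ringKrullDim (X.presheaf.stalk x) = 1 := by
    rw [hg.cover.ringKrullDim_stalk_eq, hsing.1]
  have hreg := hg.not_isRegularLocalRing hs.nodal.normalization hs.cover hsing
  have hle := preimage_le_preimage hn U
  have hcomap : ∀ {z : X'} (hz : z ∈ (p' ≫ ν) ⁻¹ᵁ U) (r : Γ(X, p ⁻¹ᵁ U)),
      pullbackOver hn U r ∈ primeAt _ z hz ↔ r ∈ primeAt (p ⁻¹ᵁ U) (n z) (hle hz) :=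
    fun {z} hz r => by
      rw [← comap_appLE_primeAt n hle hz]
      rfl
  have hnp : ∀ z : X', p (n z) = (p' ≫ ν) z := fun z => by
    rw [← hn, Scheme.Hom.comp_apply]
  let J := idealAt ((p' ≫ ν) ⁻¹' (doubleLocus Y : Set Y)) ((p' ≫ ν) ⁻¹ᵁ U)
  have hJ0 : ∀ r, pullbackOver ha U r = 0 ↔ r ∈ J := fun r => by
    rw [← hs.normalizationOf.app_eq_zero_iff]
    have h1 : pullbackOver ha U = δ.app ((p' ≫ ν) ⁻¹ᵁ U) := Scheme.Hom.appLE_eq_app _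
    rw [h1]
    exact Iff.rfl
  have hx' : IsGenericIn (p ⁻¹' (doubleLocus Y : Set Y)) x := isGenericIn_preimage p hx
  obtain ⟨z, hz⟩ := hg.normalization.surjective x
  have hzP : (p' ≫ ν) z = p x := by rw [← hnp, hz]
  have hzU : z ∈ (p' ≫ ν) ⁻¹ᵁ U := by
    have h1 : (p' ≫ ν) z ∈ U := hzP ▸ hPU
    exact h1
  have hprime : ∀ (z : X') (hz : z ∈ (p' ≫ ν) ⁻¹ᵁ U), n z = x →
      (primeAt _ (n z) (hle hz) : Ideal Γ(X, p ⁻¹ᵁ U)) = primeAt (p ⁻¹ᵁ U) x hxV := by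
    rintro z hz rfl
    rfl
  obtain ⟨Δ, hΔ, hΔe⟩ := he.swap.sq
  let E : Γ(X', (p' ≫ ν) ⁻¹ᵁ U) := p'.app (ν ⁻¹ᵁ U) e
  have hE : E ^ 2 = pullbackOver hn U (p.app U Δ) := by
    have h1 := app_comp_pullbackOver hn U
    have h2 : (p' ≫ ν).app U Δ = E ^ 2 :=
      (congrArg (p'.app (ν ⁻¹ᵁ U)) hΔe).trans (map_pow (p'.app (ν ⁻¹ᵁ U)).hom e 2)
    exact h2.symm.trans congr($h1.symm Δ)
  obtain ⟨hE1, hE2⟩ := he.pullbackOver_eq_neg hs hι hq hjq ha hb hx.1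
  have hgen := h.exists_eq_add_mul hjj hU (hs.nodal.two U) hsurj (e := E) hE1 hE2
  have hJ1 : ∀ r ∈ J, ∃ c, pullbackOver hn U c = r := fun r hr => by
    have h1 := (hJ0 r).2 hr
    have hjθ : j ≫ δ ≫ p' ≫ ν = δ ≫ p' ≫ ν := (Category.assoc _ _ _).symm.trans hb
    have h3 : pullbackOver ha U ≫ appOver hjθ U = pullbackOver hb U := by
      simp only [pullbackOver, appOver, Scheme.Hom.appLE_comp_appLE]
    have h4 : pullbackOver hb U r = 0 := congr($h3.symm r).trans
      ((congrArg (appOver hjθ U) h1).trans (map_zero (appOver hjθ U).hom))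
    exact (h.range U hU r).2 (h1.trans h4.symm)
  have hJ2 : ∀ c, pullbackOver hn U c ∈ J → c ∈ primeAt (p ⁻¹ᵁ U) x hxV := fun c hc => by
    rw [← hprime z hzU hz, ← hcomap hzU]
    refine mem_primeAt.2 (mem_idealAt.1 hc z ?_)
    have h1 : (p' ≫ ν) z ∈ (doubleLocus Y : Set Y) := hzP ▸ hx.1
    exact h1
  have hJ3 : ∀ r ∈ primeAt (p ⁻¹ᵁ U) x hxV, ∃ s ∉ primeAt (p ⁻¹ᵁ U) x hxV,
      pullbackOver hn U (s * r) ∈ J := fun r hr => by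
    obtain ⟨s, hs1, hs2⟩ := hx'.exists_notMem_mul_mem
      ((doubleLocus Y).isClosed.preimage p.continuous) hV hxV hr
    refine ⟨s, hs1, mem_idealAt.2 fun w hw hwb => ?_⟩
    have hwU : w ∈ (p' ≫ ν) ⁻¹ᵁ U := X'.basicOpen_le _ hwb
    have hwn : n w ∈ p ⁻¹' (doubleLocus Y : Set Y) := by
      have h1 : p (n w) ∈ (doubleLocus Y : Set Y) := (hnp w).symm ▸ hw
      exact h1
    have h2 : pullbackOver hn U (s * r) ∈ primeAt _ w hwU :=
      (hcomap hwU _).2 (mem_primeAt.2 (mem_idealAt.1 hs2 (n w) hwn))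
    exact mem_primeAt.1 h2 hwb
  have hQ : ∀ (Q : Ideal Γ(X', (p' ≫ ν) ⁻¹ᵁ U)) [Q.IsPrime],
      Q.comap (pullbackOver hn U).hom = primeAt (p ⁻¹ᵁ U) x hxV →
      Q.height = 1 ∧ ∀ r ∈ Q, ∃ s ∉ Q, s * r ∈ J := fun Q _ hQ => by
    obtain ⟨w, hw, rfl⟩ := exists_primeAt_eq hV' Q
    have h1 : primeAt (p ⁻¹ᵁ U) (n w) (hle hw) = primeAt (p ⁻¹ᵁ U) x hxV := by
      rw [← hQ]
      exact (comap_appLE_primeAt n hle hw).symm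
    have h2 := primeAt_injective hV (hle hw) hxV h1
    have h3 : (p' ≫ ν) w = p x := by rw [← hnp, h2]
    have h4 : IsGenericIn (doubleLocus Y : Set Y) ((p' ≫ ν) w) := h3 ▸ hx
    exact ⟨hs.height_primeAt_eq_one hU hw h4, fun r hr =>
      (hs.isGenericIn_iff.2 h4).exists_notMem_mul_mem hs.normalizationOf.isClosed hV' hw hr⟩
  let := (pullbackOver hn U).hom.toAlgebra
  have : Algebra.IsIntegral Γ(X, p ⁻¹ᵁ U) Γ(X', (p' ≫ ν) ⁻¹ᵁ U) := ⟨pullbackOver_isIntegral hn hU⟩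
  obtain ⟨u, hu, v, hv, huv, hgen'⟩ := exists_node_generators (A := Γ(X, p ⁻¹ᵁ U)) hE hgen
    (stalkNormal_of_isNormalScheme hs.normal hV') (primeAt (p ⁻¹ᵁ U) x hxV) J hJ1 hJ2 hJ3
    (h.injective U hU) hQ
  algebraize [(X.presheaf.germ (p ⁻¹ᵁ U) x hxV).hom]
  have : IsLocalization.AtPrime (X.presheaf.stalk x) (primeAt (p ⁻¹ᵁ U) x hxV) :=
    isLocalization_germ hV x hxV
  refine isNode_of_isLocalization (primeAt (p ⁻¹ᵁ U) x hxV) hdim hreg ?_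
    (hΔ.map (p.app U).hom) hu hv huv hgen'
  have h1 := (hs.nodal.two U).map (p.app U).hom
  rwa [map_ofNat] at h1

/-- Off `C` the functions on `X` and on its normalization agree, so a point of codimension one is
regular. Over `C` such a point maps to a generic point of `C` and is a node. -/
theorem IsPinching.isNormalCrossing : IsNormalCrossing X := fun x hx => by
  refine or_iff_not_imp_left.2 fun hreg => ?_
  have := hs.nodal.reduced
  have := hs.nodal.noetherian
  have := hs.nodal.finite
  have := hs.isFinite_comp
  have := hg.reduced
  have := h.affine
  have := h.isFinite_base
  have := h.isFinite
  have : IsLocallyNoetherian X := LocallyOfFiniteType.isLocallyNoetherian p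
  have hdim := hx
  rw [hg.cover.ringKrullDim_stalk_eq] at hdim
  have hxC : p x ∈ doubleLocus Y := by
    by_contra hxC
    obtain ⟨_, ⟨U, hU, rfl⟩, hxU, hUC⟩ := Y.isBasis_affineOpens.exists_subset_of_mem_open
      (a := p x) (u := (doubleLocus Y).compl) hxC (doubleLocus Y).compl.isOpen
    have hU : IsAffineOpen U := hU
    have hxU : x ∈ p ⁻¹ᵁ U := hxU
    have h1 : IsIso (n.app (p ⁻¹ᵁ U)) := h.isIso_app hU fun t ht => hUC ht (hs.mem t)
    have hsing : x ∈ singularCodimOne X := ⟨hx, hreg⟩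
    obtain ⟨-, b, hb'⟩ :=
      (mem_singularCodimOne_iff hg.normalization (hU.preimage p) hxU).1 hsing
    algebraize [(n.app (p ⁻¹ᵁ U)).hom]
    obtain ⟨c, hc⟩ := ((ConcreteCategory.isIso_iff_bijective (n.app (p ⁻¹ᵁ U))).1 h1).2 b
    have h2 : (1 : Γ(X, p ⁻¹ᵁ U)) ∈ primeAt (p ⁻¹ᵁ U) x hxU :=
      hb' (mem_denomIdeal.2 ⟨c, by rw [map_one, one_mul]; exact hc⟩)
    exact (inferInstance : (primeAt (p ⁻¹ᵁ U) x hxU).IsPrime).ne_top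
      ((Ideal.eq_top_iff_one _).2 h2)
  refine h.isNode hs hι hjj hq hjq hg
    ((isGenericIn_doubleLocus_iff hs.s2 hs.nodal.normalization).2 ?_)
  obtain ⟨_, ⟨U, hU, rfl⟩, hxU, -⟩ :=
    Y.isBasis_affineOpens.exists_subset_of_mem_open (Set.mem_univ (p x)) isOpen_univ
  have hU : IsAffineOpen U := hU
  have hxU : p x ∈ U := hxU
  refine (mem_singularCodimOne_iff hs.nodal.normalization hU hxU).2 ⟨?_,
    exists_denomIdeal_le_of_mem_doubleLocus hs.nodal.normalization hU hxU hxC⟩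
  rw [← height_primeAt hU _ hxU] at hdim
  exact (by exact_mod_cast hdim : (primeAt U (p x) hxU).height = 1).le

end Node

section CanBeGlued

variable {G : Type v} [Group G] [Finite G] {Y Y' X' Ct Dt : Scheme.{u}} {ν : Y' ⟶ Y}
  {ρ' : G →* Aut X'} {p' : X' ⟶ Y'} {δC : Ct ⟶ Y'} {δ : Dt ⟶ X'}

theorem IsSetting.canBeGlued (hs : IsSetting ν ρ' p' δC δ) {ι : Ct ⟶ Ct}
    (hι : IsSwap (δC ≫ ν) (doubleLocus Y : Set Y) ι) {j : Dt ⟶ Dt} (hjj : j ≫ j = 𝟙 Dt)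
    {q : Dt ⟶ Ct} (hq : q ≫ δC = δ ≫ p') (hjq : j ≫ q = q ≫ ι)
    (hγ : ∀ g : G, ∃ γ : Dt ⟶ Dt, γ ≫ δ = δ ≫ (ρ' g).hom ∧ γ ≫ j = j ≫ γ) :
    CanBeGlued ν ρ' p' := by
  have := hs.isFinite_comp
  have hb : (j ≫ δ) ≫ p' ≫ ν = δ ≫ p' ≫ ν := comp_comp_eq_of_isSwap hι hq hjq
  have := hs.normalizationOf.integral
  obtain ⟨X, p, n, hn, hp, hX⟩ := exists_coequalizer (a := δ) (b := j ≫ δ) (π := p' ≫ ν) rfl hb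
  have h : IsPinching hn rfl hb := ⟨hp, fun U hU => (hX U hU).1, fun U hU => (hX U hU).2⟩
  obtain ⟨ρ, hg⟩ := h.exists_isGluing hs hι hq hjq hγ
  exact ⟨X, ρ, p, n, hg.reduced, h.serreS2 hs hg, h.isNormalCrossing hs hι hjj hq hjq hg, hg.cover,
    hg.normalization, hn, hg.equivariant⟩

end CanBeGlued

/-! ### Assembling both directions over an algebraically closed field. -/

section Main

theorem isLocallyNoetherian_of_isNormalization {k : Type u} [Field k] [PerfectField k]
    {X T : Scheme.{u}} (s : X ⟶ Spec (CommRingCat.of k)) [LocallyOfFiniteType s] {Z : Closeds X}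
    {d : T ⟶ reducedSubscheme Z} (hd : IsNormalization d) : IsLocallyNoetherian T := by
  have := hd.isFinite (reducedSubschemeι Z ≫ s)
  have := isLocallyNoetherian_of_hom (reducedSubschemeι Z ≫ s)
  exact LocallyOfFiniteType.isLocallyNoetherian d

variable {G : Type v} [Group G] {Y Y' X' Ct Dt : Scheme.{u}} {ν : Y' ⟶ Y}
  {ρ' : G →* Aut X'} {p' : X' ⟶ Y'} {c : Ct ⟶ reducedSubscheme (preimageDoubleLocus ν)}
  {d : Dt ⟶ reducedSubscheme (preimageDoubleLocus (p' ≫ ν))}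

theorem isSetting_of_isNormalization {k : Type u} [Field k] [PerfectField k] (hk : (2 : k) ≠ 0)
    (s : Y ⟶ Spec (CommRingCat.of k)) [LocallyOfFiniteType s] [IsReduced Y] (hY : SerreS2 Y)
    (hnc : IsNormalCrossing Y) (hν : IsNormalization ν) (hX' : IsNormalScheme X')
    (hp' : IsGCover ρ' p') (hc : IsNormalization c) (hd : IsNormalization d) :
    IsSetting ν ρ' p' (c ≫ reducedSubschemeι (preimageDoubleLocus ν))
      (d ≫ reducedSubschemeι (preimageDoubleLocus (p' ≫ ν))) := by
  have := hν.isFinite s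
  have := hp'.finite
  have := isLocallyNoetherian_of_hom s
  have := isLocallyNoetherian_of_isNormalization (ν ≫ s) hc
  have := isLocallyNoetherian_of_isNormalization ((p' ≫ ν) ≫ s) hd
  refine ⟨hY, ⟨inferInstance, inferInstance, isUnit_two s hk, hν, inferInstance,
    (doubleLocus Y).isClosed, fun P hP => ?_,
    fun Q hQ => isGenericIn_doubleLocus_of_preimage hY hν hQ,
    hc.isNormalizationOf⟩, hX', hp', hd.isNormalizationOf⟩
  obtain ⟨h1, h2⟩ := (isGenericIn_doubleLocus_iff hY hν).1 hP
  exact (hnc P h1).resolve_left h2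

theorem isBranchInvolution_iff_isSwap
    (h : IsNodalAlong ν (doubleLocus Y : Set Y) (c ≫ reducedSubschemeι (preimageDoubleLocus ν)))
    {ι : Ct ⟶ Ct} : IsBranchInvolution ν c ι ↔
      IsSwap ((c ≫ reducedSubschemeι (preimageDoubleLocus ν)) ≫ ν) (doubleLocus Y : Set Y) ι := by
  constructor
  · rintro ⟨hι, p, hp, W, hW, hq⟩
    exact h.isSwap_of_isQuotientOver hι (hp.trans (Category.assoc _ _ _).symm) hW hq
  · intro hι
    obtain ⟨p, hp, W, hW, hq⟩ := h.exists_isQuotientOver hι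
    exact ⟨hι.involution, p, hp.trans (Category.assoc _ _ _), W, hW, hq⟩

theorem hasCoveringInvolution_iff {ι : Ct ⟶ Ct} : HasCoveringInvolution ν ρ' p' c ι d ↔
    ∃ j : Dt ⟶ Dt, j ≫ j = 𝟙 Dt ∧
      (∀ g, ∃ γ : Dt ⟶ Dt, γ ≫ d ≫ reducedSubschemeι (preimageDoubleLocus (p' ≫ ν)) =
        (d ≫ reducedSubschemeι (preimageDoubleLocus (p' ≫ ν))) ≫ (ρ' g).hom ∧ γ ≫ j = j ≫ γ) ∧
      ∃ q : Dt ⟶ Ct, q ≫ c ≫ reducedSubschemeι (preimageDoubleLocus ν) =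
        (d ≫ reducedSubschemeι (preimageDoubleLocus (p' ≫ ν))) ≫ p' ∧ j ≫ q = q ≫ ι := by
  simp only [HasCoveringInvolution, Category.assoc]

variable [Finite G]
  (hs : IsSetting ν ρ' p' (c ≫ reducedSubschemeι (preimageDoubleLocus ν))
    (d ≫ reducedSubschemeι (preimageDoubleLocus (p' ≫ ν))))
  {ι : Ct ⟶ Ct} (hι : IsSwap ((c ≫ reducedSubschemeι (preimageDoubleLocus ν)) ≫ ν)
    (doubleLocus Y : Set Y) ι)

include hs hι

theorem CanBeGlued.hasCoveringInvolution (h : CanBeGlued ν ρ' p') :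
    HasCoveringInvolution ν ρ' p' c ι d := by
  obtain ⟨X, ρ, p, n, hred, -, hnc, hp, hn, hcomm, hequi⟩ := h
  have hg : IsGluing ν ρ' p' ρ p n := ⟨hred, hp, hn, hcomm, hequi⟩
  obtain ⟨j, hj⟩ := (hg.isNodalAlong hs hnc).exists_swap
  obtain ⟨q, hq⟩ := hs.exists_map
  refine hasCoveringInvolution_iff.2 ⟨j, hj.involution, fun g => ?_, q, hq,
    swap_comp_eq_comp_swap hs hg hnc hι hj hq⟩
  obtain ⟨γ, hγ⟩ := hs.exists_lift g
  exact ⟨γ, hγ, comp_swap_comm hs hg hnc hj hγ⟩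

theorem HasCoveringInvolution.sameInertia (h : HasCoveringInvolution ν ρ' p' c ι d) :
    SameInertia ν ρ' p' c ι := by
  obtain ⟨j, hj, hγ, q, hq, hjq⟩ := hasCoveringInvolution_iff.1 h
  exact fun η hη => hs.image_inertia_eq hι.involution hι.comp_eq hj hγ hq hjq
    (isGenericIn_univ_of_mem_genericPoints hη)

theorem HasCoveringInvolution.canBeGlued (h : HasCoveringInvolution ν ρ' p' c ι d) :
    CanBeGlued ν ρ' p' := by
  obtain ⟨j, hj, hγ, q, hq, hjq⟩ := hasCoveringInvolution_iff.1 h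
  exact hs.canBeGlued hι hj hq hjq hγ

end Main

end GCoverGluing

theorem mainTheorem12 {k : Type u} [Field k] [IsAlgClosed k] (hk : (2 : k) ≠ 0)
    {G : Type v} [Group G] [Finite G]
    {Y Y' X' Ct Dt : Scheme.{u}}
    (s : Y ⟶ Spec (CommRingCat.of k)) (hs_ft : LocallyOfFiniteType s) (hs_qc : QuasiCompact s)
    (hs_sep : IsSeparated s) (hY_red : IsReduced Y)
    (hY_S2 : GCoverGluing.SerreS2 Y) (hY_nc : GCoverGluing.IsNormalCrossing Y)
    (ν : Y' ⟶ Y) (hν : GCoverGluing.IsNormalization ν)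
    (ρ' : G →* Aut X') (p' : X' ⟶ Y') (hX' : GCoverGluing.IsNormalScheme X')
    (hp' : GCoverGluing.IsGCover ρ' p')
    (c : Ct ⟶ GCoverGluing.reducedSubscheme (GCoverGluing.preimageDoubleLocus ν))
    (hc : GCoverGluing.IsNormalization c)
    (d : Dt ⟶ GCoverGluing.reducedSubscheme (GCoverGluing.preimageDoubleLocus (p' ≫ ν)))
    (hd : GCoverGluing.IsNormalization d) :
    (∃! ι : Ct ⟶ Ct, GCoverGluing.IsBranchInvolution ν c ι) ∧
      ∀ ι : Ct ⟶ Ct, GCoverGluing.IsBranchInvolution ν c ι →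
        (GCoverGluing.CanBeGlued ν ρ' p' ↔
          GCoverGluing.SameInertia ν ρ' p' c ι ∧
            GCoverGluing.HasCoveringInvolution ν ρ' p' c ι d) := by
  have := hs_ft
  have := hY_red
  have hs := GCoverGluing.isSetting_of_isNormalization hk s hY_S2 hY_nc hν hX' hp' hc hd
  refine ⟨?_, fun ι hι => ?_⟩
  · obtain ⟨ι, hι⟩ := hs.nodal.exists_swap
    exact ⟨ι, (GCoverGluing.isBranchInvolution_iff_isSwap hs.nodal).2 hι, fun ι' hι' =>
      hs.nodal.swap_unique ((GCoverGluing.isBranchInvolution_iff_isSwap hs.nodal).1 hι') hι⟩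
  · have hι' := (GCoverGluing.isBranchInvolution_iff_isSwap hs.nodal).1 hι
    refine ⟨fun h => ?_, fun h => h.2.canBeGlued hs hι'⟩
    have h1 := h.hasCoveringInvolution hs hι'
    exact ⟨h1.sameInertia hs hι', h1⟩
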